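/- \textbf{Setting.} Let $G$ be a finite undirected multigraph without self-loops (parallel edges are allowed), with $n$ vertices, $m$ edges and minimum degree at least three, given by $n$, $m$ and the list of the endpoints of its edges. Assume that $G$ is 2-edge-connected, i.e. $n\ge 2$ and no set of fewer than two edges disconnects $G$ when deleted. Time is counted on a random access machine with unit costs. \textbf{Certificates.} A \emph{2-edge-cut} is a set of two distinct edges of $G$ whose deletion leaves a disconnected graph. In a subgraph $H$ of $G$, a vertex is a \emph{branch vertex} if its degree in $H$ is at least three and a \emph{non-branch vertex} if it is two; a \emph{link} of $H$ is a (possibly closed) path in $H$ between branch vertices all of whose inner vertices are non-branch. A \emph{Mader path} with respect to $H$ is a path of $G$ whose edges and inner vertices do not belong to $H$ and which connects two (possibly equal) branch vertices of $H$, or a branch vertex and a non-branch vertex of $H$, or two non-branch vertices that are inner vertices of distinct links of $H$. A \emph{Mader sequence} of $G$ consists of a subgraph of $G$ that is a subdivision of $K_2^3$ (two vertices joined by three parallel edges), followed by paths each of which is a Mader path with respect to the union of its predecessors, such that the union of all of them is $G$. \textbf{Algorithm (Greedy-Chain-Addition).} Compute a depth-first search tree $T$ with root $r$; for every vertex $v$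 in depth-first order, mark $v$ as visited, and for every back-edge $vw$ from $v$ down to a descendant $w$ form the \emph{chain} $C$ consisting of $vw$ and the tree path from $w$ towards $r$ up to the first visited vertex $x$, mark its inner vertices as visited, and put $s(C)=v$, $t(C)=x$. The back-edges at $r$ are processed grouped by the subtrees of the children of $r$. Let $C_1,C_2,\dots$ be the chains in the order of construction. The \emph{parent} of a chain $C\ne C_1$ is $C_1$ if $t(C)=r$, and otherwise the chain containing the edge from $t(C)$ to its parent in $T$. If $C_2$ does not start in $r$ and end on $C_1\setminus r$, report the first and the last edge of $C_1$ as a cut. Otherwise let the current graph be $C_1\cup C_2$. Every link is maintained as a doubly linked list of its inner vertices; every non-branch vertex stores a pointer to its link and a doubly linked list of the chains incident to it whose endpoints are both inner vertices of that link; there is a list of addable chains. When a chain joins the current graph, each of its children whose endpoints are both inner vertices of the same link is stored in the lists of its endpoints, and every other child becomes addable (for $C_1$ and $C_2$ this is done after both are present). As long as the list of addable chains is non-empty, take a chain from it, turn each endpoint $u$ that is non-branch into a branch vertex, add the chain as a new link, and process its children. To turn $u$ into a branch vertex, walk from both ends of its link towards $u$ in lockstep, where one step either moves to the next vertex or considers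 one chain in the list of the present vertex; a considered chain whose endpoints are not on the same side of $u$ is deleted from both lists and becomes addable. As soon as one walk reaches $u$, split the link there, give a new list header to the part that was walked completely and redirect the pointers of its vertices, and make the remaining chains incident to $u$ addable. In the end, if all chains have been added, report $C_1\cup C_2$ and the other chains in the order of their addition as a Mader sequence; otherwise report the first and the last edge of a link with an inner vertex as a cut. \textbf{Theorem.} There is a constant $K$ such that for every such $G$ the Greedy-Chain-Addition algorithm terminates after at most $K\,(n+m)\log(n+m)$ time units and reports a Mader sequence of $G$ or a 2-edge-cut of $G$. -/

import Mathlib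

/-! ## Graphs: edge cuts, subdivisions, Mader paths

Finite undirected multigraphs are `Graph α β`, with vertices in `α` and edges in `β`.  A subgraph
without isolated vertices is given by its edge set `F`. -/

namespace Mader

variable {α β : Type*}

/-- Any two vertices of `G` are joined by a walk of `G`. -/
def Connected (G : Graph α β) : Prop :=
  ∀ x ∈ G.vertexSet, ∀ y ∈ G.vertexSet, Relation.ReflTransGen G.Adj x y

/-- A set of edges that leaves a disconnected graph upon deletion. -/
def IsEdgeCut (G : Graph α β) (X : Set β) : Prop :=
  X ⊆ G.edgeSet ∧ ¬ Connected (G.deleteEdges X)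

/-- At least two vertices, and no edge cut with fewer than `k` edges. -/
def EdgeConnected (k : ℕ) (G : Graph α β) : Prop :=
  2 ≤ G.vertexSet.encard ∧ ∀ X, IsEdgeCut G X → (k : ℕ∞) ≤ X.encard

/-- The degree of `v` in the subgraph of the loopless graph `G` with edge set `F`. -/
noncomputable def degree (G : Graph α β) (F : Set β) (v : α) : ℕ :=
  {e | e ∈ F ∧ G.Inc e v}.ncard

/-- `IsWalk G u es xs v`: there is a walk of positive length from `u` to `v` that uses the edges
`es` and visits the vertices `xs` in between, both in this order. -/
inductive IsWalk (G : Graph α β) : α → List β → List α → α → Prop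
  | single {u v : α} {e : β} : G.IsLink e u v → IsWalk G u [e] [] v
  | cons {u w v : α} {e : β} {es : List β} {xs : List α} :
      G.IsLink e u w → IsWalk G w es xs v → IsWalk G u (e :: es) (w :: xs) v

/-- A walk of positive length without repetitions, except that its two endpoints may coincide. -/
structure IsPath (G : Graph α β) (u : α) (es : List β) (xs : List α) (v : α) : Prop where
  walk : IsWalk G u es xs v
  nodup_edges : es.Nodup
  nodup_inner : xs.Nodup
  source_notMem : u ∉ xs
  target_notMem : v ∉ xs

/-- The edge set `F` forms a subdivision of the graph with two vertices and three parallel edges: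
it consists of three paths between two distinct vertices that share no edge and no inner vertex. -/
def IsTripleEdgeSubdivision (G : Graph α β) (F : Set β) : Prop :=
  ∃ (a b : α) (es₁ es₂ es₃ : List β) (xs₁ xs₂ xs₃ : List α), a ≠ b ∧
    IsPath G a es₁ xs₁ b ∧ IsPath G a es₂ xs₂ b ∧ IsPath G a es₃ xs₃ b ∧
    es₁.Disjoint es₂ ∧ es₁.Disjoint es₃ ∧ es₂.Disjoint es₃ ∧
    xs₁.Disjoint xs₂ ∧ xs₁.Disjoint xs₃ ∧ xs₂.Disjoint xs₃ ∧
    F = {e | e ∈ es₁ ∨ e ∈ es₂ ∨ e ∈ es₃}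

/-- Branch vertices have degree at least three in the current graph. -/
def IsBranch (G : Graph α β) (F : Set β) (v : α) : Prop := 3 ≤ degree G F v

/-- Non-branch vertices are the other vertices of the current subdivision. -/
def IsNonBranch (G : Graph α β) (F : Set β) (v : α) : Prop := degree G F v = 2

/-- A link of the current graph `F`, with edges `es` and inner vertices `xs`: a path (possibly
closed) in `F` whose inner vertices have degree two in `F`, and which cannot be extended because it
starts and ends in a branch vertex. -/
def IsLinkOf (G : Graph α β) (F : Set β) (es : List β) (xs : List α) : Prop :=
  ∃ u v, IsPath G u es xs v ∧ (∀ e ∈ es, e ∈ F) ∧ (∀ x ∈ xs, IsNonBranch G F x) ∧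
    IsBranch G F u ∧ IsBranch G F v

/-- `a` and `b` are inner vertices of two distinct links. -/
def OnDistinctLinks (G : Graph α β) (F : Set β) (a b : α) : Prop :=
  ∃ (es₁ es₂ : List β) (xs₁ xs₂ : List α), IsLinkOf G F es₁ xs₁ ∧ IsLinkOf G F es₂ xs₂ ∧
    a ∈ xs₁ ∧ b ∈ xs₂ ∧ {e | e ∈ es₁} ≠ {e | e ∈ es₂}

/-- The edge list `P` is a Mader path with respect to the current graph `F`: a path whose edges and
inner vertices are new and which connects two branch vertices, or a branch vertex and a non-branch
vertex, or two non-branch vertices on distinct links. -/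
def IsMaderPath (G : Graph α β) (F : Set β) (P : List β) : Prop :=
  ∃ (u v : α) (xs : List α), IsPath G u P xs v ∧
    (∀ e ∈ P, e ∉ F) ∧ (∀ x ∈ xs, ∀ e ∈ F, ¬ G.Inc e x) ∧
    ((IsBranch G F u ∧ IsBranch G F v) ∨
      (IsBranch G F u ∧ IsNonBranch G F v) ∨
      (IsNonBranch G F u ∧ IsBranch G F v) ∨
      (IsNonBranch G F u ∧ IsNonBranch G F v ∧ OnDistinctLinks G F u v))

/-- Starting from `F`, adding the paths in the list one after the other yields `G`, and each of
them is a Mader path with respect to the graph to which it is added. -/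
def BuildsUp (G : Graph α β) : Set β → List (List β) → Prop
  | F, [] => F = G.edgeSet ∧ ∀ v ∈ G.vertexSet, ∃ e ∈ F, G.Inc e v
  | F, P :: Ps => IsMaderPath G F P ∧ BuildsUp G (F ∪ {e | e ∈ P}) Ps

/-- A Mader construction sequence of `G`: a subdivision of the triple edge, given by its list of
edges, followed by Mader paths. -/
def IsMaderSequence (G : Graph α β) (base : List β) (Ps : List (List β)) : Prop :=
  IsTripleEdgeSubdivision G {e | e ∈ base} ∧ BuildsUp G {e | e ∈ base} Ps

end Mader

/-! ## Random access machine with unit costs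

Programs are while-programs over finitely many registers and finitely many arrays of natural
numbers.  The only arithmetic operation is addition.  Every node of an evaluated expression, every
assignment and every test costs one time unit. -/

namespace RAM

/-- Arithmetic expressions: constants, registers, array cells, sums. -/
inductive Expr (R A : Type) where
  | const (n : ℕ)
  | reg (r : R)
  | get (a : A) (i : Expr R A)
  | add (x y : Expr R A)

/-- Tests. -/
inductive Test (R A : Type) where
  | eq (x y : Expr R A)
  | ne (x y : Expr R A)
  | lt (x y : Expr R A)
  | and (b c : Test R A)

/-- Programs. -/
inductive Prog (R A : Type) where
  | skip
  | assign (r : R) (x : Expr R A)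
  | store (a : A) (i x : Expr R A)
  | seq (c d : Prog R A)
  | ite (b : Test R A) (c d : Prog R A)
  | while (b : Test R A) (c : Prog R A)

/-- The contents of the registers and of the arrays. -/
structure State (R A : Type) where
  regs : R → ℕ
  arrs : A → ℕ → ℕ

variable {R A : Type}

def Expr.eval (s : State R A) : Expr R A → ℕ
  | const n => n
  | reg r => s.regs r
  | get a i => s.arrs a (i.eval s)
  | add x y => x.eval s + y.eval s

def Expr.cost : Expr R A → ℕ
  | const _ => 1
  | reg _ => 1
  | get _ i => i.cost + 1
  | add x y => x.cost + y.cost + 1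

def Test.Holds (s : State R A) : Test R A → Prop
  | eq x y => x.eval s = y.eval s
  | ne x y => x.eval s ≠ y.eval s
  | lt x y => x.eval s < y.eval s
  | and b c => b.Holds s ∧ c.Holds s

def Test.cost : Test R A → ℕ
  | eq x y => x.cost + y.cost + 1
  | ne x y => x.cost + y.cost + 1
  | lt x y => x.cost + y.cost + 1
  | and b c => b.cost + c.cost + 1

def State.setReg [DecidableEq R] (s : State R A) (r : R) (n : ℕ) : State R A :=
  { s with regs := Function.update s.regs r n }

def State.setCell [DecidableEq A] (s : State R A) (a : A) (i n : ℕ) : State R A :=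
  { s with arrs := Function.update s.arrs a (Function.update (s.arrs a) i n) }

/-- `Exec c s s' t`: started in state `s`, the program `c` terminates in state `s'` after exactly
`t` time units. -/
inductive Exec [DecidableEq R] [DecidableEq A] :
    Prog R A → State R A → State R A → ℕ → Prop
  | skip {s} : Exec .skip s s 1
  | assign {s r x} : Exec (.assign r x) s (s.setReg r (x.eval s)) (x.cost + 1)
  | store {s a i x} :
      Exec (.store a i x) s (s.setCell a (i.eval s) (x.eval s)) (i.cost + x.cost + 1)
  | seq {c d s s' s'' t t'} : Exec c s s' t → Exec d s' s'' t' → Exec (.seq c d) s s'' (t + t')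
  | iteTrue {b c d s s' t} : b.Holds s → Exec c s s' t →
      Exec (.ite b c d) s s' (b.cost + 1 + t)
  | iteFalse {b c d s s' t} : ¬ b.Holds s → Exec d s s' t →
      Exec (.ite b c d) s s' (b.cost + 1 + t)
  | whileFalse {b c s} : ¬ b.Holds s → Exec (.while b c) s s (b.cost + 1)
  | whileTrue {b c s s' s'' t t'} : b.Holds s → Exec c s s' t → Exec (.while b c) s' s'' t' →
      Exec (.while b c) s s'' (b.cost + 1 + t + t')

/-- The final state and the running time are determined by the program and the initial state. -/
theorem Exec.deterministic [DecidableEq R] [DecidableEq A] {c : Prog R A} {s s₁ s₂ : State R A}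
    {t₁ t₂ : ℕ} (h₁ : Exec c s s₁ t₁) (h₂ : Exec c s s₂ t₂) : s₁ = s₂ ∧ t₁ = t₂ := by
  induction h₁ generalizing s₂ t₂ with
  | skip => cases h₂; exact ⟨rfl, rfl⟩
  | assign => cases h₂; exact ⟨rfl, rfl⟩
  | store => cases h₂; exact ⟨rfl, rfl⟩
  | seq _ _ ih ih' =>
    cases h₂ with
    | seq k k' =>
      obtain ⟨rfl, rfl⟩ := ih k
      obtain ⟨rfl, rfl⟩ := ih' k'
      exact ⟨rfl, rfl⟩
  | iteTrue hb _ ih =>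
    cases h₂ with
    | iteTrue _ k => obtain ⟨rfl, rfl⟩ := ih k; exact ⟨rfl, rfl⟩
    | iteFalse hb' _ => exact absurd hb hb'
  | iteFalse hb _ ih =>
    cases h₂ with
    | iteTrue hb' _ => exact absurd hb' hb
    | iteFalse _ k => obtain ⟨rfl, rfl⟩ := ih k; exact ⟨rfl, rfl⟩
  | whileFalse hb =>
    cases h₂ with
    | whileFalse _ => exact ⟨rfl, rfl⟩
    | whileTrue hb' _ _ => exact absurd hb' hb
  | whileTrue hb _ _ ih ih' =>
    cases h₂ with
    | whileFalse hb' => exact absurd hb hb'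
    | whileTrue _ k k' =>
      obtain ⟨rfl, rfl⟩ := ih k
      obtain ⟨rfl, rfl⟩ := ih' k'
      exact ⟨rfl, rfl⟩

/-- Sequential composition of a list of programs. -/
def block : List (Prog R A) → Prog R A
  | [] => .skip
  | [c] => c
  | c :: d :: l => .seq c (block (d :: l))

/-- Conditional without an alternative. -/
def when (b : Test R A) (c : Prog R A) : Prog R A := .ite b c .skip

end RAM

/-! ## The Greedy-Chain-Addition algorithm

Vertices are the numbers `1, …, n`, edges are `1, …, m`, chains are numbered from `1` on in the
order of their construction, and so are links.  The value `0` stands for the null pointer. -/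

namespace GreedyChainAddition

/-- The registers of the program. -/
inductive Reg where
  | numV | numE                                   -- number of vertices and of edges
  | i | j | v | w | e | h | cnt | x               -- scratch registers
  | numC | pos                                    -- number of chains; next free cell of `chainEdge`
  | numL | numAdded                               -- number of links and of added chains
  | addHead | cur                                 -- head of the list of addable chains; the chain
                                                  -- that is being added
  | pv | d | z                                    -- scratch registers
  | u | L                                         -- vertex that becomes branch vertex; its link
  | p | a | q | b                                 -- the two walkers: vertex and list entry of each
  | o | nxt | far | y                             -- scratch registers
  | res | cut1 | cut2                             -- verdict; the edges of the cut
  deriving DecidableEq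

/-- The arrays of the program. -/
inductive Arr where
  -- input: first and second endpoint of each edge
  | end1 | end2
  -- incidence lists: first entry for each vertex; edge, other endpoint and successor of each entry
  | incHead | incEdge | incOther | incNext
  -- depth-first search: number, parent, parent edge; vertex with a given number
  | num | par | parEdge | vertexAt
  -- back edges: list for each upper endpoint, successor in the list, lower endpoint
  | backHead | backNext | low
  -- visited vertices; the chain to which a vertex strongly belongs
  | visited | sBelongs
  -- chains: source, target, back edge, and the cells of `chainEdge` that hold the edges
  | src | tgt | backEdge | chainStart | chainEdge
  -- list of children for each chain, successor in the list
  | childHead | childNext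
  -- label of a vertex: 0 inactive, 1 non-branch, 2 branch
  | status
  -- link of a non-branch vertex; neighbours in the doubly linked list of inner vertices of the link
  | linkOf | next | prev
  -- links: first and last inner vertex; first edge
  | linkFirst | linkLast | linkEdge
  -- doubly linked list, for each non-branch vertex, of the chains incident to it that have both
  -- endpoints as inner vertices of the same link; an entry knows its vertex, its chain and the
  -- entry of the same chain at the other endpoint
  | listHead | entNext | entPrev | entVertex | entChain | entTwin
  -- successor in the list of addable chains; chains in the order of their addition
  | addNext | order
  deriving DecidableEq

abbrev Expr := RAM.Expr Reg Arr
abbrev Test := RAM.Test Reg Arr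
abbrev Prog := RAM.Prog Reg Arr
abbrev State := RAM.State Reg Arr

section Program

open Reg Arr RAM

local instance : Coe Reg Expr := ⟨RAM.Expr.reg⟩
local instance (n : ℕ) : OfNat Expr n := ⟨RAM.Expr.const n⟩
local instance : Add Expr := ⟨RAM.Expr.add⟩
local instance : CoeFun Arr (fun _ => Expr → Expr) := ⟨RAM.Expr.get⟩

local infix:50 " =? " => RAM.Test.eq
local infix:50 " ≠? " => RAM.Test.ne
local infix:50 " <? " => RAM.Test.lt
local infixr:35 " &&? " => RAM.Test.and
local infix:30 " ≔ " => RAM.Prog.assign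
local notation:30 a:max "〔" i "〕" " ≔ " x:31 => RAM.Prog.store a i x

/-- Build the incidence lists of all vertices. -/
def buildIncidenceLists : Prog := block [
  i ≔ 1,
  .while (i <? (numE : Expr) + 1) (block [
    incEdge〔i〕 ≔ i,
    incOther〔i〕 ≔ end2 i,
    incNext〔i〕 ≔ incHead (end1 i),
    incHead〔end1 i〕 ≔ i,
    j ≔ (numE : Expr) + i,
    incEdge〔j〕 ≔ i,
    incOther〔j〕 ≔ end1 i,
    incNext〔j〕 ≔ incHead (end2 i),
    incHead〔end2 i〕 ≔ j,
    i ≔ (i : Expr) + 1])]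

/-- Depth-first search from the root `1`.  When a back edge is explored from its lower endpoint, it
is put on the list of its upper endpoint.  Thus the back edges into the same subtree of a child of
the root are consecutive in the list of the root. -/
def depthFirstSearch : Prog := block [
  num〔1〕 ≔ 1,
  vertexAt〔1〕 ≔ 1,
  cnt ≔ 1,
  v ≔ 1,
  .while (v ≠? 0) (block [
    h ≔ incHead v,
    .ite (h =? 0)
      (v ≔ par v)
      (block [
        incHead〔v〕 ≔ incNext h,
        e ≔ incEdge h,
        w ≔ incOther h,
        .ite (num w =? 0)
          (block [
            par〔w〕 ≔ v,
            parEdge〔w〕 ≔ e,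
            cnt ≔ (cnt : Expr) + 1,
            num〔w〕 ≔ cnt,
            vertexAt〔cnt〕 ≔ w,
            v ≔ w])
          (when (num w <? num v &&? e ≠? parEdge v) (block [
            low〔e〕 ≔ v,
            backNext〔e〕 ≔ backHead w,
            backHead〔w〕 ≔ e]))])])]

/-- Construct the chains.  The edges of chain `c` are written to the cells of `chainEdge` from
`chainStart c` up to, but excluding, `chainStart (c + 1)`.  The parent of a chain other than the
first one is the chain to which its target strongly belongs; the second chain is not put on the list
of children since it belongs to the initial current graph. -/
def chainDecomposition : Prog := block [
  sBelongs〔1〕 ≔ 1,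
  numC ≔ 0,
  pos ≔ 0,
  i ≔ 1,
  .while (i <? (numV : Expr) + 1) (block [
    v ≔ vertexAt i,
    visited〔v〕 ≔ 1,
    e ≔ backHead v,
    .while (e ≠? 0) (block [
      numC ≔ (numC : Expr) + 1,
      src〔numC〕 ≔ v,
      backEdge〔numC〕 ≔ e,
      chainStart〔numC〕 ≔ pos,
      chainEdge〔pos〕 ≔ e,
      pos ≔ (pos : Expr) + 1,
      x ≔ low e,
      .while (visited x =? 0) (block [
        visited〔x〕 ≔ 1,
        sBelongs〔x〕 ≔ numC,
        chainEdge〔pos〕 ≔ parEdge x,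
        pos ≔ (pos : Expr) + 1,
        x ≔ par x]),
      tgt〔numC〕 ≔ x,
      when (2 <? numC) (block [
        childNext〔numC〕 ≔ childHead (sBelongs x),
        childHead〔sBelongs x〕 ≔ numC]),
      e ≔ backNext e]),
    i ≔ (i : Expr) + 1]),
  chainStart〔(numC : Expr) + 1〕 ≔ pos]

/-- Insert the chain `c` into the list of addable chains. -/
def pushAddable (c : Expr) : Prog := block [
  addNext〔c〕 ≔ addHead,
  addHead ≔ c]

/-- Delete the entry `z` from the doubly linked list that contains it. -/
def deleteEntry : Prog := block [
  .ite (entPrev z =? 0)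
    (listHead〔entVertex z〕 ≔ entNext z)
    (entNext〔entPrev z〕 ≔ entNext z),
  when (entNext z ≠? 0) (entPrev〔entNext z〕 ≔ entPrev z)]

/-- Insert the entry `z` into the list of the vertex `y`. -/
def insertEntry : Prog := block [
  entVertex〔z〕 ≔ y,
  entChain〔z〕 ≔ d,
  entPrev〔z〕 ≔ 0,
  entNext〔z〕 ≔ listHead y,
  when (listHead y ≠? 0) (entPrev〔listHead y〕 ≔ z),
  listHead〔y〕 ≔ z]

/-- Associate the chain `d` with the link containing both endpoints by inserting it into the lists
of both endpoints, as the entries `d` and `numE + d`. -/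
def associateChain : Prog := block [
  z ≔ d,
  y ≔ src d,
  insertEntry,
  entTwin〔d〕 ≔ (numE : Expr) + d,
  z ≔ (numE : Expr) + d,
  y ≔ tgt d,
  insertEntry,
  entTwin〔(numE : Expr) + d〕 ≔ d]

/-- Delete the chain `d` from the lists of both endpoints and make it addable. -/
def makeAddable : Prog := block [
  z ≔ d,
  deleteEntry,
  z ≔ (numE : Expr) + d,
  deleteEntry,
  pushAddable d]

/-- Establish the chain `cur` as a new link; its inner vertices become non-branch vertices. -/
def addLink : Prog := block [
  numL ≔ (numL : Expr) + 1,
  linkEdge〔numL〕 ≔ backEdge cur,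
  linkFirst〔numL〕 ≔ 0,
  pv ≔ 0,
  x ≔ low (backEdge cur),
  .while (x ≠? tgt cur) (block [
    status〔x〕 ≔ 1,
    linkOf〔x〕 ≔ numL,
    prev〔x〕 ≔ pv,
    next〔x〕 ≔ 0,
    .ite (pv =? 0) (linkFirst〔numL〕 ≔ x) (next〔pv〕 ≔ x),
    pv ≔ x,
    x ≔ par x]),
  linkLast〔numL〕 ≔ pv,
  numAdded ≔ (numAdded : Expr) + 1,
  order〔numAdded〕 ≔ cur]

/-- Process the children of the chain `cur`. -/
def processChildren : Prog := block [
  d ≔ childHead cur,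
  .while (d ≠? 0) (block [
    .ite (status (src d) =? 1 &&? status (tgt d) =? 1 &&? linkOf (src d) =? linkOf (tgt d))
      associateChain
      (pushAddable d),
    d ≔ childNext d])]

/-- One step of the walker that comes from the first inner vertex of the link: consider the next
chain of the list of its vertex `p`, or move on to the next vertex.  The inner vertices of a link
appear in decreasing order of their numbers, so a chain stays on the part of the walker if and only
if the other endpoint has a larger number than `u`.  If the list entry at which the other walker is
about to look gets deleted, then that walker is advanced to the following entry. -/
def stepFromFirst : Prog :=
  .ite (a ≠? 0)
    (block [
      d ≔ entChain a,
      far ≔ entTwin a,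
      o ≔ entVertex far,
      nxt ≔ entNext a,
      when (num o <? (num u : Expr) + 1) (block [
        when (b =? far) (b ≔ entNext b),
        makeAddable]),
      a ≔ nxt])
    (block [
      p ≔ next p,
      a ≔ listHead p])

/-- One step of the walker that comes from the last inner vertex of the link. -/
def stepFromLast : Prog :=
  .ite (b ≠? 0)
    (block [
      d ≔ entChain b,
      far ≔ entTwin b,
      o ≔ entVertex far,
      nxt ≔ entNext b,
      when (num u <? (num o : Expr) + 1) (block [
        when (a =? far) (a ≔ entNext a),
        makeAddable]),
      b ≔ nxt])
    (block [
      q ≔ prev q,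
      b ≔ listHead q])

/-- Let all vertices in the list of the newest link point to it. -/
def redirectPointers : Prog := block [
  y ≔ linkFirst numL,
  .while (y ≠? 0) (block [
    linkOf〔y〕 ≔ numL,
    y ≔ next y])]

/-- Split the link `L` at its inner vertex `u`.  The part before `u` gets a new list header, the
part after `u` retains its identity. -/
def splitOffFirstPart : Prog := block [
  numL ≔ (numL : Expr) + 1,
  linkEdge〔numL〕 ≔ linkEdge L,
  linkLast〔numL〕 ≔ prev u,
  .ite (prev u =? 0)
    (linkFirst〔numL〕 ≔ 0)
    (block [
      linkFirst〔numL〕 ≔ linkFirst L,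
      next〔prev u〕 ≔ 0]),
  linkEdge〔L〕 ≔ parEdge u,
  linkFirst〔L〕 ≔ next u,
  .ite (next u =? 0)
    (linkLast〔L〕 ≔ 0)
    (prev〔next u〕 ≔ 0),
  redirectPointers]

/-- Split the link `L` at its inner vertex `u`.  The part after `u` gets a new list header, the
part before `u` retains its identity. -/
def splitOffLastPart : Prog := block [
  numL ≔ (numL : Expr) + 1,
  linkEdge〔numL〕 ≔ parEdge u,
  linkFirst〔numL〕 ≔ next u,
  .ite (next u =? 0)
    (linkLast〔numL〕 ≔ 0)
    (block [
      linkLast〔numL〕 ≔ linkLast L,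
      prev〔next u〕 ≔ 0]),
  linkLast〔L〕 ≔ prev u,
  .ite (prev u =? 0)
    (linkFirst〔L〕 ≔ 0)
    (next〔prev u〕 ≔ 0),
  redirectPointers]

/-- If `u` is a non-branch vertex, make it a branch vertex: walk from both ends of its link towards
`u` in lockstep, stop once a walker reaches `u`, split the link there, and make the remaining chains
incident to `u` addable. -/
def makeBranch : Prog :=
  when (status u =? 1) (block [
    status〔u〕 ≔ 2,
    L ≔ linkOf u,
    p ≔ linkFirst L,
    a ≔ listHead p,
    q ≔ linkLast L,
    b ≔ listHead q,
    .while (p ≠? u &&? q ≠? u) (block [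
      stepFromFirst,
      stepFromLast]),
    .ite (p =? u) splitOffFirstPart splitOffLastPart,
    .while (listHead u ≠? 0) (block [
      d ≔ entChain (listHead u),
      makeAddable])])

/-- Initialize the current graph to the union of the first two chains, which has three links. -/
def setUpCurrentGraph : Prog := block [
  status〔1〕 ≔ 2,
  cur ≔ 1,
  addLink,
  u ≔ tgt 2,
  makeBranch,
  cur ≔ 2,
  addLink,
  cur ≔ 1,
  processChildren,
  cur ≔ 2,
  processChildren]

/-- As long as the list of addable chains is non-empty, add a chain. -/
def addChains : Prog :=
  .while (addHead ≠? 0) (block [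
    cur ≔ addHead,
    addHead ≔ addNext cur,
    u ≔ src cur,
    makeBranch,
    u ≔ tgt cur,
    makeBranch,
    addLink,
    processChildren])

/-- Report a Mader sequence (`res = 1`) if all chains have been added.  Otherwise find a link with
an inner vertex and report its first and its last edge as a cut (`res = 2`). -/
def report : Prog :=
  .ite (numAdded =? numC)
    (res ≔ 1)
    (block [
      i ≔ 1,
      .while (res =? 0 &&? i <? (numL : Expr) + 1) (block [
        when (linkFirst i ≠? 0) (block [
          cut1 ≔ linkEdge i,
          cut2 ≔ parEdge (linkLast i),
          res ≔ 2]),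
        i ≔ (i : Expr) + 1])])

/-- Report the first and the last edge of the first chain as a cut. -/
def reportFirstChain : Prog := block [
  cut1 ≔ backEdge 1,
  x ≔ low (backEdge 1),
  .while (x ≠? 1) (block [
    cut2 ≔ parEdge x,
    x ≔ par x]),
  res ≔ 2]

/-- The whole algorithm.  If there is no second chain that starts in the root and ends in the
subtree containing the first chain, then the first chain provides a cut. -/
def program : Prog := block [
  buildIncidenceLists,
  depthFirstSearch,
  chainDecomposition,
  .ite (src 2 =? 1 &&? tgt 2 ≠? 1)
    (block [setUpCurrentGraph, addChains, report])
    reportFirstChain]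

end Program

/-- The initial state: the numbers of vertices and edges and the endpoints of the edges are given,
all other registers and arrays are zero. -/
def input (n m : ℕ) (end1 end2 : ℕ → ℕ) : State where
  regs
    | .numV => n
    | .numE => m
    | _ => 0
  arrs
    | .end1 => end1
    | .end2 => end2
    | _ => fun _ => 0

/-- The edges of the chain `c`, in order. -/
def chainEdges (s : State) (c : ℕ) : List ℕ :=
  (List.range (s.arrs .chainStart (c + 1) - s.arrs .chainStart c)).map
    fun k => s.arrs .chainEdge (s.arrs .chainStart c + k)

/-- The chains in the order in which they have been added to the current graph. -/
def addedChains (s : State) : List (List ℕ) :=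
  (List.range (s.regs .numAdded)).map fun k => chainEdges s (s.arrs .order (k + 1))

/-- The final state reports a Mader sequence of `G`: the first two chains added form a subdivision
of the triple edge, and the others are Mader paths, in the order of their addition. -/
def ReportsMaderSequence (G : Graph ℕ ℕ) (s : State) : Prop :=
  s.regs .res = 1 ∧ ∃ (C₁ C₂ : List ℕ) (Ps : List (List ℕ)),
    addedChains s = C₁ :: C₂ :: Ps ∧ Mader.IsMaderSequence G (C₁ ++ C₂) Ps

/-- The final state reports a 2-edge-cut of `G`. -/
def ReportsTwoEdgeCut (G : Graph ℕ ℕ) (s : State) : Prop :=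
  s.regs .res = 2 ∧ s.regs .cut1 ≠ s.regs .cut2 ∧
    Mader.IsEdgeCut G {s.regs .cut1, s.regs .cut2}

end GreedyChainAddition

set_option linter.unusedSimpArgs false
set_option linter.unusedSectionVars false

/-! ## Total correctness with time credits -/

namespace RAM

variable {R A : Type} [DecidableEq R] [DecidableEq A]

/-! Chains. Every edge of `G` is a tree edge or a back edge of the depth-first search tree, and
since `G` has no bridge, every tree edge is spanned by a back edge (`Palm.exists_back`). Hence the
chains partition the edges, and every vertex other than the root belongs strongly to exactly one
chain. The source of a chain is an ancestor of its target. Therefore a set of chains that is closed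
under taking parents covers a set of vertices closed under taking ancestors (`ChainDec.Closed`), and
once the parent of a chain has been added, both endpoints of the chain lie in the current graph
while its inner vertices are new. In the current graph a vertex has degree two unless it is the root
or an endpoint of an added chain (`Labels.nonBranch`, `Labels.branch`), and a link is an ascending
tree path preceded by a single edge (`ChainDec.Links`). So a missing chain with an added parent is a
Mader path unless both endpoints are inner vertices of the same link (`Links.isMaderPath`).

Cuts. Suppose that no chain is addable although some are missing. Then every missing chain with an
added parent has both endpoints inside one link, and the missing chain with the smallest number
shows that some link has an inner vertex (`Links.exists_mem`). For such a link `L`, consider its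
inner vertices together with everything that hangs off them by missing chains. No edge of a missing
chain leaves this set: this is `Links.hangs_anc`, an induction on the number of the chain that uses
that chains are constructed in depth-first order of their sources. Only the first and the last edge
of `L` leave it, and they form a cut (`Links.isEdgeCut`). If instead the second chain does not start
in the root and end in the subtree of the first one, then, as the back edges at the root are grouped
by subtrees, only the back edge of the first chain joins the root to that subtree, and its first and
last edge form a cut (`ChainDec.isEdgeCut_first`).

Time. The weight of a link is the number of its inner vertices plus the number of list entries
stored at them. Walking in lockstep makes the price of a split at `u` proportional to the weight of
the lighter side plus the weight of `u`. The sum of `logSum` over the weights of the links drops by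
at least this amount (`logSum_split`, `potential_split`). It grows only when a chain becomes a link
or is associated with a link, by at most a logarithm per inner vertex or list entry. Each chain is
added at most once and associated at most once, namely when its parent is processed, so credits
proportional to `(n + 2 * m) * log (n + 2 * m)` suffice (`ChainDec.debt`, `credits_le`).

The program is verified by a calculus of weakest preconditions whose postconditions also speak about
the remaining time credits, so that termination, running time and functional correctness are proved
at once. -/

/-- Started in `s` with `k` time credits, the program `c` terminates within the credits, and the
final state together with the remaining credits satisfies `Q`. -/
def WP (c : Prog R A) (s : State R A) (k : ℕ) (Q : State R A → ℕ → Prop) : Prop :=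
  ∃ s' t, Exec c s s' t ∧ t ≤ k ∧ Q s' (k - t)

@[simp] theorem regs_setReg (s : State R A) (r r' : R) (n : ℕ) :
    (s.setReg r n).regs r' = if r' = r then n else s.regs r' := by
  simp [State.setReg, Function.update_apply]

@[simp] theorem arrs_setReg (s : State R A) (r : R) (n : ℕ) : (s.setReg r n).arrs = s.arrs := rfl

@[simp] theorem regs_setCell (s : State R A) (a : A) (i n : ℕ) :
    (s.setCell a i n).regs = s.regs := rfl

@[simp] theorem arrs_setCell (s : State R A) (a a' : A) (i n : ℕ) :
    (s.setCell a i n).arrs a' = if a' = a then Function.update (s.arrs a) i n else s.arrs a' := by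
  by_cases h : a' = a
  · subst h; simp [State.setCell]
  · simp [State.setCell, h]

def Prog.loopFree : Prog R A → Bool
  | .skip => true
  | .assign _ _ => true
  | .store _ _ _ => true
  | .seq c d => c.loopFree && d.loopFree
  | .ite _ c d => c.loopFree && d.loopFree
  | .while _ _ => false

/-- An upper bound for the running time of a loop-free program. -/
def Prog.maxCost : Prog R A → ℕ
  | .skip => 1
  | .assign _ x => x.cost + 1
  | .store _ i x => i.cost + x.cost + 1
  | .seq c d => c.maxCost + d.maxCost
  | .ite b c d => b.cost + 1 + max c.maxCost d.maxCost
  | .while _ _ => 0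

open Classical in
/-- The final state of a loop-free program. -/
noncomputable def run : Prog R A → State R A → State R A
  | .skip, s => s
  | .assign r x, s => s.setReg r (x.eval s)
  | .store a i x, s => s.setCell a (i.eval s) (x.eval s)
  | .seq c d, s => run d (run c s)
  | .ite b c d, s => if b.Holds s then run c s else run d s
  | .while _ _, s => s

def Prog.writesReg (r : R) : Prog R A → Bool
  | .skip => false
  | .assign r' _ => r = r'
  | .store _ _ _ => false
  | .seq c d => c.writesReg r || d.writesReg r
  | .ite _ c d => c.writesReg r || d.writesReg r
  | .while _ c => c.writesReg r

def Prog.writesArr (a : A) : Prog R A → Bool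
  | .skip => false
  | .assign _ _ => false
  | .store a' _ _ => a = a'
  | .seq c d => c.writesArr a || d.writesArr a
  | .ite _ c d => c.writesArr a || d.writesArr a
  | .while _ c => c.writesArr a

/-- The states `s` and `s'` agree on everything that `c` does not write. -/
structure Frame (c : Prog R A) (s s' : State R A) : Prop where
  regs : ∀ r, c.writesReg r = false → s'.regs r = s.regs r
  arrs : ∀ a, c.writesArr a = false → s'.arrs a = s.arrs a

theorem Exec.frame {c : Prog R A} {s s' : State R A} {t : ℕ} (h : Exec c s s' t) :
    Frame c s s' := by
  induction h with
  | skip => exact ⟨fun _ _ => rfl, fun _ _ => rfl⟩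
  | assign => exact ⟨fun r hr => by simp_all [Prog.writesReg], fun a _ => rfl⟩
  | store => exact ⟨fun r _ => rfl, fun a ha => by simp_all [Prog.writesArr]⟩
  | seq _ _ h₁ h₂ =>
    refine ⟨fun r hr => ?_, fun a ha => ?_⟩
    · simp only [Prog.writesReg, Bool.or_eq_false_iff] at hr
      rw [h₂.regs r hr.2, h₁.regs r hr.1]
    · simp only [Prog.writesArr, Bool.or_eq_false_iff] at ha
      rw [h₂.arrs a ha.2, h₁.arrs a ha.1]
  | iteTrue _ _ h =>
    refine ⟨fun r hr => ?_, fun a ha => ?_⟩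
    · simp only [Prog.writesReg, Bool.or_eq_false_iff] at hr
      exact h.regs r hr.1
    · simp only [Prog.writesArr, Bool.or_eq_false_iff] at ha
      exact h.arrs a ha.1
  | iteFalse _ _ h =>
    refine ⟨fun r hr => ?_, fun a ha => ?_⟩
    · simp only [Prog.writesReg, Bool.or_eq_false_iff] at hr
      exact h.regs r hr.2
    · simp only [Prog.writesArr, Bool.or_eq_false_iff] at ha
      exact h.arrs a ha.2
  | whileFalse => exact ⟨fun _ _ => rfl, fun _ _ => rfl⟩
  | whileTrue _ _ _ h₁ h₂ =>
    refine ⟨fun r hr => ?_, fun a ha => ?_⟩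
    · rw [h₂.regs r hr, h₁.regs r hr]
    · rw [h₂.arrs a ha, h₁.arrs a ha]

/-- Besides weakening, this rule supplies the syntactic frame. Specifications then mention only what
a program modifies, and everything else is recovered by evaluating `writesReg` and `writesArr`,
usually with `rfl`. -/
theorem WP.conseq {c : Prog R A} {s : State R A} {k : ℕ} {P Q : State R A → ℕ → Prop}
    (h : WP c s k P) (hPQ : ∀ s' k', P s' k' → Frame c s s' → Q s' k') : WP c s k Q := by
  obtain ⟨s', t, he, ht, hp⟩ := h
  exact ⟨s', t, he, ht, hPQ _ _ hp he.frame⟩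

theorem WP.seq {c d : Prog R A} {s : State R A} {k : ℕ} {Q : State R A → ℕ → Prop}
    (h : WP c s k fun s' k' => WP d s' k' Q) : WP (.seq c d) s k Q := by
  obtain ⟨s', t, he, ht, s'', t', he', ht', hq⟩ := h
  refine ⟨s'', t + t', he.seq he', by omega, ?_⟩
  rwa [← Nat.sub_sub]

theorem WP.ite {b : Test R A} {c d : Prog R A} {s : State R A} {k : ℕ}
    {Q : State R A → ℕ → Prop} (hk : b.cost + 1 ≤ k)
    (h₁ : b.Holds s → WP c s (k - (b.cost + 1)) Q)
    (h₂ : ¬ b.Holds s → WP d s (k - (b.cost + 1)) Q) : WP (.ite b c d) s k Q := by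
  by_cases hb : b.Holds s
  · obtain ⟨s', t, he, ht, hq⟩ := h₁ hb
    refine ⟨s', _, he.iteTrue hb, by omega, ?_⟩
    rwa [← Nat.sub_sub]
  · obtain ⟨s', t, he, ht, hq⟩ := h₂ hb
    refine ⟨s', _, he.iteFalse hb, by omega, ?_⟩
    rwa [← Nat.sub_sub]

/-- The invariant speaks about the remaining credits. Since each test consumes some of them, strong
induction on the credits replaces a separate termination measure. The invariant may also use that
nothing outside the loop body's write set has changed. -/
theorem WP.while {b : Test R A} {c : Prog R A} {s : State R A} {k : ℕ}
    {Q : State R A → ℕ → Prop} (I : State R A → ℕ → Prop) (h₀ : I s k)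
    (h : ∀ s' k', I s' k' → Frame c s s' → b.cost + 1 ≤ k' ∧
      (b.Holds s' → WP c s' (k' - (b.cost + 1)) I) ∧
      (¬ b.Holds s' → Q s' (k' - (b.cost + 1)))) : WP (.while b c) s k Q := by
  have key : ∀ k' s', I s' k' → Frame c s s' → WP (.while b c) s' k' Q := by
    intro k'
    induction k' using Nat.strong_induction_on with
    | _ k' ih =>
      intro s' hI hf
      obtain ⟨hk, h₁, h₂⟩ := h s' k' hI hf
      by_cases hb : b.Holds s'
      · obtain ⟨s₁, t, he, ht, hI'⟩ := h₁ hb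
        have hf' : Frame c s s₁ := ⟨fun r hr => by rw [he.frame.regs r hr, hf.regs r hr],
          fun a ha => by rw [he.frame.arrs a ha, hf.arrs a ha]⟩
        obtain ⟨s₂, t', he', ht', hq⟩ := ih (k' - (b.cost + 1) - t) (by omega) s₁ hI' hf'
        refine ⟨s₂, _, he.whileTrue hb he', by omega, ?_⟩
        rwa [← Nat.sub_sub, ← Nat.sub_sub]
      · exact ⟨s', _, .whileFalse hb, hk, h₂ hb⟩
  exact key k s h₀ ⟨fun _ _ => rfl, fun _ _ => rfl⟩

theorem exec_run {c : Prog R A} (hc : c.loopFree = true) (s : State R A) :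
    ∃ t ≤ c.maxCost, Exec c s (run c s) t := by
  induction c generalizing s with
  | skip => exact ⟨1, le_rfl, .skip⟩
  | assign r x => exact ⟨_, le_rfl, .assign⟩
  | store a i x => exact ⟨_, le_rfl, .store⟩
  | seq c d hc' hd =>
    simp only [Prog.loopFree, Bool.and_eq_true] at hc
    obtain ⟨t, ht, he⟩ := hc' hc.1 s
    obtain ⟨t', ht', he'⟩ := hd hc.2 (run c s)
    exact ⟨_, Nat.add_le_add ht ht', he.seq he'⟩
  | ite b c d hc' hd =>
    simp only [Prog.loopFree, Bool.and_eq_true] at hc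
    simp only [run, Prog.maxCost]
    split_ifs with hb
    · obtain ⟨t, ht, he⟩ := hc' hc.1 s
      exact ⟨_, by omega, he.iteTrue hb⟩
    · obtain ⟨t, ht, he⟩ := hd hc.2 s
      exact ⟨_, by omega, he.iteFalse hb⟩
  | _ => simp [Prog.loopFree] at hc

/-- Loop-free code is executed symbolically by `run`. Branches may differ in cost, so the remaining
credits are known only up to the bound `M`. The last two arguments are settled by evaluation; the
values of `run` and `maxCost` at loops are never used. -/
theorem WP.run {c : Prog R A} {s : State R A} {k : ℕ} {Q : State R A → ℕ → Prop} (M : ℕ)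
    (hk : M ≤ k) (h : ∀ k', k ≤ k' + M → Q (run c s) k') (hc : c.loopFree = true := by rfl)
    (hM : c.maxCost ≤ M := by decide) : WP c s k Q := by
  obtain ⟨t, ht, he⟩ := exec_run hc s
  exact ⟨_, t, he, by omega, h _ (by omega)⟩

end RAM

/-! ## Linked lists -/

/-- Starting from `h` and following the successor function `nx`, one passes through the elements of
the list and arrives at `e`. -/
def Trail (nx : ℕ → ℕ) : ℕ → List ℕ → ℕ → Prop
  | h, [], e => h = e
  | h, x :: l, e => h = x ∧ Trail nx (nx x) l e

namespace Trail

variable {nx nx' : ℕ → ℕ} {h e x : ℕ} {l l₁ l₂ : List ℕ}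

theorem append_iff : Trail nx h (l₁ ++ l₂) e ↔ ∃ y, Trail nx h l₁ y ∧ Trail nx y l₂ e := by
  induction l₁ generalizing h with
  | nil => simp [Trail]
  | cons a l ih => simp [Trail, ih, and_assoc]

theorem congr (ht : Trail nx h l e) (hn : ∀ x ∈ l, nx' x = nx x) : Trail nx' h l e := by
  induction l generalizing h with
  | nil => exact ht
  | cons a l ih =>
    refine ⟨ht.1, ?_⟩
    rw [hn a (by simp)]
    exact ih ht.2 fun x hx => hn x (by simp [hx])

theorem update (ht : Trail nx h l e) (hx : x ∉ l) (n : ℕ) :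
    Trail (Function.update nx x n) h l e :=
  ht.congr fun y hy => Function.update_of_ne (by rintro rfl; exact hx hy) _ _

theorem eq_nil_of_notMem (ht : Trail nx h l e) (hh : h ∉ l) : l = [] := by
  cases l with
  | nil => rfl
  | cons a l => exact absurd (by simp [ht.1]) hh

theorem exists_cons (ht : Trail nx h l e) (hh : h ≠ e) :
    ∃ l', l = h :: l' ∧ Trail nx (nx h) l' e := by
  cases l with
  | nil => exact absurd ht hh
  | cons a l =>
    obtain ⟨rfl, h'⟩ := ht
    exact ⟨l, rfl, h'⟩

theorem head_eq (ht : Trail nx h l e) : h = l.headD e := by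
  cases l with
  | nil => exact ht
  | cons a l => exact ht.1

/-- Deleting an element from a singly linked list whose end is `0`. -/
theorem delete {z : ℕ} (ht : Trail nx h (l₁ ++ z :: l₂) 0) (hn : (l₁ ++ z :: l₂).Nodup)
    (h0 : 0 ∉ l₁) :
    Trail (if l₁.getLastD 0 = 0 then nx else Function.update nx (l₁.getLastD 0) (nx z))
      (if l₁.getLastD 0 = 0 then nx z else h) (l₁ ++ l₂) 0 := by
  obtain ⟨y, hy, rfl, h₂⟩ := append_iff.1 ht
  -- If `l₁` is empty, the deleted element is the head and the default `0` signals this; otherwise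
  -- the last element of `l₁` is the predecessor whose pointer is redirected.
  rcases List.eq_nil_or_concat l₁ with rfl | ⟨l, w, rfl⟩
  · simpa using h₂
  · simp only [List.concat_eq_append] at *
    obtain ⟨y', hy', rfl, -⟩ := append_iff.1 hy
    have hw : y' ≠ 0 := by rintro rfl; simp at h0
    simp only [List.append_assoc, List.nodup_append, List.nodup_cons] at hn
    have hwl : y' ∉ l := fun hm => hn.2.2 _ hm y' (by simp) rfl
    have hw2 : y' ∉ l₂ := fun hm => hn.2.1.2.2 y' (by simp) _ (by simp [hm]) rfl
    simp only [List.getLastD_concat, hw, if_false, List.append_assoc]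
    refine append_iff.2 ⟨y', hy'.update hwl _, rfl, ?_⟩
    simpa using h₂.update hw2 _

end Trail

/-- A doubly linked list with first element `h` and last element `t`. -/
structure DLL (nx pv : ℕ → ℕ) (h t : ℕ) (l : List ℕ) : Prop where
  fwd : Trail nx h l 0
  bwd : Trail pv t l.reverse 0

/-! ## A potential function -/

/-- A function that grows like `n log n` and pays for splitting at the price of the smaller part. -/
def logSum (n : ℕ) : ℕ := ∑ i ∈ Finset.range n, (Nat.log 2 (i + 1) + 1)

theorem logSum_succ (n : ℕ) : logSum (n + 1) = logSum n + (Nat.log 2 (n + 1) + 1) :=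
  Finset.sum_range_succ _ _

theorem logSum_mono {a b : ℕ} (h : a ≤ b) : logSum a ≤ logSum b :=
  Finset.sum_le_sum_of_subset (by simpa using h)

theorem logSum_add_le (a e : ℕ) : logSum a + e ≤ logSum (a + e) := by
  induction e with
  | zero => simp
  | succ e ih =>
    have := logSum_succ (a + e)
    rw [← add_assoc a]
    omega

/-- Each of the `e` increments is at most `Nat.log 2 N + 1`. This bounds the growth of the potential
when vertices or list entries are inserted. -/
theorem logSum_add_le_mul (a e N : ℕ) (h : a + e ≤ N) :
    logSum (a + e) ≤ logSum a + e * (Nat.log 2 N + 1) := by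
  induction e with
  | zero => simp
  | succ e ih =>
    rw [← add_assoc, logSum_succ, Nat.succ_mul]
    have := Nat.log_mono_right (b := 2) (show a + e + 1 ≤ N by omega)
    have := ih (by omega)
    omega

/-- Let the smaller part grow one unit at a time and compare increments: the whole is at least twice
as large as the smaller part, so its logarithm exceeds that of the smaller part by one, which pays
for this unit of the minimum. The `1 + e` remaining units pay for themselves because every increment
is at least one. -/
theorem logSum_split (a b e : ℕ) :
    logSum a + logSum b + min a b + (1 + e) ≤ logSum (a + (1 + e + b)) := by
  have key : ∀ a b, a ≤ b → logSum a + logSum b + a ≤ logSum (a + b) := by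
    intro a
    induction a with
    | zero => simp [logSum]
    | succ a ih =>
      intro b hab
      have h₁ := ih b (by omega)
      -- This is `2 * (a + 1) ≤ a + b + 1`, which holds because `a + 1 ≤ b`.
      have h₂ : Nat.log 2 (a + 1) + 1 ≤ Nat.log 2 (a + b + 1) := by
        rw [← Nat.log_mul_base (by norm_num) (by omega)]
        exact Nat.log_mono_right (by omega)
      rw [show a + 1 + b = a + b + 1 by omega, logSum_succ, logSum_succ]
      omega
  have h := logSum_add_le (a + b) (1 + e)
  rw [show a + (1 + e + b) = a + b + (1 + e) by omega]
  rcases le_total a b with hab | hab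
  · have := key a b hab
    omega
  · have := key b a hab
    rw [add_comm b a] at this
    omega

/-! ## Graphs given as input -/

/-- `G` is a loopless 2-edge-connected graph with vertices `1, …, n` and edges `1, …, m`, and the
endpoints of the edges are given by `end1` and `end2`. -/
structure IsInput (G : Graph ℕ ℕ) (n m : ℕ) (end1 end2 : ℕ → ℕ) : Prop where
  vertexSet : G.vertexSet = Set.Icc 1 n
  edgeSet : G.edgeSet = Set.Icc 1 m
  loopless : G.Loopless
  isLink : ∀ e ∈ G.edgeSet, G.IsLink e (end1 e) (end2 e)
  conn : Mader.EdgeConnected 2 G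

/-- For each vertex `x`, `inc x` lists entries that represent the edges incident to `x`; the entry
`h` represents the edge `eo h`, whose other endpoint is `ot h`. -/
structure IncLists (G : Graph ℕ ℕ) (inc : ℕ → List ℕ) (eo ot : ℕ → ℕ) : Prop where
  link : ∀ {x h}, h ∈ inc x → G.IsLink (eo h) x (ot h)
  exists_entry : ∀ {e x y}, G.IsLink e x y → ∃ h ∈ inc x, eo h = e ∧ ot h = y
  inj : ∀ {x h h'}, h ∈ inc x → h' ∈ inc x → eo h = eo h' → h = h'
  nodup : ∀ x, (inc x).Nodup
  zero_notMem : ∀ x, 0 ∉ inc x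

/-- All lists share the successor array `nx`. As `z` occurs in none of them, writing its successor
disturbs no list. -/
theorem Trail.push {nx hd : ℕ → ℕ} {ls : ℕ → List ℕ} (h : ∀ x, Trail nx (hd x) (ls x) 0) {z : ℕ}
    (hz : ∀ x, z ∉ ls x) (y x : ℕ) :
    Trail (Function.update nx z (hd y)) (Function.update hd y z x)
      (Function.update ls y (z :: ls y) x) 0 := by
  by_cases hx : x = y
  · subst hx
    simpa [Trail] using (h x).update (hz x) (hd x)
  · simpa [hx] using (h x).update (hz x) (hd y)

theorem sum_length_update (ls : ℕ → List ℕ) (S : Finset ℕ) {y : ℕ} (hy : y ∈ S) (l : List ℕ) :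
    ∑ x ∈ S, (Function.update ls y l x).length + (ls y).length =
      ∑ x ∈ S, (ls x).length + l.length := by
  rw [← Finset.add_sum_erase S _ hy, ← Finset.add_sum_erase S (fun x => (ls x).length) hy,
    Finset.sum_congr rfl (g := fun x => (ls x).length)
      (fun x hx => by rw [Function.update_of_ne (Finset.ne_of_mem_erase hx)])]
  simp
  omega

/-! ### Invariant of depth-first search -/

/-- The state of a depth-first search in the course of its execution: `v` is the current vertex,
`rem x` lists the unexplored entries at `x`, `anc x` the ancestors of `x`, `bk y` the back edges
found so far with upper endpoint `y`, and `top x` is the child of the root above `x`. -/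
structure DFSInv (G : Graph ℕ ℕ) (n : ℕ) (inc : ℕ → List ℕ) (eo ot : ℕ → ℕ)
    (num par parEdge vertexAt low : ℕ → ℕ) (cnt v : ℕ) (rem anc bk : ℕ → List ℕ) (top : ℕ → ℕ) :
    Prop where
  rem_suffix : ∀ x, rem x <:+ inc x
  bk_nodup : ∀ x, (bk x).Nodup
  num_one : num 1 = 1
  par_one : par 1 = 0
  vis : ∀ x, num x ≠ 0 → 1 ≤ x ∧ x ≤ n ∧ num x ≤ cnt ∧ vertexAt (num x) = x
  vertexAt : ∀ k, 1 ≤ k → k ≤ cnt → num (vertexAt k) = k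
  tree : ∀ x, num x ≠ 0 → x ≠ 1 →
    num (par x) ≠ 0 ∧ num (par x) < num x ∧ G.IsLink (parEdge x) x (par x)
  parEdge_one : parEdge 1 = 0
  anc_zero : anc 0 = []
  anc_eq : ∀ x, num x ≠ 0 → anc x = x :: anc (par x)
  unvis : ∀ x, num x = 0 → rem x = inc x
  fin : ∀ x, num x ≠ 0 → x ∉ anc v → rem x = []
  cur : v ≠ 0 → num v ≠ 0
  explored : ∀ x h, num x ≠ 0 → h ∈ inc x → h ∉ rem x →
    num (ot h) ≠ 0 ∧ (x ∈ anc (ot h) ∨ ot h ∈ anc x) ∧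
    (num (ot h) < num x → eo h = parEdge x ∨ (eo h ∈ bk (ot h) ∧ low (eo h) = x))
  back : ∀ y e, e ∈ bk y → ∃ h ∈ inc (low e), h ∉ rem (low e) ∧ eo h = e ∧ ot h = y ∧
    num y ≠ 0 ∧ num (low e) ≠ 0 ∧ num y < num (low e) ∧ e ≠ parEdge (low e)
  top_eq : ∀ x, num x ≠ 0 → x ≠ 1 → top x = if par x = 1 then x else top (par x)
  top_vis : ∀ x, num x ≠ 0 → x ≠ 1 → num (top x) ≠ 0
  top_max : v ≠ 0 → v ≠ 1 → ∀ x, num x ≠ 0 → x ≠ 1 → num (top x) ≤ num (top v)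
  sorted : (bk 1).Pairwise fun e e' => num (top (low e')) ≤ num (top (low e))

namespace DFSInv

variable {G : Graph ℕ ℕ} {n : ℕ} {inc : ℕ → List ℕ} {eo ot : ℕ → ℕ}
  {num par parEdge vertexAt low : ℕ → ℕ} {cnt v : ℕ} {rem anc bk : ℕ → List ℕ} {top : ℕ → ℕ}

theorem ascend (I : DFSInv G n inc eo ot num par parEdge vertexAt low cnt v rem anc bk top)
    (hv : v ≠ 0) (hr : rem v = []) :
    DFSInv G n inc eo ot num par parEdge vertexAt low cnt (par v) rem anc bk top := by
  have hvv := I.cur hv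
  have h1 : par v ≠ 0 → v ≠ 1 := by rintro h rfl; exact h I.par_one
  refine { I with fin := ?_, cur := ?_, top_max := ?_ }
  · intro x hx hxa
    by_cases hxv : x = v
    · rw [hxv, hr]
    · exact I.fin x hx (by rw [I.anc_eq v hvv]; simp [hxv, hxa])
  · intro h
    exact (I.tree v hvv (h1 h)).1
  · intro h h' x hx hx1
    have := I.top_max hv (h1 h) x hx hx1
    rwa [I.top_eq v hvv (h1 h), if_neg h'] at this

/-- There are no cross edges: a visited neighbour that is not an ancestor of `v` is finished, so it
has already explored the same edge from its own side, and comparability was recorded then. -/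
theorem comparable (I : DFSInv G n inc eo ot num par parEdge vertexAt low cnt v rem anc bk top)
    (hi : IncLists G inc eo ot) {h : ℕ} (hh : h ∈ inc v) (hw : num (ot h) ≠ 0) :
    v ∈ anc (ot h) ∨ ot h ∈ anc v := by
  by_cases hm : ot h ∈ anc v
  · exact .inr hm
  · have hr := I.fin _ hw hm
    obtain ⟨h', hh', he, ho⟩ := hi.exists_entry (hi.link hh).symm
    have := (I.explored _ h' hw hh' (by simp [hr])).2.1
    rw [ho] at this
    exact this.symm

/-- The new vertex receives the largest number so far and becomes a child of `v`. It opens a new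
subtree of the root exactly when `v` is the root, and otherwise inherits `top v`; in both cases its
`top` has the largest number among all values of `top`. -/
theorem descend (I : DFSInv G n inc eo ot num par parEdge vertexAt low cnt v rem anc bk top)
    (hi : IncLists G inc eo ot) (hV : G.vertexSet = Set.Icc 1 n) {h : ℕ} {t : List ℕ} (hv : v ≠ 0)
    (hr : rem v = h :: t) (hw : num (ot h) = 0) :
    DFSInv G n inc eo ot (Function.update num (ot h) (cnt + 1)) (Function.update par (ot h) v)
      (Function.update parEdge (ot h) (eo h)) (Function.update vertexAt (cnt + 1) (ot h)) low
      (cnt + 1) (ot h) (Function.update rem v t) (Function.update anc (ot h) (ot h :: anc v)) bk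
      (Function.update top (ot h) (if v = 1 then ot h else top v)) := by
  have hvv := I.cur hv
  have hh : h ∈ inc v := (I.rem_suffix v).subset (by simp [hr])
  have hl := hi.link hh
  set w := ot h with hwdef
  have hwr : w ∈ Set.Icc 1 n := hV ▸ hl.right_mem
  have hne : ∀ x, num x ≠ 0 → x ≠ w := by rintro x hx rfl; exact hx hw
  have hvw := hne v hvv
  have hn : (rem v).Nodup := (hi.nodup v).sublist (I.rem_suffix v).sublist
  have hvc := (I.vis v hvv).2.2.1
  have hw1 : w ≠ 1 := (hne 1 (by simp [I.num_one])).symm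
  have hw0 : w ≠ 0 := by have := hwr.1; omega
  have hpw : ∀ x, num x ≠ 0 → par x ≠ w := by
    intro x hx
    by_cases hx1 : x = 1
    · rw [hx1, I.par_one]; exact hw0.symm
    · exact hne _ (I.tree x hx hx1).1
  have hlow : ∀ y e, e ∈ bk y → low e ≠ w := by
    intro y e he
    obtain ⟨h', -, -, -, -, -, h2, -⟩ := I.back y e he
    exact hne _ h2
  have hsub : ∀ x z, z ∈ Function.update rem v t x → z ∈ rem x := by
    intro x z
    by_cases hx : x = v
    · subst hx; simp only [Function.update_self, hr]; exact List.mem_cons_of_mem _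
    · simp [hx]
  have hvm : v ∈ anc v := by rw [I.anc_eq v hvv]; simp
  have htw : ∀ x, num x ≠ 0 → x ≠ 1 → top x ≠ w := fun x hx hx1 => hne _ (I.top_vis x hx hx1)
  have htc : ∀ x, num x ≠ 0 → x ≠ 1 → num (top x) ≤ cnt := fun x hx hx1 =>
    (I.vis _ (I.top_vis x hx hx1)).2.2.1
  refine
    { bk_nodup := I.bk_nodup, rem_suffix := fun x => ?_, num_one := ?_, par_one := ?_,
      vis := fun x hx => ?_, vertexAt := fun k hk hkc => ?_, tree := fun x hx hx1 => ?_,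
      parEdge_one := ?_, anc_zero := ?_, anc_eq := fun x hx => ?_, unvis := fun x hx => ?_,
      fin := fun x hx hxa => ?_, cur := fun _ => ?_, explored := fun x h' hx hh' hr' => ?_,
      back := fun y e he => ?_, top_eq := fun x hx hx1 => ?_, top_vis := fun x hx hx1 => ?_,
      top_max := fun _ _ x hx hx1 => ?_, sorted := ?_ }
  · by_cases hx : x = v
    · subst hx
      simp only [Function.update_self]
      exact (List.suffix_cons h t).trans (hr ▸ I.rem_suffix x)
    · simpa [hx] using I.rem_suffix x
  · simp [hw1.symm, I.num_one]
  · simp [hw1.symm, I.par_one]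
  · by_cases hxw : x = w
    · subst hxw; simpa using hwr
    · simp only [Function.update_of_ne hxw] at hx ⊢
      obtain ⟨a, b, c, d⟩ := I.vis x hx
      exact ⟨a, b, by omega, by rw [Function.update_of_ne (by omega), d]⟩
  · by_cases hk' : k = cnt + 1
    · subst hk'; simp
    · have := I.vertexAt k hk (by omega)
      rw [Function.update_of_ne hk', Function.update_of_ne (hne _ (by omega)), this]
  · by_cases hxw : x = w
    · subst hxw
      simp only [Function.update_self, Function.update_of_ne hvw]
      exact ⟨hvv, by omega, hl.symm⟩
    · simp only [Function.update_of_ne hxw] at hx ⊢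
      rw [Function.update_of_ne (hpw x hx)]
      exact I.tree x hx hx1
  · simp [hw1.symm, I.parEdge_one]
  · simp [hw0.symm, I.anc_zero]
  · by_cases hxw : x = w
    · subst hxw; simp [hvw]
    · simp only [Function.update_of_ne hxw] at hx ⊢
      rw [Function.update_of_ne (hpw x hx)]
      exact I.anc_eq x hx
  · by_cases hxw : x = w
    · subst hxw; simp at hx
    · simp only [Function.update_of_ne hxw] at hx
      rw [Function.update_of_ne (by rintro rfl; exact hvv hx), I.unvis x hx]
  · simp only [Function.update_self, List.mem_cons, not_or] at hxa
    rw [Function.update_of_ne hxa.1] at hx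
    rw [Function.update_of_ne (by rintro rfl; exact hxa.2 hvm)]
    exact I.fin x hx hxa.2
  · simp
  · by_cases hxw : x = w
    · subst hxw
      rw [Function.update_of_ne hvw.symm, I.unvis _ hw] at hr'
      exact absurd hh' hr'
    · rw [Function.update_of_ne hxw] at hx
      by_cases hcase : x = v ∧ h' = h
      · obtain ⟨rfl, rfl⟩ := hcase
        simp only [← hwdef, Function.update_self, Function.update_of_ne hvw]
        exact ⟨by simp, .inl (by simp [hvm]), fun hlt => by omega⟩
      · have hr2 : h' ∉ rem x := by
          by_cases hxv : x = v
          · subst hxv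
            rw [Function.update_self] at hr'
            rw [hr]
            simp_all
          · rwa [Function.update_of_ne hxv] at hr'
        obtain ⟨h1, h2, h3⟩ := I.explored x h' hx hh' hr2
        simp only [Function.update_of_ne hxw, Function.update_of_ne (hne _ h1)]
        exact ⟨h1, h2, h3⟩
  · obtain ⟨h', h1, h2, h3, h4, h5, h6, h7, h8⟩ := I.back y e he
    refine ⟨h', h1, fun hm => h2 (hsub _ _ hm), h3, h4, ?_⟩
    simp only [Function.update_of_ne (hne _ h5), Function.update_of_ne (hne _ h6)]
    exact ⟨h5, h6, h7, h8⟩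
  · by_cases hxw : x = w
    · subst hxw
      simp only [Function.update_self, Function.update_of_ne hvw]
    · simp only [Function.update_of_ne hxw] at hx ⊢
      rw [Function.update_of_ne (hpw x hx)]
      exact I.top_eq x hx hx1
  · by_cases hxw : x = w
    · subst hxw
      simp only [Function.update_self]
      split_ifs with hv1
      · simp
      · rw [Function.update_of_ne (htw v hvv hv1)]
        exact I.top_vis v hvv hv1
    · simp only [Function.update_of_ne hxw] at hx ⊢
      rw [Function.update_of_ne (htw x hx hx1)]
      exact I.top_vis x hx hx1
  · by_cases hxw : x = w
    · subst hxw; exact le_rfl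
    · simp only [Function.update_of_ne hxw] at hx ⊢
      rw [Function.update_of_ne (htw x hx hx1)]
      simp only [Function.update_self]
      have := htc x hx hx1
      split_ifs with hv1
      · simp only [Function.update_self]; omega
      · rw [Function.update_of_ne (htw v hvv hv1)]
        exact I.top_max hv hv1 x hx hx1
  · have hlow1 : ∀ e ∈ bk 1, num (low e) ≠ 0 ∧ low e ≠ 1 := by
      intro e he
      obtain ⟨h', h1, h2, h3, h4, h5, h6, h7, h8⟩ := I.back 1 e he
      exact ⟨h6, by rintro h; rw [h] at h7; exact lt_irrefl _ h7⟩
    refine I.sorted.imp_of_mem fun {a b} ha hb hab => ?_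
    rw [Function.update_of_ne (hlow 1 a ha), Function.update_of_ne (hlow 1 b hb),
      Function.update_of_ne (htw _ (hlow1 a ha).1 (hlow1 a ha).2),
      Function.update_of_ne (htw _ (hlow1 b hb).1 (hlow1 b hb).2)]
    exact hab

theorem skip (I : DFSInv G n inc eo ot num par parEdge vertexAt low cnt v rem anc bk top)
    (hi : IncLists G inc eo ot) {h : ℕ} {t : List ℕ} (hv : v ≠ 0) (hr : rem v = h :: t)
    (hw : num (ot h) ≠ 0) (hskip : num (ot h) < num v → eo h = parEdge v) :
    DFSInv G n inc eo ot num par parEdge vertexAt low cnt v (Function.update rem v t) anc bk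
      top := by
  have hvv := I.cur hv
  have hh : h ∈ inc v := (I.rem_suffix v).subset (by simp [hr])
  have hvm : v ∈ anc v := by rw [I.anc_eq v hvv]; simp
  refine { I with rem_suffix := fun x => ?_, unvis := fun x hx => ?_, fin := fun x hx hxa => ?_,
                  explored := fun x h' hx hh' hr' => ?_, back := fun y e he => ?_ }
  · by_cases hx : x = v
    · subst hx
      simp only [Function.update_self]
      exact (List.suffix_cons h t).trans (hr ▸ I.rem_suffix x)
    · simpa [hx] using I.rem_suffix x
  · rw [Function.update_of_ne (by rintro rfl; exact hvv hx), I.unvis x hx]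
  · rw [Function.update_of_ne (by rintro rfl; exact hxa hvm)]
    exact I.fin x hx hxa
  · by_cases hcase : x = v ∧ h' = h
    · obtain ⟨rfl, rfl⟩ := hcase
      exact ⟨hw, I.comparable hi hh hw, fun hlt => .inl (hskip hlt)⟩
    · refine I.explored x h' hx hh' ?_
      by_cases hxv : x = v
      · subst hxv
        rw [Function.update_self] at hr'
        rw [hr]
        simp_all
      · rwa [Function.update_of_ne hxv] at hr'
  · obtain ⟨h', h1, h2, h3⟩ := I.back y e he
    refine ⟨h', h1, fun hm => h2 ?_, h3⟩
    by_cases hx : low e = v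
    · rw [hx] at hm ⊢
      rw [hr]
      simp_all
    · simpa [hx] using hm

/-- A recorded back edge was recorded by an explored entry at its lower endpoint. Comparing numbers,
this endpoint is `v`, and `inj` identifies the entry with `h`, which is still unexplored. -/
theorem fresh (I : DFSInv G n inc eo ot num par parEdge vertexAt low cnt v rem anc bk top)
    (hi : IncLists G inc eo ot) {h : ℕ} {t : List ℕ} (hr : rem v = h :: t)
    (hlt : num (ot h) < num v) (y : ℕ) : eo h ∉ bk y := by
  intro he
  have hh : h ∈ inc v := (I.rem_suffix v).subset (by simp [hr])
  obtain ⟨h', h1, h2, h3, h4, h5, h6, h7, h8⟩ := I.back y _ he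
  have hl := hi.link h1
  rw [h3, h4] at hl
  rcases hl.eq_and_eq_or_eq_and_eq (hi.link hh) with ⟨ha, hb⟩ | ⟨ha, hb⟩
  · rw [ha] at h1 h2
    rw [hi.inj h1 hh h3] at h2
    simp [hr] at h2
  · rw [ha, hb] at h7
    omega

theorem backEdge (I : DFSInv G n inc eo ot num par parEdge vertexAt low cnt v rem anc bk top)
    (hi : IncLists G inc eo ot) {h : ℕ} {t : List ℕ} (hv : v ≠ 0) (hr : rem v = h :: t)
    (hw : num (ot h) ≠ 0) (hlt : num (ot h) < num v) (hne : eo h ≠ parEdge v) :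
    DFSInv G n inc eo ot num par parEdge vertexAt (Function.update low (eo h) v) cnt v
      (Function.update rem v t) anc (Function.update bk (ot h) (eo h :: bk (ot h))) top := by
  have hvv := I.cur hv
  have hh : h ∈ inc v := (I.rem_suffix v).subset (by simp [hr])
  have hvm : v ∈ anc v := by rw [I.anc_eq v hvv]; simp
  have hfresh := I.fresh hi hr hlt
  have hn : (rem v).Nodup := (hi.nodup v).sublist (I.rem_suffix v).sublist
  have hbk : ∀ y e, e ∈ Function.update bk (ot h) (eo h :: bk (ot h)) y ↔
      e ∈ bk y ∨ (e = eo h ∧ y = ot h) := by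
    intro y e
    by_cases hy : y = ot h
    · subst hy; simp [or_comm]
    · simp [hy]
  refine { I with rem_suffix := fun x => ?_, unvis := fun x hx => ?_, fin := fun x hx hxa => ?_,
                  explored := fun x h' hx hh' hr' => ?_, back := fun y e he => ?_,
                  bk_nodup := fun x => ?_, sorted := ?_ }
  · by_cases hx : x = v
    · subst hx
      simp only [Function.update_self]
      exact (List.suffix_cons h t).trans (hr ▸ I.rem_suffix x)
    · simpa [hx] using I.rem_suffix x
  · by_cases hx : x = ot h
    · subst hx; simp [I.bk_nodup, hfresh]
    · simpa [hx] using I.bk_nodup x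
  · rw [Function.update_of_ne (by rintro rfl; exact hvv hx), I.unvis x hx]
  · rw [Function.update_of_ne (by rintro rfl; exact hxa hvm)]
    exact I.fin x hx hxa
  · rw [hbk]
    by_cases hcase : x = v ∧ h' = h
    · obtain ⟨rfl, rfl⟩ := hcase
      exact ⟨hw, I.comparable hi hh hw, fun _ => .inr (by simp)⟩
    · have := I.explored x h' hx hh' (by
        by_cases hxv : x = v
        · subst hxv
          rw [Function.update_self] at hr'
          rw [hr]
          simp_all
        · rwa [Function.update_of_ne hxv] at hr')
      refine ⟨this.1, this.2.1, fun hl => (this.2.2 hl).imp id fun h' => ⟨.inl h'.1, ?_⟩⟩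
      rw [Function.update_of_ne (by rintro h2; exact hfresh _ (h2 ▸ h'.1)), h'.2]
  · rcases (hbk y e).1 he with he | ⟨rfl, rfl⟩
    · obtain ⟨h', h1, h2, h3⟩ := I.back y e he
      rw [Function.update_of_ne (by rintro rfl; exact hfresh y he)]
      refine ⟨h', h1, fun hm => h2 ?_, h3⟩
      by_cases hx : low e = v
      · rw [hx] at hm ⊢
        rw [hr]
        simp_all
      · simpa [hx] using hm
    · simp only [Function.update_self]
      refine ⟨h, hh, ?_, rfl, rfl, hw, hvv, hlt, hne⟩
      rw [hr] at hn
      exact (List.nodup_cons.1 hn).1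
  · have hold : (bk 1).Pairwise fun e e' => num (top (Function.update low (eo h) v e')) ≤
        num (top (Function.update low (eo h) v e)) := by
      refine I.sorted.imp_of_mem fun {a b} ha hb hab => ?_
      rwa [Function.update_of_ne (ne_of_mem_of_not_mem ha (hfresh 1)),
        Function.update_of_ne (ne_of_mem_of_not_mem hb (hfresh 1))]
    -- A new back edge to the root is put in front of the list. Its lower endpoint is the current
    -- vertex, whose root subtree is the most recent one by `top_max`, so the list stays sorted.
    by_cases h1 : ot h = 1
    · rw [h1, Function.update_self, List.pairwise_cons]
      refine ⟨fun e he => ?_, hold⟩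
      rw [Function.update_of_ne (by rintro rfl; exact hfresh 1 he), Function.update_self]
      obtain ⟨h', -, -, -, -, -, h6, h7, -⟩ := I.back 1 e he
      have := I.num_one
      refine I.top_max hv ?_ _ h6 ?_
      · rintro rfl; omega
      · intro hl; rw [hl] at h7; omega
    · rwa [Function.update_of_ne (Ne.symm h1)]

end DFSInv

/-! ### Evaluation of program text; incidence lists -/

namespace GreedyChainAddition

open RAM

attribute [simp] RAM.Expr.eval RAM.Test.Holds RAM.Expr.cost RAM.Test.cost RAM.run

-- The program text is written with local instances for numerals and sums of expressions. Naming
-- these instances explicitly lets `simp` evaluate the text outside of their scope; the same holds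
-- for the costs.
@[simp] theorem eval_ofNat (s : State) (n : ℕ) :
    RAM.Expr.eval s (@OfNat.ofNat Expr n (instOfNatExpr n)) = n := rfl

@[simp] theorem eval_add (s : State) (x y : Expr) :
    RAM.Expr.eval s (@HAdd.hAdd _ _ _ (@instHAdd _ instAddExpr) x y) = x.eval s + y.eval s := rfl

@[simp] theorem cost_ofNat (n : ℕ) : RAM.Expr.cost (@OfNat.ofNat Expr n (instOfNatExpr n)) = 1 := rfl

@[simp] theorem cost_add (x y : Expr) :
    RAM.Expr.cost (@HAdd.hAdd _ _ _ (@instHAdd _ instAddExpr) x y) = x.cost + y.cost + 1 := rfl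

end GreedyChainAddition

open RAM GreedyChainAddition

/-- The incidence lists of `G` during their construction, when all edges below `i` have been
processed. -/
structure IncInv (n m : ℕ) (end1 end2 incEdge incOther incNext incHead : ℕ → ℕ) (i : ℕ)
    (inc : ℕ → List ℕ) : Prop where
  pos : 1 ≤ i ∧ i ≤ m + 1
  mem : ∀ x h, h ∈ inc x ↔ (1 ≤ h ∧ h < i ∧ end1 h = x) ∨ (m < h ∧ h < m + i ∧ end2 (h - m) = x)
  nodup : ∀ x, (inc x).Nodup
  trail : ∀ x, Trail incNext (incHead x) (inc x) 0
  entry₁ : ∀ h, 1 ≤ h → h < i → incEdge h = h ∧ incOther h = end2 h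
  entry₂ : ∀ h, m < h → h < m + i → incEdge h = h - m ∧ incOther h = end1 (h - m)
  sum : ∑ x ∈ Finset.Icc 1 n, (inc x).length ≤ 2 * (i - 1)

theorem IncInv.step {n m : ℕ} {end1 end2 incEdge incOther incNext incHead : ℕ → ℕ} {i : ℕ}
    {inc : ℕ → List ℕ} (I : IncInv n m end1 end2 incEdge incOther incNext incHead i inc)
    (hi : i < m + 1) (h1 : end1 i ∈ Finset.Icc 1 n) (h2 : end2 i ∈ Finset.Icc 1 n)
    (hne : end1 i ≠ end2 i) :
    ∃ inc', IncInv n m end1 end2 (Function.update (Function.update incEdge i i) (m + i) i)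
      (Function.update (Function.update incOther i (end2 i)) (m + i) (end1 i))
      (Function.update (Function.update incNext i (incHead (end1 i))) (m + i)
        (Function.update incHead (end1 i) i (end2 i)))
      (Function.update (Function.update incHead (end1 i) i) (end2 i) (m + i)) (i + 1) inc' := by
  have hz : ∀ x, i ∉ inc x := by
    intro x hx
    rcases (I.mem x i).1 hx with h | h <;> omega
  have hp := I.pos.1
  obtain ⟨inc₁, hinc₁⟩ : ∃ inc₁, inc₁ = Function.update inc (end1 i) (i :: inc (end1 i)) := ⟨_, rfl⟩
  have hm₁ : ∀ x h, h ∈ inc₁ x ↔ h ∈ inc x ∨ (h = i ∧ x = end1 i) := by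
    intro x h
    by_cases hx : x = end1 i
    · subst hx; simp [hinc₁, or_comm]
    · simp [hinc₁, hx]
  have hz' : ∀ x, m + i ∉ inc₁ x := by
    intro x hx
    rcases (hm₁ x _).1 hx with h | h
    · rcases (I.mem x _).1 h with h | h <;> omega
    · omega
  obtain ⟨inc₂, hinc₂⟩ : ∃ inc₂, inc₂ = Function.update inc₁ (end2 i) ((m + i) :: inc₁ (end2 i)) :=
    ⟨_, rfl⟩
  have hm₂ : ∀ x h, h ∈ inc₂ x ↔ h ∈ inc₁ x ∨ (h = m + i ∧ x = end2 i) := by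
    intro x h
    by_cases hx : x = end2 i
    · subst hx; simp [hinc₂, or_comm]
    · simp [hinc₂, hx]
  have ht₁ := Trail.push I.trail hz (end1 i)
  rw [← hinc₁] at ht₁
  have ht₂ := Trail.push ht₁ hz' (end2 i)
  rw [← hinc₂] at ht₂
  have e₁ := sum_length_update inc _ h1 (i :: inc (end1 i))
  have e₂ := sum_length_update inc₁ _ h2 ((m + i) :: inc₁ (end2 i))
  rw [← hinc₁] at e₁
  rw [← hinc₂] at e₂
  have hn₁ : ∀ x, (inc₁ x).Nodup := by
    intro x
    by_cases hx : x = end1 i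
    · subst hx; simp [hinc₁, I.nodup, hz]
    · simpa [hinc₁, hx] using I.nodup x
  refine ⟨inc₂, ⟨by omega, fun x h => ?_, fun x => ?_, ht₂,
    fun h hh1 hh2 => ?_, fun h hh1 hh2 => ?_, ?_⟩⟩
  · rw [hm₂, hm₁, I.mem]
    have hsub : m + i - m = i := by omega
    have : h = m + i → h - m = i := by omega
    constructor
    · rintro (((h' | h') | ⟨rfl, rfl⟩) | ⟨rfl, rfl⟩)
      · exact .inl ⟨h'.1, by omega, h'.2.2⟩
      · exact .inr ⟨h'.1, by omega, h'.2.2⟩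
      · exact .inl ⟨by omega, by omega, rfl⟩
      · exact .inr ⟨by omega, by omega, by simp⟩
    · rintro (h' | h')
      · by_cases hh : h = i
        · subst hh; exact .inl (.inr ⟨rfl, h'.2.2.symm⟩)
        · exact .inl (.inl (.inl ⟨h'.1, by omega, h'.2.2⟩))
      · by_cases hh : h = m + i
        · subst hh; refine .inr ⟨rfl, ?_⟩; simpa using h'.2.2.symm
        · exact .inl (.inl (.inr ⟨h'.1, by omega, h'.2.2⟩))
  · by_cases hx : x = end2 i
    · subst hx; simp [hinc₂, hz', hn₁]
    · simpa [hinc₂, hx] using hn₁ x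
  · have hh' : h ≠ m + i := by omega
    by_cases hh : h = i
    · rw [Function.update_of_ne hh', Function.update_of_ne hh', hh]; simp
    · simpa [hh, hh'] using I.entry₁ h hh1 (by omega)
  · have hh' : h ≠ i := by omega
    by_cases hh : h = m + i
    · subst hh; simp
    · simpa [hh, hh'] using I.entry₂ h hh1 (by omega)
  · have := I.sum
    simp only [List.length_cons] at e₁ e₂
    omega

/-- The entries `h` and `m + h` represent the same edge at its two endpoints. They never occur in
the list of the same vertex because there are no loops, and this gives injectivity. -/
theorem IncInv.incLists {G : Graph ℕ ℕ} {n m : ℕ}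
    {end1 end2 incEdge incOther incNext incHead : ℕ → ℕ} (hG : IsInput G n m end1 end2)
    {inc : ℕ → List ℕ}
    (I : IncInv n m end1 end2 incEdge incOther incNext incHead (m + 1) inc) :
    IncLists G inc incEdge incOther := by
  have hE : ∀ e, 1 ≤ e → e ≤ m → G.IsLink e (end1 e) (end2 e) := fun e h₁ h₂ =>
    hG.isLink e (by rw [hG.edgeSet]; exact ⟨h₁, h₂⟩)
  have hloop := hG.loopless
  have hlink : ∀ {x h}, h ∈ inc x → G.IsLink (incEdge h) x (incOther h) := by
    intro x h hh
    rcases (I.mem x h).1 hh with ⟨h1, h2, rfl⟩ | ⟨h1, h2, rfl⟩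
    · rw [(I.entry₁ h h1 h2).1, (I.entry₁ h h1 h2).2]
      exact hE h h1 (by omega)
    · rw [(I.entry₂ h h1 h2).1, (I.entry₂ h h1 h2).2]
      exact (hE (h - m) (by omega) (by omega)).symm
  refine ⟨hlink, fun {e x y} he => ?_, fun {x h h'} hh hh' he => ?_, I.nodup, fun x hx => ?_⟩
  · have hm := he.edge_mem
    rw [hG.edgeSet] at hm
    obtain ⟨h1, h2⟩ := hm
    rcases he.eq_and_eq_or_eq_and_eq (hE e h1 h2) with ⟨rfl, rfl⟩ | ⟨rfl, rfl⟩
    · exact ⟨e, (I.mem _ _).2 (.inl ⟨h1, by omega, rfl⟩), I.entry₁ e h1 (by omega)⟩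
    · refine ⟨m + e, (I.mem _ _).2 (.inr ⟨by omega, by omega, by simp⟩), ?_⟩
      have := I.entry₂ (m + e) (by omega) (by omega)
      simpa using this
  · rcases (I.mem x h).1 hh with ⟨h1, h2, h3⟩ | ⟨h1, h2, h3⟩ <;>
    rcases (I.mem x h').1 hh' with ⟨k1, k2, k3⟩ | ⟨k1, k2, k3⟩
    · rw [(I.entry₁ h h1 h2).1, (I.entry₁ h' k1 k2).1] at he; exact he
    · rw [(I.entry₁ h h1 h2).1, (I.entry₂ h' k1 k2).1] at he
      have := (hE h h1 (by omega)).ne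
      rw [← he] at k3
      exact absurd (h3.trans k3.symm) this
    · rw [(I.entry₂ h h1 h2).1, (I.entry₁ h' k1 k2).1] at he
      have := (hE h' k1 (by omega)).ne
      rw [he] at h3
      exact absurd (k3.trans h3.symm) this
    · rw [(I.entry₂ h h1 h2).1, (I.entry₂ h' k1 k2).1] at he; omega
  · rcases (I.mem x 0).1 hx with h | h <;> omega

theorem wp_buildIncidenceLists {G : Graph ℕ ℕ} {n m : ℕ} {end1 end2 : ℕ → ℕ}
    (hG : IsInput G n m end1 end2) {s : State} (hs : s = input n m end1 end2) {k : ℕ}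
    (hk : 60 * m + 20 ≤ k) :
    WP buildIncidenceLists s k fun s' k' => k ≤ k' + (60 * m + 20) ∧
      ∃ inc, IncLists G inc (s'.arrs .incEdge) (s'.arrs .incOther) ∧
        (∀ x, Trail (s'.arrs .incNext) (s'.arrs .incHead x) (inc x) 0) ∧
        ∑ x ∈ Finset.Icc 1 n, (inc x).length ≤ 2 * m := by
  have hE : ∀ e, 1 ≤ e → e ≤ m → G.IsLink e (end1 e) (end2 e) := fun e h₁ h₂ =>
    hG.isLink e (by rw [hG.edgeSet]; exact ⟨h₁, h₂⟩)
  have hloop := hG.loopless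
  have hV : ∀ {e x y}, G.IsLink e x y → x ∈ Finset.Icc 1 n := fun h => by
    have := h.left_mem
    rw [hG.vertexSet] at this
    simpa using this
  unfold buildIncidenceLists
  simp only [block]
  refine .seq (.run 2 (by omega) fun k₁ hk₁ => ?_)
  refine .while (fun s' k' => k ≤ k' + 60 * (s'.regs .i - 1) + 2 ∧ s'.regs .i ≤ m + 1 ∧
    ∃ inc, IncInv n m end1 end2 (s'.arrs .incEdge) (s'.arrs .incOther) (s'.arrs .incNext)
      (s'.arrs .incHead) (s'.regs .i) inc) ?_ ?_
  · refine ⟨by simp; omega, by simp, fun _ => [], ?_⟩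
    subst hs
    constructor <;> simp [input, Trail] <;> omega
  · rintro s' k' ⟨hk', him, inc, I⟩ hf
    have hm : s'.regs .numE = m := by rw [hf.regs _ rfl]; subst hs; simp [input]
    have he1 : s'.arrs .end1 = end1 := by rw [hf.arrs _ rfl]; subst hs; simp [input]
    have he2 : s'.arrs .end2 = end2 := by rw [hf.arrs _ rfl]; subst hs; simp [input]
    have hpos := I.pos
    refine ⟨by simp; omega, fun hb => ?_, fun hb => ?_⟩
    · simp [hm] at hb
      refine .run 50 (by simp; omega) fun k₂ hk₂ => ?_
      have hl := hE (s'.regs .i) hpos.1 (by omega)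
      obtain ⟨inc', I'⟩ := I.step (by omega) (hV hl) (hV hl.symm) hl.ne
      simp [hm, he1, he2] at hk₂ ⊢
      exact ⟨by omega, by omega, inc', I'⟩
    · simp [hm] at hb
      have : s'.regs .i = m + 1 := by omega
      rw [this] at I hk'
      refine ⟨by simp; omega, inc, I.incLists hG, I.trail, ?_⟩
      simpa using I.sum

/-! ### Depth-first search trees and verification of the search -/

/-- A depth-first search tree with root `1` of a graph with vertices `1, …, n`, together with the
back edges: `bk y` lists the back edges with upper endpoint `y`, `low e` is the lower endpoint of the
back edge `e`, `anc x` lists the ancestors of `x`, and `top x` is the child of the root above `x`. -/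
structure Palm (G : Graph ℕ ℕ) (n : ℕ) where
  num : ℕ → ℕ
  par : ℕ → ℕ
  parEdge : ℕ → ℕ
  vertexAt : ℕ → ℕ
  low : ℕ → ℕ
  top : ℕ → ℕ
  anc : ℕ → List ℕ
  bk : ℕ → List ℕ
  vertexSet : G.vertexSet = Set.Icc 1 n
  num_one : num 1 = 1
  par_one : par 1 = 0
  num_mem : ∀ x, 1 ≤ x → x ≤ n → 1 ≤ num x ∧ num x ≤ n ∧ vertexAt (num x) = x
  vertexAt_mem : ∀ k, 1 ≤ k → k ≤ n → 1 ≤ vertexAt k ∧ vertexAt k ≤ n ∧ num (vertexAt k) = k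
  tree : ∀ x, 1 ≤ x → x ≤ n → x ≠ 1 →
    1 ≤ par x ∧ par x ≤ n ∧ num (par x) < num x ∧ G.IsLink (parEdge x) x (par x)
  anc_zero : anc 0 = []
  anc_eq : ∀ x, 1 ≤ x → x ≤ n → anc x = x :: anc (par x)
  back : ∀ y e, e ∈ bk y → G.IsLink e (low e) y ∧ y ∈ anc (low e) ∧ num y < num (low e) ∧
    e ≠ parEdge (low e)
  bk_nodup : ∀ y, (bk y).Nodup
  edge : ∀ {e x y}, G.IsLink e x y → num y < num x → e = parEdge x ∨ (e ∈ bk y ∧ low e = x)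
  top_eq : ∀ x, 1 ≤ x → x ≤ n → x ≠ 1 → top x = if par x = 1 then x else top (par x)
  sorted : (bk 1).Pairwise fun e e' => num (top (low e')) ≤ num (top (low e))

namespace Mader

theorem EdgeConnected.connected {α β : Type*} {G : Graph α β} (h : EdgeConnected 2 G) :
    Connected G := by
  by_contra hc
  have := h.2 ∅ ⟨by simp, by simpa using hc⟩
  simp at this

/-- A connected graph has an edge that leaves a given proper subset of the vertices. -/
theorem Connected.exists_isLink {α β : Type*} {G : Graph α β} (hc : Connected G) {S : Set α}
    {x y : α} (hx : x ∈ G.vertexSet) (hy : y ∈ G.vertexSet) (hxS : x ∈ S) (hyS : y ∉ S) :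
    ∃ e u v, G.IsLink e u v ∧ u ∈ S ∧ v ∉ S := by
  by_contra! hcon
  have : ∀ z, Relation.ReflTransGen G.Adj x z → z ∈ S := by
    intro z hz
    induction hz with
    | refl => exact hxS
    | tail _ hadj ih => obtain ⟨e, he⟩ := hadj; exact hcon e _ _ he ih
  exact hyS (this y (hc x hx y hy))

end Mader

namespace DFSInv

variable {G : Graph ℕ ℕ} {n : ℕ} {inc : ℕ → List ℕ} {eo ot : ℕ → ℕ}
  {num par parEdge vertexAt low : ℕ → ℕ} {cnt v : ℕ} {rem anc bk : ℕ → List ℕ} {top : ℕ → ℕ}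

theorem init (G : Graph ℕ ℕ) {n : ℕ} (hn : 1 ≤ n) (inc : ℕ → List ℕ) (eo ot : ℕ → ℕ) :
    DFSInv G n inc eo ot (Function.update (fun _ => 0) 1 1) (fun _ => 0) (fun _ => 0)
      (Function.update (fun _ => 0) 1 1) (fun _ => 0) 1 1 inc (Function.update (fun _ => []) 1 [1])
      (fun _ => []) (fun _ => 0) := by
  have hz : ∀ x, Function.update (fun _ => 0) 1 1 x ≠ 0 → x = 1 := by
    intro x hx
    by_contra h
    simp [h] at hx
  exact
    { rem_suffix := fun x => List.suffix_rfl
      bk_nodup := by simp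
      num_one := by simp
      par_one := rfl
      vis := fun x hx => by obtain rfl := hz x hx; simpa using hn
      vertexAt := fun k h1 h2 => by
        obtain rfl : k = 1 := by omega
        simp
      tree := fun x hx h1 => absurd (hz x hx) h1
      parEdge_one := rfl
      anc_zero := by simp
      anc_eq := fun x hx => by obtain rfl := hz x hx; simp
      unvis := fun _ _ => rfl
      fin := fun x hx h => by obtain rfl := hz x hx; simp at h
      cur := by simp
      explored := fun x h hx h1 h2 => absurd h1 h2
      back := by simp
      top_eq := fun x hx h1 => absurd (hz x hx) h1
      top_vis := fun x hx h1 => absurd (hz x hx) h1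
      top_max := fun _ h => absurd rfl h
      sorted := by simp }

theorem num_le_of_mem_anc
    (I : DFSInv G n inc eo ot num par parEdge vertexAt low cnt v rem anc bk top) {x y : ℕ}
    (hx : num x ≠ 0) (hy : y ∈ anc x) : num y ≤ num x := by
  induction hk : num x using Nat.strong_induction_on generalizing x with
  | _ k ih =>
    subst hk
    rw [I.anc_eq x hx] at hy
    rcases List.mem_cons.1 hy with rfl | hy
    · exact le_rfl
    · by_cases hx1 : x = 1
      · rw [hx1, I.par_one, I.anc_zero] at hy
        simp at hy
      · obtain ⟨h1, h2, -⟩ := I.tree x hx hx1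
        exact (ih _ h2 h1 hy rfl).trans h2.le

/-- The search ends at the null vertex, which has no ancestors, so every visited vertex is finished.
An edge leaving the set of visited vertices would be explored from its visited end; hence by
connectedness all vertices are visited. -/
theorem exists_palm
    (I : DFSInv G n inc eo ot num par parEdge vertexAt low cnt 0 rem anc bk top)
    (hi : IncLists G inc eo ot) (hV : G.vertexSet = Set.Icc 1 n) (hc : Mader.Connected G)
    (hn : 1 ≤ n) :
    ∃ P : Palm G n, P.num = num ∧ P.par = par ∧ P.parEdge = parEdge ∧ P.vertexAt = vertexAt ∧
      P.low = low ∧ P.top = top ∧ P.anc = anc ∧ P.bk = bk := by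
  have hrem : ∀ x, num x ≠ 0 → rem x = [] := fun x hx => I.fin x hx (by simp [I.anc_zero])
  have hvis : ∀ x, 1 ≤ x → x ≤ n → num x ≠ 0 := by
    intro x h1 h2
    by_contra hx
    obtain ⟨e, u, w, he, hu, hw⟩ := hc.exists_isLink (S := {x | num x ≠ 0}) (x := 1) (y := x)
      (by rw [hV]; exact ⟨le_rfl, hn⟩) (by rw [hV]; exact ⟨h1, h2⟩) (by simp [I.num_one])
      (by simpa using hx)
    obtain ⟨h, hh, -, rfl⟩ := hi.exists_entry he
    exact hw (I.explored u h hu hh (by simp [hrem u hu])).1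
  -- Numbering is a bijection from the vertices onto the numbers up to `cnt`.
  have hcn : cnt = n := by
    have : Finset.image num (Finset.Icc 1 n) = Finset.Icc 1 cnt := by
      ext k
      simp only [Finset.mem_image, Finset.mem_Icc]
      constructor
      · rintro ⟨x, ⟨h1, h2⟩, rfl⟩
        have := hvis x h1 h2
        exact ⟨by omega, (I.vis x this).2.2.1⟩
      · rintro ⟨h1, h2⟩
        have h := I.vertexAt k h1 h2
        obtain ⟨a, b, -⟩ := I.vis (vertexAt k) (by omega)
        exact ⟨_, ⟨a, b⟩, h⟩
    have hcard := congrArg Finset.card this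
    rw [Finset.card_image_of_injOn, Nat.card_Icc, Nat.card_Icc] at hcard
    · omega
    · intro x hx y hy hxy
      simp only [Finset.coe_Icc, Set.mem_Icc] at hx hy
      rw [← (I.vis x (hvis x hx.1 hx.2)).2.2.2, hxy, (I.vis y (hvis y hy.1 hy.2)).2.2.2]
  subst hcn
  have hmem : ∀ {e x y}, G.IsLink e x y → num x ≠ 0 := fun h => by
    have := h.left_mem
    rw [hV] at this
    exact hvis _ this.1 this.2
  refine ⟨⟨num, par, parEdge, vertexAt, low, top, anc, bk, hV, I.num_one, I.par_one,
    fun x h1 h2 => ?_, fun k h1 h2 => ?_, fun x h1 h2 hx => ?_, I.anc_zero,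
    fun x h1 h2 => I.anc_eq x (hvis x h1 h2), fun y e he => ?_, I.bk_nodup, fun {e x y} he hlt => ?_,
    fun x h1 h2 => I.top_eq x (hvis x h1 h2), I.sorted⟩, rfl, rfl, rfl, rfl, rfl, rfl, rfl, rfl⟩
  · have h := hvis x h1 h2
    exact ⟨by omega, (I.vis x h).2.2⟩
  · have h := I.vertexAt k h1 h2
    obtain ⟨a, b, -⟩ := I.vis (vertexAt k) (by omega)
    exact ⟨a, b, h⟩
  · obtain ⟨a, b, c⟩ := I.tree x (hvis x h1 h2) hx
    obtain ⟨d, e, -⟩ := I.vis _ a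
    exact ⟨d, e, b, c⟩
  · obtain ⟨h, h1, h2, rfl, rfl, h5, h6, h7, h8⟩ := I.back y e he
    refine ⟨hi.link h1, ?_, h7, h8⟩
    refine (I.explored _ h h6 h1 h2).2.1.resolve_left fun hm => ?_
    have := I.num_le_of_mem_anc h5 hm
    omega
  · have hx := hmem he
    obtain ⟨h, hh, rfl, rfl⟩ := hi.exists_entry he
    exact (I.explored x h hx hh (by simp [hrem x hx])).2.2 hlt

end DFSInv

theorem wp_depthFirstSearch {G : Graph ℕ ℕ} {n m : ℕ} {end1 end2 : ℕ → ℕ}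
    (hG : IsInput G n m end1 end2) (hn : 1 ≤ n) {s : State} {inc : ℕ → List ℕ}
    (hi : IncLists G inc (s.arrs .incEdge) (s.arrs .incOther))
    (ht : ∀ x, Trail (s.arrs .incNext) (s.arrs .incHead x) (inc x) 0)
    (hsum : ∑ x ∈ Finset.Icc 1 n, (inc x).length ≤ 2 * m)
    (h0 : ∀ a ∈ [Arr.num, .par, .parEdge, .vertexAt, .backHead, .backNext, .low], s.arrs a = fun _ => 0)
    {k : ℕ} (hk : 400 * m + 400 ≤ k) :
    WP depthFirstSearch s k fun s' k' => k ≤ k' + (400 * m + 400) ∧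
      ∃ P : Palm G n, s'.arrs .num = P.num ∧ s'.arrs .par = P.par ∧ s'.arrs .parEdge = P.parEdge ∧
        s'.arrs .vertexAt = P.vertexAt ∧ s'.arrs .low = P.low ∧
        ∀ x, Trail (s'.arrs .backNext) (s'.arrs .backHead x) (P.bk x) 0 := by
  simp only [List.mem_cons, List.not_mem_nil, or_false, forall_eq_or_imp, forall_eq] at h0
  obtain ⟨hnum, hpar, hparEdge, hvertexAt, hbackHead, hbackNext, hlow⟩ := h0
  have hV := hG.vertexSet
  unfold depthFirstSearch
  simp only [block]
  refine .seq (.run 3 (by omega) fun k₁ hk₁ => .seq (.run 3 (by omega) fun k₂ hk₂ => .seq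
    (.run 2 (by omega) fun k₃ hk₃ => .seq (.run 2 (by omega) fun k₄ hk₄ => ?_))))
  -- The measure counts every unexplored entry twice and every vertex on the current tree path once.
  -- Descending consumes an entry and lengthens the path by one, ascending shortens the path, and
  -- other rounds consume an entry. So each round lowers the measure, which starts at no more than
  -- `4 * m + 1`.
  refine .while (fun s' k' => ∃ rem anc bk top, k + 100 * (2 * ∑ x ∈ Finset.Icc 1 n, (rem x).length +
      (anc (s'.regs .v)).length) ≤ k' + (400 * m + 200) ∧
    DFSInv G n inc (s.arrs .incEdge) (s.arrs .incOther) (s'.arrs .num) (s'.arrs .par)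
      (s'.arrs .parEdge) (s'.arrs .vertexAt) (s'.arrs .low) (s'.regs .cnt) (s'.regs .v) rem anc bk
      top ∧ (∀ x, Trail (s'.arrs .incNext) (s'.arrs .incHead x) (rem x) 0) ∧
      ∀ x, Trail (s'.arrs .backNext) (s'.arrs .backHead x) (bk x) 0) ?_ ?_
  · refine ⟨inc, Function.update (fun _ => []) 1 [1], fun _ => [], fun _ => 0, ?_, ?_, ?_, ?_⟩
    · simp; omega
    · simpa [hnum, hpar, hparEdge, hvertexAt, hlow] using DFSInv.init G hn inc _ _
    · simpa using ht
    · simp [hbackHead, Trail]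
  · rintro s' k' ⟨rem, anc, bk, top, hk', I, hrem, hbk⟩ hf
    have heo : s'.arrs .incEdge = s.arrs .incEdge := by rw [hf.arrs _ rfl]; simp
    have hot : s'.arrs .incOther = s.arrs .incOther := by rw [hf.arrs _ rfl]; simp
    have hz : ∀ x, 0 ∉ rem x := fun x hx => hi.zero_notMem x ((I.rem_suffix x).subset hx)
    refine ⟨by simp; omega, fun hb => ?_, fun hb => ?_⟩
    · simp at hb
      have hvv := I.cur hb
      have hva := I.anc_eq _ hvv
      have hvn := (I.vis _ hvv)
      have hlen : (anc (s'.regs .v)).length = (anc (s'.arrs .par (s'.regs .v))).length + 1 := by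
        rw [hva]; simp
      refine .run 60 (by simp; omega) fun k₅ hk₅ => ?_
      simp only [Test.cost, Expr.cost] at hk₅
      by_cases hh : s'.arrs .incHead (s'.regs .v) = 0
      · have hr : rem (s'.regs .v) = [] := (hrem _).eq_nil_of_notMem (by rw [hh]; exact hz _)
        refine ⟨rem, anc, bk, top, ?_, ?_, ?_, ?_⟩
        · simp [hh]; omega
        · simpa [hh] using I.ascend hb hr
        · simpa [hh] using hrem
        · simpa [hh] using hbk
      · obtain ⟨t, hr, ht'⟩ := (hrem (s'.regs .v)).exists_cons hh
        have hmem : s'.arrs .incHead (s'.regs .v) ∈ inc (s'.regs .v) :=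
          (I.rem_suffix _).subset (by simp [hr])
        have hsl := sum_length_update rem (Finset.Icc 1 n) (y := s'.regs .v)
          (by simp; omega) t
        have htr : ∀ x, Trail (s'.arrs .incNext)
            (Function.update (s'.arrs .incHead) (s'.regs .v)
              (s'.arrs .incNext (s'.arrs .incHead (s'.regs .v))) x)
            (Function.update rem (s'.regs .v) t x) 0 := by
          intro x
          by_cases hx : x = s'.regs .v
          · subst hx; simpa using ht'
          · simpa [hx] using hrem x
        rw [hr] at hsl
        simp only [List.length_cons] at hsl
        by_cases hw : s'.arrs .num (s.arrs .incOther (s'.arrs .incHead (s'.regs .v))) = 0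
        · refine ⟨Function.update rem (s'.regs .v) t, Function.update anc (s.arrs .incOther (s'.arrs .incHead (s'.regs .v)))
              ((s.arrs .incOther (s'.arrs .incHead (s'.regs .v))) :: anc (s'.regs .v)), bk,
            Function.update top (s.arrs .incOther (s'.arrs .incHead (s'.regs .v)))
              (if s'.regs .v = 1 then (s.arrs .incOther (s'.arrs .incHead (s'.regs .v))) else top (s'.regs .v)),
            ?_, ?_, ?_, ?_⟩
          rotate_left
          · simpa [hh, heo, hot, hw] using I.descend hi hV hb hr hw
          · simpa [hh, heo, hot, hw] using htr
          · simpa [hh, heo, hot, hw] using hbk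
          · simp [hh, heo, hot, hw]; omega
        · by_cases hc : s'.arrs .num (s.arrs .incOther (s'.arrs .incHead (s'.regs .v))) <
              s'.arrs .num (s'.regs .v) ∧ s.arrs .incEdge (s'.arrs .incHead (s'.regs .v)) ≠
                s'.arrs .parEdge (s'.regs .v)
          · refine ⟨Function.update rem (s'.regs .v) t, anc, Function.update bk (s.arrs .incOther (s'.arrs .incHead (s'.regs .v)))
                ((s.arrs .incEdge (s'.arrs .incHead (s'.regs .v))) :: bk (s.arrs .incOther (s'.arrs .incHead (s'.regs .v)))), top, ?_, ?_, ?_, ?_⟩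
            rotate_left
            · simpa [hh, heo, hot, hw, when, hc] using I.backEdge hi hb hr hw hc.1 hc.2
            · simpa [hh, heo, hot, hw, when, hc] using htr
            · simpa [hh, heo, hot, hw, when, hc] using
                Trail.push hbk (I.fresh hi hr hc.1) _
            · simp [hh, heo, hot, hw, when, hc]; omega
          · have hskip := fun h => not_not.1 fun h' => hc ⟨h, h'⟩
            refine ⟨Function.update rem (s'.regs .v) t, anc, bk, top, ?_, ?_, ?_, ?_⟩
            rotate_left
            · simpa [hh, heo, hot, hw, when, hc] using I.skip hi hb hr hw hskip
            · simpa [hh, heo, hot, hw, when, hc] using htr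
            · simpa [hh, heo, hot, hw, when, hc] using hbk
            · simp [hh, heo, hot, hw, when, hc]; omega
    · simp at hb
      rw [hb] at I
      obtain ⟨P, h1, h2, h3, h4, h5, h6, h7, h8⟩ := I.exists_palm hi hV hG.conn.connected hn
      refine ⟨by simp; omega, P, h1.symm, h2.symm, h3.symm, h4.symm, h5.symm, ?_⟩
      rw [h8]
      exact hbk

theorem Trail.next_mem {nx : ℕ → ℕ} {h e x : ℕ} {l : List ℕ} (ht : Trail nx h l e) (hx : x ∈ l) :
    nx x ∈ l ∨ nx x = e := by
  induction l generalizing h with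
  | nil => simp at hx
  | cons a l ih =>
    obtain ⟨rfl, ht⟩ := ht
    rcases List.mem_cons.1 hx with rfl | hx
    · cases l with
      | nil => exact .inr ht
      | cons b l => exact .inl (by simp [ht.1])
    · exact (ih ht hx).imp_left (List.mem_cons_of_mem _)

/-! ### Ancestors, tree edges and back edges -/

namespace Palm

variable {G : Graph ℕ ℕ} {n : ℕ} (P : Palm G n)

theorem mem_range (P : Palm G n) {e x y : ℕ} (h : G.IsLink e x y) : 1 ≤ x ∧ x ≤ n := by
  have := h.left_mem
  rwa [P.vertexSet] at this

theorem num_inj {x y : ℕ} (hx : 1 ≤ x ∧ x ≤ n) (hy : 1 ≤ y ∧ y ≤ n) (h : P.num x = P.num y) :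
    x = y := by
  rw [← (P.num_mem x hx.1 hx.2).2.2, h, (P.num_mem y hy.1 hy.2).2.2]

theorem one_lt_num {x : ℕ} (hx : 1 ≤ x ∧ x ≤ n) (h1 : x ≠ 1) : 1 < P.num x := by
  obtain ⟨a, b, c, d⟩ := P.tree x hx.1 hx.2 h1
  have := (P.num_mem _ a b).1
  omega

theorem mem_anc_self {x : ℕ} (hx : 1 ≤ x ∧ x ≤ n) : x ∈ P.anc x := by
  rw [P.anc_eq x hx.1 hx.2]; simp

/-- Induction from a vertex upwards along its ancestors. -/
theorem anc_induction {x y : ℕ} (hx : 1 ≤ x ∧ x ≤ n) (hy : y ∈ P.anc x) {p : ℕ → Prop} (h : p x)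
    (hp : ∀ z, 1 ≤ z ∧ z ≤ n → z ≠ 1 → y ∈ P.anc z → y ≠ z → p z → p (P.par z)) : p y := by
  induction hk : P.num x using Nat.strong_induction_on generalizing x with
  | _ k ih =>
    subst hk
    by_cases hxy : y = x
    · rwa [hxy]
    have hy' := hy
    rw [P.anc_eq x hx.1 hx.2] at hy'
    have hy' := (List.mem_cons.1 hy').resolve_left hxy
    by_cases hx1 : x = 1
    · rw [hx1, P.par_one, P.anc_zero] at hy'
      simp at hy'
    obtain ⟨a, b, c, d⟩ := P.tree x hx.1 hx.2 hx1
    exact ih _ c ⟨a, b⟩ hy' (hp x hx hx1 hy hxy h) rfl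

theorem mem_anc_par {x y : ℕ} (hx : 1 ≤ x ∧ x ≤ n) (hy : y ∈ P.anc x) (hxy : y ≠ x) :
    y ∈ P.anc (P.par x) := by
  rw [P.anc_eq x hx.1 hx.2] at hy
  exact (List.mem_cons.1 hy).resolve_left hxy

theorem anc_one {y : ℕ} (hn : 1 ≤ n) (hy : y ∈ P.anc 1) : y = 1 := by
  rw [P.anc_eq 1 le_rfl hn, P.par_one, P.anc_zero] at hy
  simpa using hy

theorem par_mem {x : ℕ} (hx : 1 ≤ x ∧ x ≤ n) (h1 : x ≠ 1) : 1 ≤ P.par x ∧ P.par x ≤ n :=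
  ⟨(P.tree x hx.1 hx.2 h1).1, (P.tree x hx.1 hx.2 h1).2.1⟩

theorem anc_mem {x y : ℕ} (hx : 1 ≤ x ∧ x ≤ n) (hy : y ∈ P.anc x) : 1 ≤ y ∧ y ≤ n :=
  P.anc_induction hx hy (p := fun z => 1 ≤ z ∧ z ≤ n) hx fun _ hz h1 _ _ _ => P.par_mem hz h1

theorem num_le_of_mem_anc {x y : ℕ} (hx : 1 ≤ x ∧ x ≤ n) (hy : y ∈ P.anc x) :
    P.num y ≤ P.num x :=
  P.anc_induction hx hy (p := fun z => P.num z ≤ P.num x) le_rfl fun z hz h1 _ _ h =>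
    ((P.tree z hz.1 hz.2 h1).2.2.1.trans_le h).le

theorem anc_trans {x y z : ℕ} (hx : 1 ≤ x ∧ x ≤ n) (hy : y ∈ P.anc x) (hz : z ∈ P.anc y) :
    z ∈ P.anc x := by
  have key : z ∈ P.anc y → z ∈ P.anc x :=
    P.anc_induction hx hy (p := fun w => z ∈ P.anc w → z ∈ P.anc x) id fun w hw _ _ _ h h' =>
      h (by rw [P.anc_eq w hw.1 hw.2]; exact List.mem_cons_of_mem _ h')
  exact key hz

theorem par_mem_anc {x : ℕ} (hx : 1 ≤ x ∧ x ≤ n) (h1 : x ≠ 1) : P.par x ∈ P.anc x := by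
  rw [P.anc_eq x hx.1 hx.2]
  exact List.mem_cons_of_mem _ (P.mem_anc_self (P.par_mem hx h1))

/-- Two ancestors of the same vertex are comparable. -/
theorem anc_of_num_le {x y z : ℕ} (hx : 1 ≤ x ∧ x ≤ n) (hy : y ∈ P.anc x) (hz : z ∈ P.anc x)
    (h : P.num y ≤ P.num z) : y ∈ P.anc z := by
  refine P.anc_induction hx hz (p := fun w => y ∈ P.anc w) hy fun w hw h1 hzw hne hyw => ?_
  refine P.mem_anc_par hw hyw ?_
  rintro rfl
  exact hne (P.num_inj (P.anc_mem hw hzw) hw (le_antisymm (P.num_le_of_mem_anc hw hzw) h))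

theorem parEdge_inj {x y : ℕ} (hx : 1 ≤ x ∧ x ≤ n) (hx1 : x ≠ 1) (hy : 1 ≤ y ∧ y ≤ n) (hy1 : y ≠ 1)
    (h : P.parEdge x = P.parEdge y) : x = y := by
  obtain ⟨-, -, a, b⟩ := P.tree x hx.1 hx.2 hx1
  obtain ⟨-, -, c, d⟩ := P.tree y hy.1 hy.2 hy1
  rw [h] at b
  rcases b.eq_and_eq_or_eq_and_eq d with ⟨e, -⟩ | ⟨e, f⟩
  · exact e
  · rw [f] at a; rw [← e] at c; omega

theorem low_mem {y e : ℕ} (he : e ∈ P.bk y) : 1 ≤ P.low e ∧ P.low e ≤ n :=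
  P.mem_range (P.back y e he).1

theorem upper_mem {y e : ℕ} (he : e ∈ P.bk y) : 1 ≤ y ∧ y ≤ n :=
  P.mem_range (P.back y e he).1.symm

theorem low_ne_one {y e : ℕ} (he : e ∈ P.bk y) : P.low e ≠ 1 := by
  intro h
  have := (P.back y e he).2.2.1
  have h' := P.upper_mem he
  rw [h, P.num_one] at this
  have := (P.num_mem y h'.1 h'.2).1
  omega

theorem bk_disjoint {y y' e : ℕ} (h : e ∈ P.bk y) (h' : e ∈ P.bk y') : y = y' :=
  (P.back y e h).1.right_unique (P.back y' e h').1

theorem parEdge_ne {x y e : ℕ} (hx : 1 ≤ x ∧ x ≤ n) (hx1 : x ≠ 1) (he : e ∈ P.bk y) :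
    P.parEdge x ≠ e := by
  rintro rfl
  obtain ⟨-, -, a, b⟩ := P.tree x hx.1 hx.2 hx1
  obtain ⟨c, -, d, f⟩ := P.back y _ he
  rcases b.eq_and_eq_or_eq_and_eq c with ⟨h, -⟩ | ⟨h, h'⟩
  · rw [← h] at f; exact f rfl
  · rw [← h, ← h'] at d; omega

theorem edge_cases {e x y : ℕ} (he : G.IsLink e x y) (hne : x ≠ y) :
    (e = P.parEdge x ∧ x ≠ 1 ∧ y = P.par x) ∨ (e = P.parEdge y ∧ y ≠ 1 ∧ x = P.par y) ∨
      (e ∈ P.bk y ∧ P.low e = x) ∨ (e ∈ P.bk x ∧ P.low e = y) := by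
  have key : ∀ {x y}, G.IsLink e x y → P.num y < P.num x →
      (e = P.parEdge x ∧ x ≠ 1 ∧ y = P.par x) ∨ (e ∈ P.bk y ∧ P.low e = x) := by
    intro x y he hlt
    have hx := P.mem_range he
    have hx1 : x ≠ 1 := by
      rintro rfl
      have := P.num_mem y (P.mem_range he.symm).1 (P.mem_range he.symm).2
      rw [P.num_one] at hlt
      omega
    rcases P.edge he hlt with rfl | h
    · exact .inl ⟨rfl, hx1, he.right_unique (P.tree x hx.1 hx.2 hx1).2.2.2⟩
    · exact .inr h
  rcases lt_trichotomy (P.num x) (P.num y) with h | h | h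
  · rcases key he.symm h with h | h <;> simp [h]
  · exact absurd (P.num_inj (P.mem_range he) (P.mem_range he.symm) h) hne
  · rcases key he h with h | h <;> simp [h]

/-- Numbers drop along parent pointers. This shows that tree paths have no repetitions and fixes the
order in which a link lists its inner vertices. -/
theorem trail_pairwise {h e : ℕ} {l : List ℕ} (ht : Trail P.par h l e)
    (hl : ∀ x ∈ l, (1 ≤ x ∧ x ≤ n) ∧ x ≠ 1) :
    l.Pairwise (fun x y => P.num y < P.num x) ∧ ∀ x ∈ l, P.num e < P.num x := by
  induction l generalizing h with
  | nil => simp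
  | cons a l ih =>
    obtain ⟨rfl, ht⟩ := ht
    obtain ⟨ih₁, ih₂⟩ := ih ht fun x hx => hl x (List.mem_cons_of_mem _ hx)
    have ha := hl h (by simp)
    have hlt := (P.tree h ha.1.1 ha.1.2 ha.2).2.2.1
    have : ∀ y ∈ l, P.num y < P.num h := by
      intro y hy
      cases l with
      | nil => simp at hy
      | cons b l =>
        obtain ⟨rfl, -⟩ := ht
        rcases List.mem_cons.1 hy with rfl | hy
        · exact hlt
        · exact ((List.pairwise_cons.1 ih₁).1 y hy).trans hlt
    refine ⟨List.pairwise_cons.2 ⟨this, ih₁⟩, fun x hx => ?_⟩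
    rcases List.mem_cons.1 hx with rfl | hx
    · cases l with
      | nil => rw [← show P.par x = e from ht]; exact hlt
      | cons b l => exact (ih₂ b (by simp)).trans (this b (by simp))
    · exact ih₂ x hx

/-- In a graph without bridges, every tree edge is spanned by a back edge. -/
theorem exists_back {m : ℕ} {end1 end2 : ℕ → ℕ} (hG : IsInput G n m end1 end2) {x : ℕ}
    (hx : 1 ≤ x ∧ x ≤ n) (hx1 : x ≠ 1) :
    ∃ y e, e ∈ P.bk y ∧ x ∈ P.anc (P.low e) ∧ P.num y < P.num x := by
  have hn : 1 ≤ n := hx.1.trans hx.2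
  have hloop := hG.loopless
  have hc : Mader.Connected (G.deleteEdges {P.parEdge x}) := by
    by_contra hc
    have := hG.conn.2 {P.parEdge x}
      ⟨by simpa using (P.tree x hx.1 hx.2 hx1).2.2.2.edge_mem, hc⟩
    rw [Set.encard_singleton] at this
    exact absurd this (by decide)
  have hV : (G.deleteEdges {P.parEdge x}).vertexSet = Set.Icc 1 n := by simp [P.vertexSet]
  -- Apply connectedness without the tree edge above `x` to the set of descendants of `x`. Among
  -- tree and back edges, only a back edge from a descendant to a proper ancestor of `x` can leave
  -- this set.
  obtain ⟨e, u, v, he, hu, hv⟩ := hc.exists_isLink (S := {z | x ∈ P.anc z}) (x := x) (y := 1)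
    (by rw [hV]; exact hx) (by rw [hV]; exact ⟨le_rfl, hn⟩) (P.mem_anc_self hx)
    (fun h => hx1 (P.anc_one hn h))
  simp only [Graph.deleteEdges_isLink, Set.mem_singleton_iff] at he
  obtain ⟨he, hne⟩ := he
  have hu' := P.mem_range he
  have hv' := P.mem_range he.symm
  simp only [Set.mem_ofPred_eq] at hu hv
  rcases P.edge_cases he he.ne with ⟨rfl, h1, rfl⟩ | ⟨rfl, h1, rfl⟩ | ⟨h, rfl⟩ | ⟨h, rfl⟩
  · exfalso
    by_cases hxu : x = u
    · exact hne (by rw [hxu])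
    · exact hv (P.mem_anc_par hu' hu hxu)
  · exact absurd (P.anc_trans hv' (P.par_mem_anc hv' h1) hu) hv
  · refine ⟨v, e, h, hu, ?_⟩
    by_contra hlt
    exact hv (P.anc_of_num_le hu' hu (P.back v e h).2.1 (by omega))
  · exact absurd (P.anc_trans hv' (P.back u e h).2.1 hu) hv

end Palm

/-! ### Chain decompositions and their construction -/

/-- A chain decomposition: the chain `c` consists of the back edge `backEdge c` from `src c` down and
of the tree path from there up to `tgt c`, whose vertices before `tgt c` are listed by `xs c`.  The
vertex `x` strongly belongs to the chain `sB x`, and `ch c` lists the children of `c`. -/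
structure ChainDec (G : Graph ℕ ℕ) (n : ℕ) extends Palm G n where
  N : ℕ
  src : ℕ → ℕ
  tgt : ℕ → ℕ
  backEdge : ℕ → ℕ
  sB : ℕ → ℕ
  xs : ℕ → List ℕ
  ch : ℕ → List ℕ
  back_mem : ∀ c, 1 ≤ c → c ≤ N → backEdge c ∈ bk (src c)
  back_inj : ∀ c c', 1 ≤ c → c ≤ N → 1 ≤ c' → c' ≤ N → backEdge c = backEdge c' → c = c'
  back_surj : ∀ y e, e ∈ bk y → ∃ c, 1 ≤ c ∧ c ≤ N ∧ backEdge c = e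
  trail : ∀ c, 1 ≤ c → c ≤ N → Trail par (low (backEdge c)) (xs c) (tgt c)
  mem_xs : ∀ c x, 1 ≤ c → c ≤ N → (x ∈ xs c ↔ (1 ≤ x ∧ x ≤ n) ∧ x ≠ 1 ∧ sB x = c)
  sB_one : sB 1 = 1
  sB_mem : ∀ x, 1 ≤ x ∧ x ≤ n → x ≠ 1 → 1 ≤ sB x ∧ sB x ≤ N
  tgt_mem : ∀ c, 1 ≤ c → c ≤ N → 1 ≤ tgt c ∧ tgt c ≤ n
  tgt_lt : ∀ c, 1 ≤ c → c ≤ N → tgt c = 1 ∨ sB (tgt c) < c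
  src_anc : ∀ c, 1 ≤ c → c ≤ N → src c ∈ anc (tgt c)
  src_mono : ∀ c c', 1 ≤ c → c < c' → c' ≤ N → num (src c) ≤ num (src c')
  chain_sorted : ∀ c c', 1 ≤ c → c < c' → c' ≤ N → src c = 1 → src c' = 1 →
    num (top (low (backEdge c'))) ≤ num (top (low (backEdge c)))
  ch_mem : ∀ c d, d ∈ ch c ↔ 2 < d ∧ d ≤ N ∧ sB (tgt d) = c
  ch_nodup : ∀ c, (ch c).Nodup

namespace Palm

variable {G : Graph ℕ ℕ} {n : ℕ} (P : Palm G n)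

/-- From every vertex one can walk up to the first vertex of a set that contains the root. -/
theorem exists_trail {good : ℕ → Prop} (h1 : good 1) {x : ℕ} (hx : 1 ≤ x ∧ x ≤ n) :
    ∃ l t, Trail P.par x l t ∧ (∀ y ∈ l, (1 ≤ y ∧ y ≤ n) ∧ y ≠ 1 ∧ ¬ good y) ∧ good t ∧
      1 ≤ t ∧ t ≤ n := by
  induction hk : P.num x using Nat.strong_induction_on generalizing x with
  | _ k ih =>
    subst hk
    by_cases hg : good x
    · exact ⟨[], x, rfl, by simp, hg, hx⟩
    · have hx1 : x ≠ 1 := by rintro rfl; exact hg h1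
      obtain ⟨a, b, c, d⟩ := P.tree x hx.1 hx.2 hx1
      obtain ⟨l, t, h₁, h₂, h₃⟩ := ih _ c ⟨a, b⟩ rfl
      exact ⟨x :: l, t, ⟨rfl, h₁⟩, by simpa [hx, hx1, hg] using h₂, h₃⟩

/-- An ascending path that does not pass through an ancestor `y` of its start stops at or below `y`.
For chains this means that the source is an ancestor of the target. -/
theorem anc_of_trail {h t y : ℕ} {l : List ℕ} (ht : Trail P.par h l t)
    (hl : ∀ x ∈ l, (1 ≤ x ∧ x ≤ n) ∧ x ≠ 1) (hy : y ∈ P.anc h) (hyl : y ∉ l) : y ∈ P.anc t := by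
  induction l generalizing h with
  | nil => rwa [← show h = t from ht]
  | cons a l ih =>
    obtain ⟨rfl, ht⟩ := ht
    simp only [List.mem_cons, not_or] at hyl
    exact ih ht (fun x hx => hl x (List.mem_cons_of_mem _ hx))
      (P.mem_anc_par (hl h (by simp)).1 hy hyl.1) hyl.2

end Palm

/-- The chain decomposition in the course of its construction: `C` chains have been constructed, all
back edges with an upper endpoint whose number is below `i` have been processed, and so have those
at the vertex with number `i` which do not belong to the list `todo`. -/
structure ChInv {G : Graph ℕ ℕ} {n : ℕ} (P : Palm G n) (i : ℕ) (todo : List ℕ) (C : ℕ)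
    (src tgt backEdge sB : ℕ → ℕ) (xs : ℕ → List ℕ) : Prop where
  back_mem : ∀ c, 1 ≤ c → c ≤ C → backEdge c ∈ P.bk (src c)
  src_le : ∀ c, 1 ≤ c → c ≤ C → P.num (src c) ≤ i
  fresh : ∀ c, 1 ≤ c → c ≤ C → backEdge c ∉ todo
  inj : ∀ c c', 1 ≤ c → c ≤ C → 1 ≤ c' → c' ≤ C → backEdge c = backEdge c' → c = c'
  done : ∀ y e, e ∈ P.bk y → P.num y < i ∨ (P.num y = i ∧ e ∉ todo) →
    ∃ c, 1 ≤ c ∧ c ≤ C ∧ backEdge c = e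
  trail : ∀ c, 1 ≤ c → c ≤ C → Trail P.par (P.low (backEdge c)) (xs c) (tgt c)
  mem_xs : ∀ c x, 1 ≤ c → c ≤ C → (x ∈ xs c ↔ (1 ≤ x ∧ x ≤ n) ∧ x ≠ 1 ∧ sB x = c)
  sB_one : sB 1 = 1
  sB_le : ∀ x, 1 ≤ x ∧ x ≤ n → x ≠ 1 → sB x ≤ C
  tgt_mem : ∀ c, 1 ≤ c → c ≤ C → 1 ≤ tgt c ∧ tgt c ≤ n
  tgt_lt : ∀ c, 1 ≤ c → c ≤ C → tgt c = 1 ∨ (sB (tgt c) ≠ 0 ∧ sB (tgt c) < c)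
  src_anc : ∀ c, 1 ≤ c → c ≤ C → src c ∈ P.anc (tgt c)
  src_mono : ∀ c c', 1 ≤ c → c < c' → c' ≤ C → P.num (src c) ≤ P.num (src c')
  chain_sorted : ∀ c c', 1 ≤ c → c < c' → c' ≤ C → src c = 1 → src c' = 1 →
    P.num (P.top (P.low (backEdge c'))) ≤ P.num (P.top (P.low (backEdge c)))

namespace ChInv

variable {G : Graph ℕ ℕ} {n : ℕ} {P : Palm G n} {i : ℕ} {todo : List ℕ} {C : ℕ}
  {src tgt backEdge sB : ℕ → ℕ} {xs : ℕ → List ℕ}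

theorem init (P : Palm G n) (src tgt backEdge : ℕ → ℕ) (xs : ℕ → List ℕ) :
    ChInv P 1 (P.bk (P.vertexAt 1)) 0 src tgt backEdge (Function.update (fun _ => 0) 1 1) xs := by
  constructor <;> try (intros; omega)
  · intro y e he h
    have hy := P.upper_mem he
    obtain ⟨a, b, c⟩ := P.num_mem y hy.1 hy.2
    rcases h with h | ⟨h, h'⟩
    · omega
    · rw [← h, c] at h'; exact absurd he h'
  · simp
  · intro x _ hx; simp [hx]

theorem advance (I : ChInv P i [] C src tgt backEdge sB xs) :
    ChInv P (i + 1) (if i + 1 ≤ n then P.bk (P.vertexAt (i + 1)) else []) C src tgt backEdge sB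
      xs := by
  refine { I with src_le := fun c h1 h2 => (I.src_le c h1 h2).trans (by omega),
                  fresh := fun c h1 h2 h => ?_, done := fun y e he h => I.done y e he ?_ }
  · split_ifs at h with hin
    · have hs := I.src_le c h1 h2
      rw [← P.bk_disjoint h (I.back_mem c h1 h2), (P.vertexAt_mem _ (by omega) hin).2.2] at hs
      omega
    · simp at h
  · have hy := P.upper_mem he
    obtain ⟨a, b, c⟩ := P.num_mem y hy.1 hy.2
    rcases h with h | ⟨h, h'⟩
    · by_cases h2 : P.num y < i
      · exact .inl h2
      · exact .inr ⟨by omega, by simp⟩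
    · rw [if_pos (by omega), ← h, c] at h'
      exact absurd he h'

/-- The set of vertices that are visited is closed under taking parents. -/
theorem good_par (I : ChInv P i todo C src tgt backEdge sB xs) {x : ℕ} (hx : 1 ≤ x ∧ x ≤ n)
    (hx1 : x ≠ 1) (hs : sB x ≠ 0) : P.par x = 1 ∨ sB (P.par x) ≠ 0 := by
  have hc := I.sB_le x hx hx1
  have h1 : 1 ≤ sB x := by omega
  rcases (I.trail _ h1 hc).next_mem ((I.mem_xs _ x h1 hc).2 ⟨hx, hx1, rfl⟩) with h | h
  · have := ((I.mem_xs _ _ h1 hc).1 h).2.2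
    right; omega
  · rw [h]
    exact (I.tgt_lt _ h1 hc).imp_right fun h => h.1

theorem good_low (I : ChInv P i todo C src tgt backEdge sB xs) {c : ℕ} (h1 : 1 ≤ c) (hc : c ≤ C) :
    sB (P.low (backEdge c)) ≠ 0 := by
  have ht := I.trail c h1 hc
  rcases hx : xs c with _ | ⟨a, l⟩
  · rw [hx] at ht
    rw [show P.low (backEdge c) = tgt c from ht]
    rcases I.tgt_lt c h1 hc with h | h
    · rw [h, I.sB_one]; simp
    · exact h.1
  · have := (I.mem_xs c a h1 hc).1 (by simp [hx])
    rw [hx] at ht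
    rw [ht.1]
    omega

/-- The tree edge above `x` is spanned by a back edge whose upper endpoint has a smaller number,
hence has been processed. Its chain reaches a visited vertex, and being visited is inherited upwards
to `x`. In particular a vertex already belongs to a chain when its own back edges are about to be
processed, unless it is the root. -/
theorem sB_ne_zero {m : ℕ} {end1 end2 : ℕ → ℕ} (hG : IsInput G n m end1 end2)
    (I : ChInv P i todo C src tgt backEdge sB xs) {x : ℕ} (hx : 1 ≤ x ∧ x ≤ n) (hx1 : x ≠ 1)
    (hi : P.num x ≤ i) : sB x ≠ 0 := by
  obtain ⟨y, e, he, hxa, hlt⟩ := P.exists_back hG hx hx1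
  obtain ⟨c, h1, hc, rfl⟩ := I.done y e he (.inl (by omega))
  refine (P.anc_induction (P.low_mem he) hxa (p := fun z => z = 1 ∨ sB z ≠ 0)
    (.inr (I.good_low h1 hc)) fun z hz hz1 _ _ h => I.good_par hz hz1 ?_).resolve_left hx1
  exact h.resolve_left hz1

/-- The new path consists of vertices that belonged to no chain. So it avoids `v`, its own end `t`
and the targets of all earlier chains, and labelling its vertices by `C + 1` affects none of the
earlier statements. -/
theorem addChain (I : ChInv P i todo C src tgt backEdge sB xs) {v e t : ℕ}
    {l todo' before : List ℕ} (htodo : todo = e :: todo') (hbk : P.bk v = before ++ todo)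
    (hv : P.num v = i) (ht : Trail P.par (P.low e) l t)
    (hl : ∀ y ∈ l, (1 ≤ y ∧ y ≤ n) ∧ y ≠ 1 ∧ sB y = 0) (hgood : t = 1 ∨ sB t ≠ 0)
    (htr : 1 ≤ t ∧ t ≤ n) (hvg : v = 1 ∨ sB v ≠ 0) :
    ChInv P i todo' (C + 1) (Function.update src (C + 1) v) (Function.update tgt (C + 1) t)
      (Function.update backEdge (C + 1) e) (fun y => if y ∈ l then C + 1 else sB y)
      (Function.update xs (C + 1) l) := by
  have heb : e ∈ P.bk v := by rw [hbk, htodo]; simp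
  have hnd : (before ++ e :: todo').Nodup := by rw [← htodo, ← hbk]; exact P.bk_nodup v
  have hfresh : ∀ c, 1 ≤ c → c ≤ C → backEdge c ≠ e := by
    rintro c h1 h2 rfl
    exact I.fresh c h1 h2 (by simp [htodo])
  have hlr : ∀ y ∈ l, (1 ≤ y ∧ y ≤ n) ∧ y ≠ 1 := fun y hy => ⟨(hl y hy).1, (hl y hy).2.1⟩
  have hvl : v ∉ l := by
    intro h
    obtain ⟨-, h1, h2⟩ := hl v h
    exact hvg.elim h1 fun h => h h2
  have htl : t ∉ l := by
    intro h
    obtain ⟨-, h1, h2⟩ := hl t h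
    exact hgood.elim h1 fun h => h h2
  have htgtl : ∀ c, 1 ≤ c → c ≤ C → tgt c ∉ l := by
    intro c h1 h2 h
    obtain ⟨-, h3, h4⟩ := hl _ h
    rcases I.tgt_lt c h1 h2 with h | h
    · exact h3 h
    · exact h.1 h4
  have hcase : ∀ c, c ≤ C + 1 → c ≤ C ∨ c = C + 1 := fun c h => by omega
  have hne : ∀ c, c ≤ C → c ≠ C + 1 := fun c h => by omega
  constructor
  · intro c h1 h2
    rcases hcase c h2 with h | rfl
    · simpa [hne c h] using I.back_mem c h1 h
    · simpa using heb
  · intro c h1 h2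
    rcases hcase c h2 with h | rfl
    · simpa [hne c h] using I.src_le c h1 h
    · simp [hv]
  · intro c h1 h2
    rcases hcase c h2 with h | rfl
    · have := I.fresh c h1 h
      simp only [ne_eq, hne c h, not_false_eq_true, Function.update_of_ne]
      exact fun h' => this (by simp [htodo, h'])
    · simp only [Function.update_self]
      exact (List.nodup_cons.1 (List.nodup_append.1 hnd).2.1).1
  · intro c c' h1 h2 h1' h2' heq
    rcases hcase c h2 with h | rfl <;> rcases hcase c' h2' with h' | rfl
    · simp only [ne_eq, hne c h, hne c' h', not_false_eq_true, Function.update_of_ne] at heq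
      exact I.inj c c' h1 h h1' h' heq
    · simp only [ne_eq, hne c h, not_false_eq_true, Function.update_of_ne,
        Function.update_self] at heq
      exact absurd heq (hfresh c h1 h)
    · simp only [ne_eq, hne c' h', not_false_eq_true, Function.update_of_ne,
        Function.update_self] at heq
      exact absurd heq.symm (hfresh c' h1' h')
    · rfl
  · intro y e' he' h
    by_cases hee : e' = e
    · exact ⟨C + 1, by omega, le_rfl, by simp [hee]⟩
    · obtain ⟨c, h1, h2, h3⟩ := I.done y e' he' (by
        refine h.imp_right fun h => ⟨h.1, ?_⟩
        rw [htodo]; simp [hee, h.2])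
      exact ⟨c, h1, by omega, by simpa [hne c h2] using h3⟩
  · intro c h1 h2
    rcases hcase c h2 with h | rfl
    · simpa [hne c h] using I.trail c h1 h
    · simpa using ht
  · intro c x h1 h2
    rcases hcase c h2 with h | rfl
    · simp only [ne_eq, hne c h, not_false_eq_true, Function.update_of_ne]
      rw [I.mem_xs c x h1 h]
      by_cases hx : x ∈ l
      · have := (hl x hx).2.2
        simp only [hx, if_true]
        constructor <;> intro h' <;> omega
      · simp [hx]
    · simp only [Function.update_self]
      by_cases hx : x ∈ l
      · simpa [hx] using hlr x hx
      · simp only [hx, if_false, false_iff]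
        rintro ⟨hxr, hx1, h'⟩
        have := I.sB_le x hxr hx1
        omega
  · have : 1 ∉ l := fun h => (hlr 1 h).2 rfl
    simp [this, I.sB_one]
  · intro x hx hx1
    have := I.sB_le x hx hx1
    split_ifs <;> omega
  · intro c h1 h2
    rcases hcase c h2 with h | rfl
    · simpa [hne c h] using I.tgt_mem c h1 h
    · simpa using htr
  · intro c h1 h2
    rcases hcase c h2 with h | rfl
    · simpa [hne c h, htgtl c h1 h] using I.tgt_lt c h1 h
    · simp only [Function.update_self, htl, if_false]
      by_cases ht1 : t = 1
      · exact .inl ht1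
      · have := I.sB_le t htr ht1
        have := hgood.resolve_left ht1
        right; omega
  · intro c h1 h2
    rcases hcase c h2 with h | rfl
    · simpa [hne c h] using I.src_anc c h1 h
    · simpa using P.anc_of_trail ht hlr (P.back v e heb).2.1 hvl
  · intro c c' h1 h2 h3
    rcases hcase c' h3 with h | rfl
    · simpa [hne c (by omega), hne c' h] using I.src_mono c c' h1 h2 h
    · simpa [hne c (by omega), hv] using I.src_le c h1 (by omega)
  · intro c c' h1 h2 h3
    rcases hcase c' h3 with h | rfl
    · simpa [hne c (by omega), hne c' h] using I.chain_sorted c c' h1 h2 h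
    · simp only [ne_eq, hne c (by omega), not_false_eq_true, Function.update_of_ne,
        Function.update_self]
      rintro hs rfl
      have hb := I.back_mem c h1 (by omega)
      rw [hs, hbk] at hb
      -- The back edge of an earlier chain from the root has been processed already, so it precedes
      -- `e` in the sorted list of the root.
      have hb := (List.mem_append.1 hb).resolve_right (I.fresh c h1 (by omega))
      have hsort := P.sorted
      rw [hbk, htodo] at hsort
      exact (List.pairwise_append.1 hsort).2.2 _ hb _ (by simp)

/-- There is room for one more chain as long as there is an unprocessed back edge. -/
theorem lt_of_mem {m : ℕ} {end1 end2 : ℕ → ℕ} (hG : IsInput G n m end1 end2)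
    (I : ChInv P i todo C src tgt backEdge sB xs) {v e : ℕ} (he : e ∈ todo) (hv : e ∈ P.bk v) :
    C < m := by
  have hE : ∀ {y e}, e ∈ P.bk y → e ∈ Finset.Icc 1 m := fun h => by
    have := (P.back _ _ h).1.edge_mem
    rw [hG.edgeSet] at this
    simpa using this
  have hsub : insert e ((Finset.Icc 1 C).image backEdge) ⊆ Finset.Icc 1 m := by
    intro x hx
    rcases Finset.mem_insert.1 hx with rfl | hx
    · exact hE hv
    · obtain ⟨c, hc, rfl⟩ := Finset.mem_image.1 hx
      rw [Finset.mem_Icc] at hc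
      exact hE (I.back_mem c hc.1 hc.2)
  have hcard := Finset.card_le_card hsub
  rw [Finset.card_insert_of_notMem, Finset.card_image_of_injOn, Nat.card_Icc, Nat.card_Icc] at hcard
  · omega
  · intro c hc c' hc' h
    simp only [Finset.coe_Icc, Set.mem_Icc] at hc hc'
    exact I.inj c c' hc.1 hc.2 hc'.1 hc'.2 h
  · intro h
    obtain ⟨c, hc, rfl⟩ := Finset.mem_image.1 h
    rw [Finset.mem_Icc] at hc
    exact I.fresh c hc.1 hc.2 he

end ChInv

/-- The lists of children during the construction of a chain decomposition. -/
structure KidInv (C : ℕ) (sB tgt childNext childHead : ℕ → ℕ) (ch : ℕ → List ℕ) : Prop where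
  mem : ∀ c d, d ∈ ch c ↔ 2 < d ∧ d ≤ C ∧ sB (tgt d) = c
  nodup : ∀ c, (ch c).Nodup
  trail : ∀ c, Trail childNext (childHead c) (ch c) 0

/-- The hypothesis `h` holds because targets of earlier chains were visited and visited vertices are
never relabelled. The test `2 < C + 1` keeps the two initial chains out of all lists of children. -/
theorem KidInv.step {C : ℕ} {sB tgt childNext childHead sB' tgt' : ℕ → ℕ} {ch : ℕ → List ℕ}
    (I : KidInv C sB tgt childNext childHead ch)
    (h : ∀ d, 1 ≤ d → d ≤ C → sB' (tgt' d) = sB (tgt d)) :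
    ∃ ch', KidInv (C + 1) sB' tgt'
      (if 2 < C + 1 then Function.update childNext (C + 1) (childHead (sB' (tgt' (C + 1))))
        else childNext)
      (if 2 < C + 1 then Function.update childHead (sB' (tgt' (C + 1))) (C + 1) else childHead)
      ch' := by
  split_ifs with hC
  · have hz : ∀ c, C + 1 ∉ ch c := fun c hc => by have := (I.mem c _).1 hc; omega
    refine ⟨Function.update ch (sB' (tgt' (C + 1))) ((C + 1) :: ch (sB' (tgt' (C + 1)))),
      fun c d => ?_, fun c => ?_, Trail.push I.trail hz _⟩
    · have : d ∈ Function.update ch (sB' (tgt' (C + 1))) ((C + 1) :: ch (sB' (tgt' (C + 1)))) c ↔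
          d ∈ ch c ∨ (d = C + 1 ∧ sB' (tgt' (C + 1)) = c) := by
        by_cases hc : c = sB' (tgt' (C + 1))
        · subst hc; simp [or_comm]
        · simp [hc, Ne.symm hc]
      rw [this, I.mem]
      constructor
      · rintro (⟨h1, h2, h3⟩ | ⟨rfl, h⟩)
        · exact ⟨h1, by omega, by rw [h d (by omega) h2, h3]⟩
        · exact ⟨hC, le_rfl, h⟩
      · rintro ⟨h1, h2, h3⟩
        by_cases hd : d = C + 1
        · subst hd; exact .inr ⟨rfl, h3⟩
        · exact .inl ⟨h1, by omega, by rw [← h d (by omega) (by omega), h3]⟩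
    · by_cases hc : c = sB' (tgt' (C + 1))
      · subst hc; simp [hz, I.nodup]
      · simpa [hc] using I.nodup c
  · refine ⟨ch, fun c d => ?_, I.nodup, I.trail⟩
    rw [I.mem]
    constructor <;> rintro ⟨h1, h2, h3⟩ <;> omega

/-- Starting from position `a`, the cells of the array `f` hold the list `l`. -/
def Cells (f : ℕ → ℕ) (a : ℕ) (l : List ℕ) : Prop := ∀ k (h : k < l.length), f (a + k) = l[k]

theorem Cells.snoc {f : ℕ → ℕ} {a : ℕ} {l : List ℕ} (h : Cells f a l) (z : ℕ) :
    Cells (Function.update f (a + l.length) z) a (l ++ [z]) := fun k hk => by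
  by_cases hkl : k < l.length
  · rw [List.getElem_append_left hkl, Function.update_of_ne (by omega), h k hkl]
  · obtain rfl : k = l.length := by simp at hk; omega
    simp

/-- The edges of the chain with back edge `e` and inner vertices `l`. -/
def edgeList (parEdge : ℕ → ℕ) (e : ℕ) (l : List ℕ) : List ℕ := e :: l.map parEdge

/-- The first `C` chains are stored in `chainEdge`, of which the first `pos` cells are in use. -/
structure CellInv (parEdge backEdge chainStart chainEdge : ℕ → ℕ) (xs : ℕ → List ℕ) (C pos : ℕ) :
    Prop where
  cells : ∀ c, 1 ≤ c → c ≤ C →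
    Cells chainEdge (chainStart c) (edgeList parEdge (backEdge c) (xs c))
  next : ∀ c, 1 ≤ c → c ≤ C → chainStart c + (edgeList parEdge (backEdge c) (xs c)).length =
    if c = C then pos else chainStart (c + 1)
  le : ∀ c, 1 ≤ c → c ≤ C → chainStart c ≤ pos

theorem CellInv.step {parEdge backEdge chainStart chainEdge chainEdge' : ℕ → ℕ} {xs : ℕ → List ℕ}
    {C pos e : ℕ} (I : CellInv parEdge backEdge chainStart chainEdge xs C pos) (l : List ℕ)
    (hold : ∀ j < pos, chainEdge' j = chainEdge j)
    (hnew : Cells chainEdge' pos (edgeList parEdge e l)) :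
    CellInv parEdge (Function.update backEdge (C + 1) e) (Function.update chainStart (C + 1) pos)
      chainEdge' (Function.update xs (C + 1) l) (C + 1) (pos + (edgeList parEdge e l).length) := by
  have hle : ∀ c, 1 ≤ c → c ≤ C →
      chainStart c + (edgeList parEdge (backEdge c) (xs c)).length ≤ pos := by
    intro c h1 h2
    rw [I.next c h1 h2]
    split_ifs
    · exact le_rfl
    · exact I.le _ (by omega) (by omega)
  constructor
  · intro c h1 h2
    by_cases hc : c = C + 1
    · subst hc; simpa using hnew
    · have := hle c h1 (by omega)
      simp only [ne_eq, hc, not_false_eq_true, Function.update_of_ne]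
      intro k hk
      rw [hold _ (by omega), I.cells c h1 (by omega) k hk]
  · intro c h1 h2
    by_cases hc : c = C + 1
    · subst hc; simp
    · have hn := I.next c h1 (by omega)
      simp only [ne_eq, hc, not_false_eq_true, Function.update_of_ne, if_false]
      rw [hn]
      by_cases hc' : c = C
      · subst hc'; simp
      · rw [if_neg hc', Function.update_of_ne (by omega)]
  · intro c h1 h2
    by_cases hc : c = C + 1
    · subst hc; simp
    · have := I.le c h1 (by omega)
      simp only [ne_eq, hc, not_false_eq_true, Function.update_of_ne]
      omega

/-- The arrays of the state `s` hold the depth-first search tree `P`. -/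
structure Palm.Stored {G : Graph ℕ ℕ} {n : ℕ} (P : Palm G n) (s : State) : Prop where
  num : s.arrs .num = P.num
  par : s.arrs .par = P.par
  parEdge : s.arrs .parEdge = P.parEdge
  vertexAt : s.arrs .vertexAt = P.vertexAt
  low : s.arrs .low = P.low
  back : ∀ x, Trail (s.arrs .backNext) (s.arrs .backHead x) (P.bk x) 0

/-- The state `s` holds the chains that have been constructed when, at the vertex with number `i`,
the back edges in the list `todo` have not been processed. -/
def ChState {G : Graph ℕ ℕ} {n : ℕ} (P : Palm G n) (s : State) (i : ℕ) (todo : List ℕ) : Prop :=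
  ∃ xs ch, ChInv P i todo (s.regs .numC) (s.arrs .src) (s.arrs .tgt) (s.arrs .backEdge)
      (s.arrs .sBelongs) xs ∧
    KidInv (s.regs .numC) (s.arrs .sBelongs) (s.arrs .tgt) (s.arrs .childNext) (s.arrs .childHead)
      ch ∧
    CellInv P.parEdge (s.arrs .backEdge) (s.arrs .chainStart) (s.arrs .chainEdge) xs (s.regs .numC)
      (s.regs .pos)

/-- The number of vertices that do not belong to a chain. -/
def unmarked (n : ℕ) (sB : ℕ → ℕ) : ℕ := ((Finset.Icc 1 n).filter fun x => sB x = 0).card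

theorem unmarked_le (n : ℕ) (sB : ℕ → ℕ) : unmarked n sB ≤ n :=
  (Finset.card_filter_le _ _).trans (by simp)

theorem unmarked_add {n C : ℕ} {sB : ℕ → ℕ} {l : List ℕ} (hl : l.Nodup)
    (h : ∀ y ∈ l, (1 ≤ y ∧ y ≤ n) ∧ y ≠ 1 ∧ sB y = 0) :
    unmarked n (fun y => if y ∈ l then C + 1 else sB y) + l.length = unmarked n sB := by
  have : (Finset.Icc 1 n).filter (fun x => (if x ∈ l then C + 1 else sB x) = 0) =
      (Finset.Icc 1 n).filter (fun x => sB x = 0) \ l.toFinset := by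
    ext x
    simp only [Finset.mem_filter, Finset.mem_sdiff, List.mem_toFinset]
    by_cases hx : x ∈ l <;> simp [hx]
  have hsub : l.toFinset ⊆ (Finset.Icc 1 n).filter fun x => sB x = 0 := by
    intro x hx
    obtain ⟨h1, -, h2⟩ := h x (by simpa using hx)
    simp [h1, h2]
  have hc := Finset.card_le_card hsub
  rw [unmarked, this, Finset.card_sdiff_of_subset hsub, List.toFinset_card_of_nodup hl]
  rw [List.toFinset_card_of_nodup hl] at hc
  exact Nat.sub_add_cancel hc

theorem ChInv.tgt_notMem {G : Graph ℕ ℕ} {n : ℕ} {P : Palm G n} {i : ℕ} {todo : List ℕ} {C : ℕ}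
    {src tgt backEdge sB : ℕ → ℕ} {xs : ℕ → List ℕ} (I : ChInv P i todo C src tgt backEdge sB xs)
    {l : List ℕ} (hl : ∀ y ∈ l, (1 ≤ y ∧ y ≤ n) ∧ y ≠ 1 ∧ sB y = 0) {c : ℕ} (h1 : 1 ≤ c)
    (h2 : c ≤ C) : tgt c ∉ l := by
  intro h
  obtain ⟨-, h3, h4⟩ := hl _ h
  rcases I.tgt_lt c h1 h2 with h | h
  · exact h3 h
  · exact h.1 h4

theorem ChInv.exists_chainDec {G : Graph ℕ ℕ} {n m : ℕ} {end1 end2 : ℕ → ℕ} {P : Palm G n}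
    {C : ℕ} {src tgt backEdge sB : ℕ → ℕ} {xs ch : ℕ → List ℕ} {childNext childHead : ℕ → ℕ}
    (hG : IsInput G n m end1 end2) (I : ChInv P (n + 1) [] C src tgt backEdge sB xs)
    (J : KidInv C sB tgt childNext childHead ch) :
    ∃ D : ChainDec G n, D.toPalm = P ∧ D.N = C ∧ D.src = src ∧ D.tgt = tgt ∧
      D.backEdge = backEdge ∧ D.sB = sB ∧ D.xs = xs ∧ D.ch = ch := by
  have hnum : ∀ x, 1 ≤ x ∧ x ≤ n → P.num x ≤ n := fun x hx => (P.num_mem x hx.1 hx.2).2.1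
  refine ⟨⟨P, C, src, tgt, backEdge, sB, xs, ch, I.back_mem, I.inj, fun y e he => ?_, I.trail,
    I.mem_xs, I.sB_one, fun x hx hx1 => ?_, I.tgt_mem, fun c h1 h2 => ?_, I.src_anc, I.src_mono,
    I.chain_sorted, J.mem, J.nodup⟩, rfl, rfl, rfl, rfl, rfl, rfl, rfl, rfl⟩
  · exact I.done y e he (.inl (by have := hnum y (P.upper_mem he); omega))
  · have := I.sB_ne_zero hG hx hx1 (by have := hnum x hx; omega)
    exact ⟨by omega, I.sB_le x hx hx1⟩
  · exact (I.tgt_lt c h1 h2).imp_right And.right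

theorem wp_chainDecomposition {G : Graph ℕ ℕ} {n m : ℕ} {end1 end2 : ℕ → ℕ}
    (hG : IsInput G n m end1 end2) (hn : 1 ≤ n) {P : Palm G n} {s : State} (hP : P.Stored s)
    (hV : s.regs .numV = n)
    (h0 : ∀ a ∈ [Arr.visited, .sBelongs, .childHead], s.arrs a = fun _ => 0)
    {k : ℕ} (hk : 500 * (n + m) + 500 ≤ k) :
    WP chainDecomposition s k fun s' k' => k ≤ k' + (500 * (n + m) + 500) ∧
      ∃ D : ChainDec G n, D.toPalm = P ∧ s'.regs .numC = D.N ∧ D.N ≤ m ∧ s'.arrs .src = D.src ∧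
        s'.arrs .tgt = D.tgt ∧ s'.arrs .backEdge = D.backEdge ∧
        (∀ c, Trail (s'.arrs .childNext) (s'.arrs .childHead c) (D.ch c) 0) ∧
        ∀ c, 1 ≤ c → c ≤ D.N →
          chainEdges s' c = edgeList D.parEdge (D.backEdge c) (D.xs c) := by
  simp only [List.mem_cons, List.not_mem_nil, or_false, forall_eq_or_imp, forall_eq] at h0
  obtain ⟨hvis0, hsB0, hch0⟩ := h0
  have hz : ∀ x, 0 ∉ P.bk x := fun x hx => by
    have := (P.back x 0 hx).1.edge_mem
    rw [hG.edgeSet] at this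
    simp at this
  unfold chainDecomposition
  simp only [block]
  refine .seq (.run 3 (by omega) fun k₁ hk₁ => .seq (.run 3 (by omega) fun k₂ hk₂ => .seq
    (.run 2 (by omega) fun k₃ hk₃ => .seq (.run 2 (by omega) fun k₄ hk₄ => .seq ?_))))
  -- The credits spent are bounded by 100 per vertex of the outer loop, 200 per chain, and 100 per
  -- vertex that has been put on a chain, `unmarked` being the number of those still without a
  -- chain. The root has its own clause for `visited` since it belongs to the first chain from the
  -- start but is marked only in the first round.
  refine .while (fun s' k' =>
    k + 100 * unmarked n (s'.arrs .sBelongs) ≤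
      k' + 100 * (s'.regs .i) + 200 * s'.regs .numC + 100 * n ∧
    1 ≤ s'.regs .i ∧ s'.regs .i ≤ n + 1 ∧ s'.regs .numC ≤ m ∧
    (∀ x, 1 ≤ x ∧ x ≤ n → (s'.arrs .visited x ≠ 0 ↔
      (x ≠ 1 ∧ s'.arrs .sBelongs x ≠ 0) ∨ (x = 1 ∧ 2 ≤ s'.regs .i))) ∧
    ChState P s' (s'.regs .i)
      (if s'.regs .i ≤ n then P.bk (P.vertexAt (s'.regs .i)) else [])) ?_ ?_
  · have := unmarked_le n (Function.update (fun _ => 0) 1 1)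
    simp [hsB0, hvis0, hn]
    refine ⟨by omega, fun x _ _ => ?_, ?_⟩
    · by_cases hx : x = 1 <;> simp [hx]
    · refine ⟨fun _ => [], fun _ => [], ?_, ?_, ?_⟩
      · simpa [hsB0] using ChInv.init P _ _ _ _
      · constructor <;> simp [hch0, Trail]
        intro c d; omega
      · constructor <;> simp <;> omega
  · rintro s' k' ⟨hk', hi1, hin, hCm, hvis, hch⟩ hf
    have hnumV : s'.regs .numV = n := by rw [hf.regs _ rfl]; simpa using hV
    have hlow : s'.arrs .low = P.low := by rw [hf.arrs _ rfl]; simpa using hP.low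
    have hpar : s'.arrs .par = P.par := by rw [hf.arrs _ rfl]; simpa using hP.par
    have hparEdge : s'.arrs .parEdge = P.parEdge := by rw [hf.arrs _ rfl]; simpa using hP.parEdge
    have hvertexAt : s'.arrs .vertexAt = P.vertexAt := by
      rw [hf.arrs _ rfl]; simpa using hP.vertexAt
    have hback : ∀ x, Trail (s'.arrs .backNext) (s'.arrs .backHead x) (P.bk x) 0 := by
      intro x
      rw [hf.arrs .backNext rfl, hf.arrs .backHead rfl]
      simpa using hP.back x
    refine ⟨by simp; omega, fun hb => ?_, fun hb => ?_⟩
    · simp [hnumV] at hb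
      obtain ⟨hv1, hv2, hv3⟩ := P.vertexAt_mem _ hi1 hb
      rw [if_pos hb] at hch
      have hgood : P.vertexAt (s'.regs .i) = 1 ∨ s'.arrs .sBelongs (P.vertexAt (s'.regs .i)) ≠ 0 := by
        obtain ⟨xs, ch, I, -⟩ := hch
        by_cases h1 : P.vertexAt (s'.regs .i) = 1
        · exact .inl h1
        · exact .inr (I.sB_ne_zero hG ⟨hv1, hv2⟩ h1 hv3.le)
      simp only [Test.cost, Expr.cost, cost_add, cost_ofNat]
      refine .seq (.run 3 (by omega) fun k₅ hk₅ => .seq (.run 3 (by omega) fun k₆ hk₆ => .seq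
        (.run 3 (by omega) fun k₇ hk₇ => .seq ?_)))
      refine .while (fun t l =>
        k + 100 * unmarked n (t.arrs .sBelongs) ≤
          l + 100 * (s'.regs .i) + 50 + 200 * t.regs .numC + 100 * n ∧
        t.regs .numC ≤ m ∧
        (∀ x, 1 ≤ x ∧ x ≤ n → (t.arrs .visited x ≠ 0 ↔ x = 1 ∨ t.arrs .sBelongs x ≠ 0)) ∧
        ∃ before todo, P.bk (P.vertexAt (s'.regs .i)) = before ++ todo ∧
          Trail (s'.arrs .backNext) (t.regs .e) todo 0 ∧
          (P.vertexAt (s'.regs .i) = 1 ∨ t.arrs .sBelongs (P.vertexAt (s'.regs .i)) ≠ 0) ∧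
          ChState P t (s'.regs .i) todo) ?_ ?_
      · simp [hvertexAt]
        refine ⟨by omega, hCm, fun x h1 h2 => ?_, [], _, rfl, hback _, hgood, hch⟩
        by_cases hxv : x = P.vertexAt (s'.regs .i)
        · rw [hxv]; simpa using hgood
        · have := hvis x ⟨h1, h2⟩
          simp [hxv, this]
          by_cases hx1 : x = 1
          · subst hx1
            simp only [true_or, iff_true, not_true_eq_false, false_and, false_or, true_and]
            have : s'.regs .i ≠ 1 := by
              intro h
              rw [h] at hxv
              have := P.num_mem 1 le_rfl hn
              rw [P.num_one] at this
              exact hxv this.2.2.symm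
            omega
          · simp [hx1]
      · rintro t l ⟨hl, htm, htv, before, todo, hbk, htr, hvg, xs, ch, I, J, K⟩ hft
        have hlow : t.arrs .low = P.low := by rw [hft.arrs _ rfl]; simpa using hlow
        have hpar : t.arrs .par = P.par := by rw [hft.arrs _ rfl]; simpa using hpar
        have hparEdge : t.arrs .parEdge = P.parEdge := by rw [hft.arrs _ rfl]; simpa using hparEdge
        have hbn : t.arrs .backNext = s'.arrs .backNext := by rw [hft.arrs _ rfl]; simp
        have hti : t.regs .i = s'.regs .i := by rw [hft.regs _ rfl]; simp
        have htv' : t.regs .v = P.vertexAt (s'.regs .i) := by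
          rw [hft.regs _ rfl]; simp [hvertexAt]
        refine ⟨by simp; omega, fun hb' => ?_, fun hb' => ?_⟩
        · simp at hb'
          obtain ⟨todo', rfl, htr'⟩ := htr.exists_cons hb'
          have heb : t.regs .e ∈ P.bk (P.vertexAt (s'.regs .i)) := by rw [hbk]; simp
          have hCm' := I.lt_of_mem hG (List.mem_cons_self ..) heb
          -- The path that the inner loop is going to walk is fixed in advance: `p` are the
          -- unvisited vertices above the lower endpoint and `q` is the first visited one. The
          -- invariant of that loop merely splits `p` into a finished and a remaining part.
          obtain ⟨p, q, hpt, hp, hq, hqr⟩ := P.exists_trail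
            (good := fun x => x = 1 ∨ t.arrs .sBelongs x ≠ 0) (.inl rfl) (P.low_mem heb)
          have hp' : ∀ y ∈ p, (1 ≤ y ∧ y ≤ n) ∧ y ≠ 1 ∧ t.arrs .sBelongs y = 0 := by
            intro y hy
            obtain ⟨a, b, c⟩ := hp y hy
            exact ⟨a, b, by simpa [b] using c⟩
          have hpp := P.trail_pairwise hpt fun y hy => ⟨(hp' y hy).1, (hp' y hy).2.1⟩
          have hpn : p.Nodup := hpp.1.imp fun h => by rintro rfl; exact lt_irrefl _ h
          have hqp : q ∉ p := fun h => lt_irrefl _ (hpp.2 q h)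
          have hum := unmarked_add (C := t.regs .numC) hpn hp'
          simp only [Test.cost, Expr.cost, cost_ofNat]
          refine .seq (.run 4 (by omega) fun l₁ hl₁ => .seq (.run 3 (by omega) fun l₂ hl₂ => .seq
            (.run 3 (by omega) fun l₃ hl₃ => .seq (.run 3 (by omega) fun l₄ hl₄ => .seq
            (.run 3 (by omega) fun l₅ hl₅ => .seq (.run 4 (by omega) fun l₆ hl₆ => .seq
            (.run 3 (by omega) fun l₇ hl₇ => .seq ?_)))))))
          refine .while (fun u l' => ∃ done rest, p = done ++ rest ∧
            Trail P.par (u.regs .x) rest q ∧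
            u.arrs .sBelongs = (fun y => if y ∈ done then t.regs .numC + 1 else t.arrs .sBelongs y) ∧
            u.arrs .visited = (fun y => if y ∈ done then 1 else t.arrs .visited y) ∧
            u.regs .pos = t.regs .pos + (edgeList P.parEdge (t.regs .e) done).length ∧
            Cells (u.arrs .chainEdge) (t.regs .pos) (edgeList P.parEdge (t.regs .e) done) ∧
            (∀ j < t.regs .pos, u.arrs .chainEdge j = t.arrs .chainEdge j) ∧
            l ≤ l' + 50 + 50 * done.length) ?_ ?_
          · refine ⟨[], p, rfl, by simpa [hlow] using hpt, by simp, by simp, ?_, ?_, ?_, ?_⟩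
            · simp [edgeList]
            · intro j hj
              simp [edgeList] at hj
              simp [hj, edgeList]
            · intro j hj
              simp [hj.ne]
            · simp; omega
          · rintro u l' ⟨done, rest, rfl, hrest, husB, huv, hupos, hcells, hold, hl'⟩ hfu
            have hpar : u.arrs .par = P.par := by rw [hfu.arrs _ rfl]; simpa using hpar
            have hparEdge : u.arrs .parEdge = P.parEdge := by
              rw [hfu.arrs _ rfl]; simpa using hparEdge
            have hlen : (done ++ rest).length = done.length + rest.length := by simp
            have huC : u.regs .numC = t.regs .numC + 1 := by rw [hfu.regs _ rfl]; simp
            refine ⟨by simp; omega, fun hb => ?_, fun hb => ?_⟩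
            · simp at hb
              have hxq : u.regs .x ≠ q := by
                rintro h
                rw [h, huv] at hb
                have : q ∉ done := fun h => hqp (by simp [h])
                simp only [this, if_false] at hb
                exact (htv q hqr).2 hq hb
              obtain ⟨rest', rfl, hrest'⟩ := hrest.exists_cons hxq
              have hlen' : rest'.length + 1 = (u.regs .x :: rest').length := by simp
              refine .run 30 (by simp; omega) fun l₈ hl₈ => ?_
              simp [hpar, hparEdge, huC] at hl₈ ⊢
              refine ⟨done ++ [u.regs .x], rest', by simp, hrest', ?_, ?_, ?_, ?_, ?_, ?_⟩
              · rw [husB]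
                funext y
                by_cases hy : y = u.regs .x <;> simp [hy, Function.update_apply]
              · rw [huv]
                funext y
                by_cases hy : y = u.regs .x <;> simp [hy, Function.update_apply]
              · rw [hupos]; simp [edgeList, add_assoc]
              · have := hcells.snoc (P.parEdge (u.regs .x))
                rw [← hupos] at this
                simpa [edgeList] using this
              · intro j hj
                rw [Function.update_of_ne (by omega), hold j hj]
              · simp; omega
            · simp at hb
              have hrest0 : rest = [] := by
                cases rest with
                | nil => rfl
                | cons y rest =>
                  exfalso
                  obtain ⟨hy, -⟩ := hrest
                  have hyd : y ∉ done := fun h =>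
                    (List.nodup_append.1 hpn).2.2 y h y (by simp) rfl
                  obtain ⟨a, b, c⟩ := hp' y (by simp)
                  rw [hy, huv] at hb
                  simp only [hyd, if_false] at hb
                  have := (htv y a).1 hb
                  simp [b, c] at this
              subst hrest0
              simp only [List.append_nil] at *
              have hx : u.regs .x = q := hrest
              have I' := I.addChain rfl hbk hv3 hpt hp' hq hqr hvg
              have K' := K.step done hold hcells
              obtain ⟨ch', J'⟩ := J.step
                (sB' := fun y => if y ∈ done then t.regs .numC + 1 else t.arrs .sBelongs y)
                (tgt' := Function.update (t.arrs .tgt) (t.regs .numC + 1) q) (by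
                  intro d h1 h2
                  rw [Function.update_of_ne (by omega)]
                  simp [I.tgt_notMem hp' h1 h2])
              have hsrc : u.arrs .src = Function.update (t.arrs .src) (t.regs .numC + 1)
                  (P.vertexAt (s'.regs .i)) := by rw [hfu.arrs _ rfl]; simp [htv']
              have hbe : u.arrs .backEdge = Function.update (t.arrs .backEdge) (t.regs .numC + 1)
                  (t.regs .e) := by rw [hfu.arrs _ rfl]; simp
              have hcs : u.arrs .chainStart = Function.update (t.arrs .chainStart)
                  (t.regs .numC + 1) (t.regs .pos) := by rw [hfu.arrs _ rfl]; simp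
              have htg : u.arrs .tgt = t.arrs .tgt := by rw [hfu.arrs _ rfl]; simp
              have hcn : u.arrs .childNext = t.arrs .childNext := by rw [hfu.arrs _ rfl]; simp
              have hchh : u.arrs .childHead = t.arrs .childHead := by rw [hfu.arrs _ rfl]; simp
              have hue : u.regs .e = t.regs .e := by rw [hfu.regs _ rfl]; simp
              have hubn : u.arrs .backNext = s'.arrs .backNext := by
                rw [hfu.arrs _ rfl]; simpa using hbn
              rw [← husB] at hum I' J'
              refine .seq (.run 3 (by simp; omega) fun l₈ hl₈ => ?_)
              simp only [Test.cost, Expr.cost, cost_ofNat] at hl₈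
              refine .seq (.run 15 (by omega) fun l₉ hl₉ => .run 3 (by omega) fun l₁₀ hl₁₀ => ?_)
              have hvis' : ∀ x, 1 ≤ x ∧ x ≤ n →
                  (u.arrs .visited x ≠ 0 ↔ x = 1 ∨ u.arrs .sBelongs x ≠ 0) := by
                intro x hx
                rw [huv, husB]
                by_cases hxd : x ∈ done
                · simp [hxd]
                · simpa [hxd] using htv x hx
              have hvg' : P.vertexAt (s'.regs .i) = 1 ∨
                  u.arrs .sBelongs (P.vertexAt (s'.regs .i)) ≠ 0 := by
                refine hvg.imp_right fun h => ?_
                rw [husB]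
                by_cases hxd : P.vertexAt (s'.regs .i) ∈ done <;> simp [hxd, h]
              by_cases h2 : 2 < t.regs .numC + 1
              · simp only [h2, if_true] at J'
                simp [when, huC, h2, hx, hue, hubn, hchh, hcn, htg, hbe, hcs, hsrc]
                refine ⟨by omega, by omega, by simpa using hvis', before ++ [t.regs .e], todo',
                  by simp [hbk], htr', by simpa using hvg',
                  Function.update xs (t.regs .numC + 1) done, ch', ?_, ?_, ?_⟩
                · simpa [huC, hsrc, hbe, htg] using I'
                · simpa [huC, htg, hcn, hchh, congrFun husB] using J'
                · simpa [huC, hupos, hbe, hcs] using K'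
              · simp only [h2, if_false] at J'
                simp [when, huC, h2, hx, hue, hubn, hchh, hcn, htg, hbe, hcs, hsrc]
                refine ⟨by omega, by omega, by simpa using hvis', before ++ [t.regs .e], todo',
                  by simp [hbk], htr', by simpa using hvg',
                  Function.update xs (t.regs .numC + 1) done, ch', ?_, ?_, ?_⟩
                · simpa [huC, hsrc, hbe, htg] using I'
                · simpa [huC, htg, hcn, hchh] using J'
                · simpa [huC, hupos, hbe, hcs] using K'
        · simp at hb'
          have htodo : todo = [] := htr.eq_nil_of_notMem (by
            rw [hb']; intro h; exact hz (P.vertexAt (s'.regs .i)) (by rw [hbk]; simp [h]))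
          subst htodo
          refine .run 5 (by simp; omega) fun l₁ hl₁ => ?_
          simp only [Test.cost, Expr.cost, cost_ofNat] at hl₁
          simp [hti]
          refine ⟨by omega, by omega, htm, fun x h1 h2 => ?_, xs, ch, I.advance, J, K⟩
          have := htv x ⟨h1, h2⟩
          simp only [ne_eq] at this
          rw [this]
          by_cases hx1 : x = 1
          · simp [hx1]; omega
          · simp [hx1]
    · simp [hnumV] at hb
      obtain ⟨xs, ch, I, J, K⟩ := hch
      have hi : s'.regs .i = n + 1 := by omega
      rw [hi, if_neg (by omega)] at I
      obtain ⟨D, h1, h2, h3, h4, h5, h6, h7, h8⟩ := I.exists_chainDec hG J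
      refine .run 5 (by simp; omega) fun l₁ hl₁ => ?_
      simp only [Test.cost, Expr.cost, cost_add, cost_ofNat] at hl₁
      have hum := unmarked_le n (s'.arrs .sBelongs)
      refine ⟨by omega, D, h1, by simp [h2], by omega, by simp [h3], by simp [h4], by simp [h5],
        by simpa [h8] using J.trail, fun c hc1 hc2 => ?_⟩
      rw [h2] at hc2
      have hcell := K.cells c hc1 hc2
      have hnext := K.next c hc1 hc2
      rw [h5, h7, h1]
      have hlen : (if c = s'.regs .numC then s'.regs .pos else s'.arrs .chainStart (c + 1)) -
          s'.arrs .chainStart c = (edgeList P.parEdge (s'.arrs .backEdge c) (xs c)).length := by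
        omega
      have hcC : c ≠ s'.regs .numC + 1 := by omega
      refine List.ext_getElem ?_ fun j hj hj' => ?_
      · simp only [chainEdges, List.length_map, List.length_range]
        by_cases h : c = s'.regs .numC
        · rw [if_pos h] at hlen; simp [h] at hlen ⊢; exact hlen
        · rw [if_neg h] at hlen; simp [h, hcC, hlen, Function.update_apply]
      · simp [chainEdges, Function.update_of_ne hcC, hcell j hj']

/-! ### Chains as paths -/

namespace Mader

variable {α β : Type*} {G : Graph α β}

theorem IsWalk.snoc {u v w : α} {es : List β} {xs : List α} {e : β} (h : IsWalk G u es xs v)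
    (he : G.IsLink e v w) : IsWalk G u (es ++ [e]) (xs ++ [v]) w := by
  induction h with
  | single h => exact .cons h (.single he)
  | cons h _ ih => exact .cons h (ih he)

theorem IsWalk.reverse {u v : α} {es : List β} {xs : List α} (h : IsWalk G u es xs v) :
    IsWalk G v es.reverse xs.reverse u := by
  induction h with
  | single h => exact .single h.symm
  | cons h _ ih => simpa using ih.snoc h.symm

theorem IsPath.reverse {u v : α} {es : List β} {xs : List α} (h : IsPath G u es xs v) :
    IsPath G v es.reverse xs.reverse u :=
  ⟨h.walk.reverse, List.nodup_reverse.2 h.nodup_edges, List.nodup_reverse.2 h.nodup_inner,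
    by simpa using h.target_notMem, by simpa using h.source_notMem⟩

end Mader

/-- Following the successor function along a list without repetitions never returns to the start and
never merges. For parent pointers it says that a chain enters each of its inner vertices by only one
edge from below. -/
theorem Trail.next_inj {nx : ℕ → ℕ} {h e : ℕ} {l : List ℕ} (ht : Trail nx h l e) (hl : l.Nodup)
    (he : e ∉ l) : (∀ y ∈ l, nx y ≠ h) ∧ ∀ y ∈ l, ∀ z ∈ l, nx y = nx z → y = z := by
  induction l generalizing h with
  | nil => simp
  | cons a l ih =>
    obtain ⟨rfl, ht⟩ := ht
    have hl' := List.nodup_cons.1 hl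
    simp only [List.mem_cons, not_or] at he
    obtain ⟨ih₁, ih₂⟩ := ih ht hl'.2 he.2
    have hne : ∀ y ∈ h :: l, nx y ≠ h := by
      intro y hy hyh
      rcases Trail.next_mem (h := h) (l := h :: l) ⟨rfl, ht⟩ hy with h' | h'
      · rcases List.mem_cons.1 hy with rfl | hy
        · cases l with
          | nil => rw [← show nx y = e from ht] at he; exact he.1 hyh
          | cons b l => rw [ht.1] at hyh; exact hl'.1 (by simp [hyh])
        · rcases ht.next_mem hy with h'' | h''
          · rw [hyh] at h''; exact hl'.1 h''
          · rw [hyh] at h''; exact he.1 h''.symm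
      · rw [hyh] at h'; exact he.1 h'.symm
    refine ⟨hne, fun y hy z hz hyz => ?_⟩
    rcases List.mem_cons.1 hy with hy' | hy' <;> rcases List.mem_cons.1 hz with hz' | hz'
    · rw [hy', hz']
    · exact absurd (hyz.symm.trans (by rw [hy'])) (ih₁ z hz')
    · exact absurd (hyz.trans (by rw [hz'])) (ih₁ y hy')
    · exact ih₂ y hy' z hz' hyz

theorem Trail.pred {nx : ℕ → ℕ} {h e x : ℕ} {l : List ℕ} (ht : Trail nx h l e) (hx : x ∈ l) :
    x = h ∨ ∃ y ∈ l, nx y = x := by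
  induction l generalizing h with
  | nil => simp at hx
  | cons a l ih =>
    obtain ⟨rfl, ht⟩ := ht
    rcases List.mem_cons.1 hx with rfl | hx
    · exact .inl rfl
    · rcases ih ht hx with rfl | ⟨y, hy, h⟩
      · exact .inr ⟨h, by simp, rfl⟩
      · exact .inr ⟨y, by simp [hy], h⟩

theorem Trail.pred_end {nx : ℕ → ℕ} {h e : ℕ} {l : List ℕ} (ht : Trail nx h l e) :
    (l = [] ∧ h = e) ∨ ∃ y ∈ l, nx y = e := by
  induction l generalizing h with
  | nil => exact .inl ⟨rfl, ht⟩
  | cons a l ih =>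
    obtain ⟨rfl, ht⟩ := ht
    right
    rcases ih ht with ⟨-, h'⟩ | ⟨y, hy, h'⟩
    · exact ⟨h, by simp, h'⟩
    · exact ⟨y, by simp [hy], h'⟩

namespace Palm

variable {G : Graph ℕ ℕ} {n : ℕ} (P : Palm G n)

theorem walk_of_trail {h t u e : ℕ} {l : List ℕ} (ht : Trail P.par h l t)
    (hl : ∀ x ∈ l, (1 ≤ x ∧ x ≤ n) ∧ x ≠ 1) (he : G.IsLink e u h) :
    Mader.IsWalk G u (edgeList P.parEdge e l) l t := by
  induction l generalizing h u e with
  | nil => rw [← show h = t from ht]; exact .single he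
  | cons a l ih =>
    obtain ⟨rfl, ht⟩ := ht
    have ha := hl h (by simp)
    exact .cons he (ih ht (fun x hx => hl x (List.mem_cons_of_mem _ hx))
      (P.tree h ha.1.1 ha.1.2 ha.2).2.2.2)

theorem trail_nodup {h t : ℕ} {l : List ℕ} (ht : Trail P.par h l t)
    (hl : ∀ x ∈ l, (1 ≤ x ∧ x ≤ n) ∧ x ≠ 1) : l.Nodup ∧ t ∉ l := by
  obtain ⟨h₁, h₂⟩ := P.trail_pairwise ht hl
  exact ⟨h₁.imp fun h => by rintro rfl; omega, fun h => lt_irrefl _ (h₂ t h)⟩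

theorem path_of_trail {h t u e : ℕ} {l : List ℕ} (ht : Trail P.par h l t)
    (hl : ∀ x ∈ l, (1 ≤ x ∧ x ≤ n) ∧ x ≠ 1) (he : G.IsLink e u h) (hu : u ∉ l)
    (hne : ∀ x ∈ l, e ≠ P.parEdge x) : Mader.IsPath G u (edgeList P.parEdge e l) l t := by
  obtain ⟨h₁, h₂⟩ := P.trail_nodup ht hl
  refine ⟨P.walk_of_trail ht hl he, List.nodup_cons.2 ⟨?_, ?_⟩, h₁, hu, h₂⟩
  · simp only [List.mem_map, not_exists, not_and]
    exact fun x hx h => hne x hx h.symm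
  · exact h₁.map_on fun x hx y hy h =>
      P.parEdge_inj (hl x hx).1 (hl x hx).2 (hl y hy).1 (hl y hy).2 h

end Palm

namespace ChainDec

variable {G : Graph ℕ ℕ} {n : ℕ} (D : ChainDec G n)

theorem mem_xs_range {c x : ℕ} (h1 : 1 ≤ c) (hc : c ≤ D.N) (hx : x ∈ D.xs c) :
    (1 ≤ x ∧ x ≤ n) ∧ x ≠ 1 :=
  ⟨((D.mem_xs c x h1 hc).1 hx).1, ((D.mem_xs c x h1 hc).1 hx).2.1⟩

theorem num_tgt_lt {c x : ℕ} (h1 : 1 ≤ c) (hc : c ≤ D.N) (hx : x ∈ D.xs c) :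
    D.num (D.tgt c) < D.num x :=
  (D.trail_pairwise (D.trail c h1 hc) fun _ => D.mem_xs_range h1 hc).2 x hx

theorem num_src_le {c : ℕ} (h1 : 1 ≤ c) (hc : c ≤ D.N) : D.num (D.src c) ≤ D.num (D.tgt c) :=
  D.num_le_of_mem_anc (D.tgt_mem c h1 hc) (D.src_anc c h1 hc)

theorem tgt_notMem {c : ℕ} (h1 : 1 ≤ c) (hc : c ≤ D.N) : D.tgt c ∉ D.xs c := fun h =>
  lt_irrefl _ (D.num_tgt_lt h1 hc h)

theorem src_notMem {c : ℕ} (h1 : 1 ≤ c) (hc : c ≤ D.N) : D.src c ∉ D.xs c := fun h =>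
  (D.num_tgt_lt h1 hc h).not_ge (D.num_src_le h1 hc)

theorem src_mem {c : ℕ} (h1 : 1 ≤ c) (hc : c ≤ D.N) : 1 ≤ D.src c ∧ D.src c ≤ n :=
  D.upper_mem (D.back_mem c h1 hc)

theorem back_link {c : ℕ} (h1 : 1 ≤ c) (hc : c ≤ D.N) :
    G.IsLink (D.backEdge c) (D.src c) (D.low (D.backEdge c)) :=
  (D.back _ _ (D.back_mem c h1 hc)).1.symm

theorem backEdge_ne {c x : ℕ} (h1 : 1 ≤ c) (hc : c ≤ D.N) (hx : 1 ≤ x ∧ x ≤ n) (hx1 : x ≠ 1) :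
    D.backEdge c ≠ D.parEdge x := (D.parEdge_ne hx hx1 (D.back_mem c h1 hc)).symm

/-- The edges of a chain. -/
def edges (c : ℕ) : List ℕ := edgeList D.parEdge (D.backEdge c) (D.xs c)

theorem mem_edges {c e : ℕ} : e ∈ D.edges c ↔ e = D.backEdge c ∨ ∃ x ∈ D.xs c, e = D.parEdge x := by
  simp [edges, edgeList, eq_comm]

theorem path {c : ℕ} (h1 : 1 ≤ c) (hc : c ≤ D.N) :
    Mader.IsPath G (D.src c) (D.edges c) (D.xs c) (D.tgt c) :=
  D.path_of_trail (D.trail c h1 hc) (fun _ => D.mem_xs_range h1 hc) (D.back_link h1 hc)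
    (D.src_notMem h1 hc) fun _ hx =>
      D.backEdge_ne h1 hc (D.mem_xs_range h1 hc hx).1 (D.mem_xs_range h1 hc hx).2

theorem low_cases {c : ℕ} (h1 : 1 ≤ c) (hc : c ≤ D.N) :
    D.low (D.backEdge c) ∈ D.xs c ∨ (D.xs c = [] ∧ D.low (D.backEdge c) = D.tgt c) := by
  have := D.trail c h1 hc
  rcases hx : D.xs c with _ | ⟨a, l⟩
  · rw [hx] at this; exact .inr ⟨rfl, this⟩
  · rw [hx] at this; exact .inl (by simp [this.1])

/-- Back edges differ from tree edges and determine their chain, and a tree edge determines its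
lower endpoint, which belongs strongly to a single chain. -/
theorem edges_disjoint {c c' e : ℕ} (h1 : 1 ≤ c) (hc : c ≤ D.N) (h1' : 1 ≤ c') (hc' : c' ≤ D.N)
    (he : e ∈ D.edges c) (he' : e ∈ D.edges c') : c = c' := by
  rw [mem_edges] at he he'
  rcases he with rfl | ⟨x, hx, rfl⟩ <;> rcases he' with h | ⟨y, hy, h⟩
  · exact D.back_inj _ _ h1 hc h1' hc' h
  · exact absurd h (D.backEdge_ne h1 hc (D.mem_xs_range h1' hc' hy).1 (D.mem_xs_range h1' hc' hy).2)
  · exact absurd h.symm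
      (D.backEdge_ne h1' hc' (D.mem_xs_range h1 hc hx).1 (D.mem_xs_range h1 hc hx).2)
  · have hx' := D.mem_xs_range h1 hc hx
    have hy' := D.mem_xs_range h1' hc' hy
    have := D.parEdge_inj hx'.1 hx'.2 hy'.1 hy'.2 h
    rw [← ((D.mem_xs _ _ h1 hc).1 hx).2.2, ← ((D.mem_xs _ _ h1' hc').1 hy).2.2, this]

theorem tgt_first {c : ℕ} (hc : c ≤ D.N) (h : c = 1) : D.tgt c = 1 := by
  subst h
  by_contra h
  have := (D.tgt_lt 1 le_rfl hc).resolve_left h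
  have := (D.sB_mem _ (D.tgt_mem 1 le_rfl hc) h).1
  omega

/-! ### Unions of chains closed under parents, and degrees in them -/

/-- The edge set of the union of the chains in the list `A`. -/
def union (A : List ℕ) : Set ℕ := {e | ∃ c ∈ A, e ∈ D.edges c}

theorem union_append (A : List ℕ) (c : ℕ) : D.union (A ++ [c]) = D.union A ∪ {e | e ∈ D.edges c} := by
  ext e
  simp only [union, List.mem_append, List.mem_singleton, Set.mem_ofPred_eq, Set.mem_union]
  constructor
  · rintro ⟨d, hd | rfl, h⟩
    · exact .inl ⟨d, hd, h⟩
    · exact .inr h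
  · rintro (⟨d, hd, h⟩ | h)
    · exact ⟨d, .inl hd, h⟩
    · exact ⟨c, .inr rfl, h⟩

/-- The list `A` of chains contains the first chain and is closed under taking parents. -/
structure Closed (A : List ℕ) : Prop where
  range : ∀ c ∈ A, 1 ≤ c ∧ c ≤ D.N
  nodup : A.Nodup
  one : 1 ∈ A
  parent : ∀ c ∈ A, D.sB (D.tgt c) ∈ A

namespace Closed

variable {D} {A : List ℕ} (hA : D.Closed A)

include hA in
-- Along the chain `sB x`, the parent of `x` is either another inner vertex or the target, which
-- belongs to the parent chain.
theorem cov_par {x : ℕ} (hx : 1 ≤ x ∧ x ≤ n) (hx1 : x ≠ 1) (h : D.sB x ∈ A) :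
    D.sB (D.par x) ∈ A := by
  obtain ⟨h1, hc⟩ := hA.range _ h
  rcases (D.trail _ h1 hc).next_mem ((D.mem_xs _ x h1 hc).2 ⟨hx, hx1, rfl⟩) with h' | h'
  · rwa [((D.mem_xs _ _ h1 hc).1 h').2.2]
  · rw [h']; exact hA.parent _ h

include hA in
theorem cov_anc {x y : ℕ} (hx : 1 ≤ x ∧ x ≤ n) (h : D.sB x ∈ A) (hy : y ∈ D.anc x) :
    D.sB y ∈ A :=
  D.anc_induction hx hy (p := fun z => D.sB z ∈ A) h fun _ hz h1 _ _ h => hA.cov_par hz h1 h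

include hA in
theorem cov_src {c : ℕ} (h1 : 1 ≤ c) (hc : c ≤ D.N) (h : D.sB (D.tgt c) ∈ A) :
    D.sB (D.src c) ∈ A := hA.cov_anc (D.tgt_mem c h1 hc) h (D.src_anc c h1 hc)

include hA in
theorem cov_of_mem_xs {c x : ℕ} (hc : c ∈ A) (hx : x ∈ D.xs c) : D.sB x ∈ A := by
  rwa [((D.mem_xs c x (hA.range c hc).1 (hA.range c hc).2).1 hx).2.2]

include hA in
theorem parEdge_mem {x : ℕ} (hx : 1 ≤ x ∧ x ≤ n) (hx1 : x ≠ 1) (h : D.sB x ∈ A) :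
    D.parEdge x ∈ D.union A :=
  ⟨_, h, D.mem_edges.2 (.inr ⟨x, (D.mem_xs _ x (hA.range _ h).1 (hA.range _ h).2).2
    ⟨hx, hx1, rfl⟩, rfl⟩)⟩

theorem _root_.ChainDec.inc_parEdge {x v : ℕ} (hx : 1 ≤ x ∧ x ≤ n) (hx1 : x ≠ 1)
    (h : G.Inc (D.parEdge x) v) : v = x ∨ v = D.par x := by
  have := (D.tree x hx.1 hx.2 hx1).2.2.2
  exact h.eq_or_eq_of_isLink this

theorem _root_.ChainDec.inc_backEdge {c v : ℕ} (h1 : 1 ≤ c) (hc : c ≤ D.N)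
    (h : G.Inc (D.backEdge c) v) : v = D.src c ∨ v = D.low (D.backEdge c) :=
  h.eq_or_eq_of_isLink (D.back_link h1 hc)

include hA in
/-- An edge of the union is incident to covered vertices only. -/
theorem cov_of_inc {e v : ℕ} (he : e ∈ D.union A) (h : G.Inc e v) : D.sB v ∈ A := by
  obtain ⟨c, hc, he⟩ := he
  obtain ⟨h1, hN⟩ := hA.range c hc
  rcases D.mem_edges.1 he with rfl | ⟨x, hx, rfl⟩
  · rcases D.inc_backEdge h1 hN h with rfl | rfl
    · exact hA.cov_src h1 hN (hA.parent c hc)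
    · rcases D.low_cases h1 hN with h | ⟨-, h⟩
      · exact hA.cov_of_mem_xs hc h
      · rw [h]; exact hA.parent c hc
  · obtain ⟨hx', hx1⟩ := D.mem_xs_range h1 hN hx
    rcases D.inc_parEdge hx' hx1 h with rfl | rfl
    · exact hA.cov_of_mem_xs hc hx
    · exact hA.cov_par hx' hx1 (hA.cov_of_mem_xs hc hx)

end Closed

/-- The labels `st` of the vertices with respect to the union of the chains in `A`: inactive,
non-branch and branch vertices are labelled by 0, 1, 2. -/
structure Labels (A : List ℕ) (st : ℕ → ℕ) : Prop where
  zero : ∀ x, 1 ≤ x ∧ x ≤ n → (st x = 0 ↔ D.sB x ∉ A)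
  two : ∀ x, 1 ≤ x ∧ x ≤ n →
    (st x = 2 ↔ x = 1 ∨ D.sB x ∈ A ∧ ∃ c ∈ A, D.src c = x ∨ D.tgt c = x)
  le : ∀ x, 1 ≤ x ∧ x ≤ n → st x ≤ 2

/-- The edge by which the chain `sB x` enters `x`. -/
theorem exists_inEdge {x : ℕ} (hx : 1 ≤ x ∧ x ≤ n) (hx1 : x ≠ 1) :
    ∃ e ∈ D.edges (D.sB x), e ≠ D.parEdge x ∧ G.Inc e x ∧
      ((e = D.backEdge (D.sB x) ∧ x = D.low (D.backEdge (D.sB x))) ∨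
        ∃ y ∈ D.xs (D.sB x), D.par y = x ∧ e = D.parEdge y) := by
  obtain ⟨h1, hc⟩ := D.sB_mem x hx hx1
  have hxm := (D.mem_xs _ x h1 hc).2 ⟨hx, hx1, rfl⟩
  rcases (D.trail _ h1 hc).pred hxm with h | ⟨y, hy, h⟩
  · refine ⟨_, D.mem_edges.2 (.inl rfl), D.backEdge_ne h1 hc hx hx1, ?_, .inl ⟨rfl, h⟩⟩
    have := (D.back_link h1 hc).inc_right
    rwa [← h] at this
  · obtain ⟨hy', hy1⟩ := D.mem_xs_range h1 hc hy
    have ht := D.tree y hy'.1 hy'.2 hy1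
    refine ⟨_, D.mem_edges.2 (.inr ⟨y, hy, rfl⟩), fun he => ?_, ?_, .inr ⟨y, hy, h, rfl⟩⟩
    · have := D.parEdge_inj hy' hy1 hx hx1 he
      have h' := ht.2.2.1
      rw [h, this] at h'
      omega
    · have := ht.2.2.2.inc_right
      rwa [h] at this

/-- The edge by which the chain `c` enters its target. -/
theorem exists_endEdge {c : ℕ} (h1 : 1 ≤ c) (hc : c ≤ D.N) :
    ∃ e ∈ D.edges c, G.Inc e (D.tgt c) ∧ (e = D.backEdge c → D.xs c = []) := by
  rcases (D.trail c h1 hc).pred_end with ⟨h', h⟩ | ⟨y, hy, h⟩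
  · refine ⟨_, D.mem_edges.2 (.inl rfl), ?_, fun _ => h'⟩
    have := (D.back_link h1 hc).inc_right
    rwa [h] at this
  · obtain ⟨hy', hy1⟩ := D.mem_xs_range h1 hc hy
    refine ⟨_, D.mem_edges.2 (.inr ⟨y, hy, rfl⟩), ?_,
      fun he => absurd he.symm (D.backEdge_ne h1 hc hy' hy1)⟩
    have := (D.tree y hy'.1 hy'.2 hy1).2.2.2.inc_right
    rwa [h] at this

namespace Labels

variable {D} {A : List ℕ} {st : ℕ → ℕ}

theorem cov (hst : D.Labels A st) {x : ℕ} (hx : 1 ≤ x ∧ x ≤ n) (h : st x ≠ 0) : D.sB x ∈ A :=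
  not_not.1 (mt (hst.zero x hx).2 h)

theorem one_or_two (hst : D.Labels A st) {x : ℕ} (hx : 1 ≤ x ∧ x ≤ n) (h : D.sB x ∈ A) :
    st x = 1 ∨ st x = 2 := by
  have := hst.le x hx
  have := mt (hst.zero x hx).1 (not_not.2 h)
  omega

theorem src_two (hst : D.Labels A st) (hA : D.Closed A) {c : ℕ} (hc : c ∈ A) :
    st (D.src c) = 2 := by
  obtain ⟨h1, hN⟩ := hA.range c hc
  exact (hst.two _ (D.src_mem h1 hN)).2
    (.inr ⟨hA.cov_src h1 hN (hA.parent c hc), c, hc, .inl rfl⟩)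

theorem tgt_two (hst : D.Labels A st) (hA : D.Closed A) {c : ℕ} (hc : c ∈ A) :
    st (D.tgt c) = 2 := by
  obtain ⟨h1, hN⟩ := hA.range c hc
  exact (hst.two _ (D.tgt_mem c h1 hN)).2 (.inr ⟨hA.parent c hc, c, hc, .inr rfl⟩)

/-- An edge of the union at a non-branch vertex `x` lies on the chain `sB x`. -/
theorem inc_one (hst : D.Labels A st) (hA : D.Closed A) {x e : ℕ} (hx : 1 ≤ x ∧ x ≤ n)
    (h : st x = 1) (he : e ∈ D.union A) (hi : G.Inc e x) :
    e = D.parEdge x ∨ (e = D.backEdge (D.sB x) ∧ x = D.low (D.backEdge (D.sB x))) ∨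
      ∃ y ∈ D.xs (D.sB x), D.par y = x ∧ e = D.parEdge y := by
  obtain ⟨c, hc, he⟩ := he
  obtain ⟨h1, hN⟩ := hA.range c hc
  rcases D.mem_edges.1 he with rfl | ⟨y, hy, rfl⟩
  · rcases D.inc_backEdge h1 hN hi with rfl | hl
    · rw [hst.src_two hA hc] at h; omega
    · rcases D.low_cases h1 hN with h' | ⟨-, h'⟩
      · rw [← hl] at h'
        rw [((D.mem_xs _ _ h1 hN).1 h').2.2]
        exact .inr (.inl ⟨rfl, hl⟩)
      · rw [hl, h', hst.tgt_two hA hc] at h; omega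
  · obtain ⟨hy', hy1⟩ := D.mem_xs_range h1 hN hy
    rcases D.inc_parEdge hy' hy1 hi with rfl | hl
    · exact .inl rfl
    · rcases (D.trail c h1 hN).next_mem hy with h' | h'
      · rw [← hl] at h'
        rw [((D.mem_xs _ _ h1 hN).1 h').2.2]
        exact .inr (.inr ⟨y, hy, hl.symm, rfl⟩)
      · rw [hl, h', hst.tgt_two hA hc] at h; omega

theorem ne_one (hst : D.Labels A st) {x : ℕ} (hx : 1 ≤ x ∧ x ≤ n) (h : st x ≠ 2) : x ≠ 1 :=
  fun h1 => h ((hst.two x hx).2 (.inl h1))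

/-- The union has only one edge that enters a non-branch vertex from below. -/
theorem inEdge_unique (hst : D.Labels A st) (hA : D.Closed A) {x e e' : ℕ} (hx : 1 ≤ x ∧ x ≤ n)
    (h : st x = 1) (he : e ∈ D.union A) (hi : G.Inc e x) (hne : e ≠ D.parEdge x)
    (he' : e' ∈ D.union A) (hi' : G.Inc e' x) (hne' : e' ≠ D.parEdge x) : e = e' := by
  have hx1 := hst.ne_one hx (by omega)
  obtain ⟨h1, hN⟩ := D.sB_mem x hx hx1
  have ht := D.trail _ h1 hN
  have hr := fun y => D.mem_xs_range (x := y) h1 hN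
  obtain ⟨hnd, hnt⟩ := D.trail_nodup ht hr
  obtain ⟨hn₁, hn₂⟩ := ht.next_inj hnd hnt
  rcases (hst.inc_one hA hx h he hi).resolve_left hne with ⟨h₁, h₂⟩ | ⟨y, hy, hyx, rfl⟩ <;>
    rcases (hst.inc_one hA hx h he' hi').resolve_left hne' with ⟨h₃, h₄⟩ | ⟨z, hz, hzx, rfl⟩
  · rw [h₁, h₃]
  · exact absurd (hzx.trans h₂) (hn₁ z hz)
  · exact absurd (hyx.trans h₄) (hn₁ y hy)
  · rw [hn₂ y hy z hz (hyx.trans hzx.symm)]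

/-- The two edges are the parent edge and the unique edge of the union that enters from below. -/
theorem nonBranch (hst : D.Labels A st) (hA : D.Closed A) {x : ℕ} (hx : 1 ≤ x ∧ x ≤ n)
    (h : st x = 1) : Mader.IsNonBranch G (D.union A) x := by
  have hx1 := hst.ne_one hx (by omega)
  have hcov := hst.cov hx (by omega)
  obtain ⟨e, he, hne, hi, -⟩ := D.exists_inEdge hx hx1
  have hp := hA.parEdge_mem hx hx1 hcov
  have : {e' | e' ∈ D.union A ∧ G.Inc e' x} = {e, D.parEdge x} := by
    ext e'
    simp only [Set.mem_ofPred_eq, Set.mem_insert_iff, Set.mem_singleton_iff]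
    constructor
    · rintro ⟨h₁, h₂⟩
      by_cases hp' : e' = D.parEdge x
      · exact .inr hp'
      · exact .inl (hst.inEdge_unique hA hx h h₁ h₂ hp' ⟨_, hcov, he⟩ hi hne)
    · rintro (rfl | rfl)
      · exact ⟨⟨_, hcov, he⟩, hi⟩
      · exact ⟨hp, (D.tree x hx.1 hx.2 hx1).2.2.2.inc_left⟩
  rw [Mader.IsNonBranch, Mader.degree, this, Set.ncard_pair hne]

end Labels

theorem union_subset {A : List ℕ} (hA : D.Closed A) : D.union A ⊆ G.edgeSet := by
  rintro e ⟨c, hc, he⟩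
  obtain ⟨h1, hN⟩ := hA.range c hc
  rcases D.mem_edges.1 he with rfl | ⟨y, hy, rfl⟩
  · exact (D.back_link h1 hN).edge_mem
  · obtain ⟨hy', hy1⟩ := D.mem_xs_range h1 hN hy
    exact (D.tree y hy'.1 hy'.2 hy1).2.2.2.edge_mem

theorem three_le_degree {m : ℕ} (hm : G.edgeSet = Set.Icc 1 m) {F : Set ℕ} {v e₁ e₂ e₃ : ℕ}
    (h₁ : e₁ ∈ F ∧ G.Inc e₁ v) (h₂ : e₂ ∈ F ∧ G.Inc e₂ v) (h₃ : e₃ ∈ F ∧ G.Inc e₃ v)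
    (h₁₂ : e₁ ≠ e₂) (h₁₃ : e₁ ≠ e₃) (h₂₃ : e₂ ≠ e₃) : 3 ≤ Mader.degree G F v := by
  have hf : {e | e ∈ F ∧ G.Inc e v}.Finite :=
    (Set.finite_Icc 1 m).subset fun e he => hm ▸ he.2.edge_mem
  have : ({e₁, e₂, e₃} : Finset ℕ).card = 3 := by
    rw [Finset.card_eq_three]; exact ⟨e₁, e₂, e₃, h₁₂, h₁₃, h₂₃, rfl⟩
  rw [← this, Mader.degree, ← Set.ncard_coe_finset]
  refine Set.ncard_le_ncard ?_ hf
  intro e he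
  simp only [Finset.coe_insert, Finset.coe_singleton, Set.mem_insert_iff,
    Set.mem_singleton_iff] at he
  rcases he with rfl | rfl | rfl <;> assumption

/-- At the root the three edges are both ends of the first chain and the back edge of the second
one. At another branch vertex they are the edges by which its own chain enters and leaves it, and an
end edge of a different chain. -/
theorem Labels.branch {D : ChainDec G n} {A : List ℕ} {st : ℕ → ℕ} {m : ℕ}
    (hst : D.Labels A st) (hA : D.Closed A) (hm : G.edgeSet = Set.Icc 1 m) (h2 : 2 ∈ A)
    (hs1 : D.src 1 = 1) (hs2 : D.src 2 = 1) {x : ℕ}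
    (hx : 1 ≤ x ∧ x ≤ n) (h : st x = 2) : Mader.IsBranch G (D.union A) x := by
  by_cases hx1 : x = 1
  · subst hx1
    obtain ⟨h11, h1N⟩ := hA.range 1 hA.one
    obtain ⟨h21, h2N⟩ := hA.range 2 h2
    obtain ⟨e, he, hi, hb⟩ := D.exists_endEdge h11 h1N
    rw [D.tgt_first h1N rfl] at hi
    have i1 := (D.back_link h11 h1N).inc_left
    have i2 := (D.back_link h21 h2N).inc_left
    rw [hs1] at i1
    rw [hs2] at i2
    refine three_le_degree hm (e₁ := e) (e₂ := D.backEdge 1) (e₃ := D.backEdge 2)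
      ⟨⟨1, hA.one, he⟩, hi⟩
      ⟨⟨1, hA.one, D.mem_edges.2 (.inl rfl)⟩, i1⟩ ⟨⟨2, h2, D.mem_edges.2 (.inl rfl)⟩, i2⟩ ?_ ?_ ?_
    · intro h'
      have ht := D.trail 1 h11 h1N
      rw [hb h', D.tgt_first h1N rfl] at ht
      exact D.low_ne_one (D.back_mem 1 h11 h1N) ht
    · rintro rfl
      exact absurd (D.edges_disjoint h11 h1N h21 h2N he (D.mem_edges.2 (.inl rfl))) (by decide)
    · intro h'
      exact absurd (D.back_inj _ _ h11 h1N h21 h2N h') (by decide)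
  · obtain ⟨hcov, c, hc, hcx⟩ := ((hst.two x hx).1 h).resolve_left hx1
    obtain ⟨h1, hN⟩ := hA.range c hc
    obtain ⟨b1, bN⟩ := hA.range _ hcov
    have hxm := (D.mem_xs _ x b1 bN).2 ⟨hx, hx1, rfl⟩
    have hpe : D.parEdge x ∈ D.edges (D.sB x) := D.mem_edges.2 (.inr ⟨x, hxm, rfl⟩)
    have hne : c ≠ D.sB x := by
      intro h'
      rw [← h'] at hxm
      rcases hcx with h' | h'
      · exact D.src_notMem h1 hN (by rwa [h'])
      · exact D.tgt_notMem h1 hN (by rwa [h'])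
    obtain ⟨e, he, hi⟩ : ∃ e ∈ D.edges c, G.Inc e x := by
      rcases hcx with rfl | rfl
      · exact ⟨_, D.mem_edges.2 (.inl rfl), (D.back_link h1 hN).inc_left⟩
      · obtain ⟨e, he, hi, -⟩ := D.exists_endEdge h1 hN
        exact ⟨e, he, hi⟩
    obtain ⟨e', he', hne', hi', -⟩ := D.exists_inEdge hx hx1
    refine three_le_degree hm (e₁ := e) (e₂ := D.parEdge x) (e₃ := e') ⟨⟨c, hc, he⟩, hi⟩
      ⟨⟨_, hcov, hpe⟩, (D.tree x hx.1 hx.2 hx1).2.2.2.inc_left⟩ ⟨⟨_, hcov, he'⟩, hi'⟩ ?_ ?_ hne'.symm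
    · rintro rfl; exact hne (D.edges_disjoint h1 hN b1 bN he hpe)
    · rintro rfl; exact hne (D.edges_disjoint h1 hN b1 bN he he')

/-! ### Links, Mader paths and the initial subdivision -/

/-- The links of the union of the chains in `A`: the link `L` has the inner vertices `lk L`, listed
upwards, and the lowest edge `le L`. -/
structure Links (A : List ℕ) (st lo : ℕ → ℕ) (nL : ℕ) (lk : ℕ → List ℕ) (le : ℕ → ℕ) : Prop where
  mem : ∀ L x, x ∈ lk L ↔ (1 ≤ x ∧ x ≤ n) ∧ st x = 1 ∧ lo x = L
  bound : ∀ x, 1 ≤ x ∧ x ≤ n → st x = 1 → 1 ≤ lo x ∧ lo x ≤ nL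
  one : st 1 = 2
  cov : ∀ x, 1 ≤ x ∧ x ≤ n → st x ≠ 0 → D.sB x ∈ A
  link : ∀ L, 1 ≤ L → L ≤ nL → ∃ u h t, Trail D.par h (lk L) t ∧ (1 ≤ t ∧ t ≤ n) ∧ st t = 2 ∧
    G.IsLink (le L) u h ∧ st u = 2 ∧ le L ∈ D.union A ∧
    ((∃ c ∈ A, le L = D.backEdge c) ∨ ∃ y, (1 ≤ y ∧ y ≤ n) ∧ y ≠ 1 ∧ st y = 2 ∧ le L = D.parEdge y)

namespace Links

variable {D} {A : List ℕ} {st lo : ℕ → ℕ} {nL : ℕ} {lk : ℕ → List ℕ} {le : ℕ → ℕ}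

theorem mem_range (hL : D.Links A st lo nL lk le) {L x : ℕ} (hx : x ∈ lk L) :
    (1 ≤ x ∧ x ≤ n) ∧ x ≠ 1 := by
  obtain ⟨h₁, h₂, -⟩ := (hL.mem L x).1 hx
  refine ⟨h₁, ?_⟩
  rintro rfl
  rw [hL.one] at h₂; omega

/-- The first edge of a link is a back edge or the parent edge of a branch vertex, whereas inner
vertices of links are non-branch. -/
theorem first_ne (hL : D.Links A st lo nL lk le) (hA : D.Closed A) {L L' x : ℕ} (h1 : 1 ≤ L)
    (hn : L ≤ nL) (hx : x ∈ lk L') : le L ≠ D.parEdge x := by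
  obtain ⟨u, h, t, -, -, -, -, -, -, hc⟩ := hL.link L h1 hn
  obtain ⟨hx', hx1⟩ := hL.mem_range hx
  rcases hc with ⟨c, hc, he⟩ | ⟨y, hy, hy1, hy2, he⟩
  · rw [he]
    exact D.backEdge_ne (hA.range c hc).1 (hA.range c hc).2 hx' hx1
  · rw [he]
    intro h'
    rw [D.parEdge_inj hy hy1 hx' hx1 h', ((hL.mem _ _).1 hx).2.1] at hy2
    omega

theorem isLinkOf (hL : D.Links A st lo nL lk le) (hA : D.Closed A) (hst : D.Labels A st) {m : ℕ}
    (hm : G.edgeSet = Set.Icc 1 m) (h2 : 2 ∈ A) (hs1 : D.src 1 = 1) (hs2 : D.src 2 = 1) {L : ℕ}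
    (h1 : 1 ≤ L) (hn : L ≤ nL) :
    Mader.IsLinkOf G (D.union A) (edgeList D.parEdge (le L) (lk L)) (lk L) := by
  obtain ⟨u, h, t, ht, htr, ht2, he, hu2, hmem, hc⟩ := hL.link L h1 hn
  have hone : ∀ x ∈ lk L, st x = 1 := fun x hx => ((hL.mem L x).1 hx).2.1
  refine ⟨u, t, D.path_of_trail ht (fun x => hL.mem_range) he
    (fun h' => by rw [hone u h'] at hu2; omega)
    (fun x hx => hL.first_ne hA h1 hn hx), ?_, ?_, hst.branch hA hm h2 hs1 hs2 (D.mem_range he) hu2,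
    hst.branch hA hm h2 hs1 hs2 htr ht2⟩
  · intro e he'
    simp only [edgeList, List.mem_cons, List.mem_map] at he'
    rcases he' with rfl | ⟨x, hx, rfl⟩
    · exact hmem
    · obtain ⟨hx', hx1⟩ := hL.mem_range hx
      exact hA.parEdge_mem hx' hx1 (hst.cov hx' (by rw [hone x hx]; simp))
  · exact fun x hx => hst.nonBranch hA (hL.mem_range hx).1 (hone x hx)

/-- A chain whose parent has been added is a Mader path, unless both endpoints are inner vertices of
the same link. -/
theorem isMaderPath (hL : D.Links A st lo nL lk le) (hA : D.Closed A) (hst : D.Labels A st) {m : ℕ}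
    (hm : G.edgeSet = Set.Icc 1 m) (h2 : 2 ∈ A) (hs1 : D.src 1 = 1) (hs2 : D.src 2 = 1) {c : ℕ}
    (h1 : 1 ≤ c) (hN : c ≤ D.N) (hc : c ∉ A) (hp : D.sB (D.tgt c) ∈ A)
    (hne : ¬ (st (D.src c) = 1 ∧ st (D.tgt c) = 1 ∧ lo (D.src c) = lo (D.tgt c))) :
    Mader.IsMaderPath G (D.union A) (D.edges c) := by
  have hs := D.src_mem h1 hN
  have ht := D.tgt_mem c h1 hN
  refine ⟨_, _, _, D.path h1 hN, ?_, ?_, ?_⟩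
  · rintro e he ⟨c', hc', he'⟩
    rw [D.edges_disjoint h1 hN (hA.range c' hc').1 (hA.range c' hc').2 he he'] at hc
    exact hc hc'
  · intro x hx e he hi
    have := hA.cov_of_inc he hi
    rw [((D.mem_xs c x h1 hN).1 hx).2.2] at this
    exact hc this
  · rcases hst.one_or_two hs (hA.cov_src h1 hN hp) with h | h <;>
      rcases hst.one_or_two ht hp with h' | h'
    · refine .inr (.inr (.inr ⟨hst.nonBranch hA hs h, hst.nonBranch hA ht h', ?_⟩))
      have hb := hL.bound _ hs h
      have hb' := hL.bound _ ht h'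
      have hms : D.src c ∈ lk (lo (D.src c)) := (hL.mem _ _).2 ⟨hs, h, rfl⟩
      have hmt : D.tgt c ∈ lk (lo (D.tgt c)) := (hL.mem _ _).2 ⟨ht, h', rfl⟩
      refine ⟨_, _, _, _, hL.isLinkOf hA hst hm h2 hs1 hs2 hb.1 hb.2,
        hL.isLinkOf hA hst hm h2 hs1 hs2 hb'.1 hb'.2, hms, hmt, fun heq => ?_⟩
      -- The parent edge of the source witnesses that the links are distinct. It lies on the link of
      -- the source, and if it lay on the link of the target, the source would be an inner vertex of
      -- that link as well.
      have : D.parEdge (D.src c) ∈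
          {e | e ∈ edgeList D.parEdge (le (lo (D.src c))) (lk (lo (D.src c)))} := by
        simpa [edgeList] using .inr ⟨_, hms, rfl⟩
      rw [heq] at this
      simp only [edgeList, List.mem_cons, List.mem_map, Set.mem_ofPred_eq] at this
      rcases this with h'' | ⟨y, hy, h''⟩
      · exact hL.first_ne hA hb'.1 hb'.2 hms h''.symm
      · obtain ⟨hy', hy1⟩ := hL.mem_range hy
        rw [D.parEdge_inj hy' hy1 hs (hL.mem_range hms).2 h''] at hy
        exact hne ⟨h, h', ((hL.mem _ _).1 hy).2.2⟩
    · exact .inr (.inr (.inl ⟨hst.nonBranch hA hs h, hst.branch hA hm h2 hs1 hs2 ht h'⟩))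
    · exact .inr (.inl ⟨hst.branch hA hm h2 hs1 hs2 hs h, hst.nonBranch hA ht h'⟩)
    · exact .inl ⟨hst.branch hA hm h2 hs1 hs2 hs h, hst.branch hA hm h2 hs1 hs2 ht h'⟩

end Links

/-- The first two chains form a subdivision of the triple edge. -/
theorem triple (h2 : 2 ≤ D.N) (hs1 : D.src 1 = 1) (hs2 : D.src 2 = 1) (ht2 : D.tgt 2 ≠ 1) :
    Mader.IsTripleEdgeSubdivision G {e | e ∈ D.edges 1 ++ D.edges 2} := by
  have h1 : 1 ≤ D.N := by omega
  have htr := D.tgt_mem 2 (by omega) h2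
  have hsb : D.sB (D.tgt 2) = 1 := by
    have := (D.tgt_lt 2 (by omega) h2).resolve_left ht2
    have := (D.sB_mem _ htr ht2).1
    omega
  have hb : D.tgt 2 ∈ D.xs 1 := (D.mem_xs 1 _ le_rfl h1).2 ⟨htr, ht2, hsb⟩
  -- The target of the second chain cuts the cycle formed by the first one into two paths: the back
  -- edge followed by `p`, and `q` read backwards from the root. The second chain is the third path.
  obtain ⟨p, q, hpq⟩ := List.append_of_mem hb
  have ht := D.trail 1 le_rfl h1
  have hr : ∀ x ∈ D.xs 1, (1 ≤ x ∧ x ≤ n) ∧ x ≠ 1 := fun _ => D.mem_xs_range le_rfl h1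
  have hnd := (D.trail_nodup ht hr).1
  have hp₁ := D.path le_rfl h1
  have hp₂ := D.path (by omega) h2
  rw [hs1, D.tgt_first h1 rfl] at hp₁
  rw [hs2] at hp₂
  rw [hpq] at ht hr hnd
  obtain ⟨y, hty, rfl, htq⟩ := Trail.append_iff.1 ht
  rw [D.tgt_first h1 rfl] at htq
  have hl1 := D.back_link le_rfl h1
  rw [hs1] at hl1
  have hr1 : ∀ x ∈ p, (1 ≤ x ∧ x ≤ n) ∧ x ≠ 1 := fun x hx => hr x (by simp [hx])
  have hr2 : ∀ x ∈ q, (1 ≤ x ∧ x ≤ n) ∧ x ≠ 1 := fun x hx => hr x (by simp [hx])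
  have q₁ := D.path_of_trail hty hr1 hl1 (fun h => (hr1 1 h).2 rfl)
    (fun x hx => D.backEdge_ne le_rfl h1 (hr1 x hx).1 (hr1 x hx).2)
  simp only [List.nodup_append, List.nodup_cons, List.mem_cons] at hnd
  obtain ⟨-, ⟨hbq, -⟩, hdis⟩ := hnd
  have hpb := fun x hx => D.parEdge_inj (x := x) (y := D.tgt 2) (hr2 x hx).1 (hr2 x hx).2 htr ht2
  have q₂ := D.path_of_trail htq hr2 (D.tree _ htr.1 htr.2 ht2).2.2.2 hbq fun x hx h => by
    exact hbq (hpb x hx h.symm ▸ hx)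
  have hd : ∀ e, e ∈ D.edges 1 → e ∉ D.edges 2 := fun e he he' =>
    absurd (D.edges_disjoint le_rfl h1 (by omega) h2 he he') (by decide)
  have hdx : ∀ x, x ∈ D.xs 1 → x ∉ D.xs 2 := fun x hx hx' => by
    have a := ((D.mem_xs 1 x le_rfl h1).1 hx).2.2
    have b := ((D.mem_xs 2 x (by omega) h2).1 hx').2.2
    omega
  have he1 : ∀ e, e ∈ D.edges 1 ↔
      e ∈ edgeList D.parEdge (D.backEdge 1) p ∨ e ∈ edgeList D.parEdge (D.parEdge (D.tgt 2)) q := by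
    intro e
    simp only [edges, hpq, edgeList, List.map_append, List.map_cons, List.mem_append, List.mem_cons]
    tauto
  refine ⟨1, D.tgt 2, _, _, _, _, _, _, fun h => ht2 h.symm, q₁, q₂.reverse, hp₂, ?_, ?_, ?_, ?_, ?_,
    ?_, ?_⟩
  · intro e he he'
    simp only [List.mem_reverse, edgeList, List.mem_cons, List.mem_map] at he he'
    rcases he with rfl | ⟨x, hx, rfl⟩ <;> rcases he' with h | ⟨z, hz, h⟩
    · exact D.backEdge_ne le_rfl h1 htr ht2 h
    · exact D.backEdge_ne le_rfl h1 (hr2 z hz).1 (hr2 z hz).2 h.symm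
    · exact hdis x hx (D.tgt 2) (.inl rfl)
        (D.parEdge_inj (hr1 x hx).1 (hr1 x hx).2 htr ht2 h)
    · exact hdis x hx z (.inr hz)
        (D.parEdge_inj (hr1 x hx).1 (hr1 x hx).2 (hr2 z hz).1 (hr2 z hz).2 h.symm)
  · exact fun e he => hd e ((he1 e).2 (.inl he))
  · exact fun e he => hd e ((he1 e).2 (.inr (List.mem_reverse.1 he)))
  · exact fun x hx hx' => hdis x hx x (.inr (List.mem_reverse.1 hx')) rfl
  · exact fun x hx => hdx x (by rw [hpq]; simp [hx])
  · exact fun x hx => hdx x (by rw [hpq]; simp [List.mem_reverse.1 hx])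
  · ext e
    simp only [List.mem_append, Set.mem_ofPred_eq, List.mem_reverse, he1]
    exact or_assoc

/-- By counting, `A` contains all chains. Every tree edge lies on the chain of its lower endpoint
and every back edge starts a chain. -/
theorem union_all {A : List ℕ} (hA : D.Closed A) (hlen : A.length = D.N) (hloop : G.Loopless) :
    D.union A = G.edgeSet := by
  have hall : ∀ c, 1 ≤ c → c ≤ D.N → c ∈ A := by
    have hs : A.toFinset ⊆ Finset.Icc 1 D.N := fun c hc => by
      simpa using hA.range c (by simpa using hc)
    have := Finset.eq_of_subset_of_card_le hs (by
      rw [List.toFinset_card_of_nodup hA.nodup, hlen]; simp)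
    intro c h1 hN
    rw [← List.mem_toFinset, this]
    simp [h1, hN]
  refine (D.union_subset hA).antisymm fun e he => ?_
  obtain ⟨x, y, hl⟩ := G.exists_isLink_of_mem_edgeSet he
  have key : ∀ x, (1 ≤ x ∧ x ≤ n) → x ≠ 1 → D.parEdge x ∈ D.union A := fun x hx hx1 =>
    hA.parEdge_mem hx hx1 (hall _ (D.sB_mem x hx hx1).1 (D.sB_mem x hx hx1).2)
  have key' : ∀ y, e ∈ D.bk y → e ∈ D.union A := by
    intro y hy
    obtain ⟨c, h1, hN, rfl⟩ := D.back_surj y e hy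
    exact ⟨c, hall c h1 hN, D.mem_edges.2 (.inl rfl)⟩
  rcases D.edge_cases hl hl.ne with ⟨rfl, h, -⟩ | ⟨rfl, h, -⟩ | ⟨h, -⟩ | ⟨h, -⟩
  · exact key _ (D.mem_range hl) h
  · exact key _ (D.mem_range hl.symm) h
  · exact key' _ h
  · exact key' _ h

end ChainDec

/-! ### Cuts of two edges -/

namespace Mader

/-- The edges that leave a proper subset of the vertices form a cut. -/
theorem isEdgeCut_of_leaving {α β : Type*} {G : Graph α β} {S : Set α} {X : Set β} {x y : α}
    (hX : X ⊆ G.edgeSet) (hx : x ∈ G.vertexSet) (hy : y ∈ G.vertexSet) (hxS : x ∈ S) (hyS : y ∉ S)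
    (h : ∀ e u v, G.IsLink e u v → u ∈ S → v ∉ S → e ∈ X) : IsEdgeCut G X := by
  refine ⟨hX, fun hc => ?_⟩
  obtain ⟨e, u, v, he, hu, hv⟩ := hc.exists_isLink (S := S) (by simpa using hx) (by simpa using hy)
    hxS hyS
  simp only [Graph.deleteEdges_isLink] at he
  exact he.2 (h e u v he.1 hu hv)

end Mader

namespace ChainDec

variable {G : Graph ℕ ℕ} {n : ℕ} {D : ChainDec G n}

/-- The vertices of the link `L` and the vertices that hang off it by chains outside `A`. -/
inductive Hangs (D : ChainDec G n) (A : List ℕ) (st lo : ℕ → ℕ) (L : ℕ) : ℕ → Prop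
  | inner {x} : st x = 1 → lo x = L → Hangs D A st lo L x
  | chain {x} : st x = 0 → D.sB x ∉ A → Hangs D A st lo L (D.tgt (D.sB x)) → Hangs D A st lo L x

variable {A : List ℕ} {st lo : ℕ → ℕ} {nL : ℕ} {lk : ℕ → List ℕ} {le : ℕ → ℕ} {L : ℕ}

theorem hangs_cov {x : ℕ} (h : st x ≠ 0) : Hangs D A st lo L x ↔ st x = 1 ∧ lo x = L := by
  constructor
  · rintro (⟨h₁, h₂⟩ | ⟨h₁, -, -⟩)
    · exact ⟨h₁, h₂⟩
    · exact absurd h₁ h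
  · exact fun h => .inner h.1 h.2

theorem hangs_iff (hst : D.Labels A st) {c x : ℕ} (h1 : 1 ≤ c) (hN : c ≤ D.N) (hc : c ∉ A)
    (hx : x ∈ D.xs c) : Hangs D A st lo L x ↔ Hangs D A st lo L (D.tgt c) := by
  obtain ⟨hx', hx1, rfl⟩ := (D.mem_xs c x h1 hN).1 hx
  have h0 := (hst.zero x hx').2 hc
  constructor
  · rintro (⟨h₁, h₂⟩ | ⟨-, -, h⟩)
    · omega
    · exact h
  · exact .chain h0 hc

namespace Links

/-- A vertex between two inner vertices of a link belongs to the link. -/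
theorem between (hL : D.Links A st lo nL lk le) (h1 : 1 ≤ L) (hn : L ≤ nL) {x y z : ℕ}
    (hx : x ∈ lk L) (hy : y ∈ lk L) (hz : z ∈ D.anc x) (hyz : D.num y ≤ D.num z) : z ∈ lk L := by
  obtain ⟨u, h, t, ht, -⟩ := hL.link L h1 hn
  have hlt := (D.trail_pairwise ht fun x => hL.mem_range).2
  have hxr := (hL.mem_range hx).1
  refine D.anc_induction hxr hz (p := fun w => w ∈ lk L) hx fun w hw hw1 hzw hne hwl => ?_
  rcases ht.next_mem hwl with h' | h'
  · exact h'
  · have h₁ := hlt y hy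
    have h₂ := D.num_le_of_mem_anc (D.par_mem hw hw1) (D.mem_anc_par hw hzw hne)
    rw [h'] at h₂
    omega

variable (hL : D.Links A st lo nL lk le) (hA : D.Closed A) (hst : D.Labels A st)
  (hdone : ∀ c, 1 ≤ c → c ≤ D.N → c ∉ A → D.sB (D.tgt c) ∈ A →
    st (D.src c) = 1 ∧ st (D.tgt c) = 1 ∧ lo (D.src c) = lo (D.tgt c))

include hL hA hst hdone in
-- No edge of a missing chain can leave the set of hanging vertices, because everything on the tree
-- path from source to target behaves like the target. If the parent is present, `hdone` puts source
-- and target on one link, and so is everything between them. If the parent is missing, the target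
-- behaves like the target of the parent, and `z` either lies on the parent or above the parent's
-- target. In the latter case induction applies, since chains are constructed in depth-first order
-- of their sources: the parent's source has a number at most that of the source of `c`.
theorem hangs_anc {c : ℕ} (h1 : 1 ≤ c) (hN : c ≤ D.N) (hc : c ∉ A) :
    ∀ z ∈ D.anc (D.tgt c), D.num (D.src c) ≤ D.num z →
      (Hangs D A st lo L z ↔ Hangs D A st lo L (D.tgt c)) := by
  induction c using Nat.strong_induction_on with
  | _ c ih =>
    intro z hz hnum
    have ht := D.tgt_mem c h1 hN
    have hs := D.src_mem h1 hN
    by_cases hp : D.sB (D.tgt c) ∈ A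
    · obtain ⟨h₁, h₂, h₃⟩ := hdone c h1 hN hc hp
      have hb := hL.bound _ ht h₂
      have hz' := hL.between hb.1 hb.2 ((hL.mem _ _).2 ⟨ht, h₂, rfl⟩)
        ((hL.mem _ _).2 ⟨hs, h₁, h₃⟩) hz hnum
      obtain ⟨-, h₄, h₅⟩ := (hL.mem _ _).1 hz'
      rw [hangs_cov (by omega), hangs_cov (by omega), h₂, h₄, h₅]
    · have ht1 : D.tgt c ≠ 1 := by
        intro h; rw [h, D.sB_one] at hp; exact hp hA.one
      have hlt := (D.tgt_lt c h1 hN).resolve_left ht1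
      obtain ⟨h1', hN'⟩ := D.sB_mem _ ht ht1
      have hm := (D.mem_xs _ _ h1' hN').2 ⟨ht, ht1, rfl⟩
      rw [hangs_iff hst h1' hN' hp hm]
      by_cases hzm : z ∈ D.xs (D.sB (D.tgt c))
      · exact hangs_iff hst h1' hN' hp hzm
      · refine ih _ hlt h1' hN' hp z ?_
          ((D.src_mono _ _ h1' hlt hN).trans hnum)
        have htr := D.trail _ h1' hN'
        obtain ⟨p, q, hpq⟩ := List.append_of_mem hm
        rw [hpq] at htr
        obtain ⟨y, -, rfl, hq⟩ := Trail.append_iff.1 htr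
        refine D.anc_of_trail (h := D.tgt c) (l := D.tgt c :: q) ⟨rfl, hq⟩
          (fun x hx => D.mem_xs_range h1' hN' (by rw [hpq]; exact List.mem_append_right _ hx)) hz ?_
        intro h
        exact hzm (by rw [hpq]; exact List.mem_append_right _ h)

include hL hA hst in
/-- An edge of the union that enters an inner vertex of a link from below belongs to the link. -/
theorem inEdge (h1 : 1 ≤ L) (hn : L ≤ nL) {x e : ℕ} (hx : x ∈ lk L) (he : e ∈ D.union A)
    (hi : G.Inc e x) (hne : e ≠ D.parEdge x) : e = le L ∨ ∃ y ∈ lk L, e = D.parEdge y := by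
  obtain ⟨u, h, t, ht, htr, ht2, hl, hu2, hmem, -⟩ := hL.link L h1 hn
  obtain ⟨hx', hx1⟩ := hL.mem_range hx
  have hx₁ := ((hL.mem L x).1 hx).2.1
  rcases ht.pred hx with rfl | ⟨y, hy, rfl⟩
  · exact .inl (hst.inEdge_unique hA hx' hx₁ he hi hne hmem hl.inc_right (hL.first_ne hA h1 hn hx))
  · obtain ⟨hy', hy1⟩ := hL.mem_range hy
    have htree := D.tree y hy'.1 hy'.2 hy1
    refine .inr ⟨y, hy, hst.inEdge_unique hA hx' hx₁ he hi hne (hA.parEdge_mem hy' hy1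
      (hst.cov hy' (by rw [((hL.mem L y).1 hy).2.1]; simp))) htree.2.2.2.inc_right fun h' => ?_⟩
    have h'' := D.parEdge_inj hy' hy1 hx' hx1 h'
    have hlt := htree.2.2.1
    rw [← h''] at hlt
    omega

include hL hA hst hdone in
/-- If no further chain can be added, the first and the last edge of a link with an inner vertex
form a cut. -/
theorem isEdgeCut (hV : G.vertexSet = Set.Icc 1 n) (hloop : G.Loopless) (h1 : 1 ≤ L) (hn : L ≤ nL)
    {z : ℕ} {p : List ℕ} (hz : lk L = p ++ [z]) :
    le L ≠ D.parEdge z ∧ Mader.IsEdgeCut G {le L, D.parEdge z} := by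
  have hzL : z ∈ lk L := by simp [hz]
  obtain ⟨hz', hz1⟩ := hL.mem_range hzL
  obtain ⟨u, h, t, ht, htr, ht2, hl, hu2, hmem, -⟩ := hL.link L h1 hn
  refine ⟨hL.first_ne hA h1 hn hzL, ?_⟩
  have hztree := D.tree z hz'.1 hz'.2 hz1
  -- The set separates the inner vertex `z` from the root, which is a branch vertex and so hangs off
  -- no link. It remains to see that any edge other than the two given ones has both or none of its
  -- endpoints in the set.
  refine Mader.isEdgeCut_of_leaving (S := {x | Hangs D A st lo L x}) (x := z) (y := 1) ?_
    (by rw [hV]; exact hz') (by rw [hV]; exact ⟨le_rfl, hz'.1.trans hz'.2⟩)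
    (.inner ((hL.mem L z).1 hzL).2.1 ((hL.mem L z).1 hzL).2.2)
    (fun h => by
      have := (hangs_cov (by rw [hL.one]; simp)).1 h
      rw [hL.one] at this; omega) ?_
  · rintro e (rfl | rfl)
    · exact hl.edge_mem
    · exact hztree.2.2.2.edge_mem
  -- an edge whose endpoints are both covered
  have hcov : ∀ e u v, G.IsLink e u v → (1 ≤ u ∧ u ≤ n) → st u ≠ 0 → e ∈ D.union A →
      Hangs D A st lo L u → e ≠ le L → u ∈ lk L ∧
        (e = D.parEdge u ∨ ∃ y ∈ lk L, e = D.parEdge y) := by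
    intro e u v he hu h0 heA hS hne
    obtain ⟨h₁, h₂⟩ := (hangs_cov h0).1 hS
    have huL := (hL.mem L u).2 ⟨hu, h₁, h₂⟩
    refine ⟨huL, ?_⟩
    by_cases h' : e = D.parEdge u
    · exact .inl h'
    · exact .inr ((hL.inEdge hA hst h1 hn huL heA he.inc_left h').resolve_left hne)
  -- tree edges
  have htree : ∀ x, (1 ≤ x ∧ x ≤ n) → x ≠ 1 → D.parEdge x ≠ le L → D.parEdge x ≠ D.parEdge z →
      (Hangs D A st lo L x ↔ Hangs D A st lo L (D.par x)) := by
    intro x hx hx1 hne₁ hne₂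
    obtain ⟨hb, hbN⟩ := D.sB_mem x hx hx1
    have hxm := (D.mem_xs _ x hb hbN).2 ⟨hx, hx1, rfl⟩
    by_cases hxA : D.sB x ∈ A
    · have hpr := D.par_mem hx hx1
      have h0 := mt (hst.zero x hx).1 (not_not.2 hxA)
      have h0' := mt (hst.zero _ hpr).1 (not_not.2 (hA.cov_par hx hx1 hxA))
      have hlink := (D.tree x hx.1 hx.2 hx1).2.2.2
      have heA := hA.parEdge_mem hx hx1 hxA
      have key : x ∈ lk L → D.par x ∈ lk L := by
        intro hxL
        rw [hz] at ht hxL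
        obtain ⟨w, hw, rfl, -⟩ := Trail.append_iff.1 ht
        rcases List.mem_append.1 hxL with hxp | hxz
        · rw [hz]
          rcases hw.next_mem hxp with h' | h'
          · simp [h']
          · simp [h']
        · rw [List.mem_singleton] at hxz
          exact absurd (by rw [hxz]) hne₂
      have toL : ∀ w, w ∈ lk L → Hangs D A st lo L w := fun w hw =>
        .inner ((hL.mem L w).1 hw).2.1 ((hL.mem L w).1 hw).2.2
      constructor
      · intro h
        exact toL _ (key (hcov _ _ _ hlink hx h0 heA h hne₁).1)
      · intro h
        obtain ⟨hpL, h' | ⟨y, hy, h'⟩⟩ := hcov _ _ _ hlink.symm hpr h0' heA h hne₁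
        · have hp1 := (hL.mem_range hpL).2
          have h'' := D.parEdge_inj hx hx1 hpr hp1 h'
          have hlt := (D.tree x hx.1 hx.2 hx1).2.2.1
          rw [← h''] at hlt; omega
        · rw [D.parEdge_inj hx hx1 (hL.mem_range hy).1 (hL.mem_range hy).2 h']
          exact toL _ hy
    · rw [hangs_iff hst hb hbN hxA hxm]
      rcases (D.trail _ hb hbN).next_mem hxm with h' | h'
      · rw [hangs_iff hst hb hbN hxA h']
      · rw [h']
  -- back edges
  have hback : ∀ y e, e ∈ D.bk y → e ≠ le L →
      (Hangs D A st lo L (D.low e) ↔ Hangs D A st lo L y) := by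
    intro y e he hne
    obtain ⟨c, hc1, hcN, rfl⟩ := D.back_surj y e he
    obtain rfl := D.bk_disjoint he (D.back_mem c hc1 hcN)
    by_cases hcA : c ∈ A
    · have hs2 := hst.src_two hA hcA
      have hlr := D.low_mem he
      have hl0 : st (D.low (D.backEdge c)) ≠ 0 := by
        refine mt (hst.zero _ hlr).1 (not_not.2 ?_)
        exact hA.cov_of_inc ⟨c, hcA, D.mem_edges.2 (.inl rfl)⟩ (D.back_link hc1 hcN).inc_right
      constructor
      · intro h
        obtain ⟨h₁, h' | ⟨y, hy, h'⟩⟩ := hcov _ _ _ (D.back_link hc1 hcN).symm hlr hl0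
          ⟨c, hcA, D.mem_edges.2 (.inl rfl)⟩ h hne
        · exact absurd h' (D.backEdge_ne hc1 hcN hlr (D.low_ne_one he))
        · exact absurd h' (D.backEdge_ne hc1 hcN (hL.mem_range hy).1 (hL.mem_range hy).2)
      · intro h
        have := ((hangs_cov (by omega)).1 h).1
        omega
    -- The source itself is the extreme case of a vertex between source and target.
    · rw [hL.hangs_anc hA hst hdone hc1 hcN hcA _ (D.src_anc c hc1 hcN) le_rfl]
      rcases D.low_cases hc1 hcN with h' | ⟨-, h'⟩
      · exact hangs_iff hst hc1 hcN hcA h'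
      · rw [h']
  intro e x y he hx hy
  simp only [Set.mem_ofPred_eq] at hx hy
  by_contra hne
  simp only [Set.mem_insert_iff, Set.mem_singleton_iff, not_or] at hne
  rcases D.edge_cases he he.ne with ⟨rfl, h1, rfl⟩ | ⟨rfl, h1, rfl⟩ | ⟨h, rfl⟩ | ⟨h, rfl⟩
  · exact hy ((htree x (D.mem_range he) h1 hne.1 hne.2).1 hx)
  · exact hy ((htree y (D.mem_range he.symm) h1 hne.1 hne.2).2 hx)
  · exact hy ((hback _ e h hne.1).1 hx)
  · exact hy ((hback _ e h hne.1).2 hx)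

include hL hA hdone in
-- The missing chain with the smallest number has an added parent, because parents have smaller
-- numbers. By `hdone` its target is an inner vertex of a link.
theorem exists_mem (hlen : A.length ≠ D.N) : ∃ L x, 1 ≤ L ∧ L ≤ nL ∧ x ∈ lk L := by
  have hex : ∃ c, 1 ≤ c ∧ c ≤ D.N ∧ c ∉ A := by
    by_contra! hcon
    apply hlen
    have : A.toFinset = Finset.Icc 1 D.N := by
      ext c
      rw [List.mem_toFinset, Finset.mem_Icc]
      exact ⟨hA.range c, fun h => hcon c h.1 h.2⟩
    rw [← List.toFinset_card_of_nodup hA.nodup, this]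
    simp
  obtain ⟨h1, hN, hc⟩ := Nat.find_spec hex
  have hmin := fun c => Nat.find_min hex (m := c)
  set c := Nat.find hex
  have hp : D.sB (D.tgt c) ∈ A := by
    by_cases ht1 : D.tgt c = 1
    · rw [ht1, D.sB_one]; exact hA.one
    · have hlt := (D.tgt_lt c h1 hN).resolve_left ht1
      by_contra hcon
      exact hmin _ hlt ⟨(D.sB_mem _ (D.tgt_mem c h1 hN) ht1).1, by omega, hcon⟩
  obtain ⟨-, h₂, -⟩ := hdone c h1 hN hc hp
  have hb := hL.bound _ (D.tgt_mem c h1 hN) h₂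
  exact ⟨_, _, hb.1, hb.2, (hL.mem _ _).2 ⟨D.tgt_mem c h1 hN, h₂, rfl⟩⟩

end Links

/-- The tree edge above the vertex numbered `2` is spanned by a back edge whose upper endpoint has a
smaller number, which is the root. Sources are sorted by number, so the first chain starts at the
root. -/
theorem first {m : ℕ} {end1 end2 : ℕ → ℕ} (hG : IsInput G n m end1 end2) (hn : 2 ≤ n) :
    1 ≤ D.N ∧ D.src 1 = 1 := by
  obtain ⟨hv, hv', hv2⟩ := D.vertexAt_mem 2 (by omega) hn
  have h1 : D.vertexAt 2 ≠ 1 := fun h => by rw [h, D.num_one] at hv2; omega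
  obtain ⟨y, e, he, -, hlt⟩ := D.exists_back hG ⟨hv, hv'⟩ h1
  have hy := D.upper_mem he
  have hy1 : y = 1 := by
    by_contra h
    have := D.one_lt_num hy h
    omega
  subst hy1
  obtain ⟨c, hc1, hcN, rfl⟩ := D.back_surj 1 e he
  have hs := D.bk_disjoint he (D.back_mem c hc1 hcN)
  refine ⟨by omega, ?_⟩
  by_contra hne
  have := D.one_lt_num (D.src_mem le_rfl (by omega : 1 ≤ D.N)) hne
  rcases Nat.lt_or_ge 1 c with h | h
  · have := D.src_mono 1 c le_rfl h hcN
    rw [← hs, D.num_one] at this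
    omega
  · obtain rfl : c = 1 := by omega
    exact hne hs.symm

/-- A graph with minimum degree three has a second chain. -/
theorem two_le {m : ℕ} {end1 end2 : ℕ → ℕ} (hG : IsInput G n m end1 end2) (hn : 2 ≤ n)
    (hdeg : ∀ v ∈ G.vertexSet, 3 ≤ Mader.degree G G.edgeSet v) : 2 ≤ D.N := by
  obtain ⟨h1, hs⟩ := D.first hG hn
  by_contra hN
  have hN1 : D.N = 1 := by omega
  have hsB : ∀ x, (1 ≤ x ∧ x ≤ n) → D.sB x = 1 := by
    intro x hx
    by_cases hx1 : x = 1
    · rw [hx1, D.sB_one]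
    · have := D.sB_mem x hx hx1
      omega
  have hA : D.Closed [1] := ⟨by simp [hN1], by simp, by simp, by
    simp [hsB _ (D.tgt_mem 1 le_rfl h1)]⟩
  have ht := D.tgt_first h1 rfl
  have hst : D.Labels [1] (fun x => if x = 1 then 2 else 1) := by
    refine ⟨fun x hx => ?_, fun x hx => ?_, fun x hx => ?_⟩
    · split_ifs <;> simp [hsB x hx]
    · split_ifs with h
      · simp [h]
      · simp [h, hs, ht, Ne.symm h]
    · split_ifs <;> simp
  -- If there were only one chain, the lower endpoint of its back edge would be a non-branch vertex
  -- of the whole graph, against the degree condition.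
  have hlow := D.low_mem (D.back_mem 1 le_rfl h1)
  have hlow1 := D.low_ne_one (D.back_mem 1 le_rfl h1)
  have h2 := hst.nonBranch hA hlow (by simp [hlow1])
  have h3 := hdeg (D.low (D.backEdge 1)) (by rw [hG.vertexSet]; exact hlow)
  rw [← D.union_all hA (by simp [hN1]) hG.loopless] at h3
  rw [Mader.IsNonBranch] at h2
  omega

theorem _root_.Palm.top_eq_of_anc (P : Palm G n) {x y : ℕ} (hx : 1 ≤ x ∧ x ≤ n) (hx1 : x ≠ 1)
    (hy : y ∈ P.anc x) (hy1 : y ≠ 1) (hp : P.par y = 1) : P.top x = y := by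
  induction hk : P.num x using Nat.strong_induction_on generalizing x with
  | _ k ih =>
    subst hk
    rw [P.top_eq x hx.1 hx.2 hx1]
    by_cases hxy : y = x
    · subst hxy; rw [if_pos hp]
    · have hm := P.mem_anc_par hx hy hxy
      have hp1 : P.par x ≠ 1 := by
        intro h
        rw [h] at hm
        exact hy1 (P.anc_one (hx.1.trans hx.2) hm)
      rw [if_neg hp1]
      exact ih _ (P.tree x hx.1 hx.2 hx1).2.2.1 (P.par_mem hx hx1) hp1 hm rfl

theorem mem_anc_low {c x : ℕ} (h1 : 1 ≤ c) (hN : c ≤ D.N) (hx : x ∈ D.xs c) :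
    x ∈ D.anc (D.low (D.backEdge c)) := by
  have key : ∀ {l : List ℕ} {h t : ℕ}, Trail D.par h l t → (∀ x ∈ l, (1 ≤ x ∧ x ≤ n) ∧ x ≠ 1) →
      x ∈ l → x ∈ D.anc h := by
    intro l
    induction l with
    | nil => simp
    | cons a l ih =>
      rintro h t ⟨rfl, ht⟩ hr hx
      have hh := (hr h (by simp)).1
      rcases List.mem_cons.1 hx with rfl | hx
      · exact D.mem_anc_self hh
      · exact D.anc_trans hh (D.par_mem_anc hh (hr h (by simp)).2)
          (ih ht (fun x hx => hr x (List.mem_cons_of_mem _ hx)) hx)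
  exact key (D.trail c h1 hN) (fun _ => D.mem_xs_range h1 hN) hx

/-- If the second chain does not start in the root and end in the subtree that contains the first
chain, then the first and the last edge of the first chain form a cut. -/
theorem isEdgeCut_first {m : ℕ} {end1 end2 : ℕ → ℕ} (hG : IsInput G n m end1 end2) (hn : 2 ≤ n)
    (hN : 2 ≤ D.N) (h : ¬ (D.src 2 = 1 ∧ D.tgt 2 ≠ 1)) {y : ℕ} (hy : y ∈ D.xs 1)
    (hp : D.par y = 1) :
    D.backEdge 1 ≠ D.parEdge y ∧ Mader.IsEdgeCut G {D.backEdge 1, D.parEdge y} := by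
  obtain ⟨h1, hs⟩ := D.first hG hn
  have hloop := hG.loopless
  obtain ⟨hyr, hy1⟩ := D.mem_xs_range le_rfl h1 hy
  refine ⟨D.backEdge_ne le_rfl h1 hyr hy1, ?_⟩
  refine Mader.isEdgeCut_of_leaving (S := {z | (1 ≤ z ∧ z ≤ n) ∧ y ∈ D.anc z}) (x := y) (y := 1) ?_
    (by rw [hG.vertexSet]; exact hyr) (by rw [hG.vertexSet]; exact ⟨le_rfl, by omega⟩)
    ⟨hyr, D.mem_anc_self hyr⟩ (fun h => hy1 (D.anc_one (by omega) h.2)) ?_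
  · rintro e (rfl | rfl)
    · exact (D.back_link le_rfl h1).edge_mem
    · exact (D.tree y hyr.1 hyr.2 hy1).2.2.2.edge_mem
  intro e u v he hu hv
  have hvr := D.mem_range he.symm
  have hur := hu.1
  have hua := hu.2
  replace hv : y ∉ D.anc v := fun h => hv ⟨hvr, h⟩
  rcases D.edge_cases he he.ne with ⟨rfl, hu1, rfl⟩ | ⟨rfl, hv1, rfl⟩ | ⟨hb, rfl⟩ | ⟨hb, rfl⟩
  · right
    by_cases huy : y = u
    · rw [huy]; rfl
    · exact absurd (D.mem_anc_par hur hua huy) hv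
  · exact absurd (D.anc_trans hvr (D.par_mem_anc hvr hv1) hua) hv
  · left
    obtain ⟨c, hc1, hcN, rfl⟩ := D.back_surj v e hb
    have hlow1 := D.low_ne_one hb
    have hb' := D.back _ _ hb
    have hv1 : v = 1 := by
      rcases Nat.lt_or_ge (D.num v) (D.num y) with hlt | hge
      · have hvy := D.anc_of_num_le hur hb'.2.1 hua hlt.le
        have := D.mem_anc_par hyr hvy (by rintro rfl; omega)
        rw [hp] at this
        exact D.anc_one (by omega) this
      · exact absurd (D.anc_of_num_le hur hua hb'.2.1 hge) hv
    subst hv1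
    have hsc := D.bk_disjoint hb (D.back_mem c hc1 hcN)
    rcases Nat.lt_or_ge 1 c with hc | hc
    -- A second back edge from the root into the subtree of `y` forces `src 2 = 1` by the order of
    -- the sources, hence `tgt 2 = 1` by `h`. As the root's chains are sorted by subtrees, chain `2`
    -- lies between `1` and `c` and reaches the root through `y` as well. Then `y` belongs strongly
    -- to both of the first two chains.
    · exfalso
      have hs2 : D.src 2 = 1 := by
        by_contra hne
        have h₁ := D.one_lt_num (D.src_mem (by omega) hN) hne
        rcases Nat.lt_or_ge 2 c with h2 | h2
        · have := D.src_mono 2 c (by omega) h2 hcN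
          rw [← hsc, D.num_one] at this; omega
        · obtain rfl : c = 2 := by omega
          exact hne hsc.symm
      have ht2 : D.tgt 2 = 1 := by
        by_contra hne; exact h ⟨hs2, hne⟩
      have top1 : D.top (D.low (D.backEdge 1)) = y :=
        D.top_eq_of_anc (D.low_mem (D.back_mem 1 le_rfl h1))
          (D.low_ne_one (D.back_mem 1 le_rfl h1)) (D.mem_anc_low le_rfl h1 hy) hy1 hp
      have topc : D.top (D.low (D.backEdge c)) = y := D.top_eq_of_anc hur hlow1 hua hy1 hp
      obtain ⟨y', hy', hyp'⟩ : ∃ y' ∈ D.xs 2, D.par y' = 1 := by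
        rcases (D.trail 2 (by omega) hN).pred_end with ⟨-, h'⟩ | ⟨y', hy', h'⟩
        · rw [ht2] at h'; exact absurd h' (D.low_ne_one (D.back_mem 2 (by omega) hN))
        · exact ⟨y', hy', by rw [h', ht2]⟩
      obtain ⟨hyr', hy1'⟩ := D.mem_xs_range (by omega) hN hy'
      have top2 : D.top (D.low (D.backEdge 2)) = y' :=
        D.top_eq_of_anc (D.low_mem (D.back_mem 2 (by omega) hN))
          (D.low_ne_one (D.back_mem 2 (by omega) hN)) (D.mem_anc_low (by omega) hN hy') hy1' hyp'
      have h12 := D.chain_sorted 1 2 le_rfl (by omega) hN hs hs2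
      rw [top1, top2] at h12
      have h2c : D.num y ≤ D.num y' := by
        rcases Nat.lt_or_ge 2 c with h2 | h2
        · have := D.chain_sorted 2 c (by omega) h2 hcN hs2 hsc.symm
          rwa [topc, top2] at this
        · obtain rfl : c = 2 := by omega
          rw [← topc, top2]
      have := D.num_inj hyr hyr' (by omega)
      subst this
      have a := ((D.mem_xs 1 _ le_rfl h1).1 hy).2.2
      have b := ((D.mem_xs 2 _ (by omega) hN).1 hy').2.2
      omega
    · rw [show c = 1 by omega]
  · exact absurd (D.anc_trans hvr (D.back _ _ hb).2.1 hua) hv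

end ChainDec

/-! ### Doubly linked lists and the stored chains -/

namespace DLL

variable {nx pv nx' pv' : ℕ → ℕ} {h t z : ℕ} {l l₁ l₂ : List ℕ}

theorem congr (hd : DLL nx pv h t l) (hn : ∀ x ∈ l, nx' x = nx x) (hp : ∀ x ∈ l, pv' x = pv x) :
    DLL nx' pv' h t l :=
  ⟨hd.fwd.congr hn, hd.bwd.congr fun x hx => hp x (List.mem_reverse.1 hx)⟩

theorem nil : DLL nx pv 0 0 [] := ⟨rfl, rfl⟩

theorem next_eq (hd : DLL nx pv h t (l₁ ++ z :: l₂)) : nx z = l₂.headD 0 := by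
  obtain ⟨y, -, rfl, h₂⟩ := Trail.append_iff.1 hd.fwd
  exact h₂.head_eq

theorem prev_eq (hd : DLL nx pv h t (l₁ ++ z :: l₂)) : pv z = l₁.getLastD 0 := by
  have := hd.bwd
  rw [List.reverse_append, List.reverse_cons, List.append_assoc, List.singleton_append] at this
  obtain ⟨y, -, rfl, h₂⟩ := Trail.append_iff.1 this
  have := h₂.head_eq
  rw [List.headD_eq_head?_getD, List.head?_reverse] at this
  rw [this, List.getLastD_eq_getLast?]

theorem headD_mem {l : List ℕ} (h : l.headD 0 ≠ 0) : l.headD 0 ∈ l := by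
  cases l <;> simp_all

theorem getLastD_mem {l : List ℕ} (h : l.getLastD 0 ≠ 0) : l.getLastD 0 ∈ l := by
  rcases List.eq_nil_or_concat l with rfl | ⟨l, w, rfl⟩ <;> simp_all

theorem headD_eq_zero {l : List ℕ} (h0 : 0 ∉ l) : l.headD 0 = 0 ↔ l = [] := by
  cases l with
  | nil => simp
  | cons a l => simp only [List.headD_cons, reduceCtorEq, iff_false]; rintro rfl; simp at h0

theorem delete (hd : DLL nx pv h t (l₁ ++ z :: l₂)) (hn : (l₁ ++ z :: l₂).Nodup)
    (h0 : 0 ∉ l₁ ++ z :: l₂) :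
    DLL (if pv z = 0 then nx else Function.update nx (pv z) (nx z))
      (if nx z = 0 then pv else Function.update pv (nx z) (pv z))
      (if pv z = 0 then nx z else h) (if nx z = 0 then pv z else t) (l₁ ++ l₂) := by
  have hp := hd.prev_eq
  have hx := hd.next_eq
  simp only [List.mem_append, List.mem_cons, not_or] at h0
  refine ⟨?_, ?_⟩
  · have := hd.fwd.delete hn h0.1
    rwa [← hp] at this
  · have hb := hd.bwd
    rw [List.reverse_append, List.reverse_cons, List.append_assoc, List.singleton_append] at hb
    have := hb.delete (by
      have := List.nodup_reverse.2 hn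
      rwa [List.reverse_append, List.reverse_cons, List.append_assoc,
        List.singleton_append] at this) (by simpa using h0.2.2)
    rw [List.getLastD_eq_getLast?, List.getLast?_reverse, ← List.headD_eq_head?_getD, ← hx,
      ← List.reverse_append] at this
    exact this

/-- Splitting a doubly linked list at an inner element. -/
theorem split (hd : DLL nx pv h t (l₁ ++ z :: l₂)) (hn : (l₁ ++ z :: l₂).Nodup)
    (h0 : 0 ∉ l₁ ++ z :: l₂) :
    DLL (if pv z = 0 then nx else Function.update nx (pv z) 0)
      (if nx z = 0 then pv else Function.update pv (nx z) 0)
      (if pv z = 0 then 0 else h) (pv z) l₁ ∧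
    DLL (if pv z = 0 then nx else Function.update nx (pv z) 0)
      (if nx z = 0 then pv else Function.update pv (nx z) 0)
      (nx z) (if nx z = 0 then 0 else t) l₂ := by
  have hp := hd.prev_eq
  have hx := hd.next_eq
  have hf := hd.fwd
  have hb := hd.bwd
  rw [List.reverse_append, List.reverse_cons, List.append_assoc, List.singleton_append] at hb
  obtain ⟨y, hy, rfl, hf₂⟩ := Trail.append_iff.1 hf
  obtain ⟨y', hy', rfl, hb₂⟩ := Trail.append_iff.1 hb
  simp only [List.mem_append, List.mem_cons, not_or] at h0
  rw [List.nodup_append, List.nodup_cons] at hn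
  obtain ⟨n₁, ⟨n₂, n₃⟩, n₄⟩ := hn
  have hpm : ∀ w ∈ l₁, w ∉ l₂ := fun w hw hw' => n₄ w hw w (by simp [hw']) rfl
  have fwd₁ : Trail (if pv y' = 0 then nx else Function.update nx (pv y') 0)
      (if pv y' = 0 then 0 else h) l₁ 0 := by
    rcases List.eq_nil_or_concat l₁ with rfl | ⟨l, w, rfl⟩
    · simp at hp; simp [hp, Trail]
    · simp only [List.concat_eq_append, List.getLastD_concat] at *
      have hw0 : w ≠ 0 := by rintro rfl; simp at h0
      rw [hp, if_neg hw0, if_neg hw0]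
      obtain ⟨v, hv, rfl, -⟩ := Trail.append_iff.1 hy
      rw [List.nodup_append] at n₁
      have hvl : v ∉ l := fun hm => n₁.2.2 v hm v (by simp) rfl
      exact Trail.append_iff.2 ⟨v, hv.update hvl _, rfl, by simp [Trail]⟩
  have bwd₂ : Trail (if nx y' = 0 then pv else Function.update pv (nx y') 0)
      (if nx y' = 0 then 0 else t) l₂.reverse 0 := by
    rcases l₂ with _ | ⟨w, l⟩
    · simp at hx; simp [hx, Trail]
    · simp only [List.headD_cons, List.reverse_cons] at *
      have hw0 : w ≠ 0 := by rintro rfl; simp at h0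
      rw [hx, if_neg hw0, if_neg hw0]
      obtain ⟨v, hv, rfl, -⟩ := Trail.append_iff.1 hy'
      rw [List.nodup_cons] at n₃
      exact Trail.append_iff.2 ⟨v, hv.update (by simpa using n₃.1) _, rfl, by simp [Trail]⟩
  refine ⟨⟨fwd₁, ?_⟩, ?_, bwd₂⟩
  · split_ifs with h'
    · exact hb₂
    · refine hb₂.update (fun hm => hpm _ (List.mem_reverse.1 hm) ?_) _
      rw [hx] at h' ⊢; exact headD_mem h'
  · split_ifs with h'
    · exact hf₂
    · refine hf₂.update (fun hm => hpm _ ?_ hm) _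
      rw [hp] at h' ⊢; exact getLastD_mem h'

theorem push (hd : DLL nx pv h t l) (hz : z ∉ l) (h0 : 0 ∉ l) :
    ∃ t', DLL (Function.update nx z h)
      (if h = 0 then Function.update pv z 0 else Function.update (Function.update pv z 0) h z) z t'
      (z :: l) := by
  have hh := hd.fwd.head_eq
  rcases l with _ | ⟨a, l⟩
  · refine ⟨z, ⟨rfl, ?_⟩, ?_⟩
    · simpa [Trail] using hh
    · simp only [List.headD_nil] at hh
      simp [hh, Trail]
  · simp only [List.headD_cons] at hh
    subst hh
    have hh0 : h ≠ 0 := by rintro rfl; simp at h0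
    refine ⟨t, ⟨rfl, ?_⟩, ?_⟩
    · simpa using hd.fwd.update hz h
    · rw [if_neg hh0]
      have hb := hd.bwd
      rw [List.reverse_cons] at hb ⊢
      obtain ⟨y, hy, rfl, h2⟩ := Trail.append_iff.1 hb
      rw [List.reverse_cons, List.append_assoc]
      simp only [List.mem_cons, not_or] at hz
      -- The old head occurs only once even though `l` is not assumed to be free of repetitions: a
      -- second occurrence would need a nonzero predecessor pointer, but the head has predecessor
      -- `0`.
      have hyl : y ∉ l.reverse := by
        intro hm
        obtain ⟨l', l'', hl⟩ := List.append_of_mem hm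
        rw [hl, List.append_assoc, List.cons_append] at hb
        obtain ⟨w, hw, hwy, hw2⟩ := Trail.append_iff.1 hb
        subst hwy
        rw [show pv w = 0 from h2] at hw2
        rcases l'' with _ | ⟨b, l''⟩
        · exact hh0 hw2.1.symm
        · refine h0 ?_
          rw [hw2.1]
          exact List.mem_cons_of_mem _ (List.mem_reverse.1 (by rw [hl]; simp))
      refine Trail.append_iff.2 ⟨y, (hy.update (by simpa using hz.2) _).update hyl _, rfl, ?_⟩
      simp [Trail, Function.update_of_ne hz.1]

end DLL

/-- The doubly linked lists of entries: the vertex `y` has the list `el y`, and each entry knows its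
vertex. -/
structure EntryLists (el : ℕ → List ℕ) (hd nx pv vtx : ℕ → ℕ) : Prop where
  dll : ∀ y, ∃ t, DLL nx pv (hd y) t (el y)
  nodup : ∀ y, (el y).Nodup
  zero : ∀ y, 0 ∉ el y
  vtx : ∀ y, ∀ z ∈ el y, vtx z = y

namespace EntryLists

variable {el : ℕ → List ℕ} {hd nx pv vtx : ℕ → ℕ}

theorem head (E : EntryLists el hd nx pv vtx) (y : ℕ) : hd y = (el y).headD 0 := by
  obtain ⟨t, h⟩ := E.dll y
  exact h.fwd.head_eq

theorem next (E : EntryLists el hd nx pv vtx) {y z : ℕ} {l₁ l₂ : List ℕ}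
    (h : el y = l₁ ++ z :: l₂) : nx z = l₂.headD 0 := by
  obtain ⟨t, h'⟩ := E.dll y
  rw [h] at h'
  exact h'.next_eq

/-- Filtering all lists at once, rather than updating the one that contains `z`, gives a uniform
description that composes when both entries of a chain are deleted. -/
theorem delete (E : EntryLists el hd nx pv vtx) {y z : ℕ} (hz : z ∈ el y) :
    EntryLists (fun x => (el x).filter (· ≠ z))
      (if pv z = 0 then Function.update hd (vtx z) (nx z) else hd)
      (if pv z = 0 then nx else Function.update nx (pv z) (nx z))
      (if nx z = 0 then pv else Function.update pv (nx z) (pv z)) vtx := by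
  refine ⟨fun x => ?_, fun x => (E.nodup x).filter _, fun x h => E.zero x (List.mem_of_mem_filter h),
    fun x w hw => E.vtx x w (List.mem_of_mem_filter hw)⟩
  have hvz := E.vtx y z hz
  obtain ⟨l₁, l₂, hl⟩ := List.append_of_mem hz
  have hn := E.nodup y
  have h0 := E.zero y
  obtain ⟨t, hd'⟩ := E.dll y
  have hpv := (hl ▸ hd').prev_eq
  have hnx := (hl ▸ hd').next_eq
  by_cases hxy : x = y
  · subst hxy
    have hfil : (el x).filter (· ≠ z) = l₁ ++ l₂ := by
      rw [hl] at hn ⊢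
      rw [List.nodup_append, List.nodup_cons] at hn
      rw [List.filter_append, List.filter_cons_of_neg (by simp), List.filter_eq_self.2,
        List.filter_eq_self.2]
      · intro w hw; simp; rintro rfl; exact hn.2.1.1 hw
      · intro w hw; simp; rintro rfl; exact hn.2.2 w hw w (by simp) rfl
    rw [hfil]
    rw [hl] at hd' hn h0
    have hh : (if pv z = 0 then Function.update hd (vtx z) (nx z) else hd) x =
        if pv z = 0 then nx z else hd x := by
      rw [hvz]; split_ifs <;> simp
    rw [hh]
    exact ⟨_, hd'.delete hn h0⟩
  · have hzx : z ∉ el x := fun h => hxy ((E.vtx x z h).symm.trans hvz)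
    have hfil : (el x).filter (· ≠ z) = el x :=
      List.filter_eq_self.2 fun w hw => by simp; rintro rfl; exact hzx hw
    rw [hfil]
    obtain ⟨t, hd''⟩ := E.dll x
    refine ⟨t, ?_⟩
    have hh : (if pv z = 0 then Function.update hd (vtx z) (nx z) else hd) x = hd x := by
      rw [hvz]; split_ifs <;> simp [hxy]
    rw [hh]
    refine hd''.congr (fun w hw => ?_) fun w hw => ?_
    · split_ifs with h
      · rfl
      · refine Function.update_of_ne ?_ _ _
        rintro rfl
        refine hxy ((E.vtx x _ hw).symm.trans (E.vtx y _ ?_))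
        rw [hl, hpv]
        rw [hpv] at h
        exact List.mem_append_left _ (DLL.getLastD_mem h)
    · split_ifs with h
      · rfl
      · refine Function.update_of_ne ?_ _ _
        rintro rfl
        refine hxy ((E.vtx x _ hw).symm.trans (E.vtx y _ ?_))
        rw [hl, hnx]
        rw [hnx] at h
        exact List.mem_append_right _ (List.mem_cons_of_mem _ (DLL.headD_mem h))

theorem push (E : EntryLists el hd nx pv vtx) {y z : ℕ} (hz : ∀ x, z ∉ el x) (hz0 : z ≠ 0) :
    EntryLists (Function.update el y (z :: el y)) (Function.update hd y z)
      (Function.update nx z (hd y))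
      (if hd y = 0 then Function.update pv z 0
        else Function.update (Function.update pv z 0) (hd y) z) (Function.update vtx z y) := by
  refine ⟨fun x => ?_, fun x => ?_, fun x => ?_, fun x w hw => ?_⟩
  · by_cases hxy : x = y
    · subst hxy
      obtain ⟨t, h⟩ := E.dll x
      simpa using h.push (hz x) (E.zero x)
    · obtain ⟨t, h⟩ := E.dll x
      refine ⟨t, ?_⟩
      simp only [Function.update_of_ne hxy]
      have hne : ∀ w ∈ el x, w ≠ z := fun w hw => by rintro rfl; exact hz x hw
      refine h.congr (fun w hw => Function.update_of_ne (hne w hw) _ _) fun w hw => ?_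
      split_ifs with h0
      · exact Function.update_of_ne (hne w hw) _ _
      · rw [Function.update_of_ne, Function.update_of_ne (hne w hw)]
        rintro rfl
        refine hxy ((E.vtx x _ hw).symm.trans (E.vtx y _ ?_))
        rw [E.head y] at h0 ⊢
        exact DLL.headD_mem h0
  · by_cases hxy : x = y
    · subst hxy; simpa using ⟨hz x, E.nodup x⟩
    · simpa [hxy] using E.nodup x
  · by_cases hxy : x = y
    · subst hxy; simpa using ⟨hz0.symm, E.zero x⟩
    · simpa [hxy] using E.zero x
  · by_cases hxy : x = y
    · subst hxy
      simp only [Function.update_self, List.mem_cons] at hw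
      rcases hw with rfl | hw
      · simp
      · rw [Function.update_of_ne (by rintro rfl; exact hz x hw), E.vtx x w hw]
    · rw [Function.update_of_ne hxy] at hw
      rw [Function.update_of_ne (by rintro rfl; exact hz x hw), E.vtx x w hw]

end EntryLists

/-- The state `s` holds the lists of entries `el`. -/
abbrev EntryLists.Stored (el : ℕ → List ℕ) (s : State) : Prop :=
  EntryLists el (s.arrs .listHead) (s.arrs .entNext) (s.arrs .entPrev) (s.arrs .entVertex)

theorem wp_deleteEntry {el : ℕ → List ℕ} {s : State} (E : EntryLists.Stored el s) {y : ℕ}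
    (hz : s.regs .z ∈ el y) {k : ℕ} (hk : 30 ≤ k) :
    WP deleteEntry s k fun s' k' => k ≤ k' + 30 ∧
      EntryLists.Stored (fun x => (el x).filter (· ≠ s.regs .z)) s' := by
  obtain ⟨l₁, l₂, hl⟩ := List.append_of_mem hz
  obtain ⟨t, hd⟩ := E.dll y
  have hn := E.nodup y
  rw [hl] at hd hn
  have hpz : s.arrs .entPrev (s.regs .z) ≠ 0 → s.regs .z ≠ s.arrs .entPrev (s.regs .z) := by
    intro h0 h
    rw [hd.prev_eq] at h0 h
    have := DLL.getLastD_mem h0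
    rw [List.nodup_append] at hn
    exact hn.2.2 _ this _ (by simp) h.symm
  have hE := E.delete hz
  unfold EntryLists.Stored
  unfold deleteEntry
  simp only [block, when]
  refine .run 30 hk fun k' hk' => ⟨hk', ?_⟩
  by_cases hp : s.arrs .entPrev (s.regs .z) = 0 <;> by_cases hx : s.arrs .entNext (s.regs .z) = 0
  all_goals first
    | simpa [hp, hx, Function.update_of_ne (hpz hp)] using hE
    | simpa [hp, hx] using hE

theorem wp_insertEntry {el : ℕ → List ℕ} {s : State} (E : EntryLists.Stored el s)
    (hz : ∀ x, s.regs .z ∉ el x) (hz0 : s.regs .z ≠ 0) {k : ℕ} (hk : 40 ≤ k) :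
    WP insertEntry s k fun s' k' => k ≤ k' + 40 ∧
      EntryLists.Stored (Function.update el (s.regs .y) (s.regs .z :: el (s.regs .y))) s' ∧
      s'.arrs .entChain = Function.update (s.arrs .entChain) (s.regs .z) (s.regs .d) := by
  have hE := E.push (y := s.regs .y) hz hz0
  unfold EntryLists.Stored
  unfold insertEntry
  simp only [block, when]
  refine .run 40 hk fun k' hk' => ⟨hk', ?_⟩
  by_cases hx : s.arrs .listHead (s.regs .y) = 0
  · simpa [hx] using hE
  · simpa [hx] using hE

/-- The set `S` of chains that are stored in the lists of their endpoints, as the entries `d` and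
`m + d`, and the list `ad` of addable chains. -/
structure Assoc (src tgt : ℕ → ℕ) (m : ℕ) (S : Finset ℕ) (ad : List ℕ) (el : ℕ → List ℕ)
    (s : State) : Prop where
  lists : EntryLists.Stored el s
  mem : ∀ y z, z ∈ el y ↔ (z ∈ S ∧ src z = y) ∨ ∃ d ∈ S, z = m + d ∧ tgt d = y
  range : ∀ d ∈ S, 1 ≤ d ∧ d ≤ m
  entry : ∀ d ∈ S, s.arrs .entChain d = d ∧ s.arrs .entChain (m + d) = d ∧
    s.arrs .entTwin d = m + d ∧ s.arrs .entTwin (m + d) = d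
  disj : ∀ d ∈ S, d ∉ ad
  ad_nodup : ad.Nodup
  ad_zero : 0 ∉ ad
  ad_trail : Trail (s.arrs .addNext) (s.regs .addHead) ad 0

namespace Assoc

variable {src tgt : ℕ → ℕ} {m : ℕ} {S : Finset ℕ} {ad : List ℕ} {el : ℕ → List ℕ} {s s' : State}

theorem congr (h : Assoc src tgt m S ad el s) (hr : s'.regs .addHead = s.regs .addHead)
    (ha : ∀ a ∈ [Arr.listHead, .entNext, .entPrev, .entVertex, .entChain, .entTwin, .addNext],
      s'.arrs a = s.arrs a) : Assoc src tgt m S ad el s' := by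
  simp only [List.mem_cons, List.not_mem_nil, or_false, forall_eq_or_imp, forall_eq] at ha
  obtain ⟨h₁, h₂, h₃, h₄, h₅, h₆, h₇⟩ := ha
  refine { h with lists := ?_, entry := ?_, ad_trail := ?_ }
  · unfold EntryLists.Stored; rw [h₁, h₂, h₃, h₄]; exact h.lists
  · rw [h₅, h₆]; exact h.entry
  · rw [h₇, hr]; exact h.ad_trail

theorem src_mem (h : Assoc src tgt m S ad el s) {d : ℕ} (hd : d ∈ S) : d ∈ el (src d) :=
  (h.mem _ _).2 (.inl ⟨hd, rfl⟩)

theorem tgt_mem (h : Assoc src tgt m S ad el s) {d : ℕ} (hd : d ∈ S) : m + d ∈ el (tgt d) :=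
  (h.mem _ _).2 (.inr ⟨d, hd, rfl, rfl⟩)

/-- An entry and its twin belong to one chain. -/
theorem cases (h : Assoc src tgt m S ad el s) {y z : ℕ} (hz : z ∈ el y) :
    ∃ d ∈ S, s.arrs .entChain z = d ∧
      ((z = d ∧ s.arrs .entTwin z = m + d ∧ src d = y ∧
          s.arrs .entVertex (s.arrs .entTwin z) = tgt d) ∨
        (z = m + d ∧ s.arrs .entTwin z = d ∧ tgt d = y ∧
          s.arrs .entVertex (s.arrs .entTwin z) = src d)) := by
  rcases (h.mem y z).1 hz with ⟨hd, rfl⟩ | ⟨d, hd, rfl, rfl⟩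
  · obtain ⟨a, b, c, e⟩ := h.entry z hd
    exact ⟨z, hd, a, .inl ⟨rfl, c, rfl, by rw [c]; exact h.lists.vtx _ _ (h.tgt_mem hd)⟩⟩
  · obtain ⟨a, b, c, e⟩ := h.entry d hd
    exact ⟨d, hd, b, .inr ⟨rfl, e, rfl, by rw [e]; exact h.lists.vtx _ _ (h.src_mem hd)⟩⟩

end Assoc

theorem wp_makeAddable {src tgt : ℕ → ℕ} {m : ℕ} {S : Finset ℕ} {ad : List ℕ} {el : ℕ → List ℕ}
    {s : State} (h : Assoc src tgt m S ad el s) (hm : s.regs .numE = m) {d : ℕ}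
    (hd : s.regs .d = d) (hS : d ∈ S) {k : ℕ} (hk : 100 ≤ k) :
    WP makeAddable s k fun s' k' => k ≤ k' + 100 ∧
      Assoc src tgt m (S.erase d) (d :: ad)
        (fun x => (el x).filter fun z => z ≠ d ∧ z ≠ m + d) s' := by
  have hr := h.range d hS
  have hne : ∀ c ∈ S, m + c ≠ d := fun c hc hcd => by have := h.range c hc; omega
  unfold makeAddable
  simp only [block]
  refine .seq (.run 2 (by omega) fun k₁ hk₁ => ?_)
  refine .seq (WP.conseq (wp_deleteEntry (el := el) (y := src d)
    (by simpa [EntryLists.Stored] using h.lists) (by simpa [hd] using h.src_mem hS)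
    (by omega)) ?_)
  rintro s₂ k₂ ⟨hk₂, E₂⟩ hf₂
  have d₂ : s₂.regs .d = d := by rw [hf₂.regs _ rfl]; simpa using hd
  have m₂ : s₂.regs .numE = m := by rw [hf₂.regs _ rfl]; simpa using hm
  simp only [run, Expr.eval, regs_setReg, if_true, hd] at E₂
  refine .seq (.run 4 (by omega) fun k₃ hk₃ => ?_)
  refine .seq (WP.conseq (wp_deleteEntry (el := fun x => (el x).filter (· ≠ d)) (y := tgt d)
    (by simpa [EntryLists.Stored] using E₂) (by
      simp [d₂, m₂, h.tgt_mem hS]; omega) (by omega)) ?_)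
  rintro s₄ k₄ ⟨hk₄, E₄⟩ hf₄
  unfold pushAddable
  simp only [block]
  have d₄ : s₄.regs .d = d := by rw [hf₄.regs _ rfl]; simpa using d₂
  have c₄ : s₄.arrs .entChain = s.arrs .entChain := by
    rw [hf₄.arrs _ rfl]; simp; rw [hf₂.arrs _ rfl]; simp
  have t₄ : s₄.arrs .entTwin = s.arrs .entTwin := by
    rw [hf₄.arrs _ rfl]; simp; rw [hf₂.arrs _ rfl]; simp
  have n₄ : s₄.arrs .addNext = s.arrs .addNext := by
    rw [hf₄.arrs _ rfl]; simp; rw [hf₂.arrs _ rfl]; simp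
  have a₄ : s₄.regs .addHead = s.regs .addHead := by
    rw [hf₄.regs _ rfl]; simp; rw [hf₂.regs _ rfl]; simp
  refine .run 8 (by omega) fun k₅ hk₅ => ⟨by omega, ?_⟩
  simp [d₂, m₂, List.filter_filter] at E₄
  refine ⟨?_, fun y z => ?_, fun c hc => h.range c (Finset.mem_of_mem_erase hc), fun c hc => ?_,
    fun c hc => ?_, ?_, ?_, ?_⟩
  · simp [d₄, EntryLists.Stored]
    convert E₄ using 3
    funext z; exact Bool.and_comm _ _
  · simp only [List.mem_filter, h.mem, Finset.mem_erase, decide_eq_true_eq]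
    constructor
    · rintro ⟨⟨h₁, h₂⟩ | ⟨c, hc, rfl, h₂⟩, h₃, h₄⟩
      · exact .inl ⟨⟨h₃, h₁⟩, h₂⟩
      · exact .inr ⟨c, ⟨by omega, hc⟩, rfl, h₂⟩
    · rintro (⟨⟨h₃, h₁⟩, h₂⟩ | ⟨c, ⟨h₃, hc⟩, rfl, h₂⟩)
      · have := h.range z h₁
        exact ⟨.inl ⟨h₁, h₂⟩, h₃, by omega⟩
      · exact ⟨.inr ⟨c, hc, rfl, h₂⟩, hne c hc, by omega⟩
  · simpa [c₄, t₄] using h.entry c (Finset.mem_of_mem_erase hc)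
  · simp only [List.mem_cons, not_or]
    exact ⟨Finset.ne_of_mem_erase hc, h.disj c (Finset.mem_of_mem_erase hc)⟩
  · exact List.nodup_cons.2 ⟨h.disj d hS, h.ad_nodup⟩
  · simp only [List.mem_cons, not_or]
    exact ⟨by omega, h.ad_zero⟩
  · simp [d₄, Trail, n₄, a₄]
    exact h.ad_trail.update (h.disj d hS) _

theorem mem_update_cons (el : ℕ → List ℕ) (x y z w : ℕ) :
    z ∈ Function.update el x (w :: el x) y ↔ (z = w ∧ y = x) ∨ z ∈ el y := by
  by_cases h : y = x
  · subst h; simp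
  · simp [h]

theorem length_update_cons (el : ℕ → List ℕ) (x y w : ℕ) :
    (Function.update el x (w :: el x) y).length = (el y).length + if y = x then 1 else 0 := by
  by_cases h : y = x
  · subst h; simp
  · simp [h]

theorem wp_associateChain {src tgt : ℕ → ℕ} {m : ℕ} {S : Finset ℕ} {ad : List ℕ}
    {el : ℕ → List ℕ} {s : State} (h : Assoc src tgt m S ad el s) (hm : s.regs .numE = m)
    (hsrc : s.arrs .src = src) (htgt : s.arrs .tgt = tgt) {d : ℕ}
    (hd : s.regs .d = d) (h1 : 1 ≤ d) (hdm : d ≤ m) (hS : d ∉ S) (had : d ∉ ad) {k : ℕ}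
    (hk : 150 ≤ k) :
    WP associateChain s k fun s' k' => k ≤ k' + 150 ∧
      ∃ el', Assoc src tgt m (insert d S) ad el' s' ∧
        (∀ y, (el' y).length = (el y).length + (if y = src d then 1 else 0) +
          (if y = tgt d then 1 else 0)) := by
  have hne : ∀ c ∈ S, m + c ≠ d := fun c hc hcd => by have := h.range c hc; omega
  have hfr₁ : ∀ x, d ∉ el x := by
    intro x hx
    rcases (h.mem x d).1 hx with h' | ⟨c, hc, h', -⟩
    · exact hS h'.1
    · exact hne c hc h'.symm
  have hfr₂ : ∀ x, m + d ∉ el x := by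
    intro x hx
    rcases (h.mem x _).1 hx with h' | ⟨c, hc, h', -⟩
    · have := h.range _ h'.1; omega
    · obtain rfl : c = d := by omega
      exact hS hc
  unfold associateChain
  simp only [block]
  refine .seq (.run 2 (by omega) fun k₁ hk₁ => ?_)
  refine .seq (.run 4 (by omega) fun k₂ hk₂ => ?_)
  refine .seq (WP.conseq (wp_insertEntry (el := el)
    (by simpa [EntryLists.Stored] using h.lists) (by simpa [hd] using hfr₁)
    (by simp [hd]; omega) (by omega)) ?_)
  rintro s₃ k₃ ⟨hk₃, E₃, C₃⟩ hf₃
  have d₃ : s₃.regs .d = d := by rw [hf₃.regs _ rfl]; simpa using hd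
  have m₃ : s₃.regs .numE = m := by rw [hf₃.regs _ rfl]; simpa using hm
  have tg₃ : s₃.arrs .tgt = tgt := by rw [hf₃.arrs _ rfl]; simpa using htgt
  have tw₃ : s₃.arrs .entTwin = s.arrs .entTwin := by rw [hf₃.arrs _ rfl]; simp
  have an₃ : s₃.arrs .addNext = s.arrs .addNext := by rw [hf₃.arrs _ rfl]; simp
  have ah₃ : s₃.regs .addHead = s.regs .addHead := by rw [hf₃.regs _ rfl]; simp
  simp [hd, hsrc] at E₃ C₃
  refine .seq (.run 8 (by omega) fun k₄ hk₄ => ?_)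
  refine .seq (.run 8 (by omega) fun k₅ hk₅ => ?_)
  refine .seq (.run 8 (by omega) fun k₆ hk₆ => ?_)
  refine .seq (WP.conseq (wp_insertEntry (el := Function.update el (src d) (d :: el (src d)))
    (by simpa [EntryLists.Stored] using E₃) (by
      simp only [run, Expr.eval, eval_add, regs_setReg, regs_setCell, if_true, d₃, m₃, reduceCtorEq,
        if_false]
      intro x
      by_cases hx : x = src d
      · subst hx; simp [hfr₂]; omega
      · simp [hx, hfr₂])
    (by simp [d₃, m₃]; omega) (by omega)) ?_)
  rintro s₇ k₇ ⟨hk₇, E₇, C₇⟩ hf₇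
  have d₇ : s₇.regs .d = d := by rw [hf₇.regs _ rfl]; simpa using d₃
  have m₇ : s₇.regs .numE = m := by rw [hf₇.regs _ rfl]; simpa using m₃
  have tw₇ : s₇.arrs .entTwin = Function.update (s.arrs .entTwin) d (m + d) := by
    rw [hf₇.arrs _ rfl]; simp [tw₃, d₃, m₃]
  have an₇ : s₇.arrs .addNext = s.arrs .addNext := by rw [hf₇.arrs _ rfl]; simp [an₃]
  have ah₇ : s₇.regs .addHead = s.regs .addHead := by rw [hf₇.regs _ rfl]; simp [ah₃]
  simp [d₃, m₃, tg₃] at E₇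
  simp [d₃, m₃, C₃, hd] at C₇
  refine .run 12 (by omega) fun k₈ hk₈ => ⟨by omega, _, ⟨by simpa [EntryLists.Stored] using E₇, ?_,
    ?_, ?_, ?_, h.ad_nodup, h.ad_zero, ?_⟩, ?_⟩
  · intro y z
    have hz : z ∈ Function.update (Function.update el (src d) (d :: el (src d))) (tgt d)
        ((m + d) :: Function.update el (src d) (d :: el (src d)) (tgt d)) y ↔
        (z = m + d ∧ tgt d = y) ∨ (z = d ∧ src d = y) ∨ z ∈ el y := by
      rw [mem_update_cons, mem_update_cons, eq_comm (a := tgt d), eq_comm (a := src d)]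
    rw [hz, h.mem]
    simp only [Finset.mem_insert, exists_eq_or_imp]
    constructor
    · rintro (h₁ | ⟨rfl, h₁⟩ | ⟨h₁, h₂⟩ | h₁)
      · exact .inr (.inl h₁)
      · exact .inl ⟨.inl rfl, h₁⟩
      · exact .inl ⟨.inr h₁, h₂⟩
      · exact .inr (.inr h₁)
    · rintro (⟨rfl | h₁, h₂⟩ | h₁ | h₁)
      · exact .inr (.inl ⟨rfl, h₂⟩)
      · exact .inr (.inr (.inl ⟨h₁, h₂⟩))
      · exact .inl h₁
      · exact .inr (.inr (.inr h₁))
  · intro c hc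
    rcases Finset.mem_insert.1 hc with rfl | hc
    · exact ⟨h1, hdm⟩
    · exact h.range c hc
  · intro c hc
    have hmd : m + d ≠ d := by omega
    have hdm' : d ≠ m + d := by omega
    rcases Finset.mem_insert.1 hc with rfl | hc
    · simp [C₇, tw₇, d₇, m₇, hmd, hdm', Function.update_apply]
    · obtain ⟨e₁, e₂, e₃, e₄⟩ := h.entry c hc
      have hcd : c ≠ d := fun h' => hS (h' ▸ hc)
      have := h.range c hc
      have h₁ : c ≠ m + d := by omega
      have h₂ : m + c ≠ d := by omega
      simp [C₇, tw₇, d₇, m₇, hcd, h₁, h₂, e₁, e₂, e₃, e₄, Function.update_apply]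
  · intro c hc
    rcases Finset.mem_insert.1 hc with rfl | hc
    · exact had
    · exact h.disj c hc
  · simpa [an₇, ah₇] using h.ad_trail
  · intro y
    rw [length_update_cons, length_update_cons]

/-! ### The walkers and their lockstep -/

/-- The number of the vertices in the list `l` and of the entries in their lists. -/
def weight (el : ℕ → List ℕ) (l : List ℕ) : ℕ := (l.map fun y => 1 + (el y).length).sum

@[simp] theorem weight_nil (el : ℕ → List ℕ) : weight el [] = 0 := rfl

@[simp] theorem weight_cons (el : ℕ → List ℕ) (y : ℕ) (l : List ℕ) :
    weight el (y :: l) = 1 + (el y).length + weight el l := rfl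

@[simp] theorem weight_append (el : ℕ → List ℕ) (l l' : List ℕ) :
    weight el (l ++ l') = weight el l + weight el l' := by simp [weight]

@[simp] theorem weight_reverse (el : ℕ → List ℕ) (l : List ℕ) :
    weight el l.reverse = weight el l := by
  induction l with
  | nil => rfl
  | cons a l ih => simp [ih]; omega

theorem weight_mono {el el' : ℕ → List ℕ} (l : List ℕ)
    (h : ∀ y ∈ l, (el' y).length ≤ (el y).length) : weight el' l ≤ weight el l := by
  induction l with
  | nil => simp
  | cons a l ih =>
    have := h a (by simp)
    have := ih fun y hy => h y (by simp [hy])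
    simp only [weight_cons]; omega

/-- After `t` steps, a walker along `path` stands at the vertex `p` and looks at the entry `a`. All
entries that it has passed are good. -/
def Walker (el : ℕ → List ℕ) (good : ℕ → Prop) (path : List ℕ) (r t p a : ℕ) : Prop :=
  ∃ dn rest bef suf, path = dn ++ p :: rest ∧ el p = bef ++ suf ∧ a = suf.headD 0 ∧
    (∀ y ∈ dn, ∀ z ∈ el y, good z) ∧ (∀ z ∈ bef, good z) ∧ dn.length ≤ t ∧
    t + 1 + suf.length + weight el rest ≤ r

namespace Walker

variable {el : ℕ → List ℕ} {good : ℕ → Prop} {path : List ℕ} {r t p a : ℕ}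

theorem mem (h : Walker el good path r t p a) : p ∈ path := by
  obtain ⟨dn, rest, bef, suf, rfl, -⟩ := h; simp

theorem lt (h : Walker el good path r t p a) : t < r := by
  obtain ⟨dn, rest, bef, suf, -, -, -, -, -, -, h⟩ := h; omega

theorem entry_mem (h : Walker el good path r t p a) (ha : a ≠ 0) : a ∈ el p := by
  obtain ⟨dn, rest, bef, suf, -, h₁, rfl, -⟩ := h
  rw [h₁]
  exact List.mem_append_right _ (DLL.headD_mem ha)

/-- The budget `r` is the weight of the whole path including `u`. Each step consumes one vertex or
one entry of it, and deletions only make the remaining weight smaller, so a walker needs fewer than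
`r` steps. -/
theorem init {u : ℕ} {pre : List ℕ} :
    Walker el good (pre ++ [u]) (weight el (pre ++ [u])) 0 ((pre ++ [u]).headD 0)
      ((el ((pre ++ [u]).headD 0)).headD 0) := by
  rcases pre with _ | ⟨x, l⟩
  · exact ⟨[], [], [], el u, rfl, rfl, rfl, by simp, by simp, by simp, by simp⟩
  · exact ⟨[], l ++ [u], [], el x, rfl, rfl, rfl, by simp, by simp, by simp, by simp⟩

theorem done {u : ℕ} {pre : List ℕ} (hn : (pre ++ [u]).Nodup)
    (h : Walker el good (pre ++ [u]) r t u a) :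
    (∀ y ∈ pre, ∀ z ∈ el y, good z) ∧ pre.length ≤ t := by
  obtain ⟨dn, rest, bef, suf, h₁, -, -, h₂, -, h₃, -⟩ := h
  have : dn = pre := by
    have hu : u ∉ pre := by
      rw [List.nodup_append] at hn
      exact fun h => hn.2.2 u h u (by simp) rfl
    rcases List.eq_nil_or_concat rest with rfl | ⟨l, w, rfl⟩
    · exact (List.append_inj_left' h₁ rfl).symm
    · rw [List.concat_eq_append, ← List.cons_append, ← List.append_assoc] at h₁
      have := List.append_inj_left' h₁ rfl
      rw [this] at hu
      simp at hu
  exact this ▸ ⟨h₂, h₃⟩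

theorem keep {hd nx pv vtx : ℕ → ℕ} (E : EntryLists el hd nx pv vtx)
    (h : Walker el good path r t p a) (ha : a ≠ 0) (hg : good a) :
    Walker el good path r (t + 1) p (nx a) := by
  obtain ⟨dn, rest, bef, suf, h₁, h₂, h₃, h₄, h₅, h₆, h₇⟩ := h
  rcases suf with _ | ⟨b, suf⟩
  · exact absurd h₃ ha
  · obtain rfl : a = b := h₃
    refine ⟨dn, rest, bef ++ [a], suf, h₁, by simp [h₂], E.next h₂, h₄, ?_, by omega, ?_⟩
    · intro z hz
      rcases List.mem_append.1 hz with hz | hz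
      · exact h₅ z hz
      · rwa [List.mem_singleton.1 hz]
    · simp only [List.length_cons] at h₇; omega

theorem move {hd nx pv vtx nxt : ℕ → ℕ} {u hh ee : ℕ} {pre : List ℕ}
    (E : EntryLists el hd nx pv vtx) (h : Walker el good (pre ++ [u]) r t p 0)
    (hp : p ≠ u) (htr : Trail nxt hh (pre ++ [u]) ee) :
    Walker el good (pre ++ [u]) r (t + 1) (nxt p) (hd (nxt p)) := by
  obtain ⟨dn, rest, bef, suf, h₁, h₂, h₃, h₄, h₅, h₆, h₇⟩ := h
  have hsuf : suf = [] := by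
    rcases suf with _ | ⟨b, suf⟩
    · rfl
    · exact absurd (by rw [h₂, show 0 = b from h₃]; simp) (E.zero p)
  subst hsuf
  rcases rest with _ | ⟨w, rest⟩
  · have := List.append_inj_right' h₁ rfl
    simp at this; exact absurd this.symm hp
  · rw [h₁] at htr
    obtain ⟨y, -, rfl, htr'⟩ := Trail.append_iff.1 htr
    obtain rfl : nxt y = w := htr'.1
    refine ⟨dn ++ [y], rest, [], el (nxt y), by simp [h₁], rfl, E.head _, ?_, by simp, ?_, ?_⟩
    · intro x hx
      rcases List.mem_append.1 hx with hx | hx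
      · exact h₄ x hx
      · rw [List.mem_singleton.1 hx, h₂]; simpa using h₅
    · simpa using h₆
    · simp only [weight_cons, List.length_nil] at h₇; omega

/-- The walker has already saved the successor of the deleted entry, and the twin lies in the list
of another vertex, so the part of its list that remains to be considered is unchanged. -/
theorem delete_own {hd nx pv vtx : ℕ → ℕ} {keep : ℕ → Bool} {f : ℕ}
    (E : EntryLists el hd nx pv vtx) (h : Walker el good path r t p a) (ha : a ≠ 0)
    (hf : f ∉ el p) (hkeep : ∀ z, keep z = true ↔ z ≠ a ∧ z ≠ f) :
    Walker (fun y => (el y).filter keep) good path r (t + 1) p (nx a) := by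
  obtain ⟨dn, rest, bef, suf, h₁, h₂, h₃, h₄, h₅, h₆, h₇⟩ := h
  rcases suf with _ | ⟨b, suf⟩
  · exact absurd h₃ ha
  · obtain rfl : a = b := h₃
    have hn := E.nodup p
    rw [h₂] at hn hf
    rw [List.nodup_append, List.nodup_cons] at hn
    simp only [List.mem_append, List.mem_cons, not_or] at hf
    refine ⟨dn, rest, bef, suf, h₁, ?_, E.next h₂, fun y hy z hz =>
      h₄ y hy z (List.mem_of_mem_filter hz), h₅, by omega, ?_⟩
    · change (el p).filter keep = _
      rw [h₂, List.filter_append, List.filter_cons_of_neg (by simp [hkeep]),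
        List.filter_eq_self.2, List.filter_eq_self.2]
      · intro z hz
        exact (hkeep z).2 ⟨fun h => hn.2.1.1 (h ▸ hz), fun h => hf.2.2 (h ▸ hz)⟩
      · intro z hz
        exact (hkeep z).2 ⟨fun h => hn.2.2 z hz a (by simp) h, fun h => hf.1 (h ▸ hz)⟩
    · have := weight_mono (el := el) (el' := fun y => (el y).filter keep) rest
        fun y _ => List.length_filter_le _ _
      simp only [List.length_cons] at h₇; omega

/-- Deletions by the opposite walker reach this one only through the twin `f`. If `f` is the very
entry to be considered next, the pointer moves on to its successor; otherwise filtering leaves the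
pointer valid. -/
theorem delete_other {hd nx pv vtx : ℕ → ℕ} {keep : ℕ → Bool} {x f : ℕ}
    (E : EntryLists el hd nx pv vtx) (h : Walker el good path r t p a)
    (hx : x ∉ el p) (hf0 : f ≠ 0) (hkeep : ∀ z, keep z = true ↔ z ≠ x ∧ z ≠ f) :
    Walker (fun y => (el y).filter keep) good path r t p (if a = f then nx a else a) := by
  obtain ⟨dn, rest, bef, suf, h₁, h₂, h₃, h₄, h₅, h₆, h₇⟩ := h
  refine ⟨dn, rest, bef.filter keep, suf.filter keep, h₁, by simp [h₂], ?_, fun y hy z hz =>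
      h₄ y hy z (List.mem_of_mem_filter hz), fun z hz => h₅ z (List.mem_of_mem_filter hz), h₆, ?_⟩
  · rcases suf with _ | ⟨b, suf⟩
    · obtain rfl : a = 0 := h₃
      simp [hf0.symm]
    · obtain rfl : a = b := h₃
      have hn := E.nodup p
      have hnx := E.next h₂
      rw [h₂] at hn hx
      rw [List.nodup_append, List.nodup_cons] at hn
      simp only [List.mem_append, List.mem_cons, not_or] at hx
      by_cases haf : a = f
      · rw [if_pos haf, hnx, List.filter_cons_of_neg (by simp [hkeep, haf]), List.filter_eq_self.2]
        intro z hz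
        exact (hkeep z).2 ⟨fun h => hx.2.2 (h ▸ hz), fun h => hn.2.1.1 (by rw [haf, ← h]; exact hz)⟩
      · rw [if_neg haf, List.filter_cons_of_pos ((hkeep a).2 ⟨fun h => hx.2.1 h.symm, haf⟩)]
        rfl
  · have := weight_mono (el := el) (el' := fun y => (el y).filter keep) rest
      fun y _ => List.length_filter_le _ _
    have := List.length_filter_le keep suf
    omega

end Walker

/-- A link with the inner vertices `pre ++ u :: post`, in the order of decreasing numbers. -/
structure LinkAt (num nxt prv : ℕ → ℕ) (pre : List ℕ) (u : ℕ) (post : List ℕ) : Prop where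
  pre_gt : ∀ y ∈ pre, num u < num y
  post_lt : ∀ y ∈ post, num y < num u
  nodup : (pre ++ u :: post).Nodup
  fwd : ∃ h e, Trail nxt h (pre ++ [u]) e
  bwd : ∃ h e, Trail prv h (post.reverse ++ [u]) e

/-- The chain `d` has no longer both endpoints on the same link after the link is split at `u`. -/
def Crosses (src tgt num : ℕ → ℕ) (pre : List ℕ) (u : ℕ) (post : List ℕ) (d : ℕ) : Prop :=
  (src d ∈ pre ∧ num (tgt d) ≤ num u) ∨ (tgt d ∈ pre ∧ num (src d) ≤ num u) ∨
    (src d ∈ post ∧ num u ≤ num (tgt d)) ∨ (tgt d ∈ post ∧ num u ≤ num (src d))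

/-- The situation after `t₁` steps of the first and `t₂` steps of the second walker. -/
structure Lockstep (src tgt num nxt prv vtx twn : ℕ → ℕ) (m : ℕ) (S₀ : Finset ℕ) (ad₀ : List ℕ)
    (el₀ : ℕ → List ℕ) (pre : List ℕ) (u : ℕ) (post : List ℕ) (r₁ r₂ t₁ t₂ : ℕ) (s : State) :
    Prop where
  u_eq : s.regs .u = u
  m_eq : s.regs .numE = m
  num_eq : s.arrs .num = num
  nxt_eq : s.arrs .next = nxt
  prv_eq : s.arrs .prev = prv
  vtx_eq : s.arrs .entVertex = vtx
  twn_eq : s.arrs .entTwin = twn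
  core : ∃ S ad el, Assoc src tgt m S ad el s ∧ S ⊆ S₀ ∧
    (∀ d, d ∈ ad ↔ d ∈ ad₀ ∨ d ∈ S₀ ∧ d ∉ S) ∧
    (∀ d ∈ S₀, d ∉ S → Crosses src tgt num pre u post d) ∧
    (∀ y, (el y).length ≤ (el₀ y).length) ∧
    Walker el (fun z => num u < num (vtx (twn z))) (pre ++ [u]) r₁ t₁ (s.regs .p) (s.regs .a) ∧
    Walker el (fun z => num (vtx (twn z)) < num u) (post.reverse ++ [u]) r₂ t₂ (s.regs .q)
      (s.regs .b)

section Step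

variable {src tgt num nxt prv vtx twn : ℕ → ℕ} {m : ℕ} {S₀ : Finset ℕ} {ad₀ : List ℕ}
    {el₀ : ℕ → List ℕ} {pre : List ℕ} {u : ℕ} {post : List ℕ} {r₁ r₂ t₁ t₂ : ℕ} {s : State}

theorem mem_ad_erase {ad : List ℕ} {S : Finset ℕ} (hS : S ⊆ S₀)
    (h : ∀ d, d ∈ ad ↔ d ∈ ad₀ ∨ d ∈ S₀ ∧ d ∉ S) {c : ℕ} (hc : c ∈ S) (d : ℕ) :
    d ∈ c :: ad ↔ d ∈ ad₀ ∨ d ∈ S₀ ∧ d ∉ S.erase c := by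
  rw [List.mem_cons, h, Finset.mem_erase]
  by_cases hd : d = c
  · subst hd; simp [hS hc]
  · simp [hd]

/-- Vertices before `u` in the link have larger numbers, so a chain seen from there survives if and
only if its other endpoint has a number above that of `u`. A surviving entry is passed as good; a
chain that fails the test crosses `u` and moves to the list of addable chains. -/
theorem wp_stepFromFirst (hL : LinkAt num nxt prv pre u post)
    (h : Lockstep src tgt num nxt prv vtx twn m S₀ ad₀ el₀ pre u post r₁ r₂ t₁ t₂ s)
    (hpu : s.regs .p ≠ u) (hpq : s.regs .q ≠ s.regs .p) {k : ℕ} (hk : 200 ≤ k) :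
    WP stepFromFirst s k fun s' k' => k ≤ k' + 200 ∧
      Lockstep src tgt num nxt prv vtx twn m S₀ ad₀ el₀ pre u post r₁ r₂ (t₁ + 1) t₂ s' := by
  obtain ⟨hu, hm, hnum, hnxt, hprv, hvtx, htwn, S, ad, el, hA, hS, had, hcr, hle, W₁, W₂⟩ := h
  have hE := hA.lists
  have hpre : s.regs .p ∈ pre := by
    have := W₁.mem
    simp only [List.mem_append, List.mem_singleton] at this
    exact this.resolve_right hpu
  unfold stepFromFirst
  simp only [block, when]
  refine .ite (by simp; omega) (fun hb => ?_) fun hb => ?_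
  · simp at hb
    have ha := W₁.entry_mem hb
    obtain ⟨d, hd, hch, hcase⟩ := hA.cases ha
    refine .seq (.run 4 (by simp; omega) fun k₁ hk₁ => ?_)
    refine .seq (.run 4 (by simp at hk₁; omega) fun k₂ hk₂ => ?_)
    refine .seq (.run 4 (by simp at hk₁; omega) fun k₃ hk₃ => ?_)
    refine .seq (.run 4 (by simp at hk₁; omega) fun k₄ hk₄ => ?_)
    simp only [Test.cost, Expr.cost, cost_ofNat] at hk₁
    refine .seq (.ite (by simp; omega) (fun hg => ?_) fun hg => ?_)
    · simp [htwn, hvtx, hnum, hu] at hg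
      have hg' : num (vtx (twn (s.regs .a))) ≤ num u := by omega
      have hnp := hL.pre_gt _ hpre
      refine .seq (.run 12 (by simp; omega) fun k₅ hk₅ => ?_)
      simp only [Test.cost, Expr.cost, cost_ofNat, cost_add] at hk₅
      refine .conseq (wp_makeAddable (S := S) (ad := ad) (el := el) (d := d)
        (hA.congr (by by_cases h : s.regs .b = s.arrs .entTwin (s.regs .a) <;> simp [h])
          (by by_cases h : s.regs .b = s.arrs .entTwin (s.regs .a) <;> simp [h]))
        (by by_cases h : s.regs .b = s.arrs .entTwin (s.regs .a) <;> simpa [h] using hm)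
        (by by_cases h : s.regs .b = s.arrs .entTwin (s.regs .a) <;> simpa [h] using hch)
        hd (by omega)) ?_
      rintro s₆ k₆ ⟨hk₆, A₆⟩ hf₆
      refine .run 2 (by omega) fun k₇ hk₇ => ⟨by omega, ?_⟩
      have hr := hA.range d hd
      -- The entries of the chain are `d` and `m + d`; the walker looks at one of them and the other
      -- is its twin, in either order.
      have hkeep : ∀ z, decide (z ≠ d ∧ z ≠ m + d) = true ↔
          z ≠ s.regs .a ∧ z ≠ twn (s.regs .a) := by
        intro z
        rw [htwn] at hcase
        rw [decide_eq_true_iff]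
        rcases hcase with ⟨h₁, h₂, -⟩ | ⟨h₁, h₂, -⟩
        · rw [h₁, ← h₁, h₂, h₁]
        · rw [h₁, ← h₁, h₂, h₁]; exact and_comm
      -- The twin sits at a vertex whose number is at most that of `u`, whereas the walker's own
      -- vertex has a larger number.
      have hf : twn (s.regs .a) ∉ el (s.regs .p) := by
        intro hf
        have := hE.vtx _ _ hf
        rw [hvtx] at this
        rw [this] at hg'
        omega
      have hf0 : twn (s.regs .a) ≠ 0 := by
        rw [htwn] at hcase
        rcases hcase with ⟨-, h₂, -⟩ | ⟨-, h₂, -⟩ <;> omega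
      have ha' : s.regs .a ∉ el (s.regs .q) := fun h =>
        hpq ((hE.vtx _ _ h).symm.trans (hE.vtx _ _ ha))
      have V₁ := W₁.delete_own hE hb hf hkeep
      have V₂ := W₂.delete_other hE ha' hf0 hkeep
      have hcross : Crosses src tgt num pre u post d := by
        rw [htwn, hvtx] at hcase
        rcases hcase with ⟨-, -, h₂, h₃⟩ | ⟨-, -, h₂, h₃⟩
        · exact .inl ⟨by rwa [h₂], by rwa [← h₃]⟩
        · exact .inr (.inl ⟨by rwa [h₂], by rwa [← h₃]⟩)
      have p₆ : s₆.regs .p = s.regs .p := by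
        rw [hf₆.regs _ rfl]; by_cases h : s.regs .b = s.arrs .entTwin (s.regs .a) <;> simp [h]
      have q₆ : s₆.regs .q = s.regs .q := by
        rw [hf₆.regs _ rfl]; by_cases h : s.regs .b = s.arrs .entTwin (s.regs .a) <;> simp [h]
      have x₆ : s₆.regs .nxt = s.arrs .entNext (s.regs .a) := by
        rw [hf₆.regs _ rfl]; by_cases h : s.regs .b = s.arrs .entTwin (s.regs .a) <;> simp [h]
      have b₆ : s₆.regs .b =
          if s.regs .b = twn (s.regs .a) then s.arrs .entNext (s.regs .b) else s.regs .b := by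
        rw [hf₆.regs _ rfl, ← htwn]
        by_cases h : s.regs .b = s.arrs .entTwin (s.regs .a) <;> simp [h]
      constructor
      · simp; rw [hf₆.regs _ rfl]
        by_cases h : s.regs .b = s.arrs .entTwin (s.regs .a) <;> simpa [h] using hu
      · simp; rw [hf₆.regs _ rfl]
        by_cases h : s.regs .b = s.arrs .entTwin (s.regs .a) <;> simpa [h] using hm
      · simp; rw [hf₆.arrs _ rfl]
        by_cases h : s.regs .b = s.arrs .entTwin (s.regs .a) <;> simpa [h] using hnum
      · simp; rw [hf₆.arrs _ rfl]
        by_cases h : s.regs .b = s.arrs .entTwin (s.regs .a) <;> simpa [h] using hnxt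
      · simp; rw [hf₆.arrs _ rfl]
        by_cases h : s.regs .b = s.arrs .entTwin (s.regs .a) <;> simpa [h] using hprv
      · simp; rw [hf₆.arrs _ rfl]
        by_cases h : s.regs .b = s.arrs .entTwin (s.regs .a) <;> simpa [h] using hvtx
      · simp; rw [hf₆.arrs _ rfl]
        by_cases h : s.regs .b = s.arrs .entTwin (s.regs .a) <;> simpa [h] using htwn
      · refine ⟨S.erase d, d :: ad, _, A₆.congr (by simp) (by simp),
          (Finset.erase_subset _ _).trans hS, mem_ad_erase hS had hd, ?_, fun y =>
            (List.length_filter_le _ _).trans (hle y), ?_, ?_⟩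
        · intro c hc hc'
          by_cases hcd : c = d
          · rwa [hcd]
          · exact hcr c hc fun h => hc' (Finset.mem_erase.2 ⟨hcd, h⟩)
        · simpa [p₆, x₆] using V₁
        · simpa [q₆, b₆] using V₂
    · simp [htwn, hvtx, hnum, hu] at hg
      refine .run 1 (by simp; omega) fun k₅ hk₅ => ?_
      simp only [Test.cost, Expr.cost, cost_ofNat, cost_add] at hk₅
      refine .run 2 (by omega) fun k₆ hk₆ => ⟨by omega, ?_⟩
      exact ⟨by simpa using hu, by simpa using hm, by simpa using hnum, by simpa using hnxt,
        by simpa using hprv, by simpa using hvtx, by simpa using htwn, S, ad, el,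
        hA.congr (by simp) (by simp), hS, had, hcr, hle,
        by simpa using W₁.keep hE hb (by omega), by simpa using W₂⟩
  · simp at hb
    refine .seq (.run 3 (by simp; omega) fun k₁ hk₁ => ?_)
    simp only [Test.cost, Expr.cost, cost_ofNat, cost_add] at hk₁
    refine .run 3 (by omega) fun k₂ hk₂ => ⟨by omega, ?_⟩
    obtain ⟨hh, ee, htr⟩ := hL.fwd
    rw [hb] at W₁
    exact ⟨by simpa using hu, by simpa using hm, by simpa using hnum, by simpa using hnxt,
      by simpa using hprv, by simpa using hvtx, by simpa using htwn, S, ad, el,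
      hA.congr (by simp) (by simp), hS, had, hcr, hle,
      by simpa [hnxt] using W₁.move hE hpu htr, by simpa using W₂⟩

/-- This is the mirror image, with `post` in place of `pre` and the comparisons of numbers reversed.
-/
theorem wp_stepFromLast (hL : LinkAt num nxt prv pre u post)
    (h : Lockstep src tgt num nxt prv vtx twn m S₀ ad₀ el₀ pre u post r₁ r₂ t₁ t₂ s)
    (hqu : s.regs .q ≠ u) (hpq : s.regs .p ≠ s.regs .q) {k : ℕ} (hk : 200 ≤ k) :
    WP stepFromLast s k fun s' k' => k ≤ k' + 200 ∧
      Lockstep src tgt num nxt prv vtx twn m S₀ ad₀ el₀ pre u post r₁ r₂ t₁ (t₂ + 1) s' := by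
  obtain ⟨hu, hm, hnum, hnxt, hprv, hvtx, htwn, S, ad, el, hA, hS, had, hcr, hle, W₁, W₂⟩ := h
  have hE := hA.lists
  have hpost : s.regs .q ∈ post := by
    have := W₂.mem
    simp only [List.mem_append, List.mem_reverse, List.mem_singleton] at this
    exact this.resolve_right hqu
  unfold stepFromLast
  simp only [block, when]
  refine .ite (by simp; omega) (fun hb => ?_) fun hb => ?_
  · simp at hb
    have ha := W₂.entry_mem hb
    obtain ⟨d, hd, hch, hcase⟩ := hA.cases ha
    refine .seq (.run 4 (by simp; omega) fun k₁ hk₁ => ?_)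
    refine .seq (.run 4 (by simp at hk₁; omega) fun k₂ hk₂ => ?_)
    refine .seq (.run 4 (by simp at hk₁; omega) fun k₃ hk₃ => ?_)
    refine .seq (.run 4 (by simp at hk₁; omega) fun k₄ hk₄ => ?_)
    simp only [Test.cost, Expr.cost, cost_ofNat] at hk₁
    refine .seq (.ite (by simp; omega) (fun hg => ?_) fun hg => ?_)
    · simp [htwn, hvtx, hnum, hu] at hg
      have hg' : num u ≤ num (vtx (twn (s.regs .b))) := by omega
      have hnp := hL.post_lt _ hpost
      refine .seq (.run 12 (by simp; omega) fun k₅ hk₅ => ?_)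
      simp only [Test.cost, Expr.cost, cost_ofNat, cost_add] at hk₅
      refine .conseq (wp_makeAddable (S := S) (ad := ad) (el := el) (d := d)
        (hA.congr (by by_cases h : s.regs .a = s.arrs .entTwin (s.regs .b) <;> simp [h])
          (by by_cases h : s.regs .a = s.arrs .entTwin (s.regs .b) <;> simp [h]))
        (by by_cases h : s.regs .a = s.arrs .entTwin (s.regs .b) <;> simpa [h] using hm)
        (by by_cases h : s.regs .a = s.arrs .entTwin (s.regs .b) <;> simpa [h] using hch)
        hd (by omega)) ?_
      rintro s₆ k₆ ⟨hk₆, A₆⟩ hf₆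
      refine .run 2 (by omega) fun k₇ hk₇ => ⟨by omega, ?_⟩
      have hr := hA.range d hd
      have hkeep : ∀ z, decide (z ≠ d ∧ z ≠ m + d) = true ↔
          z ≠ s.regs .b ∧ z ≠ twn (s.regs .b) := by
        intro z
        rw [htwn] at hcase
        rw [decide_eq_true_iff]
        rcases hcase with ⟨h₁, h₂, -⟩ | ⟨h₁, h₂, -⟩
        · rw [h₁, ← h₁, h₂, h₁]
        · rw [h₁, ← h₁, h₂, h₁]; exact and_comm
      have hf : twn (s.regs .b) ∉ el (s.regs .q) := by
        intro hf
        have := hE.vtx _ _ hf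
        rw [hvtx] at this
        rw [this] at hg'
        omega
      have hf0 : twn (s.regs .b) ≠ 0 := by
        rw [htwn] at hcase
        rcases hcase with ⟨-, h₂, -⟩ | ⟨-, h₂, -⟩ <;> omega
      have ha' : s.regs .b ∉ el (s.regs .p) := fun h =>
        hpq ((hE.vtx _ _ h).symm.trans (hE.vtx _ _ ha))
      have V₂ := W₂.delete_own hE hb hf hkeep
      have V₁ := W₁.delete_other hE ha' hf0 hkeep
      have hcross : Crosses src tgt num pre u post d := by
        rw [htwn, hvtx] at hcase
        rcases hcase with ⟨-, -, h₂, h₃⟩ | ⟨-, -, h₂, h₃⟩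
        · exact .inr (.inr (.inl ⟨by rwa [h₂], by rwa [← h₃]⟩))
        · exact .inr (.inr (.inr ⟨by rwa [h₂], by rwa [← h₃]⟩))
      have p₆ : s₆.regs .q = s.regs .q := by
        rw [hf₆.regs _ rfl]; by_cases h : s.regs .a = s.arrs .entTwin (s.regs .b) <;> simp [h]
      have q₆ : s₆.regs .p = s.regs .p := by
        rw [hf₆.regs _ rfl]; by_cases h : s.regs .a = s.arrs .entTwin (s.regs .b) <;> simp [h]
      have x₆ : s₆.regs .nxt = s.arrs .entNext (s.regs .b) := by
        rw [hf₆.regs _ rfl]; by_cases h : s.regs .a = s.arrs .entTwin (s.regs .b) <;> simp [h]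
      have b₆ : s₆.regs .a =
          if s.regs .a = twn (s.regs .b) then s.arrs .entNext (s.regs .a) else s.regs .a := by
        rw [hf₆.regs _ rfl, ← htwn]
        by_cases h : s.regs .a = s.arrs .entTwin (s.regs .b) <;> simp [h]
      constructor
      · simp; rw [hf₆.regs _ rfl]
        by_cases h : s.regs .a = s.arrs .entTwin (s.regs .b) <;> simpa [h] using hu
      · simp; rw [hf₆.regs _ rfl]
        by_cases h : s.regs .a = s.arrs .entTwin (s.regs .b) <;> simpa [h] using hm
      · simp; rw [hf₆.arrs _ rfl]
        by_cases h : s.regs .a = s.arrs .entTwin (s.regs .b) <;> simpa [h] using hnum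
      · simp; rw [hf₆.arrs _ rfl]
        by_cases h : s.regs .a = s.arrs .entTwin (s.regs .b) <;> simpa [h] using hnxt
      · simp; rw [hf₆.arrs _ rfl]
        by_cases h : s.regs .a = s.arrs .entTwin (s.regs .b) <;> simpa [h] using hprv
      · simp; rw [hf₆.arrs _ rfl]
        by_cases h : s.regs .a = s.arrs .entTwin (s.regs .b) <;> simpa [h] using hvtx
      · simp; rw [hf₆.arrs _ rfl]
        by_cases h : s.regs .a = s.arrs .entTwin (s.regs .b) <;> simpa [h] using htwn
      · refine ⟨S.erase d, d :: ad, _, A₆.congr (by simp) (by simp),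
          (Finset.erase_subset _ _).trans hS, mem_ad_erase hS had hd, ?_, fun y =>
            (List.length_filter_le _ _).trans (hle y), ?_, ?_⟩
        · intro c hc hc'
          by_cases hcd : c = d
          · rwa [hcd]
          · exact hcr c hc fun h => hc' (Finset.mem_erase.2 ⟨hcd, h⟩)
        · simpa [q₆, b₆] using V₁
        · simpa [p₆, x₆] using V₂
    · simp [htwn, hvtx, hnum, hu] at hg
      refine .run 1 (by simp; omega) fun k₅ hk₅ => ?_
      simp only [Test.cost, Expr.cost, cost_ofNat, cost_add] at hk₅
      refine .run 2 (by omega) fun k₆ hk₆ => ⟨by omega, ?_⟩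
      exact ⟨by simpa using hu, by simpa using hm, by simpa using hnum, by simpa using hnxt,
        by simpa using hprv, by simpa using hvtx, by simpa using htwn, S, ad, el,
        hA.congr (by simp) (by simp), hS, had, hcr, hle,
        by simpa using W₁, by simpa using W₂.keep hE hb (by omega)⟩
  · simp at hb
    refine .seq (.run 3 (by simp; omega) fun k₁ hk₁ => ?_)
    simp only [Test.cost, Expr.cost, cost_ofNat, cost_add] at hk₁
    refine .run 3 (by omega) fun k₂ hk₂ => ⟨by omega, ?_⟩
    obtain ⟨hh, ee, htr⟩ := hL.bwd
    rw [hb] at W₂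
    exact ⟨by simpa using hu, by simpa using hm, by simpa using hnum, by simpa using hnxt,
      by simpa using hprv, by simpa using hvtx, by simpa using htwn, S, ad, el,
      hA.congr (by simp) (by simp), hS, had, hcr, hle,
      by simpa using W₁, by simpa [hprv] using W₂.move hE hqu htr⟩

end Step

/-! ### Splitting a link, its potential, and its implementation -/

namespace ChainDec

variable {G : Graph ℕ ℕ} {n : ℕ} {D : ChainDec G n}

/-- Both endpoints of the chain `d` are inner vertices of the same link. -/
def Same (D : ChainDec G n) (st lo : ℕ → ℕ) (d : ℕ) : Prop :=
  st (D.src d) = 1 ∧ st (D.tgt d) = 1 ∧ lo (D.src d) = lo (D.tgt d)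

namespace Links

variable {A : List ℕ} {st lo : ℕ → ℕ} {nL : ℕ} {lk : ℕ → List ℕ} {le : ℕ → ℕ} {L : ℕ}

theorem zero_notMem (hL : D.Links A st lo nL lk le) (L : ℕ) : 0 ∉ lk L := fun h => by
  have := (hL.mem_range h).1.1; omega

theorem pairwise (hL : D.Links A st lo nL lk le) (h1 : 1 ≤ L) (hn : L ≤ nL) :
    (lk L).Pairwise fun x y => D.num y < D.num x := by
  obtain ⟨u, h, t, ht, -⟩ := hL.link L h1 hn
  exact (D.trail_pairwise ht fun x => hL.mem_range).1

/-- The label of the link of a vertex after the link `pre ++ u :: post` has been split into the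
links `X` and `Y`. -/
def splitLabel (lo : ℕ → ℕ) (pre post : List ℕ) (X Y x : ℕ) : ℕ :=
  if x ∈ pre then X else if x ∈ post then Y else lo x

/-- The part `pre` keeps the first edge of the old link, while `post` starts with the parent edge of
the new branch vertex `u`. Leaving open which of the two labels is new covers both ways in which the
program may distribute the list headers. -/
theorem split (hL : D.Links A st lo nL lk le) (hA : D.Closed A) (h1 : 1 ≤ L) (hn : L ≤ nL)
    {pre post : List ℕ} {u : ℕ} (hlk : lk L = pre ++ u :: post) {X Y : ℕ}
    (hXY : X = L ∧ Y = nL + 1 ∨ X = nL + 1 ∧ Y = L) {le' : ℕ → ℕ} (hX : le' X = le L)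
    (hY : le' Y = D.parEdge u) (hle : ∀ M, M ≠ X → M ≠ Y → le' M = le M) :
    D.Links A (Function.update st u 2) (splitLabel lo pre post X Y) (nL + 1)
      (Function.update (Function.update lk X pre) Y post) le' := by
  have hmem := hL.mem L
  rw [hlk] at hmem
  have hu := (hmem u).1 (by simp)
  have hnd : (pre ++ u :: post).Nodup := hlk ▸ (hL.pairwise h1 hn).imp fun h => by
    rintro rfl; omega
  rw [List.nodup_append, List.nodup_cons] at hnd
  have hup : u ∉ pre := fun h => hnd.2.2 u h u (by simp) rfl
  have hpp : ∀ x ∈ pre, x ∉ post := fun x h h' => hnd.2.2 x h x (by simp [h']) rfl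
  have hne : ∀ x, x ∈ pre ∨ x ∈ post → x ≠ u := by
    rintro x (h | h) rfl
    · exact hup h
    · exact hnd.2.1.1 h
  have hin : ∀ x, x ∈ pre ∨ x ∈ post → (1 ≤ x ∧ x ≤ n) ∧ st x = 1 ∧ lo x = L := fun x h =>
    (hmem x).1 (by rcases h with h | h <;> simp [h])
  have hst2 : ∀ x, st x = 2 → Function.update st u 2 x = 2 := fun x h => by
    by_cases hxu : x = u
    · simp [hxu]
    · simpa [hxu] using h
  have hXne : X ≠ Y := by omega
  refine ⟨fun M x => ?_, fun x hx h => ?_, hst2 1 hL.one, fun x hx h => ?_, fun M hM1 hMn => ?_⟩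
  · have hout : x ∉ pre → x ∉ post → (1 ≤ x ∧ x ≤ n) → Function.update st u 2 x = 1 →
        lo x ≠ X ∧ lo x ≠ Y := by
      intro h₁ h₂ h₃ h₄
      have hxu : x ≠ u := by rintro rfl; simp at h₄
      rw [Function.update_of_ne hxu] at h₄
      have hb := hL.bound x h₃ h₄
      have : lo x ≠ L := fun h => by
        have := (hmem x).2 ⟨h₃, h₄, h⟩
        simp [h₁, h₂, hxu] at this
      omega
    have hM : x ∈ Function.update (Function.update lk X pre) Y post M ↔
        (M = X ∧ x ∈ pre) ∨ (M = Y ∧ x ∈ post) ∨ (M ≠ X ∧ M ≠ Y ∧ x ∈ lk M) := by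
      by_cases hMY : M = Y
      · subst hMY; simp [hXne.symm]
      · by_cases hMX : M = X
        · subst hMX; simp [hXne]
        · simp [hMX, hMY]
    rw [hM]
    unfold splitLabel
    constructor
    · rintro (⟨rfl, h⟩ | ⟨rfl, h⟩ | ⟨h₁, h₂, h⟩)
      · have := hin x (.inl h)
        refine ⟨this.1, ?_, by simp [h]⟩
        rw [Function.update_of_ne (hne x (.inl h))]; exact this.2.1
      · have := hin x (.inr h)
        refine ⟨this.1, ?_, ?_⟩
        · rw [Function.update_of_ne (hne x (.inr h))]; exact this.2.1
        · rw [if_neg fun h' => hpp x h' h, if_pos h]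
      · obtain ⟨a, b, c⟩ := (hL.mem M x).1 h
        have hML : M ≠ L := by omega
        have hx : x ∉ pre ++ u :: post := fun h' => hML (c.symm.trans ((hmem x).1 h').2.2)
        simp only [List.mem_append, List.mem_cons, not_or] at hx
        refine ⟨a, ?_, ?_⟩
        · rw [Function.update_of_ne hx.2.1]; exact b
        · rw [if_neg hx.1, if_neg hx.2.2]; exact c
    · rintro ⟨h₁, h₂, h₃⟩
      split_ifs at h₃ with h₄ h₅
      · exact .inl ⟨h₃.symm, h₄⟩
      · exact .inr (.inl ⟨h₃.symm, h₅⟩)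
      · have := hout h₄ h₅ h₁ h₂
        have hxu : x ≠ u := by rintro rfl; simp at h₂
        rw [Function.update_of_ne hxu] at h₂
        exact .inr (.inr ⟨by omega, by omega, (hL.mem M x).2 ⟨h₁, h₂, h₃⟩⟩)
  · have hxu : x ≠ u := by rintro rfl; simp at h
    rw [Function.update_of_ne hxu] at h
    have := hL.bound x hx h
    unfold splitLabel
    split_ifs <;> omega
  · by_cases hxu : x = u
    · rw [hxu]; exact hL.cov u hu.1 (by omega)
    · rw [Function.update_of_ne hxu] at h; exact hL.cov x hx h
  · obtain ⟨v, h, t, ht, htr, ht2, hl, hv2, hm, hc⟩ := hL.link L h1 hn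
    rw [hlk] at ht
    obtain ⟨y, hpre, rfl, hpost⟩ := Trail.append_iff.1 ht
    have hy1 : y ≠ 1 := by
      rintro rfl; have := hL.one; omega
    by_cases hMY : M = Y
    · subst hMY
      refine ⟨y, D.par y, t, by simpa using hpost, htr, hst2 t ht2, ?_, by simp, ?_, ?_⟩
      · rw [hY]; exact (D.tree y hu.1.1 hu.1.2 hy1).2.2.2
      · rw [hY]; exact hA.parEdge_mem hu.1 hy1 (hL.cov y hu.1 (by omega))
      · exact .inr ⟨y, hu.1, hy1, by simp, hY⟩
    · by_cases hMX : M = X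
      · subst hMX
        refine ⟨v, h, y, by simpa [hXne] using hpre, hu.1, by simp, by rwa [hX], hst2 v hv2,
          by rwa [hX], ?_⟩
        rw [hX]
        exact hc.imp_right fun ⟨w, h₁, h₂, h₃, h₄⟩ => ⟨w, h₁, h₂, hst2 w h₃, h₄⟩
      · have hMn' : M ≤ nL := by clear hc; omega
        obtain ⟨v, h, t, ht, htr, ht2, hl, hv2, hm, hc⟩ := hL.link M hM1 hMn'
        rw [hle M hMX hMY]
        refine ⟨v, h, t, by simpa [hMX, hMY] using ht, htr, hst2 t ht2, hl, hst2 v hv2, hm,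
          hc.imp_right fun ⟨w, h₁, h₂, h₃, h₄⟩ => ⟨w, h₁, h₂, hst2 w h₃, h₄⟩⟩

end Links

/-- Splitting a link does not bring the endpoints of a chain onto the same link. -/
theorem Same.of_split {A : List ℕ} {st lo : ℕ → ℕ} {nL : ℕ} {lk : ℕ → List ℕ} {le : ℕ → ℕ}
    {L : ℕ} (hL : D.Links A st lo nL lk le) {pre post : List ℕ} {u : ℕ}
    (hlk : lk L = pre ++ u :: post) {X Y : ℕ} {lk' : ℕ → List ℕ} {nL' : ℕ} {le' : ℕ → ℕ}
    (hL' : D.Links A (Function.update st u 2) (Links.splitLabel lo pre post X Y) nL'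
      (Function.update (Function.update lk' X pre) Y post) le') (hXY : X ≠ Y)
    {d : ℕ} (h1 : 1 ≤ d) (hd : d ≤ D.N)
    (h : D.Same (Function.update st u 2) (Links.splitLabel lo pre post X Y) d) :
    D.Same st lo d ∧ (D.src d ∈ pre ↔ D.tgt d ∈ pre) ∧ (D.src d ∈ post ↔ D.tgt d ∈ post) ∧
      D.src d ≠ u ∧ D.tgt d ≠ u := by
  obtain ⟨h₁, h₂, h₃⟩ := h
  have hs := D.src_mem h1 hd
  have ht := D.tgt_mem d h1 hd
  have hsu : D.src d ≠ u := fun h => by rw [h] at h₁; simp at h₁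
  have htu : D.tgt d ≠ u := fun h => by rw [h] at h₂; simp at h₂
  have hX : ∀ x, x ∈ pre ↔ (1 ≤ x ∧ x ≤ n) ∧ Function.update st u 2 x = 1 ∧
      Links.splitLabel lo pre post X Y x = X := fun x => by
    rw [← hL'.mem]; simp [hXY]
  have hY : ∀ x, x ∈ post ↔ (1 ≤ x ∧ x ≤ n) ∧ Function.update st u 2 x = 1 ∧
      Links.splitLabel lo pre post X Y x = Y := fun x => by
    rw [← hL'.mem]; simp
  have hpre : D.src d ∈ pre ↔ D.tgt d ∈ pre := by rw [hX, hX, h₁, h₂, h₃]; simp [hs, ht]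
  have hpost : D.src d ∈ post ↔ D.tgt d ∈ post := by rw [hY, hY, h₁, h₂, h₃]; simp [hs, ht]
  rw [Function.update_of_ne hsu] at h₁
  rw [Function.update_of_ne htu] at h₂
  refine ⟨⟨h₁, h₂, ?_⟩, hpre, hpost, hsu, htu⟩
  have hlo : ∀ x, x ∈ pre ∨ x ∈ post → lo x = L := fun x hx =>
    ((hL.mem L x).1 (by rw [hlk]; rcases hx with h | h <;> simp [h])).2.2
  by_cases hp : D.src d ∈ pre
  · rw [hlo _ (.inl hp), hlo _ (.inl (hpre.1 hp))]
  · by_cases hq : D.src d ∈ post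
    · rw [hlo _ (.inr hq), hlo _ (.inr (hpost.1 hq))]
    · have hp' := mt hpre.2 hp
      have hq' := mt hpost.2 hq
      simpa [Links.splitLabel, hp, hq, hp', hq'] using h₃

end ChainDec

/-- The potential of the links. -/
def potential (nL : ℕ) (lk el : ℕ → List ℕ) : ℕ :=
  ∑ M ∈ Finset.Icc 1 nL, logSum (weight el (lk M))

theorem potential_mono (nL : ℕ) (lk : ℕ → List ℕ) {el el' : ℕ → List ℕ}
    (h : ∀ y, (el' y).length ≤ (el y).length) : potential nL lk el' ≤ potential nL lk el :=
  Finset.sum_le_sum fun M _ => logSum_mono (weight_mono (lk M) fun y _ => h y)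

theorem potential_succ (nL : ℕ) (lk el : ℕ → List ℕ) :
    potential (nL + 1) lk el = potential nL lk el + logSum (weight el (lk (nL + 1))) :=
  Finset.sum_Icc_succ_top (by omega) _

theorem potential_update {nL L : ℕ} (h1 : 1 ≤ L) (hn : L ≤ nL) (lk el : ℕ → List ℕ)
    (l : List ℕ) : potential nL (Function.update lk L l) el + logSum (weight el (lk L)) =
      potential nL lk el + logSum (weight el l) := by
  have hm : L ∈ Finset.Icc 1 nL := Finset.mem_Icc.2 ⟨h1, hn⟩
  unfold potential
  rw [← Finset.add_sum_erase _ _ hm, ← Finset.add_sum_erase _ (fun M => logSum (weight el (lk M))) hm,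
    Finset.sum_congr rfl (g := fun M => logSum (weight el (lk M)))
      (fun x hx => by rw [Function.update_of_ne (Finset.ne_of_mem_erase hx)])]
  simp only [Function.update_self]
  omega

theorem potential_congr {nL : ℕ} {lk lk' : ℕ → List ℕ} (el : ℕ → List ℕ)
    (h : ∀ M, 1 ≤ M → M ≤ nL → lk' M = lk M) : potential nL lk' el = potential nL lk el :=
  Finset.sum_congr rfl fun M hM => by rw [h M (Finset.mem_Icc.1 hM).1 (Finset.mem_Icc.1 hM).2]

/-- Only the split link contributes to the change, by `logSum_split`. The released minimum pays for
the lockstep walk and for redirecting the pointers of one part, the rest for `u` and for the chains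
stored there. -/
theorem potential_split {nL L : ℕ} (h1 : 1 ≤ L) (hn : L ≤ nL) {lk : ℕ → List ℕ}
    (el : ℕ → List ℕ) {pre post : List ℕ} {u : ℕ} (hlk : lk L = pre ++ u :: post) {X Y : ℕ}
    (hXY : X = L ∧ Y = nL + 1 ∨ X = nL + 1 ∧ Y = L) :
    potential (nL + 1) (Function.update (Function.update lk X pre) Y post) el +
      (min (weight el pre) (weight el post) + (1 + (el u).length)) ≤ potential nL lk el := by
  have hs := logSum_split (weight el pre) (weight el post) (el u).length
  have hw : weight el (lk L) = weight el pre + (1 + (el u).length + weight el post) := by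
    rw [hlk]; simp
  rw [← hw] at hs
  rw [potential_succ]
  rcases hXY with ⟨rfl, rfl⟩ | ⟨rfl, rfl⟩
  · rw [Function.update_self, potential_congr (lk := Function.update lk X pre) el
      fun M _ hM => Function.update_of_ne (by omega) _ _]
    have := potential_update h1 hn lk el pre
    omega
  · rw [Function.update_comm (by omega), Function.update_self,
      potential_congr (lk := Function.update lk Y post) el
      fun M _ hM => Function.update_of_ne (by omega) _ _]
    have := potential_update h1 hn lk el post
    omega

/-- Splitting a doubly linked list does not affect a disjoint list. -/
theorem DLL.split_other {nx pv : ℕ → ℕ} {h t h' t' z : ℕ} {l l₁ l₂ : List ℕ}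
    (hl : DLL nx pv h' t' l) (hd : DLL nx pv h t (l₁ ++ z :: l₂))
    (hdis : ∀ x ∈ l, x ∉ l₁ ∧ x ∉ l₂) :
    DLL (if pv z = 0 then nx else Function.update nx (pv z) 0)
      (if nx z = 0 then pv else Function.update pv (nx z) 0) h' t' l := by
  refine hl.congr (fun x hx => ?_) fun x hx => ?_
  · split_ifs with h0
    · rfl
    · refine Function.update_of_ne ?_ _ _
      rintro rfl
      rw [hd.prev_eq] at h0 hx
      exact (hdis _ hx).1 (DLL.getLastD_mem h0)
  · split_ifs with h0
    · rfl
    · refine Function.update_of_ne ?_ _ _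
      rintro rfl
      rw [hd.next_eq] at h0 hx
      exact (hdis _ hx).2 (DLL.headD_mem h0)

theorem wp_redirectPointers {s : State} {l : List ℕ}
    (hl : Trail (s.arrs .next) (s.arrs .linkFirst (s.regs .numL)) l 0) (h0 : 0 ∉ l) {k : ℕ}
    (hk : 20 * l.length + 20 ≤ k) :
    WP redirectPointers s k fun s' k' => k ≤ k' + (20 * l.length + 20) ∧
      s'.arrs .linkOf = fun x => if x ∈ l then s.regs .numL else s.arrs .linkOf x := by
  unfold redirectPointers
  simp only [block]
  refine .seq (.run 5 (by omega) fun k₁ hk₁ => ?_)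
  refine .while (fun s' k' => ∃ l₁ l₂, l = l₁ ++ l₂ ∧ Trail (s.arrs .next) (s'.regs .y) l₂ 0 ∧
    s'.arrs .linkOf = (fun x => if x ∈ l₁ then s.regs .numL else s.arrs .linkOf x) ∧
    k + 20 * l₂.length ≤ k' + (20 * l.length + 5) ∧ 20 * l₂.length + 15 ≤ k')
    ⟨[], l, rfl, by simpa using hl, by simp, by omega, by omega⟩ ?_
  rintro s' k' ⟨l₁, l₂, rfl, ht, hlo, hk₂, hk₃⟩ hf
  have hnx : s'.arrs .next = s.arrs .next := by rw [hf.arrs _ rfl]; simp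
  have hnl : s'.regs .numL = s.regs .numL := by rw [hf.regs _ rfl]; simp
  refine ⟨by simp; omega, fun hb => ?_, fun hb => ?_⟩
  · simp at hb
    obtain ⟨l₃, rfl, ht'⟩ := ht.exists_cons hb
    simp only [List.length_cons] at hk₂ hk₃
    refine .run 8 (by simp; omega) fun k₄ hk₄ => ⟨l₁ ++ [s'.regs .y], l₃, by simp, ?_, ?_, ?_, ?_⟩
    · simpa [hnx] using ht'
    · funext x
      simp only [run, Expr.eval, regs_setCell, arrs_setCell, arrs_setReg, hnl, hlo, if_true,
        Function.update_apply, List.mem_append, List.mem_singleton]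
      by_cases hx : x = s'.regs .y <;> simp [hx]
    · simp at hk₂ hk₄ ⊢; omega
    · simp at hk₄ ⊢; omega
  · simp at hb
    rw [hb] at ht
    have : l₂ = [] := ht.eq_nil_of_notMem fun h => h0 (by simp [h])
    subst this
    refine ⟨by simp at hk₂ ⊢; omega, by simpa using hlo⟩

/-- The effect of splitting the link `L` with the inner vertices `pre ++ u :: post` into the links
`X` and `Y`. -/
structure SplitAt (D : ℕ → ℕ) (s s' : State) (pre : List ℕ) (u : ℕ) (post : List ℕ) (L X Y : ℕ) :
    Prop where
  labels : X = L ∧ Y = s.regs .numL + 1 ∨ X = s.regs .numL + 1 ∧ Y = L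
  numL : s'.regs .numL = s.regs .numL + 1
  linkOf : s'.arrs .linkOf = ChainDec.Links.splitLabel (s.arrs .linkOf) pre post X Y
  edge : s'.arrs .linkEdge X = s.arrs .linkEdge L ∧ s'.arrs .linkEdge Y = D u ∧
    ∀ M, M ≠ X → M ≠ Y → s'.arrs .linkEdge M = s.arrs .linkEdge M
  dll : ∀ M l, M ≠ X → M ≠ Y → (∀ x ∈ l, x ∉ pre ∧ x ∉ post) →
    DLL (s.arrs .next) (s.arrs .prev) (s.arrs .linkFirst M) (s.arrs .linkLast M) l →
    DLL (s'.arrs .next) (s'.arrs .prev) (s'.arrs .linkFirst M) (s'.arrs .linkLast M) l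
  dll₁ : DLL (s'.arrs .next) (s'.arrs .prev) (s'.arrs .linkFirst X) (s'.arrs .linkLast X) pre
  dll₂ : DLL (s'.arrs .next) (s'.arrs .prev) (s'.arrs .linkFirst Y) (s'.arrs .linkLast Y) post

section Split

variable {pe : ℕ → ℕ} {s : State} {pre post : List ℕ} {u L : ℕ}

theorem wp_splitOffFirstPart (hu : s.regs .u = u) (hL : s.regs .L = L) (hLn : L ≤ s.regs .numL)
    (hpe : s.arrs .parEdge = pe)
    (hd : DLL (s.arrs .next) (s.arrs .prev) (s.arrs .linkFirst L) (s.arrs .linkLast L)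
      (pre ++ u :: post))
    (hn : (pre ++ u :: post).Nodup) (h0 : 0 ∉ pre ++ u :: post)
    (hlo : ∀ x ∈ pre ++ u :: post, s.arrs .linkOf x = L) {k : ℕ}
    (hk : 20 * pre.length + 200 ≤ k) :
    WP splitOffFirstPart s k fun s' k' => k ≤ k' + (20 * pre.length + 200) ∧
      SplitAt pe s s' pre u post L (s.regs .numL + 1) L := by
  have hp := hd.prev_eq
  have hx := hd.next_eq
  obtain ⟨d₁, d₂⟩ := hd.split hn h0
  have hLn' : L ≠ s.regs .numL + 1 := by omega
  have hnd := hn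
  rw [List.nodup_append, List.nodup_cons] at hnd
  have hpu : s.arrs .prev u ≠ 0 → s.arrs .prev u ≠ u := fun h h' => by
    rw [hp] at h h'
    have := DLL.getLastD_mem h
    rw [h'] at this
    exact hnd.2.2 u this u (by simp) rfl
  -- The pointer that is cut belongs to the predecessor of `u` and not to `u` itself, so later reads
  -- at `u` still see the original list. The proof then distinguishes whether `u` has a predecessor
  -- and a successor within the link.
  have hU : s.arrs .prev u ≠ 0 → ∀ (f : ℕ → ℕ) v, Function.update f (s.arrs .prev u) v u = f u :=
    fun h f v => Function.update_of_ne (hpu h).symm _ _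
  have h0' : 0 ∉ pre := fun h => h0 (by simp [h])
  unfold splitOffFirstPart
  simp only [block]
  refine .seq (.run 10 (by omega) fun k₁ hk₁ => ?_)
  refine .seq (.run 10 (by omega) fun k₂ hk₂ => ?_)
  refine .seq (.run 10 (by omega) fun k₃ hk₃ => ?_)
  refine .seq (.run 30 (by omega) fun k₄ hk₄ => ?_)
  refine .seq (.run 10 (by omega) fun k₅ hk₅ => ?_)
  refine .seq (.run 10 (by omega) fun k₆ hk₆ => ?_)
  refine .seq (.run 30 (by omega) fun k₇ hk₇ => ?_)
  have f₁ := d₁.fwd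
  refine .conseq (wp_redirectPointers (l := pre) ?_ h0' (by omega)) ?_
  · by_cases hp0 : s.arrs .prev u = 0 <;> by_cases hx0 : s.arrs .next u = 0 <;>
      simpa [hu, hL, hp0, hx0, hU, hLn', hLn'.symm] using f₁
  rintro s' k' ⟨hk', hlo'⟩ hf
  have e₁ : s'.regs .numL = s.regs .numL + 1 := by
    rw [hf.regs _ rfl]
    by_cases hp0 : s.arrs .prev u = 0 <;> by_cases hx0 : s.arrs .next u = 0 <;>
      simp [hu, hL, hp0, hx0, hU]
  have e₂ : s'.arrs .linkOf = fun x => if x ∈ pre then s.regs .numL + 1 else s.arrs .linkOf x := by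
    rw [hlo']
    by_cases hp0 : s.arrs .prev u = 0 <;> by_cases hx0 : s.arrs .next u = 0 <;>
      simp [hu, hL, hp0, hx0, hU]
  have e₃ : s'.arrs .linkEdge = Function.update (Function.update (s.arrs .linkEdge)
      (s.regs .numL + 1) (s.arrs .linkEdge L)) L (pe u) := by
    rw [hf.arrs _ rfl]
    by_cases hp0 : s.arrs .prev u = 0 <;> by_cases hx0 : s.arrs .next u = 0 <;>
      simp [hu, hL, hp0, hx0, hU, hpe]
  have e₄ : s'.arrs .next = if s.arrs .prev u = 0 then s.arrs .next else
      Function.update (s.arrs .next) (s.arrs .prev u) 0 := by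
    rw [hf.arrs _ rfl]
    by_cases hp0 : s.arrs .prev u = 0 <;> by_cases hx0 : s.arrs .next u = 0 <;>
      simp [hu, hL, hp0, hx0, hU]
  have e₅ : s'.arrs .prev = if s.arrs .next u = 0 then s.arrs .prev else
      Function.update (s.arrs .prev) (s.arrs .next u) 0 := by
    rw [hf.arrs _ rfl]
    by_cases hp0 : s.arrs .prev u = 0 <;> by_cases hx0 : s.arrs .next u = 0 <;>
      simp [hu, hL, hp0, hx0, hU]
  have e₆ : s'.arrs .linkFirst = Function.update (Function.update (s.arrs .linkFirst)
      (s.regs .numL + 1) (if s.arrs .prev u = 0 then 0 else s.arrs .linkFirst L)) L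
      (s.arrs .next u) := by
    rw [hf.arrs _ rfl]
    by_cases hp0 : s.arrs .prev u = 0 <;> by_cases hx0 : s.arrs .next u = 0 <;>
      simp [hu, hL, hp0, hx0, hU]
  have e₇ : s'.arrs .linkLast = Function.update (Function.update (s.arrs .linkLast)
      (s.regs .numL + 1) (s.arrs .prev u)) L
      (if s.arrs .next u = 0 then 0 else s.arrs .linkLast L) := by
    rw [hf.arrs _ rfl]
    by_cases hp0 : s.arrs .prev u = 0 <;> by_cases hx0 : s.arrs .next u = 0 <;>
      simp [hu, hL, hp0, hx0, hU, Function.update_comm hLn', hLn', hLn'.symm]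
  refine ⟨by omega, .inr ⟨rfl, rfl⟩, e₁, ?_, ⟨?_, ?_, fun M h₁ h₂ => ?_⟩, fun M l h₁ h₂ hl h => ?_,
    ?_, ?_⟩
  · rw [e₂]
    funext x
    unfold ChainDec.Links.splitLabel
    split_ifs with h h'
    · rfl
    · exact hlo x (by simp [h'])
    · rfl
  · simp [e₃, hLn'.symm]
  · simp [e₃]
  · simp [e₃, h₁, h₂]
  · rw [e₄, e₅, e₆, e₇]
    simp only [Function.update_of_ne h₁, Function.update_of_ne h₂]
    exact h.split_other hd hl
  · rw [e₄, e₅, e₆, e₇]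
    simpa [hLn'.symm] using d₁
  · rw [e₄, e₅, e₆, e₇]
    simpa using d₂

theorem wp_splitOffLastPart (hu : s.regs .u = u) (hL : s.regs .L = L) (hLn : L ≤ s.regs .numL)
    (hpe : s.arrs .parEdge = pe)
    (hd : DLL (s.arrs .next) (s.arrs .prev) (s.arrs .linkFirst L) (s.arrs .linkLast L)
      (pre ++ u :: post))
    (hn : (pre ++ u :: post).Nodup) (h0 : 0 ∉ pre ++ u :: post)
    (hlo : ∀ x ∈ pre ++ u :: post, s.arrs .linkOf x = L) {k : ℕ}
    (hk : 20 * post.length + 200 ≤ k) :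
    WP splitOffLastPart s k fun s' k' => k ≤ k' + (20 * post.length + 200) ∧
      SplitAt pe s s' pre u post L L (s.regs .numL + 1) := by
  have hp := hd.prev_eq
  have hx := hd.next_eq
  obtain ⟨d₁, d₂⟩ := hd.split hn h0
  have hLn' : L ≠ s.regs .numL + 1 := by omega
  have hnd := hn
  rw [List.nodup_append, List.nodup_cons] at hnd
  have hxu : s.arrs .next u ≠ 0 → s.arrs .next u ≠ u := fun h h' => by
    rw [hx] at h h'
    have := DLL.headD_mem h
    rw [h'] at this
    exact hnd.2.1.1 this
  have hU : s.arrs .next u ≠ 0 → ∀ (f : ℕ → ℕ) v, Function.update f (s.arrs .next u) v u = f u :=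
    fun h f v => Function.update_of_ne (hxu h).symm _ _
  have h0' : 0 ∉ post := fun h => h0 (by simp [h])
  unfold splitOffLastPart
  simp only [block]
  refine .seq (.run 10 (by omega) fun k₁ hk₁ => ?_)
  refine .seq (.run 10 (by omega) fun k₂ hk₂ => ?_)
  refine .seq (.run 10 (by omega) fun k₃ hk₃ => ?_)
  refine .seq (.run 30 (by omega) fun k₄ hk₄ => ?_)
  refine .seq (.run 10 (by omega) fun k₅ hk₅ => ?_)
  refine .seq (.run 30 (by omega) fun k₆ hk₆ => ?_)
  have f₂ := d₂.fwd
  refine .conseq (wp_redirectPointers (l := post) ?_ h0' (by omega)) ?_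
  · by_cases hp0 : s.arrs .prev u = 0 <;> by_cases hx0 : s.arrs .next u = 0 <;>
      simpa [hu, hL, hp0, hx0, hU, hLn', hLn'.symm] using f₂
  rintro s' k' ⟨hk', hlo'⟩ hf
  have e₁ : s'.regs .numL = s.regs .numL + 1 := by
    rw [hf.regs _ rfl]
    by_cases hp0 : s.arrs .prev u = 0 <;> by_cases hx0 : s.arrs .next u = 0 <;>
      simp [hu, hL, hp0, hx0, hU]
  have e₂ : s'.arrs .linkOf = fun x => if x ∈ post then s.regs .numL + 1 else s.arrs .linkOf x := by
    rw [hlo']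
    by_cases hp0 : s.arrs .prev u = 0 <;> by_cases hx0 : s.arrs .next u = 0 <;>
      simp [hu, hL, hp0, hx0, hU]
  have e₃ : s'.arrs .linkEdge = Function.update (s.arrs .linkEdge)
      (s.regs .numL + 1) (pe u) := by
    rw [hf.arrs _ rfl]
    by_cases hp0 : s.arrs .prev u = 0 <;> by_cases hx0 : s.arrs .next u = 0 <;>
      simp [hu, hL, hp0, hx0, hU, hpe]
  have e₄ : s'.arrs .next = if s.arrs .prev u = 0 then s.arrs .next else
      Function.update (s.arrs .next) (s.arrs .prev u) 0 := by
    rw [hf.arrs _ rfl]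
    by_cases hp0 : s.arrs .prev u = 0 <;> by_cases hx0 : s.arrs .next u = 0 <;>
      simp [hu, hL, hp0, hx0, hU]
  have e₅ : s'.arrs .prev = if s.arrs .next u = 0 then s.arrs .prev else
      Function.update (s.arrs .prev) (s.arrs .next u) 0 := by
    rw [hf.arrs _ rfl]
    by_cases hp0 : s.arrs .prev u = 0 <;> by_cases hx0 : s.arrs .next u = 0 <;>
      simp [hu, hL, hp0, hx0, hU]
  have e₆ : s'.arrs .linkFirst = Function.update (Function.update (s.arrs .linkFirst)
      (s.regs .numL + 1) (s.arrs .next u)) L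
      (if s.arrs .prev u = 0 then 0 else s.arrs .linkFirst L) := by
    rw [hf.arrs _ rfl]
    by_cases hp0 : s.arrs .prev u = 0 <;> by_cases hx0 : s.arrs .next u = 0 <;>
      simp [hu, hL, hp0, hx0, hU, Function.update_comm hLn', hLn', hLn'.symm]
  have e₇ : s'.arrs .linkLast = Function.update (Function.update (s.arrs .linkLast)
      (s.regs .numL + 1) (if s.arrs .next u = 0 then 0 else s.arrs .linkLast L)) L
      (s.arrs .prev u) := by
    rw [hf.arrs _ rfl]
    by_cases hp0 : s.arrs .prev u = 0 <;> by_cases hx0 : s.arrs .next u = 0 <;>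
      simp [hu, hL, hp0, hx0, hU]
  refine ⟨by omega, .inl ⟨rfl, rfl⟩, e₁, ?_, ⟨?_, ?_, fun M h₁ h₂ => ?_⟩, fun M l h₁ h₂ hl h => ?_,
    ?_, ?_⟩
  · rw [e₂]
    funext x
    unfold ChainDec.Links.splitLabel
    split_ifs with h h' h'
    · exact absurd rfl (hnd.2.2 x h' x (by simp [h]))
    · rfl
    · exact hlo x (by simp [h'])
    · rfl
  · simp [e₃, hLn']
  · simp [e₃]
  · simp [e₃, h₁, h₂]
  · rw [e₄, e₅, e₆, e₇]
    simp only [Function.update_of_ne h₁, Function.update_of_ne h₂]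
    exact h.split_other hd hl
  · rw [e₄, e₅, e₆, e₇]
    simpa using d₁
  · rw [e₄, e₅, e₆, e₇]
    simpa [hLn'.symm] using d₂

end Split

/-! ### Stored configurations and turning a vertex into a branch vertex -/

namespace ChainDec

variable {G : Graph ℕ ℕ} {n : ℕ}

/-- The arrays and registers of the state `s` hold the chain decomposition `D`. -/
structure Stored (D : ChainDec G n) (m : ℕ) (s : State) : Prop where
  numE : s.regs .numE = m
  numC : s.regs .numC = D.N
  le : D.N ≤ m
  num : s.arrs .num = D.num
  par : s.arrs .par = D.par
  parEdge : s.arrs .parEdge = D.parEdge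
  low : s.arrs .low = D.low
  src : s.arrs .src = D.src
  tgt : s.arrs .tgt = D.tgt
  back : s.arrs .backEdge = D.backEdge
  child : ∀ c, Trail (s.arrs .childNext) (s.arrs .childHead c) (D.ch c) 0

/-- The state `s` holds the links `lk` of the union of the chains in `A`, the set `S` of pending
chains with both endpoints on the same link, stored in the lists `el` of their endpoints, and the
list `ad` of addable chains. -/
structure Conf (D : ChainDec G n) (m : ℕ) (A : List ℕ) (lk el : ℕ → List ℕ) (S : Finset ℕ)
    (ad : List ℕ) (s : State) : Prop where
  links : D.Links A (s.arrs .status) (s.arrs .linkOf) (s.regs .numL) lk (s.arrs .linkEdge)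
  dll : ∀ L, 1 ≤ L → L ≤ s.regs .numL →
    DLL (s.arrs .next) (s.arrs .prev) (s.arrs .linkFirst L) (s.arrs .linkLast L) (lk L)
  assoc : Assoc D.src D.tgt m S ad el s
  same : ∀ d ∈ S, D.Same (s.arrs .status) (s.arrs .linkOf) d
  diff : ∀ d ∈ ad, ¬ D.Same (s.arrs .status) (s.arrs .linkOf) d
  range : ∀ d, d ∈ S ∨ d ∈ ad → 1 ≤ d ∧ d ≤ D.N

end ChainDec

/-- The two walkers proceed in lockstep until one of them reaches `u`. -/
theorem wp_lockstep {src tgt num nxt prv vtx twn : ℕ → ℕ} {m : ℕ} {S₀ : Finset ℕ} {ad₀ : List ℕ}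
    {el₀ : ℕ → List ℕ} {pre : List ℕ} {u : ℕ} {post : List ℕ} {r₁ r₂ : ℕ} {s : State}
    (hL : LinkAt num nxt prv pre u post)
    (h : Lockstep src tgt num nxt prv vtx twn m S₀ ad₀ el₀ pre u post r₁ r₂ 0 0 s)
    {k : ℕ} (hk : 420 * min r₁ r₂ + 20 ≤ k) :
    WP (.while (.and (.ne (.reg .p) (.reg .u)) (.ne (.reg .q) (.reg .u)))
      (block [stepFromFirst, stepFromLast])) s k fun s' k' =>
      ∃ t, t < min r₁ r₂ ∧ k ≤ k' + 420 * t + 20 ∧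
        Lockstep src tgt num nxt prv vtx twn m S₀ ad₀ el₀ pre u post r₁ r₂ t t s' ∧
        (s'.regs .p = u ∨ s'.regs .q = u) := by
  refine .while (fun s' k' => ∃ t, t < min r₁ r₂ ∧ k ≤ k' + 420 * t ∧
    Lockstep src tgt num nxt prv vtx twn m S₀ ad₀ el₀ pre u post r₁ r₂ t t s')
    ⟨0, ?_, by omega, h⟩ ?_
  · obtain ⟨-, -, -, -, -, -, -, S, ad, el, -, -, -, -, -, W₁, W₂⟩ := h
    have := W₁.lt
    have := W₂.lt
    omega
  rintro s' k' ⟨t, ht, hk', h⟩ -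
  have hu := h.u_eq
  obtain ⟨S, ad, el, -, -, -, -, -, W₁, W₂⟩ := h.core
  have hpm := W₁.mem
  have hqm := W₂.mem
  -- The walkers stand at different vertices while both are under way, as each step requires; in
  -- particular this is still so after the first of them has moved in a round.
  have hpp : ∀ y, y ∈ pre ++ [u] → ∀ z ∈ post, y ≠ z := by
    rintro y hy z hz rfl
    have := hL.post_lt y hz
    simp only [List.mem_append, List.mem_singleton] at hy
    rcases hy with hy | hy
    · have := hL.pre_gt y hy; omega
    · rw [hy] at this; omega
  refine ⟨by simp; omega, fun hb => ?_, fun hb => ?_⟩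
  · simp only [Test.Holds, Expr.eval, hu] at hb
    have hq : s'.regs .q ∈ post := by
      simp only [List.mem_append, List.mem_reverse, List.mem_singleton] at hqm
      exact hqm.resolve_right hb.2
    simp only [block]
    refine .seq (.conseq (wp_stepFromFirst hL h hb.1 (hpp _ hpm _ hq).symm (by simp; omega)) ?_)
    rintro s₁ k₁ ⟨hk₁, h₁⟩ hf₁
    have q₁ : s₁.regs .q = s'.regs .q := hf₁.regs _ rfl
    obtain ⟨S₁, ad₁, el₁, -, -, -, -, -, V₁, V₂⟩ := h₁.core
    refine .conseq (wp_stepFromLast hL h₁ (by rw [q₁]; exact hb.2)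
      (hpp _ V₁.mem _ (by rwa [q₁])) (by simp at hk₁; omega)) ?_
    rintro s₂ k₂ ⟨hk₂, h₂⟩ hf₂
    refine ⟨t + 1, ?_, by simp at hk₁; omega, h₂⟩
    obtain ⟨-, -, -, -, -, -, -, S, ad, el, -, -, -, -, -, W₁, W₂⟩ := h₂
    have := W₁.lt
    have := W₂.lt
    omega
  · simp only [Test.Holds, Expr.eval, hu] at hb
    exact ⟨t, ht, by simp; omega, h, by tauto⟩

/-- The remaining chains incident to `u` become addable. -/
theorem wp_release {src tgt : ℕ → ℕ} {m : ℕ} {S₀ : Finset ℕ} {ad₀ : List ℕ} {el₀ : ℕ → List ℕ}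
    {u : ℕ} {s : State} (h : Assoc src tgt m S₀ ad₀ el₀ s) (hu : s.regs .u = u)
    (hm : s.regs .numE = m) {k : ℕ} (hk : 130 * (el₀ u).length + 20 ≤ k) :
    WP (.while (.ne (.get .listHead (.reg .u)) (.const 0))
      (block [.assign .d (.get .entChain (.get .listHead (.reg .u))), makeAddable])) s k
      fun s' k' => ∃ S ad el, k ≤ k' + 130 * (el₀ u).length + 20 ∧
        Assoc src tgt m S ad el s' ∧ S ⊆ S₀ ∧ (∀ d, d ∈ ad ↔ d ∈ ad₀ ∨ d ∈ S₀ ∧ d ∉ S) ∧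
        (∀ d ∈ S₀, d ∉ S ↔ src d = u ∨ tgt d = u) ∧
        ∀ y, (el y).length ≤ (el₀ y).length := by
  refine .while (fun s' k' => ∃ S ad el, Assoc src tgt m S ad el s' ∧ S ⊆ S₀ ∧
    (∀ d, d ∈ ad ↔ d ∈ ad₀ ∨ d ∈ S₀ ∧ d ∉ S) ∧
    (∀ d ∈ S₀, d ∉ S → src d = u ∨ tgt d = u) ∧
    (∀ y, (el y).length ≤ (el₀ y).length) ∧
    k + 130 * (el u).length ≤ k' + 130 * (el₀ u).length)
    ⟨S₀, ad₀, el₀, h, subset_rfl, by simp, fun d h h' => absurd h h', fun _ => le_rfl, le_rfl⟩ ?_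
  rintro s' k' ⟨S, ad, el, hA, hS, had, hd, hle, hk'⟩ hf
  have hu' : s'.regs .u = u := by rw [hf.regs _ rfl]; exact hu
  have hm' : s'.regs .numE = m := by rw [hf.regs _ rfl]; exact hm
  have hhd := hA.lists.head u
  have hleu := hle u
  refine ⟨by simp; omega, fun hb => ?_, fun hb => ?_⟩
  · simp only [Test.Holds, Expr.eval, hu'] at hb
    simp only [Test.cost, Expr.cost, cost_ofNat]
    have hm1 : s'.arrs .listHead u ∈ el u := by rw [hhd] at hb ⊢; exact DLL.headD_mem hb
    obtain ⟨d, hdS, hch, hcase⟩ := hA.cases hm1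
    have hpos : 1 ≤ (el u).length := List.length_pos_of_mem hm1
    simp only [block]
    refine .seq (.run 5 (by omega) fun k₁ hk₁ => ?_)
    refine .conseq (wp_makeAddable (S := S) (ad := ad) (el := el) (d := d)
      (hA.congr (by simp) (by simp)) (by simpa using hm') (by simpa [hu'] using hch) hdS
      (by omega)) ?_
    rintro s₂ k₂ ⟨hk₂, A₂⟩ -
    refine ⟨_, _, _, A₂, (Finset.erase_subset _ _).trans hS, mem_ad_erase hS had hdS, ?_,
      fun y => (List.length_filter_le _ _).trans (hle y), ?_⟩
    · intro c hc hc'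
      by_cases hcd : c = d
      · rw [hcd]
        rcases hcase with ⟨-, -, h, -⟩ | ⟨-, -, h, -⟩
        · exact .inl h
        · exact .inr h
      · exact hd c hc fun h => hc' (Finset.mem_erase.2 ⟨hcd, h⟩)
    · have hlt : ((el u).filter fun z => z ≠ d ∧ z ≠ m + d).length < (el u).length := by
        refine List.length_filter_lt_length_iff_exists.2 ⟨_, hm1, ?_⟩
        rcases hcase with ⟨h, -⟩ | ⟨h, -⟩ <;> simp [h]
      omega
  · simp only [Test.Holds, Expr.eval, hu', not_not] at hb
    simp only [Test.cost, Expr.cost, cost_ofNat]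
    have hnil : el u = [] := (DLL.headD_eq_zero (hA.lists.zero u)).1 (by rw [← hhd]; exact hb)
    refine ⟨S, ad, el, by omega, hA, hS, had, fun d hdS => ⟨hd d hdS, ?_⟩, hle⟩
    rintro (h | h) hd'
    · have := hA.src_mem hd'
      rw [h, hnil] at this; simp at this
    · have := hA.tgt_mem hd'
      rw [h, hnil] at this; simp at this

theorem List.split_of_mem_disjoint {pre post : List ℕ} {u : ℕ} (hn : (pre ++ u :: post).Nodup) :
    u ∉ pre ∧ u ∉ post ∧ ∀ x ∈ pre, x ∉ post := by
  rw [List.nodup_append, List.nodup_cons] at hn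
  exact ⟨fun h => hn.2.2 u h u (by simp) rfl, hn.2.1.1,
    fun x h h' => hn.2.2 x h x (by simp [h']) rfl⟩

namespace ChainDec

variable {G : Graph ℕ ℕ} {n : ℕ} {D : ChainDec G n}

theorem Conf.linkAt {m : ℕ} {A : List ℕ} {lk el : ℕ → List ℕ} {S : Finset ℕ} {ad : List ℕ}
    {s : State} (h : D.Conf m A lk el S ad s) {L : ℕ} (h1 : 1 ≤ L) (hn : L ≤ s.regs .numL)
    {pre post : List ℕ} {u : ℕ} (hlk : lk L = pre ++ u :: post) :
    LinkAt D.num (s.arrs .next) (s.arrs .prev) pre u post := by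
  have hp := h.links.pairwise h1 hn
  have hd := h.dll L h1 hn
  rw [hlk] at hp hd
  have hn : (pre ++ u :: post).Nodup := hp.imp fun h => by rintro rfl; omega
  rw [List.pairwise_append, List.pairwise_cons] at hp
  refine ⟨fun y hy => hp.2.2 y hy u (by simp), fun y hy => hp.2.1.1 y hy, hn, ?_, ?_⟩
  · have := hd.fwd
    rw [← List.singleton_append, ← List.append_assoc] at this
    obtain ⟨y, hy, -⟩ := Trail.append_iff.1 this
    exact ⟨_, _, hy⟩
  · have := hd.bwd
    rw [List.reverse_append, List.reverse_cons] at this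
    obtain ⟨y, hy, -⟩ := Trail.append_iff.1 this
    exact ⟨_, _, hy⟩

theorem sides_iff {a b a' b' : Prop} (h : a ∨ b ↔ a' ∨ b') (hab : a → ¬ b) (hab' : a' → ¬ b')
    (h₁ : a → ¬ b') (h₂ : a' → ¬ b) : (a ↔ a') ∧ (b ↔ b') := by tauto

/-- After the lockstep walk, the chains that are still stored have both endpoints on the same side
of `u`. -/
theorem sided {m : ℕ} {A : List ℕ} {st lo : ℕ → ℕ} {nL : ℕ} {lk : ℕ → List ℕ} {le : ℕ → ℕ}
    {L u : ℕ} {pre post : List ℕ} {nxt prv vtx twn : ℕ → ℕ} {el : ℕ → List ℕ} {S : Finset ℕ} {ad : List ℕ} {r₁ r₂ t : ℕ} {s : State}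
    (hL : D.Links A st lo nL lk le) (hlk : lk L = pre ++ u :: post)
    (hat : LinkAt D.num nxt prv pre u post) (hA : Assoc D.src D.tgt m S ad el s)
    (hvtx : s.arrs .entVertex = vtx) (htwn : s.arrs .entTwin = twn)
    (hsame : ∀ d ∈ S, D.Same st lo d) (hr : ∀ d ∈ S, 1 ≤ d ∧ d ≤ D.N)
    (W₁ : Walker el (fun z => D.num u < D.num (vtx (twn z))) (pre ++ [u]) r₁ t (s.regs .p)
      (s.regs .a))
    (W₂ : Walker el (fun z => D.num (vtx (twn z)) < D.num u) (post.reverse ++ [u]) r₂ t (s.regs .q)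
      (s.regs .b)) (hend : s.regs .p = u ∨ s.regs .q = u) {d : ℕ} (hd : d ∈ S)
    (hs : D.src d ≠ u) (ht : D.tgt d ≠ u) :
    (D.src d ∈ pre ↔ D.tgt d ∈ pre) ∧ (D.src d ∈ post ↔ D.tgt d ∈ post) := by
  obtain ⟨h₁, h₂, h₃⟩ := hsame d hd
  obtain ⟨hd1, hdN⟩ := hr d hd
  have hmem := hL.mem L
  rw [hlk] at hmem
  -- Both endpoints have the same link label and differ from `u`, so either both or neither lie on
  -- the link being split. It remains to exclude that they lie on opposite sides.
  have key : (D.src d ∈ pre ∨ D.src d ∈ post) ↔ (D.tgt d ∈ pre ∨ D.tgt d ∈ post) := by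
    have hx := hmem (D.src d)
    have hy := hmem (D.tgt d)
    simp only [List.mem_append, List.mem_cons, hs, ht, false_or, h₁, h₂, h₃, D.src_mem hd1 hdN,
      D.tgt_mem d hd1 hdN, true_and] at hx hy
    rw [hx, hy]
  have hv₁ : vtx (twn d) = D.tgt d := by
    rw [← hvtx, ← htwn, (hA.entry d hd).2.2.1]
    exact hA.lists.vtx _ _ (hA.tgt_mem hd)
  have hv₂ : vtx (twn (m + d)) = D.src d := by
    rw [← hvtx, ← htwn, (hA.entry d hd).2.2.2]
    exact hA.lists.vtx _ _ (hA.src_mem hd)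
  have hpre := hat.pre_gt
  have hpost := hat.post_lt
  obtain ⟨-, -, hdis⟩ := List.split_of_mem_disjoint hat.nodup
  have hnd := hat.nodup
  -- The walker that has reached `u` has examined all entries on its side, and the surviving ones
  -- lead to that same side. Since a chain is stored at both endpoints, one complete walk rules out
  -- all chains across `u`.
  rcases hend with h | h
  · rw [h] at W₁
    have hg := (W₁.done (by
      rw [List.nodup_append, List.nodup_cons] at hnd
      exact List.nodup_append.2 ⟨hnd.1, by simp, fun a ha b hb => hnd.2.2 a ha b (by simp_all)⟩)).1
    have hg₁ : D.src d ∈ pre → D.tgt d ∉ post := fun hp hq => by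
      have := hg _ hp _ (hA.src_mem hd)
      rw [hv₁] at this
      have := hpost _ hq
      omega
    have hg₂ : D.tgt d ∈ pre → D.src d ∉ post := fun hp hq => by
      have := hg _ hp _ (hA.tgt_mem hd)
      rw [hv₂] at this
      have := hpost _ hq
      omega
    exact sides_iff key (hdis _) (hdis _) hg₁ hg₂
  · rw [h] at W₂
    have hg := (W₂.done (by
      rw [List.nodup_append, List.nodup_cons] at hnd
      refine List.nodup_append.2 ⟨List.nodup_reverse.2 hnd.2.1.2, by simp, fun a ha b hb => ?_⟩
      rw [List.mem_singleton] at hb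
      rw [List.mem_reverse] at ha
      rintro rfl
      rw [hb] at ha
      exact hnd.2.1.1 ha)).1
    have hg₁ : D.src d ∈ post → D.tgt d ∉ pre := fun hp hq => by
      have := hg _ (List.mem_reverse.2 hp) _ (hA.src_mem hd)
      rw [hv₁] at this
      have := hpre _ hq
      omega
    have hg₂ : D.tgt d ∈ post → D.src d ∉ pre := fun hp hq => by
      have := hg _ (List.mem_reverse.2 hp) _ (hA.tgt_mem hd)
      rw [hv₂] at this
      have := hpre _ hq
      omega
    exact (sides_iff (by rwa [or_comm, or_comm (a := D.tgt d ∈ post)])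
      (fun h h' => hdis _ h' h) (fun h h' => hdis _ h' h) hg₁ hg₂).symm

end ChainDec

theorem mem_trans {p q q₁ q₃ : Prop} (h₁ : q₁ → q) (h₃ : q₃ → q₁) :
    (p ∨ q ∧ ¬ q₁) ∨ q₁ ∧ ¬ q₃ ↔ p ∨ q ∧ ¬ q₃ := by tauto

theorem mem_total {p q q₃ : Prop} (h : q₃ → q) : q₃ ∨ p ∨ q ∧ ¬ q₃ ↔ q ∨ p := by tauto

namespace ChainDec

variable {G : Graph ℕ ℕ} {n : ℕ} {D : ChainDec G n}

/-- The potential is weighted by 800. With `t` below the smaller of the two path weights, the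
lockstep walk costs 420 per step, redirecting pointers 20 per vertex and releasing the chains at `u`
130 per entry. The drop in potential dominates `t` as well as the number of entries at `u`, so the
amortized cost is the constant 2000. Chains only move from `S` to `ad`. -/
theorem wp_makeBranch {m : ℕ} {A : List ℕ} (hA : D.Closed A) {lk el : ℕ → List ℕ} {S : Finset ℕ}
    {ad : List ℕ} {s : State} (hs : D.Stored m s) (h : D.Conf m A lk el S ad s)
    (hur : 1 ≤ s.regs .u ∧ s.regs .u ≤ n)
    (hst : s.arrs .status (s.regs .u) = 1 ∨ s.arrs .status (s.regs .u) = 2) {k : ℕ}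
    (hk : 800 * potential (s.regs .numL) lk el + 2000 ≤ k) :
    WP makeBranch s k fun s' k' => ∃ lk' el' S' ad',
      k + 800 * potential (s'.regs .numL) lk' el' ≤
        k' + 800 * potential (s.regs .numL) lk el + 2000 ∧
      s'.regs .numL ≤ s.regs .numL + 1 ∧ D.Conf m A lk' el' S' ad' s' ∧
      s'.arrs .status = Function.update (s.arrs .status) (s.regs .u) 2 ∧
      ∀ d, (d ∈ S' ∨ d ∈ ad') ↔ (d ∈ S ∨ d ∈ ad) := by
  obtain ⟨u, hu⟩ : ∃ u, s.regs .u = u := ⟨_, rfl⟩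
  rw [hu] at hur hst
  rw [hu]
  unfold makeBranch
  simp only [when, block]
  refine .ite (by simp; omega) (fun hb => ?_) fun hb => ?_
  swap
  · simp [hu] at hb
    have hst2 := hst.resolve_left hb
    refine .run 1 (by simp; omega) fun k₁ hk₁ => ?_
    simp only [Test.cost, Expr.cost, cost_ofNat] at hk₁
    have hupd : Function.update (s.arrs .status) u 2 = s.arrs .status := by
      rw [← hst2]; simp
    exact ⟨lk, el, S, ad, by simp; omega, by simp, by simpa using h, by simpa using hupd.symm,
      fun d => Iff.rfl⟩
  simp [hu] at hb
  have hL := h.links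
  obtain ⟨L, hLu⟩ : ∃ L, s.arrs .linkOf u = L := ⟨_, rfl⟩
  have hLb := hL.bound u hur hb
  rw [hLu] at hLb
  obtain ⟨hL1, hLn⟩ := hLb
  have hmem : u ∈ lk L := (hL.mem L u).2 ⟨hur, hb, hLu⟩
  obtain ⟨pre, post, hlk⟩ := List.append_of_mem hmem
  have hat := h.linkAt hL1 hLn hlk
  have hdll := h.dll L hL1 hLn
  have h0 := hL.zero_notMem L
  rw [hlk] at hdll h0
  obtain ⟨hupre, hupost, hdis⟩ := List.split_of_mem_disjoint hat.nodup
  have hfirst : s.arrs .linkFirst L = (pre ++ [u]).headD 0 := by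
    rw [hdll.fwd.head_eq]; cases pre <;> simp
  have hlast : s.arrs .linkLast L = (post.reverse ++ [u]).headD 0 := by
    rw [hdll.bwd.head_eq, List.reverse_append, List.reverse_cons]
    cases post.reverse <;> simp
  have hE := h.assoc.lists
  -- budgets
  have hpot : ∀ X Y, (X = L ∧ Y = s.regs .numL + 1 ∨ X = s.regs .numL + 1 ∧ Y = L) →
      potential (s.regs .numL + 1) (Function.update (Function.update lk X pre) Y post) el +
      (min (weight el pre) (weight el post) + (1 + (el u).length)) ≤
        potential (s.regs .numL) lk el := fun X Y hXY => potential_split hL1 hLn el hlk hXY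
  have hw₁ : weight el (pre ++ [u]) = weight el pre + (1 + (el u).length) := by simp
  have hw₂ : weight el (post.reverse ++ [u]) = weight el post + (1 + (el u).length) := by simp
  have hpot₀ := hpot L (s.regs .numL + 1) (.inl ⟨rfl, rfl⟩)
  simp only [Test.cost, Expr.cost, cost_ofNat]
  refine .seq (.run 5 (by omega) fun k₁ hk₁ => ?_)
  refine .seq (.run 5 (by omega) fun k₂ hk₂ => ?_)
  refine .seq (.run 5 (by omega) fun k₃ hk₃ => ?_)
  refine .seq (.run 5 (by omega) fun k₄ hk₄ => ?_)
  refine .seq (.run 5 (by omega) fun k₅ hk₅ => ?_)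
  refine .seq (.run 5 (by omega) fun k₆ hk₆ => ?_)
  refine .seq (.conseq (wp_lockstep (src := D.src) (tgt := D.tgt) (m := m) (S₀ := S) (ad₀ := ad)
    (el₀ := el) (r₁ := weight el (pre ++ [u])) (r₂ := weight el (post.reverse ++ [u]))
    (vtx := s.arrs .entVertex) (twn := s.arrs .entTwin) hat
    ⟨by simpa using hu, by simpa using hs.numE, by simpa using hs.num, by simp, by simp, by simp,
      by simp, S, ad, el, h.assoc.congr (by simp) (by simp), subset_rfl, by simp,
      fun d h h' => absurd h h', fun _ => le_rfl,
      by simpa [hu, hLu, hfirst, hE.head] using Walker.init,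
      -- The second walker sees the link from its last vertex, hence along the reversed upper part.
      by simpa [hu, hLu, hlast, hE.head] using Walker.init (el := el) (pre := post.reverse)⟩ (by omega)) ?_)
  rintro s₁ k₁' ⟨t, ht, hk₁', hW, hend⟩ hf₁
  obtain ⟨hu₁, hm₁, hnum₁, hnx₁, hpv₁, hvtx₁, htwn₁, S₁, ad₁, el₁, A₁, hS₁, had₁, hcr₁, hle₁, W₁,
    W₂⟩ := hW
  have hL₁ : s₁.regs .L = L := by rw [hf₁.regs _ rfl]; simp [hu, hLu]
  have hnL₁ : s₁.regs .numL = s.regs .numL := by rw [hf₁.regs _ rfl]; simp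
  have hst₁ : s₁.arrs .status = Function.update (s.arrs .status) u 2 := by
    rw [hf₁.arrs _ rfl]; simp [hu]
  have hlo₁ : s₁.arrs .linkOf = s.arrs .linkOf := by rw [hf₁.arrs _ rfl]; simp
  have hle₁' : s₁.arrs .linkEdge = s.arrs .linkEdge := by rw [hf₁.arrs _ rfl]; simp
  have hfi₁ : s₁.arrs .linkFirst = s.arrs .linkFirst := by rw [hf₁.arrs _ rfl]; simp
  have hla₁ : s₁.arrs .linkLast = s.arrs .linkLast := by rw [hf₁.arrs _ rfl]; simp
  have hpe₁ : s₁.arrs .parEdge = D.parEdge := by rw [hf₁.arrs _ rfl]; simpa using hs.parEdge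
  have hsame₁ : ∀ d ∈ S₁, D.Same (s.arrs .status) (s.arrs .linkOf) d := fun d hd =>
    h.same d (hS₁ hd)
  have hside := fun d hd => sided (d := d) hL hlk hat A₁ hvtx₁ htwn₁ hsame₁
    (fun d hd => h.range d (.inl (hS₁ hd))) W₁ W₂ hend hd
  have hd₁ : DLL (s₁.arrs .next) (s₁.arrs .prev) (s₁.arrs .linkFirst L) (s₁.arrs .linkLast L)
      (pre ++ u :: post) := by rw [hnx₁, hpv₁, hfi₁, hla₁]; exact hdll
  have hlo₁' : ∀ x ∈ pre ++ u :: post, s₁.arrs .linkOf x = L := fun x hx => by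
    rw [hlo₁]; exact ((hL.mem L x).1 (hlk ▸ hx)).2.2
  have hlen₁ : s₁.regs .p = u → pre.length ≤ t := fun h => by
    rw [h] at W₁
    refine (W₁.done ?_).2
    have := hat.nodup
    rw [List.nodup_append, List.nodup_cons] at this
    exact List.nodup_append.2 ⟨this.1, by simp, fun a ha b hb => this.2.2 a ha b (by simp_all)⟩
  have hlen₂ : s₁.regs .q = u → post.length ≤ t := fun h => by
    rw [h] at W₂
    have := (W₂.done (by
      have := hat.nodup
      rw [List.nodup_append, List.nodup_cons] at this
      refine List.nodup_append.2 ⟨List.nodup_reverse.2 this.2.1.2, by simp, fun a ha b hb => ?_⟩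
      rw [List.mem_singleton] at hb
      rintro rfl
      rw [hb] at ha
      exact hupost (List.mem_reverse.1 ha))).2
    simpa using this
  refine .seq (.conseq (P := fun s₂ k₂ => k₁' ≤ k₂ + 20 * t + 210 ∧
    ∃ X Y, SplitAt D.parEdge s₁ s₂ pre u post L X Y) ?_ ?_)
  · refine .ite (by simp; omega) (fun hb => ?_) fun hb => ?_
    · simp [hu₁] at hb
      have := hlen₁ hb
      refine .conseq (wp_splitOffFirstPart hu₁ hL₁ (by rw [hnL₁]; exact hLn) hpe₁ hd₁ hat.nodup h0
        hlo₁' (by simp; omega)) ?_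
      rintro s₂ k₂ ⟨hk₂, hsp⟩ -
      exact ⟨by simp at hk₂; omega, _, _, hsp⟩
    · simp [hu₁] at hb
      have := hlen₂ (hend.resolve_left hb)
      refine .conseq (wp_splitOffLastPart hu₁ hL₁ (by rw [hnL₁]; exact hLn) hpe₁ hd₁ hat.nodup h0
        hlo₁' (by simp; omega)) ?_
      rintro s₂ k₂ ⟨hk₂, hsp⟩ -
      exact ⟨by simp at hk₂; omega, _, _, hsp⟩
  rintro s₂ k₂' ⟨hk₂', X, Y, hsp⟩ hf₂
  have hu₂ : s₂.regs .u = u := by rw [hf₂.regs _ rfl]; exact hu₁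
  have hm₂ : s₂.regs .numE = m := by rw [hf₂.regs _ rfl]; exact hm₁
  have hst₂ : s₂.arrs .status = Function.update (s.arrs .status) u 2 := by
    rw [hf₂.arrs _ rfl]; exact hst₁
  have A₂ : Assoc D.src D.tgt m S₁ ad₁ el₁ s₂ := by
    refine A₁.congr (hf₂.regs _ rfl) ?_
    simp only [List.mem_cons, List.not_mem_nil, or_false, forall_eq_or_imp, forall_eq]
    exact ⟨hf₂.arrs _ rfl, hf₂.arrs _ rfl, hf₂.arrs _ rfl, hf₂.arrs _ rfl, hf₂.arrs _ rfl,
      hf₂.arrs _ rfl, hf₂.arrs _ rfl⟩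
  have hleu := hle₁ u
  refine .conseq (wp_release A₂ hu₂ hm₂ (by omega)) ?_
  rintro s₃ k₃' ⟨S₃, ad₃, el₃, hk₃', A₃, hS₃, had₃, hrel, hle₃⟩ hf₃
  have hlab := hsp.labels
  rw [hnL₁] at hlab
  have hpot' := hpot X Y hlab
  have hXY : X ≠ Y := by omega
  have hnL₃ : s₃.regs .numL = s.regs .numL + 1 := by rw [hf₃.regs _ rfl, hsp.numL, hnL₁]
  have hst₃ : s₃.arrs .status = Function.update (s.arrs .status) u 2 := by
    rw [hf₃.arrs _ rfl]; exact hst₂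
  have hlo₃ : s₃.arrs .linkOf = Links.splitLabel (s.arrs .linkOf) pre post X Y := by
    rw [hf₃.arrs _ rfl, hsp.linkOf, hlo₁]
  have hlinks : D.Links A (s₃.arrs .status) (s₃.arrs .linkOf) (s₃.regs .numL)
      (Function.update (Function.update lk X pre) Y post) (s₃.arrs .linkEdge) := by
    rw [hst₃, hlo₃, hnL₃, hf₃.arrs .linkEdge rfl]
    have := hsp.edge
    rw [hle₁'] at this
    exact hL.split hA hL1 hLn hlk hlab this.1 this.2.1 this.2.2
  have hof : ∀ d, 1 ≤ d → d ≤ D.N → D.Same (s₃.arrs .status) (s₃.arrs .linkOf) d →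
      D.Same (s.arrs .status) (s.arrs .linkOf) d ∧ (D.src d ∈ pre ↔ D.tgt d ∈ pre) ∧
        (D.src d ∈ post ↔ D.tgt d ∈ post) ∧ D.src d ≠ u ∧ D.tgt d ≠ u := by
    intro d h1 h2 h3
    rw [hst₃, hlo₃] at h3 hlinks
    exact h3.of_split hL hlk hlinks hXY h1 h2
  have had' : ∀ d, d ∈ ad₃ ↔ d ∈ ad ∨ d ∈ S ∧ d ∉ S₃ := by
    intro d
    rw [had₃, had₁]
    exact mem_trans (@hS₁ d) (@hS₃ d)
  refine ⟨_, el₃, S₃, ad₃, ?_, hnL₃.le, ⟨hlinks, ?_, A₃, ?_, ?_, ?_⟩, hst₃, ?_⟩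
  · have hp := potential_mono (s.regs .numL + 1) (Function.update (Function.update lk X pre) Y post)
      (el := el) (el' := el₃) fun y => (hle₃ y).trans (hle₁ y)
    rw [hnL₃]
    omega
  · intro M hM1 hMn
    rw [hnL₃] at hMn
    rw [hf₃.arrs .next rfl, hf₃.arrs .prev rfl, hf₃.arrs .linkFirst rfl, hf₃.arrs .linkLast rfl]
    by_cases hMY : M = Y
    · subst hMY; simpa using hsp.dll₂
    · by_cases hMX : M = X
      · subst hMX; simpa [hXY] using hsp.dll₁
      · simp only [Function.update_of_ne hMX, Function.update_of_ne hMY]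
        refine hsp.dll M _ hMX hMY (fun x hx => ?_) ?_
        · have hlx := ((hL.mem M x).1 hx).2.2
          have : ∀ x ∈ pre ++ u :: post, s.arrs .linkOf x = L := fun x hx =>
            ((hL.mem L x).1 (hlk ▸ hx)).2.2
          constructor
          · intro hx'; have := this x (by simp [hx']); omega
          · intro hx'; have := this x (by simp [hx']); omega
        · rw [hnx₁, hpv₁, hfi₁, hla₁]
          exact h.dll M hM1 (by omega)
  · intro d hd
    have hd₁ := hS₃ hd
    have hne := (not_iff_not.2 (hrel d hd₁)).1 (not_not.2 hd)
    rw [not_or] at hne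
    obtain ⟨h₁, h₂, h₃⟩ := hsame₁ d hd₁
    obtain ⟨hp, hq⟩ := hside d hd₁ hne.1 hne.2
    rw [hst₃, hlo₃]
    refine ⟨by rwa [Function.update_of_ne hne.1], by rwa [Function.update_of_ne hne.2], ?_⟩
    simp only [Links.splitLabel, hp, hq, h₃]
  · intro d hd hsm
    have hr : 1 ≤ d ∧ d ≤ D.N := h.range d (by
      rcases (had' d).1 hd with h | h
      · exact .inr h
      · exact .inl h.1)
    obtain ⟨ho, hp, hq, hsu, htu⟩ := hof d hr.1 hr.2 hsm
    rcases (had' d).1 hd with hd | ⟨hdS, hd₃⟩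
    · exact h.diff d hd ho
    · by_cases hd₁ : d ∈ S₁
      · rcases (hrel d hd₁).1 hd₃ with h | h
        · exact hsu h
        · exact htu h
      · have hgt := hat.pre_gt
        have hlt := hat.post_lt
        -- A chain deleted during the walk has one endpoint on a side of `u` and the other one at or
        -- beyond `u`. If both were on the same new link, they would be on the same side,
        -- contradicting the order of numbers.
        rcases hcr₁ d hdS hd₁ with ⟨h₁, h₂⟩ | ⟨h₁, h₂⟩ | ⟨h₁, h₂⟩ | ⟨h₁, h₂⟩
        · have := hgt _ (hp.1 h₁); omega
        · have := hgt _ (hp.2 h₁); omega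
        · have := hlt _ (hq.1 h₁); omega
        · have := hlt _ (hq.2 h₁); omega
  · intro d hd
    refine h.range d ?_
    rcases hd with hd | hd
    · exact .inl (hS₁ (hS₃ hd))
    · rcases (had' d).1 hd with h | h
      · exact .inr h
      · exact .inl h.1
  · intro d
    rw [had']
    exact mem_total fun h => hS₁ (hS₃ h)

end ChainDec

/-! ### Adding a chain as a link and processing its children -/

/-- Appending an element to a doubly linked list. -/
theorem DLL.snoc {nx pv : ℕ → ℕ} {h t x : ℕ} {l : List ℕ} (hd : DLL nx pv h t l)
    (hn : (l ++ [x]).Nodup) (h0 : 0 ∉ l) :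
    DLL (if t = 0 then Function.update nx x 0 else Function.update (Function.update nx x 0) t x)
      (Function.update pv x t) (if t = 0 then x else h) x (l ++ [x]) := by
  rw [List.nodup_append] at hn
  have hx : x ∉ l := fun hm => hn.2.2 x hm x (by simp) rfl
  refine ⟨?_, ?_⟩
  · rcases List.eq_nil_or_concat l with rfl | ⟨l, w, rfl⟩
    · have ht : t = 0 := hd.bwd
      simp [ht, Trail]
    · simp only [List.concat_eq_append] at *
      obtain ⟨y, hy, rfl, -⟩ := Trail.append_iff.1 hd.fwd
      have ht : t = y := by simpa using hd.bwd.head_eq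
      subst ht
      have ht0 : t ≠ 0 := by rintro rfl; simp at h0
      have htx : t ≠ x := by rintro rfl; simp at hx
      have htl : t ∉ l := by
        have := hn.1
        rw [List.nodup_append] at this
        exact fun hm => this.2.2 t hm t (by simp) rfl
      simp only [ht0, if_false, List.append_assoc]
      refine Trail.append_iff.2 ⟨t, (hy.update (by simp at hx; exact hx.1) _).update htl _, rfl, ?_⟩
      simp [Trail, htx.symm]
  · rw [List.reverse_append]
    refine ⟨rfl, ?_⟩
    simpa using hd.bwd.update (by simpa using hx) t

namespace ChainDec

variable {G : Graph ℕ ℕ} {n : ℕ} {D : ChainDec G n}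

theorem xs_nodup (D : ChainDec G n) {c : ℕ} (h1 : 1 ≤ c) (hc : c ≤ D.N) : (D.xs c).Nodup :=
  (D.path h1 hc).nodup_inner

theorem zero_notMem_xs (D : ChainDec G n) {c : ℕ} (h1 : 1 ≤ c) (hc : c ≤ D.N) : 0 ∉ D.xs c :=
  fun h => by have := (D.mem_xs_range h1 hc h).1.1; omega

namespace Links

variable {A : List ℕ} {st lo : ℕ → ℕ} {nL : ℕ} {lk : ℕ → List ℕ} {le : ℕ → ℕ}

theorem mono (hL : D.Links A st lo nL lk le) {A' : List ℕ} (h : ∀ c ∈ A, c ∈ A') :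
    D.Links A' st lo nL lk le := by
  refine { hL with cov := fun x hx hs => h _ (hL.cov x hx hs), link := fun L h1 hn => ?_ }
  obtain ⟨u, y, t, h₁, h₂, h₃, h₄, h₅, ⟨c, hc, h₆⟩, h₇⟩ := hL.link L h1 hn
  refine ⟨u, y, t, h₁, h₂, h₃, h₄, h₅, ⟨c, h c hc, h₆⟩, ?_⟩
  rcases h₇ with ⟨c, hc, h₇⟩ | h₇
  · exact .inl ⟨c, h c hc, h₇⟩
  · exact .inr h₇

/-- A chain between branch vertices becomes a new link. -/
theorem add (hL : D.Links A st lo nL lk le) {c : ℕ} (hc : c ∈ A) (h1 : 1 ≤ c) (hN : c ≤ D.N)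
    (h0 : ∀ x ∈ D.xs c, st x = 0) (hs : st (D.src c) = 2) (ht : st (D.tgt c) = 2) :
    D.Links A (fun x => if x ∈ D.xs c then 1 else st x)
      (fun x => if x ∈ D.xs c then nL + 1 else lo x) (nL + 1)
      (Function.update lk (nL + 1) (D.xs c)) (Function.update le (nL + 1) (D.backEdge c)) := by
  have hkeep : ∀ x, st x ≠ 0 → x ∉ D.xs c := fun x hx hm => hx (h0 x hm)
  have hr := fun x => D.mem_xs c x h1 hN
  refine ⟨fun L x => ?_, fun x hx hs => ?_, ?_, fun x hx hs => ?_, fun L hL1 hLn => ?_⟩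
  · by_cases hx : x ∈ D.xs c
    · have hxr := ((hr x).1 hx).1
      by_cases hLn : L = nL + 1
      · simp [hLn, hx, hxr]
      · have : x ∉ lk L := fun h => by
          have := ((hL.mem L x).1 h).2.1
          rw [h0 x hx] at this; omega
        simp [hLn, hx, this, Ne.symm hLn]
    · by_cases hLn : L = nL + 1
      · subst hLn
        simp only [Function.update_self, hx, if_false, false_iff]
        rintro ⟨h₁, h₂, h₃⟩
        have := hL.bound x h₁ h₂
        omega
      · simpa [hLn, hx] using hL.mem L x
  · by_cases hxc : x ∈ D.xs c
    · simp [hxc]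
    · simp only [hxc, if_false] at hs ⊢
      have := hL.bound x hx hs
      omega
  · simpa [hkeep 1 (by rw [hL.one]; omega)] using hL.one
  · by_cases hxc : x ∈ D.xs c
    · rw [((hr x).1 hxc).2.2]; exact hc
    · simp only [hxc, if_false] at hs
      exact hL.cov x hx hs
  · have h2 : ∀ x, st x = 2 → (if x ∈ D.xs c then 1 else st x) = 2 := fun x hx => by
      rw [if_neg (hkeep x (by omega)), hx]
    by_cases hLn' : L = nL + 1
    · subst hLn'
      simp only [Function.update_self]
      exact ⟨_, _, _, D.trail c h1 hN, D.tgt_mem c h1 hN, h2 _ ht, D.back_link h1 hN, h2 _ hs,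
        ⟨c, hc, D.mem_edges.2 (.inl rfl)⟩, .inl ⟨c, hc, rfl⟩⟩
    · simp only [Function.update_of_ne hLn']
      obtain ⟨u, y, t, h₁, h₂, h₃, h₄, h₅, h₆, h₇⟩ := hL.link L hL1 (by omega)
      refine ⟨u, y, t, h₁, h₂, h2 _ h₃, h₄, h2 _ h₅, h₆, ?_⟩
      rcases h₇ with h₇ | ⟨y, h₇, h₈, h₉, h₁₀⟩
      · exact .inl h₇
      · exact .inr ⟨y, h₇, h₈, h2 _ h₉, h₁₀⟩

end Links

/-- Relabelling the inner vertices of the new link leaves the status of the pending chains intact: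
stored chains have both endpoints labelled already, and by `had` the targets of addable chains are
active, so no addable chain comes to have both endpoints on the new link. -/
theorem wp_addLink {m : ℕ} {A : List ℕ} {lk el : ℕ → List ℕ} {S : Finset ℕ} {ad : List ℕ}
    {s : State} (hs : D.Stored m s) (h : D.Conf m A lk el S ad s) {c : ℕ} (hcur : s.regs .cur = c)
    (hc : c ∈ A) (h1 : 1 ≤ c) (hN : c ≤ D.N) (h0 : ∀ x ∈ D.xs c, s.arrs .status x = 0)
    (hsrc : s.arrs .status (D.src c) = 2) (htgt : s.arrs .status (D.tgt c) = 2)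
    (had : ∀ d ∈ ad, s.arrs .status (D.tgt d) ≠ 0) {k : ℕ} (hk : 60 * (D.xs c).length + 60 ≤ k) :
    WP addLink s k fun s' k' => k ≤ k' + (60 * (D.xs c).length + 60) ∧ ∃ lk',
      D.Conf m A lk' el S ad s' ∧ s'.regs .numL = s.regs .numL + 1 ∧
      potential (s'.regs .numL) lk' el = potential (s.regs .numL) lk el +
        logSum (D.xs c).length ∧
      (s'.arrs .status = fun x => if x ∈ D.xs c then 1 else s.arrs .status x) ∧
      s'.regs .numAdded = s.regs .numAdded + 1 ∧
      s'.arrs .order = Function.update (s.arrs .order) (s.regs .numAdded + 1) c := by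
  have hz := D.zero_notMem_xs h1 hN
  have hnd := D.xs_nodup h1 hN
  obtain ⟨nL, hnL⟩ : ∃ nL, s.regs .numL = nL := ⟨_, rfl⟩
  have hb : s.arrs .backEdge = D.backEdge := hs.back
  have hlow : s.arrs .low = D.low := hs.low
  have htg : s.arrs .tgt = D.tgt := hs.tgt
  have hpar : s.arrs .par = D.par := hs.par
  unfold addLink
  simp only [block]
  refine .seq (.run 5 (by omega) fun k₁ hk₁ => ?_)
  refine .seq (.run 5 (by omega) fun k₂ hk₂ => ?_)
  refine .seq (.run 5 (by omega) fun k₃ hk₃ => ?_)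
  refine .seq (.run 5 (by omega) fun k₄ hk₄ => ?_)
  refine .seq (.run 5 (by omega) fun k₅ hk₅ => ?_)
  generalize hs₅ : run (Prog.assign Reg.x _ : Prog) _ = s₅
  have e₁ : s₅.regs .numL = nL + 1 := by rw [← hs₅]; simp [hnL]
  have e₂ : s₅.regs .x = D.low (D.backEdge c) := by rw [← hs₅]; simp [hb, hlow, hcur]
  have e₃ : s₅.regs .pv = 0 := by rw [← hs₅]; simp
  have e₄ : s₅.regs .cur = c := by rw [← hs₅]; simpa using hcur
  have e₅ : s₅.arrs .linkFirst = Function.update (s.arrs .linkFirst) (nL + 1) 0 := by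
    rw [← hs₅]; simp [hnL]
  have e₆ : s₅.arrs .linkEdge = Function.update (s.arrs .linkEdge) (nL + 1) (D.backEdge c) := by
    rw [← hs₅]; simp [hnL, hb, hcur]
  have e₇ : ∀ a, a ≠ Arr.linkFirst → a ≠ .linkEdge → s₅.arrs a = s.arrs a := by
    intro a h₁ h₂; rw [← hs₅]; simp [h₁, h₂]
  have e₈ : ∀ r, r ≠ Reg.numL → r ≠ .pv → r ≠ .x → s₅.regs r = s.regs r := by
    intro r h₁ h₂ h₃; rw [← hs₅]; simp [h₁, h₂, h₃]
  refine .seq (.conseq (P := fun s' k' => k₅ ≤ k' + (60 * (D.xs c).length + 10) ∧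
    DLL (s'.arrs .next) (s'.arrs .prev) (s'.arrs .linkFirst (nL + 1)) (s'.regs .pv) (D.xs c) ∧
    (∀ x, x ∉ D.xs c → s'.arrs .next x = s.arrs .next x ∧ s'.arrs .prev x = s.arrs .prev x) ∧
    (∀ M, M ≠ nL + 1 → s'.arrs .linkFirst M = s.arrs .linkFirst M) ∧
    (s'.arrs .status = fun x => if x ∈ D.xs c then 1 else s.arrs .status x) ∧
    (s'.arrs .linkOf = fun x => if x ∈ D.xs c then nL + 1 else s.arrs .linkOf x)) ?_ ?_)
  · refine .while (fun s' k' => ∃ dn rest, D.xs c = dn ++ rest ∧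
      Trail D.par (s'.regs .x) rest (D.tgt c) ∧ k₅ ≤ k' + 60 * dn.length ∧
      DLL (s'.arrs .next) (s'.arrs .prev) (s'.arrs .linkFirst (nL + 1)) (s'.regs .pv) dn ∧
      (∀ x, x ∉ dn → s'.arrs .next x = s.arrs .next x ∧ s'.arrs .prev x = s.arrs .prev x) ∧
      (∀ M, M ≠ nL + 1 → s'.arrs .linkFirst M = s.arrs .linkFirst M) ∧
      (s'.arrs .status = fun x => if x ∈ dn then 1 else s.arrs .status x) ∧
      (s'.arrs .linkOf = fun x => if x ∈ dn then nL + 1 else s.arrs .linkOf x))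
      ⟨[], D.xs c, rfl, by rw [e₂]; exact D.trail c h1 hN, by simp, ?_, ?_, ?_, ?_, ?_⟩ ?_
    · rw [e₃, e₅]; simpa using DLL.nil
    · intro x _; rw [e₇ _ (by simp) (by simp), e₇ _ (by simp) (by simp)]; simp
    · intro M hM; rw [e₅]; simp [hM]
    · rw [e₇ _ (by simp) (by simp)]; simp
    · rw [e₇ _ (by simp) (by simp)]; simp
    rintro s' k' ⟨dn, rest, hx, ht, hk', hd, hoff, hfst, hst, hlo⟩ hf
    have f₁ : s'.regs .cur = c := by rw [hf.regs _ rfl]; exact e₄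
    have f₂ : s'.regs .numL = nL + 1 := by rw [hf.regs _ rfl]; exact e₁
    have f₃ : s'.arrs .tgt = D.tgt := by rw [hf.arrs _ rfl, e₇ _ (by simp) (by simp)]; exact htg
    have f₄ : s'.arrs .par = D.par := by rw [hf.arrs _ rfl, e₇ _ (by simp) (by simp)]; exact hpar
    have hlen : (D.xs c).length = dn.length + rest.length := by rw [hx]; simp
    refine ⟨by simp; omega, fun hb => ?_, fun hb => ?_⟩
    · simp only [Test.Holds, Expr.eval, f₃, f₁] at hb
      simp only [Test.cost, Expr.cost, cost_ofNat]
      obtain ⟨l', rfl, hl'⟩ := ht.exists_cons hb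
      simp only [List.length_cons] at hlen
      have hxm : s'.regs .x ∈ D.xs c := by rw [hx]; simp
      rw [hx] at hnd hz
      have hnd' : (dn ++ [s'.regs .x]).Nodup := by
        rw [List.append_cons] at hnd
        exact hnd.sublist (List.sublist_append_left _ _)
      have hsn := hd.snoc hnd' fun h => hz (by simp [h])
      have hxn : s'.regs .x ∉ dn := fun hm =>
        (List.nodup_append.1 hnd').2.2 _ hm _ (by simp) rfl
      have hpm : s'.regs .pv ≠ 0 → s'.regs .pv ∈ dn := fun h0 => by
        have := hd.bwd.head_eq
        have h := DLL.headD_mem (l := dn.reverse) (by rw [← this]; exact h0)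
        rw [← this] at h
        simpa using h
      refine .run 50 (by omega) fun k₆ hk₆ => ?_
      refine ⟨dn ++ [s'.regs .x], l', by rw [hx]; simp, ?_, by simp; omega, ?_, ?_, ?_, ?_, ?_⟩
      · by_cases hp : s'.regs .pv = 0 <;> simpa [run, hp, f₂, f₄] using hl'
      · by_cases hp : s'.regs .pv = 0 <;> simpa [run, hp, f₂, f₄] using hsn
      · intro y hy
        simp only [List.mem_append, List.mem_singleton, not_or] at hy
        have hyp : s'.regs .pv ≠ 0 → y ≠ s'.regs .pv := by
          rintro h rfl; exact hy.1 (hpm h)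
        have := hoff y hy.1
        by_cases hp : s'.regs .pv = 0
        · simpa [run, hp, f₂, f₄, hy.2] using this
        · simpa [run, hp, f₂, f₄, hy.2, hyp hp] using this
      · intro M hM
        by_cases hp : s'.regs .pv = 0 <;> simpa [run, hp, f₂, f₄, hM] using hfst M hM
      · ext y
        by_cases hy : y = s'.regs .x
        · by_cases hp : s'.regs .pv = 0 <;> simp [run, hp, f₂, f₄, hy]
        · by_cases hp : s'.regs .pv = 0 <;> simp [run, hp, f₂, f₄, hst, hy]
      · ext y
        by_cases hy : y = s'.regs .x
        · by_cases hp : s'.regs .pv = 0 <;> simp [run, hp, f₂, f₄, hy]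
        · by_cases hp : s'.regs .pv = 0 <;> simp [run, hp, f₂, f₄, hlo, hy]
    · simp only [Test.Holds, Expr.eval, f₃, f₁, not_not] at hb
      simp only [Test.cost, Expr.cost, cost_ofNat]
      have hrest : rest = [] := ht.eq_nil_of_notMem fun hm =>
        D.tgt_notMem h1 hN (by rw [hx, ← hb]; simp [hm])
      subst hrest
      simp only [List.append_nil] at hx
      subst hx
      exact ⟨by omega, hd, hoff, hfst, hst, hlo⟩
  rintro s₆ k₆ ⟨hk₆, hd, hoff, hfst, hst, hlo⟩ hf₆
  have g₁ : s₆.regs .numL = nL + 1 := by rw [hf₆.regs _ rfl]; exact e₁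
  have g₂ : s₆.regs .cur = c := by rw [hf₆.regs _ rfl]; exact e₄
  have g₃ : s₆.regs .numAdded = s.regs .numAdded := by
    rw [hf₆.regs _ rfl, e₈ _ (by simp) (by simp) (by simp)]
  have g₄ : s₆.arrs .linkEdge = Function.update (s.arrs .linkEdge) (nL + 1) (D.backEdge c) := by
    rw [hf₆.arrs _ rfl]; exact e₆
  have g₅ : s₆.arrs .linkLast = s.arrs .linkLast := by
    rw [hf₆.arrs _ rfl, e₇ _ (by simp) (by simp)]
  have g₆ : s₆.arrs .order = s.arrs .order := by
    rw [hf₆.arrs _ rfl, e₇ _ (by simp) (by simp)]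
  have hlinks := h.links.add hc h1 hN h0 hsrc htgt
  rw [hnL] at hlinks
  have hA₆ : Assoc D.src D.tgt m S ad el s₆ := by
    refine h.assoc.congr ?_ ?_
    · rw [hf₆.regs _ rfl, e₈ _ (by simp) (by simp) (by simp)]
    · simp only [List.mem_cons, List.not_mem_nil, or_false, forall_eq_or_imp, forall_eq]
      refine ⟨?_, ?_, ?_, ?_, ?_, ?_, ?_⟩ <;> rw [hf₆.arrs _ rfl, e₇ _ (by simp) (by simp)]
  refine .run 20 (by omega) fun k₇ hk₇ => ?_
  refine ⟨by omega, Function.update lk (nL + 1) (D.xs c), ⟨?_, ?_, ?_, ?_, ?_, h.range⟩, by simp [run, g₁, hnL],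
    ?_, ?_, ?_, ?_⟩
  · simpa [run, g₁, g₂, g₄, hst, hlo] using hlinks
  · intro M hM1 hMn
    simp [run, g₁] at hMn
    by_cases hM : M = nL + 1
    · subst hM
      simpa [run, g₁] using hd
    · have := h.dll M hM1 (by omega)
      simp only [Function.update_of_ne hM]
      have hdis : ∀ x ∈ lk M, x ∉ D.xs c := fun x hx hxc => by
        have := ((h.links.mem M x).1 hx).2.1
        rw [h0 x hxc] at this; omega
      have := this.congr (fun x hx => (hoff x (hdis x hx)).1) fun x hx => (hoff x (hdis x hx)).2
      simpa [run, g₁, g₅, hM, hfst M hM] using this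
  · exact hA₆.congr (by simp [run]) (by simp [run])
  · intro d hd
    obtain ⟨h₁, h₂, h₃⟩ := h.same d hd
    have hn₁ : D.src d ∉ D.xs c := fun hm => by rw [h0 _ hm] at h₁; omega
    have hn₂ : D.tgt d ∉ D.xs c := fun hm => by rw [h0 _ hm] at h₂; omega
    simpa [run, Same, hst, hlo, hn₁, hn₂] using ⟨h₁, h₂, h₃⟩
  · intro d hd hsm
    have hn₂ : D.tgt d ∉ D.xs c := fun hm => had d hd (h0 _ hm)
    have hr := h.range d (.inr hd)
    refine h.diff d hd ?_
    simp only [run, Same, hst, hlo, regs_setReg, arrs_setCell, arrs_setReg] at hsm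
    simp [hst, hlo, hn₂] at hsm
    -- A source on the new link carries the label `nL + 1`, whereas the target, not being on it, has
    -- a link label of at most `nL`.
    by_cases hn₁ : D.src d ∈ D.xs c
    · have := h.links.bound _ (D.tgt_mem d hr.1 hr.2) hsm.2.1
      have := hsm.2.2
      rw [if_pos hn₁] at this
      omega
    · simpa [hn₁, Same] using hsm
  · have hw : weight el (D.xs c) = (D.xs c).length := by
      have : ∀ y ∈ D.xs c, (1 + (el y).length) = 1 := by
        intro y hy
        rw [Nat.add_eq_left, List.length_eq_zero_iff, List.eq_nil_iff_forall_not_mem]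
        intro z hz
        have hy0 := h0 y hy
        obtain ⟨d, hd, -, ⟨-, -, h₁, -⟩ | ⟨-, -, h₁, -⟩⟩ := h.assoc.cases hz
        · have := (h.same d hd).1; rw [h₁] at this; omega
        · have := (h.same d hd).2.1; rw [h₁] at this; omega
      unfold weight
      rw [List.map_congr_left this]
      simp
    have hp : potential nL (Function.update lk (nL + 1) (D.xs c)) el = potential nL lk el :=
      potential_congr el fun M _ hM => Function.update_of_ne (by omega) _ _
    simp [run, g₁, potential_succ, hw, hp, hnL]
  · simpa [run] using hst
  · simp [run, g₃]
  · simp [run, g₂, g₃, g₆]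

end ChainDec

theorem List.sum_map_ite_le {l : List ℕ} (hl : l.Nodup) (a : ℕ) :
    (l.map fun y => if y = a then 1 else 0).sum ≤ 1 := by
  induction l with
  | nil => simp
  | cons b l ih =>
    rw [List.nodup_cons] at hl
    have := ih hl.2
    by_cases hb : b = a
    · subst hb
      have : (l.map fun y => if y = b then 1 else 0).sum = 0 := by
        rw [List.sum_eq_zero_iff]
        simp only [List.mem_map, forall_exists_index, and_imp, forall_apply_eq_imp_iff₂]
        exact fun y hy => if_neg fun h : y = b => hl.1 (h ▸ hy)
      simp [this]
    · simpa [hb] using this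

theorem weight_add_two {el el' : ℕ → List ℕ} {a b : ℕ}
    (h : ∀ y, (el' y).length = (el y).length + (if y = a then 1 else 0) + (if y = b then 1 else 0))
    {l : List ℕ} (hl : l.Nodup) : weight el' l ≤ weight el l + 2 := by
  have h₁ := List.sum_map_ite_le hl a
  have h₂ := List.sum_map_ite_le hl b
  simp only [weight, h, ← add_assoc, List.sum_map_add]
  omega

namespace Assoc

variable {src tgt : ℕ → ℕ} {m : ℕ} {S : Finset ℕ} {ad : List ℕ} {el : ℕ → List ℕ} {s s' : State}

/-- Entries are distinct numbers between `1` and `2 * m`, each stored at one vertex. This bounds all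
logarithms in the potential by that of `n + 2 * m`. -/
theorem weight_le (h : Assoc src tgt m S ad el s) {n : ℕ} {l : List ℕ} (hl : l.Nodup)
    (hr : ∀ y ∈ l, 1 ≤ y ∧ y ≤ n) : weight el l ≤ n + 2 * m := by
  have h₁ : l.length ≤ n := by
    have : l.toFinset ⊆ Finset.Icc 1 n := fun y hy => by
      simpa using hr y (by simpa using hy)
    have := Finset.card_le_card this
    rwa [List.toFinset_card_of_nodup hl, Nat.card_Icc, Nat.add_sub_cancel] at this
  have h₂ : (l.flatMap el).Nodup := by
    refine List.nodup_flatMap.2 ⟨fun y _ => h.lists.nodup y, hl.imp fun {a b} hab z ha hb => hab ?_⟩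
    rw [← h.lists.vtx _ _ ha, h.lists.vtx _ _ hb]
  have h₃ : (l.flatMap el).toFinset ⊆ Finset.Icc 1 (2 * m) := fun z hz => by
    simp only [List.mem_toFinset, List.mem_flatMap] at hz
    obtain ⟨y, -, hz⟩ := hz
    rcases (h.mem y z).1 hz with ⟨hz, -⟩ | ⟨d, hd, rfl, -⟩
    · have := h.range z hz; simp; omega
    · have := h.range d hd; simp; omega
  have h₄ := Finset.card_le_card h₃
  rw [List.toFinset_card_of_nodup h₂, Nat.card_Icc, List.length_flatMap] at h₄
  have h₅ : weight el l = l.length + (l.map fun y => (el y).length).sum := by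
    simp [weight, List.sum_map_add]
  omega

theorem push (h : Assoc src tgt m S ad el s) {d : ℕ} (h0 : d ≠ 0) (hS : d ∉ S) (had : d ∉ ad)
    (hr : s'.regs .addHead = d)
    (hn : s'.arrs .addNext = Function.update (s.arrs .addNext) d (s.regs .addHead))
    (ha : ∀ a ∈ [Arr.listHead, .entNext, .entPrev, .entVertex, .entChain, .entTwin],
      s'.arrs a = s.arrs a) : Assoc src tgt m S (d :: ad) el s' := by
  simp only [List.mem_cons, List.not_mem_nil, or_false, forall_eq_or_imp, forall_eq] at ha
  obtain ⟨e₁, e₂, e₃, e₄, e₅, e₆⟩ := ha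
  refine ⟨?_, h.mem, h.range, ?_, ?_, ?_, ?_, ?_⟩
  · have := h.lists
    unfold EntryLists.Stored at this ⊢
    rwa [e₁, e₂, e₃, e₄]
  · rw [e₅, e₆]; exact h.entry
  · intro c hc
    simp only [List.mem_cons, not_or]
    exact ⟨fun h => hS (h ▸ hc), h.disj c hc⟩
  · exact List.nodup_cons.2 ⟨had, h.ad_nodup⟩
  · simpa [Ne.symm h0] using h.ad_zero
  · rw [hr, hn]
    refine ⟨rfl, ?_⟩
    simpa using h.ad_trail.update had _

end Assoc

namespace ChainDec

variable {G : Graph ℕ ℕ} {n : ℕ} {D : ChainDec G n}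

theorem Links.nodup {A : List ℕ} {st lo : ℕ → ℕ} {nL : ℕ} {lk : ℕ → List ℕ} {le : ℕ → ℕ}
    (hL : D.Links A st lo nL lk le) {L : ℕ} (h1 : 1 ≤ L) (hn : L ≤ nL) : (lk L).Nodup :=
  (hL.pairwise h1 hn).imp fun {a b} h => by rintro rfl; exact lt_irrefl _ h

/-- The increase of the potential when a chain is associated with a link. -/
theorem potential_associate {m : ℕ} {A : List ℕ} {st lo : ℕ → ℕ} {nL : ℕ} {lk : ℕ → List ℕ}
    {le : ℕ → ℕ} (hL : D.Links A st lo nL lk le) {S : Finset ℕ} {ad : List ℕ}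
    {el el' : ℕ → List ℕ} {s : State} (h : Assoc D.src D.tgt m S ad el' s) {d : ℕ}
    (hs : D.Same st lo d)
    (hel : ∀ y, (el' y).length = (el y).length + (if y = D.src d then 1 else 0) +
      (if y = D.tgt d then 1 else 0)) :
    potential nL lk el' ≤ potential nL lk el + 2 * (Nat.log 2 (n + 2 * m) + 1) := by
  have key : ∀ M ∈ Finset.Icc 1 nL, logSum (weight el' (lk M)) ≤ logSum (weight el (lk M)) +
      if M = lo (D.src d) then 2 * (Nat.log 2 (n + 2 * m) + 1) else 0 := by
    intro M hM
    rw [Finset.mem_Icc] at hM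
    -- Only the link that contains both endpoints changes its weight, and it gains at most two
    -- entries.
    by_cases hMl : M = lo (D.src d)
    · rw [if_pos hMl]
      have hnd := hL.nodup hM.1 hM.2
      have h₁ := h.weight_le hnd fun y hy => (hL.mem_range hy).1
      have h₂ := weight_add_two hel hnd
      have h₃ : weight el (lk M) ≤ weight el' (lk M) := weight_mono _ fun y _ => by rw [hel]; omega
      obtain ⟨e, he⟩ := Nat.exists_eq_add_of_le h₃
      have h₄ := logSum_add_le_mul (weight el (lk M)) e (n + 2 * m) (by omega)
      rw [he]
      exact h₄.trans (Nat.add_le_add_left (Nat.mul_le_mul_right _ (by omega)) _)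
    · rw [if_neg hMl]
      refine logSum_mono (weight_mono _ fun y hy => ?_)
      have hlo := ((hL.mem M y).1 hy).2.2
      have h₁ : y ≠ D.src d := by rintro rfl; exact hMl hlo.symm
      have h₂ : y ≠ D.tgt d := by rintro rfl; exact hMl (by rw [hs.2.2, hlo])
      simp [hel, h₁, h₂]
  refine (Finset.sum_le_sum key).trans ?_
  rw [Finset.sum_add_distrib, Finset.sum_ite_eq']
  unfold potential
  split_ifs <;> omega

/-- Each child costs 400 credits and, if it is associated with a link, an increase of the potential
by at most `2 * (Nat.log 2 (n + 2 * m) + 1)`, which is weighted by 800; this gives the factor 1600.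
-/
theorem wp_processChildren {m : ℕ} {A : List ℕ} {lk el : ℕ → List ℕ} {S : Finset ℕ} {ad : List ℕ}
    {s : State} (hs : D.Stored m s) (h : D.Conf m A lk el S ad s) {c : ℕ} (hcur : s.regs .cur = c)
    (hnew : ∀ d ∈ D.ch c, d ∉ S ∧ d ∉ ad) {k : ℕ}
    (hk : (400 + 1600 * (Nat.log 2 (n + 2 * m) + 1)) * (D.ch c).length + 20 +
      800 * potential (s.regs .numL) lk el ≤ k) :
    WP processChildren s k fun s' k' => ∃ el' S' ad',
      k + 800 * potential (s'.regs .numL) lk el' ≤ k' + 800 * potential (s.regs .numL) lk el +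
        (400 + 1600 * (Nat.log 2 (n + 2 * m) + 1)) * (D.ch c).length + 20 ∧
      D.Conf m A lk el' S' ad' s' ∧
      ∀ d, (d ∈ S' ∨ d ∈ ad') ↔ ((d ∈ S ∨ d ∈ ad) ∨ d ∈ D.ch c) := by
  obtain ⟨C, hC⟩ : ∃ C, 400 + 1600 * (Nat.log 2 (n + 2 * m) + 1) = C := ⟨_, rfl⟩
  rw [hC] at hk ⊢
  have hrange := fun d => D.ch_mem c d
  unfold processChildren
  simp only [block]
  refine .seq (.run 5 (by omega) fun k₁ hk₁ => ?_)
  generalize hs₁ : run (Prog.assign Reg.d _ : Prog) s = s₁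
  have e₀ : s₁.arrs = s.arrs := by rw [← hs₁]; simp
  have e₁ : ∀ r, r ≠ Reg.d → s₁.regs r = s.regs r := by intro r h; rw [← hs₁]; simp [h]
  have e₂ : s₁.regs .d = s.arrs .childHead c := by rw [← hs₁]; simp [hcur]
  refine .while (fun s' k' => ∃ dn rest el' S' ad', D.ch c = dn ++ rest ∧
    Trail (s.arrs .childNext) (s'.regs .d) rest 0 ∧
    k + 800 * potential (s'.regs .numL) lk el' ≤ k' + 800 * potential (s.regs .numL) lk el +
        C * dn.length + 5 ∧
    D.Conf m A lk el' S' ad' s' ∧ ∀ d, (d ∈ S' ∨ d ∈ ad') ↔ ((d ∈ S ∨ d ∈ ad) ∨ d ∈ dn))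
    ⟨[], D.ch c, el, S, ad, rfl, by rw [e₂]; exact hs.child c, ?_, ?_, by simp⟩ ?_
  · rw [e₁ _ (by simp)]; simp; omega
  · refine ⟨?_, ?_, h.assoc.congr (e₁ _ (by simp)) (by simp [e₀]), ?_, ?_, h.range⟩
    · rw [e₁ _ (by simp), e₀]; exact h.links
    · rw [e₁ _ (by simp), e₀]; exact h.dll
    · rw [e₀]; exact h.same
    · rw [e₀]; exact h.diff
  rintro s' k' ⟨dn, rest, el', S', ad', hch, ht, hk', hc, hmem⟩ hf
  have hlen : (D.ch c).length = dn.length + rest.length := by rw [hch]; simp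
  rw [hlen, mul_add] at hk
  have f₁ : s'.regs .numE = m := by rw [hf.regs _ rfl, e₁ _ (by simp)]; exact hs.numE
  have f₂ : s'.arrs .src = D.src := by rw [hf.arrs _ rfl, e₀]; exact hs.src
  have f₃ : s'.arrs .tgt = D.tgt := by rw [hf.arrs _ rfl, e₀]; exact hs.tgt
  have f₄ : s'.arrs .childNext = s.arrs .childNext := by rw [hf.arrs _ rfl, e₀]
  have f₅ : s'.regs .numL = s.regs .numL := by rw [hf.regs _ rfl, e₁ _ (by simp)]
  rw [f₅] at hk'
  refine ⟨by simp; omega, fun hb => ?_, fun hb => ?_⟩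
  · simp only [Test.Holds, Expr.eval] at hb
    simp only [Test.cost, Expr.cost, cost_ofNat]
    obtain ⟨l', rfl, hl'⟩ := ht.exists_cons hb
    obtain ⟨d, hd⟩ : ∃ d, s'.regs .d = d := ⟨_, rfl⟩
    rw [hd] at hb hl' hch
    have hdm : d ∈ D.ch c := by rw [hch]; simp
    have hdr := (hrange d).1 hdm
    have hle := hs.le
    have hnd : d ∉ dn := by
      have := D.ch_nodup c
      rw [hch, List.nodup_append] at this
      exact fun hm => this.2.2 d hm d (by simp) rfl
    have hno : ¬ (d ∈ S' ∨ d ∈ ad') := by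
      rw [hmem]; have := hnew d hdm; tauto
    rw [not_or] at hno
    have hrest : ∀ e, (e ∈ S ∨ e ∈ ad) ∨ e ∈ dn ++ [d] ↔ e = d ∨ (e ∈ S' ∨ e ∈ ad') := by
      intro e; rw [hmem]; simp only [List.mem_append, List.mem_singleton]; tauto
    simp only [List.length_cons, mul_add, mul_one] at hk
    refine .seq (.conseq (P := fun s₂ k₂ => ∃ el₂ S₂ ad₂,
      k' + 800 * potential (s.regs .numL) lk el₂ ≤ k₂ + 800 * potential (s.regs .numL) lk el' +
        (C - 100) ∧ D.Conf m A lk el₂ S₂ ad₂ s₂ ∧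
        ∀ e, (e ∈ S₂ ∨ e ∈ ad₂) ↔ e = d ∨ (e ∈ S' ∨ e ∈ ad')) ?_ ?_)
    · refine .ite (by simp [Test.cost, Expr.cost, cost_ofNat]; omega) (fun ht => ?_) fun ht => ?_
      · simp only [Test.Holds, Expr.eval, f₂, f₃, hd, eval_ofNat] at ht
        simp only [Test.cost, Expr.cost, cost_ofNat]
        refine .conseq (wp_associateChain hc.assoc f₁ f₂ f₃ hd (by omega) (by omega) hno.1 hno.2
          (by omega)) ?_
        rintro s₂ k₂ ⟨hk₂, el₂, hA₂, hel₂⟩ hf₂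
        have hp := potential_associate hc.links hA₂ ht hel₂
        rw [f₅] at hp
        refine ⟨el₂, _, _, by omega, ⟨?_, ?_, hA₂, ?_, ?_, ?_⟩, by simp [or_assoc]⟩
        · rw [hf₂.arrs _ rfl, hf₂.arrs _ rfl, hf₂.arrs _ rfl, hf₂.regs _ rfl]; exact hc.links
        · rw [hf₂.arrs _ rfl, hf₂.arrs _ rfl, hf₂.arrs _ rfl, hf₂.arrs _ rfl, hf₂.regs _ rfl]
          exact hc.dll
        · rw [hf₂.arrs _ rfl, hf₂.arrs _ rfl]
          intro e he
          rcases Finset.mem_insert.1 he with rfl | he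
          · exact ht
          · exact hc.same e he
        · rw [hf₂.arrs _ rfl, hf₂.arrs _ rfl]; exact hc.diff
        · intro e he
          rw [Finset.mem_insert, or_assoc] at he
          rcases he with rfl | he
          · omega
          · exact hc.range e he
      · simp only [Test.Holds, Expr.eval, f₂, f₃, hd, eval_ofNat] at ht
        simp only [Test.cost, Expr.cost, cost_ofNat]
        unfold pushAddable
        simp only [block]
        refine .run 20 (by omega) fun k₂ hk₂ => ?_
        refine ⟨el', S', d :: ad', by omega, ⟨?_, ?_, ?_, ?_, ?_, ?_⟩, ?_⟩
        · simpa [run] using hc.links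
        · simpa [run] using hc.dll
        · exact hc.assoc.push (by omega) hno.1 hno.2 (by simp [run, hd]) (by simp [run, hd])
            (by simp [run])
        · simpa [run] using hc.same
        · have := hc.diff
          simp only [run, arrs_setReg, arrs_setCell]
          intro e he
          rcases List.mem_cons.1 he with rfl | he
          · simpa [Same] using ht
          · simpa using this e he
        · intro e he
          simp only [List.mem_cons] at he
          rcases he with he | rfl | he
          · exact hc.range e (.inl he)
          · omega
          · exact hc.range e (.inr he)
        · intro e; simp only [List.mem_cons]; exact or_left_comm
    rintro s₂ k₂ ⟨el₂, S₂, ad₂, hk₂, hc₂, hmem₂⟩ hf₂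
    have g₁ : s₂.regs .d = d := by rw [hf₂.regs _ rfl]; exact hd
    have g₂ : s₂.arrs .childNext = s.arrs .childNext := by rw [hf₂.arrs _ rfl]; exact f₄
    have g₃ : s₂.regs .numL = s.regs .numL := by rw [hf₂.regs _ rfl]; exact f₅
    refine .run 5 (by omega) fun k₃ hk₃ => ?_
    refine ⟨dn ++ [d], l', el₂, S₂, ad₂, by rw [hch]; simp, by simpa [g₁, g₂] using hl', ?_, ?_, ?_⟩
    · simp [g₃, mul_add]; omega
    · refine ⟨?_, ?_, hc₂.assoc.congr (by simp) (by simp), ?_, ?_, hc₂.range⟩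
      · simpa using hc₂.links
      · simpa using hc₂.dll
      · simpa using hc₂.same
      · simpa using hc₂.diff
    · intro e; rw [hmem₂, hrest]
  · simp only [Test.Holds, Expr.eval, not_not] at hb
    simp only [Test.cost, Expr.cost, cost_ofNat]
    have hz : 0 ∉ rest := fun h0 => by
      have := (hrange 0).1 (by rw [hch]; simp [h0]); omega
    have hb' : s'.regs .d = 0 := hb
    rw [hb'] at ht
    have hrest : rest = [] := ht.eq_nil_of_notMem hz
    subst hrest
    simp only [List.append_nil] at hch
    subst hch
    exact ⟨el', S', ad', by rw [f₅]; omega, hc, hmem⟩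

end ChainDec

/-! ### Amortized accounting, the initial graph and the main loop -/

theorem sum_length_le {l : ℕ → List ℕ} {U T : Finset ℕ} {f : ℕ → ℕ} (hn : ∀ c ∈ U, (l c).Nodup)
    (h : ∀ c ∈ U, ∀ x ∈ l c, x ∈ T ∧ f x = c) : ∑ c ∈ U, (l c).length ≤ T.card := by
  have h₁ : ∑ c ∈ U, (l c).length = (U.biUnion fun c => (l c).toFinset).card := by
    rw [Finset.card_biUnion]
    · exact Finset.sum_congr rfl fun c hc => (List.toFinset_card_of_nodup (hn c hc)).symm
    · intro a ha b hb hab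
      refine Finset.disjoint_left.2 fun x hx hx' => hab ?_
      rw [← (h a ha x (by simpa using hx)).2, ← (h b hb x (by simpa using hx')).2]
  rw [h₁]
  refine Finset.card_le_card fun x hx => ?_
  simp only [Finset.mem_biUnion, List.mem_toFinset] at hx
  obtain ⟨c, hc, hx⟩ := hx
  exact (h c hc x hx).1

namespace ChainDec

variable {G : Graph ℕ ℕ} {n : ℕ} {D : ChainDec G n}

/-- The labels of the vertices after a chain has been added. -/
theorem Labels.add {A : List ℕ} {st st' : ℕ → ℕ} (hst : D.Labels A st) (hA : D.Closed A) {c : ℕ}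
    (h1 : 1 ≤ c) (hN : c ≤ D.N) (hc : c ∉ A) (hp : D.sB (D.tgt c) ∈ A)
    (h : ∀ x, st' x = if x ∈ D.xs c then 1 else if x = D.src c ∨ x = D.tgt c then 2 else st x) :
    D.Labels (A ++ [c]) st' := by
  have hsrc := hA.cov_src h1 hN hp
  have hmem := fun x => D.mem_xs c x h1 hN
  have hone : D.sB 1 ∈ A := by rw [D.sB_one]; exact hA.one
  have hne : ∀ x, (1 ≤ x ∧ x ≤ n) → x ∉ D.xs c → D.sB x ≠ c := fun x hx hxc he => by
    by_cases hx1 : x = 1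
    · rw [hx1] at he; exact hc (he ▸ hone)
    · exact hxc ((hmem x).2 ⟨hx, hx1, he⟩)
  refine ⟨fun x hx => ?_, fun x hx => ?_, fun x hx => ?_⟩
  · rw [h]
    by_cases hxc : x ∈ D.xs c
    · simp [hxc, ((hmem x).1 hxc).2.2]
    · by_cases hxs : x = D.src c ∨ x = D.tgt c
      · rw [if_neg hxc, if_pos hxs]
        rcases hxs with rfl | rfl <;> simp [hsrc, hp]
      · rw [if_neg hxc, if_neg hxs, hst.zero x hx]
        simp [hne x hx hxc]
  · rw [h]
    by_cases hxc : x ∈ D.xs c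
    · obtain ⟨-, hx1, hxs⟩ := (hmem x).1 hxc
      rw [if_pos hxc]
      simp only [OfNat.one_ne_ofNat, hx1, false_or, false_iff, not_and, not_exists]
      rintro - c' hc' hx'
      rcases List.mem_append.1 hc' with hc' | hc'
      · have hr := hA.range c' hc'
        have : D.sB x ∈ A := by
          rcases hx' with rfl | rfl
          · exact hA.cov_src hr.1 hr.2 (hA.parent c' hc')
          · exact hA.parent c' hc'
        rw [hxs] at this
        exact hc this
      · rw [List.mem_singleton] at hc'
        subst hc'
        rcases hx' with rfl | rfl
        · exact D.src_notMem h1 hN hxc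
        · exact D.tgt_notMem h1 hN hxc
    · by_cases hxs : x = D.src c ∨ x = D.tgt c
      · rw [if_neg hxc, if_pos hxs]
        have : D.sB x ∈ A := by rcases hxs with rfl | rfl <;> assumption
        simp only [true_iff]
        exact .inr ⟨by simp [this], c, by simp, by simpa [eq_comm] using hxs⟩
      · rw [if_neg hxc, if_neg hxs, hst.two x hx]
        simp only [not_or] at hxs
        simp [hne x hx hxc, Ne.symm hxs.1, Ne.symm hxs.2, or_and_right, exists_or]
  · rw [h]
    have := hst.le x hx
    split_ifs <;> omega

theorem Closed.append {A : List ℕ} (hA : D.Closed A) {c : ℕ} (h1 : 1 ≤ c) (hN : c ≤ D.N)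
    (hc : c ∉ A) (hp : D.sB (D.tgt c) ∈ A) : D.Closed (A ++ [c]) := by
  refine ⟨fun d hd => ?_, ?_, by simp [hA.one], fun d hd => ?_⟩
  · rcases List.mem_append.1 hd with hd | hd
    · exact hA.range d hd
    · rw [List.mem_singleton] at hd; omega
  · exact List.nodup_append.2 ⟨hA.nodup, by simp, fun a ha b hb => by
      rw [List.mem_singleton] at hb; rintro rfl; exact hc (hb ▸ ha)⟩
  · rcases List.mem_append.1 hd with hd | hd
    · simp [hA.parent d hd]
    · rw [List.mem_singleton] at hd; simp [hd, hp]

/-- The credits set aside for the chains outside `A`. -/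
def debt (D : ChainDec G n) (K : ℕ) (A : List ℕ) : ℕ :=
  ∑ c ∈ (Finset.Icc 1 D.N).filter fun c => c ∉ A, K * (1 + (D.xs c).length + (D.ch c).length)

theorem debt_append (D : ChainDec G n) (K : ℕ) {A : List ℕ} {c : ℕ} (h1 : 1 ≤ c) (hN : c ≤ D.N)
    (hc : c ∉ A) :
    D.debt K (A ++ [c]) + K * (1 + (D.xs c).length + (D.ch c).length) = D.debt K A := by
  unfold debt
  rw [← Finset.sum_erase_add _ _ (a := c) (by simp [h1, hN, hc] : c ∈
    (Finset.Icc 1 D.N).filter fun c => c ∉ A)]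
  congr 2
  ext d
  simp only [Finset.mem_filter, Finset.mem_erase, List.mem_append, List.mem_singleton, not_or]
  tauto

/-- The inner vertices of the chains are disjoint sets of vertices, and each chain is a child of at
most one chain. So the chains themselves, their inner vertices and their children number at most `n
+ 2 * D.N`. -/
theorem debt_nil_le (D : ChainDec G n) (K : ℕ) : D.debt K [] ≤ K * (n + 2 * D.N) := by
  unfold debt
  rw [← Finset.mul_sum]
  refine Nat.mul_le_mul_left _ ?_
  simp only [List.not_mem_nil, not_false_eq_true, Finset.filter_true, Finset.sum_add_distrib]
  have h₁ : ∑ c ∈ Finset.Icc 1 D.N, (D.xs c).length ≤ (Finset.Icc 1 n).card := by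
    refine sum_length_le (f := D.sB) (fun c hc => ?_) fun c hc x hx => ?_
    · rw [Finset.mem_Icc] at hc; exact D.xs_nodup hc.1 hc.2
    · rw [Finset.mem_Icc] at hc
      have := (D.mem_xs c x hc.1 hc.2).1 hx
      exact ⟨Finset.mem_Icc.2 this.1, this.2.2⟩
  have h₂ : ∑ c ∈ Finset.Icc 1 D.N, (D.ch c).length ≤ (Finset.Icc 1 D.N).card := by
    refine sum_length_le (f := fun d => D.sB (D.tgt d)) (fun c _ => D.ch_nodup c) fun c _ x hx => ?_
    have := (D.ch_mem c x).1 hx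
    exact ⟨Finset.mem_Icc.2 (by omega), this.2.2⟩
  simp only [Finset.sum_const, Nat.card_Icc, smul_eq_mul] at h₁ h₂ ⊢
  omega

theorem length_xs_le (D : ChainDec G n) {c : ℕ} (h1 : 1 ≤ c) (hN : c ≤ D.N) :
    (D.xs c).length ≤ n := by
  have := sum_length_le (l := D.xs) (U := {c}) (T := Finset.Icc 1 n) (f := fun _ => c)
    (by simpa using D.xs_nodup h1 hN)
    (by simpa using fun x hx => (D.mem_xs_range h1 hN hx).1)
  simpa using this

theorem logSum_xs_le (D : ChainDec G n) (m : ℕ) {c : ℕ} (h1 : 1 ≤ c) (hN : c ≤ D.N) :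
    logSum (D.xs c).length ≤ (D.xs c).length * (Nat.log 2 (n + 2 * m) + 1) := by
  have hn := D.length_xs_le h1 hN
  have := logSum_add_le_mul 0 (D.xs c).length (n + 2 * m) (by omega)
  simpa [logSum] using this

/-- The situation after the chains `1`, `2` and those in the list `B` have been added. -/
structure Adding (D : ChainDec G n) (m : ℕ) (B : List ℕ) (lk el : ℕ → List ℕ) (S : Finset ℕ)
    (ad : List ℕ) (s : State) : Prop where
  stored : D.Stored m s
  closed : D.Closed (1 :: 2 :: B)
  labels : D.Labels (1 :: 2 :: B) (s.arrs .status)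
  conf : D.Conf m (1 :: 2 :: B) lk el S ad s
  pending : ∀ d, (d ∈ S ∨ d ∈ ad) ↔
    (2 < d ∧ d ≤ D.N) ∧ d ∉ 1 :: 2 :: B ∧ D.sB (D.tgt d) ∈ 1 :: 2 :: B
  numAdded : s.regs .numAdded = B.length + 2
  order : (List.range (B.length + 2)).map (fun k => s.arrs .order (k + 1)) = 1 :: 2 :: B
  builds : ∀ Ps, Mader.BuildsUp G (D.union (1 :: 2 :: B)) Ps →
    Mader.BuildsUp G (D.union [1, 2]) (B.map D.edges ++ Ps)

theorem Stored.congr {m : ℕ} {s s' : State} (h : D.Stored m s)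
    (hr : ∀ r ∈ [Reg.numE, .numC], s'.regs r = s.regs r)
    (ha : ∀ a ∈ [Arr.num, .par, .parEdge, .low, .src, .tgt, .backEdge, .childNext, .childHead],
      s'.arrs a = s.arrs a) : D.Stored m s' := by
  simp only [List.mem_cons, List.not_mem_nil, or_false, forall_eq_or_imp, forall_eq] at hr ha
  obtain ⟨r₁, r₂⟩ := hr
  obtain ⟨a₁, a₂, a₃, a₄, a₅, a₆, a₇, a₈, a₉⟩ := ha
  exact ⟨by rw [r₁, h.numE], by rw [r₂, h.numC], h.le,
    by rw [a₁, h.num], by rw [a₂, h.par], by rw [a₃, h.parEdge],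
    by rw [a₄, h.low], by rw [a₅, h.src], by rw [a₆, h.tgt],
    by rw [a₇, h.back], by rw [a₈, a₉]; exact h.child⟩

theorem Stored.of_frame {m : ℕ} {s s' : State} {c : Prog} (h : D.Stored m s) (hf : Frame c s s')
    (hr : ∀ r ∈ [Reg.numE, .numC], c.writesReg r = false)
    (ha : ∀ a ∈ [Arr.num, .par, .parEdge, .low, .src, .tgt, .backEdge, .childNext, .childHead],
      c.writesArr a = false) : D.Stored m s' :=
  h.congr (fun r h => hf.regs r (hr r h)) fun a h => hf.arrs a (ha a h)

theorem Conf.mono {m : ℕ} {A A' : List ℕ} {lk el : ℕ → List ℕ} {S : Finset ℕ} {ad : List ℕ}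
    {s : State} (h : D.Conf m A lk el S ad s) (hA : ∀ c ∈ A, c ∈ A') :
    D.Conf m A' lk el S ad s := { h with links := h.links.mono hA }

theorem Conf.congr {m : ℕ} {A : List ℕ} {lk el : ℕ → List ℕ} {S : Finset ℕ} {ad : List ℕ}
    {s s' : State} (h : D.Conf m A lk el S ad s)
    (hr : ∀ r ∈ [Reg.numL, .addHead], s'.regs r = s.regs r) (ha : s'.arrs = s.arrs) :
    D.Conf m A lk el S ad s' := by
  simp only [List.mem_cons, List.not_mem_nil, or_false, forall_eq_or_imp, forall_eq] at hr
  obtain ⟨r₁, r₂⟩ := hr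
  refine ⟨?_, ?_, h.assoc.congr r₂ (by simp [ha]), ?_, ?_, h.range⟩ <;> rw [ha]
  · rw [r₁]; exact h.links
  · rw [r₁]; exact h.dll
  · exact h.same
  · exact h.diff

/-- Taking the first chain from the list of addable chains. -/
theorem Conf.pop {m : ℕ} {A : List ℕ} {lk el : ℕ → List ℕ} {S : Finset ℕ} {c : ℕ} {ad : List ℕ}
    {s s' : State} (h : D.Conf m A lk el S (c :: ad) s) (hr : s'.regs .numL = s.regs .numL)
    (ha : s'.arrs = s.arrs) (hh : s'.regs .addHead = s.arrs .addNext c) :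
    D.Conf m A lk el S ad s' := by
  have hA := h.assoc
  refine ⟨?_, ?_, ⟨?_, hA.mem, hA.range, ?_, ?_, ?_, ?_, ?_⟩, ?_, ?_, ?_⟩
  · rw [ha, hr]; exact h.links
  · rw [ha, hr]; exact h.dll
  · unfold EntryLists.Stored; rw [ha]; exact hA.lists
  · rw [ha]; exact hA.entry
  · exact fun d hd hm => hA.disj d hd (by simp [hm])
  · exact (List.nodup_cons.1 hA.ad_nodup).2
  · exact fun hm => hA.ad_zero (by simp [hm])
  · rw [ha, hh]; exact hA.ad_trail.2
  · rw [ha]; exact h.same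
  · rw [ha]; exact fun d hd => h.diff d (by simp [hd])
  · exact fun d hd => h.range d (hd.imp_right fun hm => by simp [hm])

end ChainDec

namespace ChainDec

variable {G : Graph ℕ ℕ} {n : ℕ} {D : ChainDec G n}

/-- The credits per vertex and chain. -/
def rate (n m : ℕ) : ℕ := 5000 * (Nat.log 2 (n + 2 * m) + 1)

/-- The credits set aside for the chain `c` pay for its addition. -/
theorem rate_bound {m l h B x y : ℕ} (hB : Nat.log 2 (n + 2 * m) + 1 = B) (hx : x ≤ l * B)
    (hy : y = h * B) : 5000 + 60 * l + 800 * x + 400 * h + 1600 * y ≤ rate n m * (1 + l + h) := by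
  have h₁ : l ≤ l * B := Nat.le_mul_of_pos_right _ (by omega)
  have h₂ : h ≤ h * B := Nat.le_mul_of_pos_right _ (by omega)
  have : rate n m * (1 + l + h) = 5000 * B + 5000 * (l * B) + 5000 * (h * B) := by
    rw [rate, hB]; ring
  omega

/-- The offset 4500 is the part of the credits of `c` that may have been spent before: it leaves
room for two calls of `makeBranch` with 2000 credits each and for the surrounding instructions. By
`rate_bound` the remaining credits pay for both programs. -/
theorem wp_addLink_processChildren {m : ℕ} {A : List ℕ} {lk el : ℕ → List ℕ} {S : Finset ℕ}
    {ad : List ℕ} {s : State} (hs : D.Stored m s) (h : D.Conf m A lk el S ad s) {c : ℕ}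
    (hcur : s.regs .cur = c) (hc : c ∈ A) (h1 : 1 ≤ c) (hN : c ≤ D.N)
    (h0 : ∀ x ∈ D.xs c, s.arrs .status x = 0) (hsrc : s.arrs .status (D.src c) = 2)
    (htgt : s.arrs .status (D.tgt c) = 2) (had : ∀ d ∈ ad, s.arrs .status (D.tgt d) ≠ 0)
    (hnew : ∀ d ∈ D.ch c, d ∉ S ∧ d ∉ ad) {k : ℕ}
    (hk : 800 * potential (s.regs .numL) lk el +
      rate n m * (1 + (D.xs c).length + (D.ch c).length) ≤ k + 4500) :
    WP (.seq addLink processChildren) s k fun s' k' => ∃ lk' el' S' ad',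
      k + 800 * potential (s'.regs .numL) lk' el' + 4500 ≤
        k' + 800 * potential (s.regs .numL) lk el +
          rate n m * (1 + (D.xs c).length + (D.ch c).length) ∧
      D.Conf m A lk' el' S' ad' s' ∧ s'.regs .numL = s.regs .numL + 1 ∧
      (s'.arrs .status = fun x => if x ∈ D.xs c then 1 else s.arrs .status x) ∧
      s'.regs .numAdded = s.regs .numAdded + 1 ∧
      s'.arrs .order = Function.update (s.arrs .order) (s.regs .numAdded + 1) c ∧
      ∀ d, (d ∈ S' ∨ d ∈ ad') ↔ ((d ∈ S ∨ d ∈ ad) ∨ d ∈ D.ch c) := by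
  have hlog := D.logSum_xs_le m h1 hN
  have hrate := rate_bound rfl hlog (h := (D.ch c).length) rfl
  have hmul : (400 + 1600 * (Nat.log 2 (n + 2 * m) + 1)) * (D.ch c).length =
    400 * (D.ch c).length + 1600 * ((D.ch c).length * (Nat.log 2 (n + 2 * m) + 1)) := by ring
  generalize rate n m * (1 + (D.xs c).length + (D.ch c).length) = R at hrate hk ⊢
  generalize (D.ch c).length * (Nat.log 2 (n + 2 * m) + 1) = Y at hrate hmul
  refine .seq (.conseq (wp_addLink hs h hcur hc h1 hN h0 hsrc htgt had (by omega)) ?_)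
  rintro s₁ k₁ ⟨hk₁, lk₁, hc₁, hnL₁, hp₁, hst₁, hna₁, hor₁⟩ hf₁
  have hs₁ := hs.of_frame hf₁ (by decide) (by decide)
  refine .conseq (wp_processChildren hs₁ hc₁ (c := c) (by rw [hf₁.regs _ rfl, hcur]) hnew
    (by omega)) ?_
  rintro s₂ k₂ ⟨el₂, S₂, ad₂, hk₂, hc₂, hm₂⟩ hf₂
  exact ⟨lk₁, el₂, S₂, ad₂, by omega, hc₂, by rw [hf₂.regs _ rfl, hnL₁],
    by rw [hf₂.arrs _ rfl, hst₁],
    by rw [hf₂.regs _ rfl, hna₁], by rw [hf₂.arrs _ rfl, hor₁], hm₂⟩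

/-- Adding `c` removes `c` from the pending chains and contributes exactly its children. None of
these can be in `A` already, because `A` is closed under parents and `c` is missing, and `c` is not
its own child. -/
theorem pending_append {A : List ℕ} (hA : D.Closed A) {c : ℕ} (h2 : 2 < c) (hN : c ≤ D.N)
    (hc : c ∉ A) (hp : D.sB (D.tgt c) ∈ A) (d : ℕ) :
    (((2 < d ∧ d ≤ D.N) ∧ d ∉ A ∧ D.sB (D.tgt d) ∈ A) ∧ d ≠ c ∨ d ∈ D.ch c) ↔
      (2 < d ∧ d ≤ D.N) ∧ d ∉ A ++ [c] ∧ D.sB (D.tgt d) ∈ A ++ [c] := by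
  rw [D.ch_mem]
  simp only [List.mem_append, List.mem_singleton, not_or]
  constructor
  · rintro (⟨⟨h₁, h₂, h₃⟩, h₄⟩ | ⟨h₁, h₂, h₃⟩)
    · exact ⟨h₁, ⟨h₂, h₄⟩, .inl h₃⟩
    · refine ⟨⟨h₁, h₂⟩, ⟨fun hd => hc (h₃ ▸ hA.parent d hd), ?_⟩, .inr h₃⟩
      rintro rfl
      exact hc (h₃ ▸ hp)
  · rintro ⟨h₁, ⟨h₂, h₄⟩, h₃ | h₃⟩
    · exact .inl ⟨⟨h₁, h₂, h₃⟩, h₄⟩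
    · exact .inr ⟨h₁.1, h₁.2, h₃⟩

theorem wp_addChains {m : ℕ} (hm : G.edgeSet = Set.Icc 1 m) (hs1 : D.src 1 = 1) (hs2 : D.src 2 = 1)
    {B : List ℕ} {lk el : ℕ → List ℕ} {S : Finset ℕ} {ad : List ℕ} {s : State}
    (h : D.Adding m B lk el S ad s) {k : ℕ}
    (hk : 800 * potential (s.regs .numL) lk el + D.debt (rate n m) (1 :: 2 :: B) +
      60 * s.regs .numL + 100 ≤ k) :
    WP addChains s k fun s' k' => 60 * s'.regs .numL + 80 ≤ k' ∧
      ∃ B' lk' el' S', D.Adding m B' lk' el' S' [] s' := by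
  -- The credits cover the weighted potential, the debt of the missing chains, and 60 per link. The
  -- latter are not spent here but are kept for the scan of all links in the report.
  refine .while (fun s' k' => ∃ B lk el S ad, D.Adding m B lk el S ad s' ∧
    800 * potential (s'.regs .numL) lk el + D.debt (rate n m) (1 :: 2 :: B) +
      60 * s'.regs .numL + 100 ≤ k')
    ⟨B, lk, el, S, ad, h, hk⟩ ?_
  clear h hk
  rintro s' k' ⟨B, lk, el, S, ad, h, hk'⟩ -
  have hhead := h.conf.assoc.ad_trail.head_eq
  refine ⟨by simp; omega, fun hb => ?_, fun hb => ?_⟩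
  swap
  · simp only [Test.Holds, Expr.eval, not_not] at hb
    have : ad = [] := (DLL.headD_eq_zero h.conf.assoc.ad_zero).1 (by rw [← hhead]; exact hb)
    subst this
    exact ⟨by simp only [Test.cost, Expr.cost, cost_ofNat]; omega, B, lk, el, S, h⟩
  simp only [Test.Holds, Expr.eval] at hb
  simp only [Test.cost, Expr.cost, cost_ofNat]
  obtain ⟨c, ad, rfl⟩ : ∃ c l, ad = c :: l := by
    cases ad with
    | nil => exact absurd hhead hb
    | cons c l => exact ⟨c, l, rfl⟩
  replace hhead : s'.regs .addHead = c := hhead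
  obtain ⟨⟨h2, hN⟩, hc, hp⟩ := (h.pending c).1 (.inr (by simp))
  have hA := h.closed
  have hst := h.labels
  have hdiff := h.conf.diff c (by simp)
  have hcS : c ∉ S := fun hm => h.conf.assoc.disj c hm (by simp)
  have hcad : c ∉ ad := (List.nodup_cons.1 h.conf.assoc.ad_nodup).1
  have hsB := hA.cov_src (by omega) hN hp
  have hsr := D.src_mem (by omega : 1 ≤ c) hN
  have htr := D.tgt_mem c (by omega) hN
  have hdebt := D.debt_append (rate n m) (by omega : 1 ≤ c) hN hc
  obtain ⟨R, hR⟩ : ∃ R, rate n m * (1 + (D.xs c).length + (D.ch c).length) = R := ⟨_, rfl⟩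
  have hR5 : 5000 ≤ R := by
    have := rate_bound (n := n) (m := m) rfl (Nat.zero_le ((D.xs c).length * _))
      (h := (D.ch c).length) rfl
    rw [hR] at this
    omega
  rw [hR] at hdebt
  simp only [block]
  refine .seq (.run 5 (by omega) fun k₁ hk₁ => ?_)
  refine .seq (.run 5 (by omega) fun k₂ hk₂ => ?_)
  refine .seq (.run 5 (by omega) fun k₃ hk₃ => ?_)
  generalize hs₁ : run (Prog.assign Reg.u _ : Prog) _ = s₁
  have e₀ : s₁.arrs = s'.arrs := by rw [← hs₁]; simp
  have e₁ : ∀ r, r ≠ Reg.u → r ≠ .cur → r ≠ .addHead → s₁.regs r = s'.regs r := by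
    intro r h₁ h₂ h₃; rw [← hs₁]; simp [h₁, h₂, h₃]
  have e₂ : s₁.regs .cur = c := by rw [← hs₁]; simp [hhead]
  have e₃ : s₁.regs .u = D.src c := by rw [← hs₁]; simp [hhead, h.stored.src]
  have e₄ : s₁.regs .addHead = s'.arrs .addNext c := by rw [← hs₁]; simp [hhead]
  have e₅ := e₁ .numL (by simp) (by simp) (by simp)
  have hS₁ : D.Stored m s₁ := h.stored.congr
    (by simp [e₁ .numE (by simp) (by simp) (by simp), e₁ .numC (by simp) (by simp) (by simp)])
    (by simp [e₀])
  have hC₁ := h.conf.pop e₅ e₀ e₄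
  refine .seq (.conseq (wp_makeBranch hA hS₁ hC₁ (by rw [e₃]; exact hsr)
    (by rw [e₃, e₀]; exact hst.one_or_two hsr hsB) (by rw [e₅]; omega)) ?_)
  rintro s₂ k₄ ⟨lk₂, el₂, S₂, ad₂, hk₄, hl₂, hC₂, hst₂, hm₂⟩ hf₂
  have hS₂ := hS₁.of_frame hf₂ (by decide) (by decide)
  rw [e₃, e₀] at hst₂
  rw [e₅] at hk₄ hl₂
  have g₁ : s₂.regs .cur = c := by rw [hf₂.regs _ rfl]; exact e₂
  refine .seq (.run 5 (by omega) fun k₅ hk₅ => ?_)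
  generalize hs₃ : run (Prog.assign Reg.u _ : Prog) _ = s₃
  have i₀ : s₃.arrs = s₂.arrs := by rw [← hs₃]; simp
  have i₁ : ∀ r, r ≠ Reg.u → s₃.regs r = s₂.regs r := by
    intro r h₁; rw [← hs₃]; simp [h₁]
  have i₂ : s₃.regs .u = D.tgt c := by rw [← hs₃]; simp [g₁, hS₂.tgt]
  have hS₃ : D.Stored m s₃ := hS₂.congr (by simp [i₁]) (by simp [i₀])
  have hC₃ := hC₂.congr (s' := s₃) (by simp [i₁]) i₀
  have i₃ := i₁ .numL (by simp)
  refine .seq (.conseq (wp_makeBranch hA hS₃ hC₃ (by rw [i₂]; exact htr) (by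
    rw [i₂, i₀, hst₂]
    by_cases hx : D.tgt c = D.src c
    · simp [hx]
    · rw [Function.update_of_ne hx]; exact hst.one_or_two htr hp) (by rw [i₃]; omega)) ?_)
  rintro s₄ k₆ ⟨lk₄, el₄, S₄, ad₄, hk₆, hl₄, hC₄, hst₄, hm₄⟩ hf₄
  have hS₄ := hS₃.of_frame hf₄ (by decide) (by decide)
  rw [i₂, i₀, hst₂] at hst₄
  rw [i₃] at hk₆ hl₄
  have hm₄' : ∀ d, (d ∈ S₄ ∨ d ∈ ad₄) ↔ ((2 < d ∧ d ≤ D.N) ∧ d ∉ 1 :: 2 :: B ∧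
      D.sB (D.tgt d) ∈ 1 :: 2 :: B) ∧ d ≠ c := by
    intro d
    rw [hm₄, hm₂, ← h.pending]
    simp only [List.mem_cons]
    by_cases hd : d = c
    · subst hd; simp [hcS, hcad]
    · simp [hd]
  have hcov : ∀ x, x ∈ D.xs c → s₄.arrs .status x = 0 := by
    intro x hx
    have h₁ : x ≠ D.src c := fun h => D.src_notMem (by omega) hN (h ▸ hx)
    have h₂ : x ≠ D.tgt c := fun h => D.tgt_notMem (by omega) hN (h ▸ hx)
    have hxm := (D.mem_xs c x (by omega) hN).1 hx
    rw [hst₄, Function.update_of_ne h₂, Function.update_of_ne h₁, hst.zero x hxm.1, hxm.2.2]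
    exact hc
  have hsub : ∀ d ∈ 1 :: 2 :: B, d ∈ 1 :: 2 :: B ++ [c] := fun d hd =>
    List.mem_append.2 (.inl hd)
  refine .conseq (wp_addLink_processChildren hS₄ (hC₄.mono hsub) (c := c) ?_ (by simp) (by omega) hN
    hcov ?_ ?_ (fun d hd => ?_) (fun d hd => ?_) (by omega)) ?_
  · rw [hf₄.regs _ rfl, i₁ _ (by simp)]; exact g₁
  · rw [hst₄]
    by_cases hx : D.src c = D.tgt c
    · simp [hx]
    · simp [Function.update_of_ne hx]
  · simp [hst₄]
  · obtain ⟨⟨hd₁, -, hd₂⟩, -⟩ := (hm₄' d).1 (.inr hd)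
    rw [hst₄]
    by_cases hx : D.tgt d = D.tgt c
    · simp [hx]
    by_cases hy : D.tgt d = D.src c
    · rw [Function.update_of_ne hx, hy]; simp
    rw [Function.update_of_ne hx, Function.update_of_ne hy, Ne,
      hst.zero _ (D.tgt_mem d (by omega) hd₁.2)]
    exact not_not.2 hd₂
  · rw [← not_or, hm₄']
    rintro ⟨⟨-, -, hd'⟩, -⟩
    rw [((D.ch_mem c d).1 hd).2.2] at hd'
    exact hc hd'
  rintro s₅ k₇ ⟨lk₅, el₅, S₅, ad₅, hk₇, hC₅, hl₅, hst₅, hna₅, hor₅, hm₅⟩ hf₅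
  have n₁ : s₄.regs .numAdded = B.length + 2 := by
    rw [hf₄.regs _ rfl, i₁ _ (by simp), hf₂.regs _ rfl, e₁ _ (by simp) (by simp) (by simp)]
    exact h.numAdded
  have n₂ : s₄.arrs .order = s'.arrs .order := by
    rw [hf₄.arrs _ rfl, i₀, hf₂.arrs _ rfl, e₀]
  rw [hR] at hk₇
  refine ⟨B ++ [c], lk₅, el₅, S₅, ad₅, ⟨hS₄.of_frame hf₅ (by decide) (by decide),
    hA.append (by omega) hN hc hp, ?_, hC₅, fun d => ?_, ?_, ?_, fun Ps hPs => ?_⟩, ?_⟩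
  · refine hst.add hA (by omega) hN hc hp fun x => ?_
    rw [hst₅, hst₄]
    by_cases h₁ : x = D.tgt c
    · subst h₁; simp
    · by_cases h₂ : x = D.src c
      · subst h₂; simp [h₁]
      · simp [h₁, h₂]
  · rw [hm₅, hm₄']
    exact pending_append hA h2 hN hc hp d
  · rw [hna₅, n₁]; simp
  · have ho := h.order
    rw [hor₅, n₁, n₂, List.length_append, List.length_singleton, show B.length + 1 + 2 =
      B.length + 2 + 1 by omega, List.range_succ, List.map_append]
    simp only [List.map_cons, List.map_nil, Function.update_self]
    rw [← List.cons_append, ← List.cons_append, ← ho]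
    congr 1
    refine List.map_congr_left fun i hi => Function.update_of_ne ?_ _ _
    have := List.mem_range.1 hi
    omega
  -- `BuildsUp` recurses from the front while chains are added at the end. The invariant therefore
  -- quantifies over all continuations `Ps`, and the new chain is put in front of the continuation.
  · have hP := h.conf.links.isMaderPath hA hst hm (by simp) hs1 hs2 (by omega) hN hc hp hdiff
    have hu := D.union_append (1 :: 2 :: B) c
    have := h.builds (D.edges c :: Ps) ⟨hP, by rw [← hu]; exact hPs⟩
    simpa using this
  · rw [show (1 :: 2 :: (B ++ [c])) = 1 :: 2 :: B ++ [c] from rfl]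
    omega

end ChainDec

namespace ChainDec

variable {G : Graph ℕ ℕ} {n : ℕ} {D : ChainDec G n}

theorem sB_tgt_two (h2 : 2 ≤ D.N) (ht2 : D.tgt 2 ≠ 1) : D.sB (D.tgt 2) = 1 := by
  have := (D.tgt_lt 2 (by omega) h2).resolve_left ht2
  have := (D.sB_mem _ (D.tgt_mem 2 (by omega) h2) ht2).1
  omega

theorem closed_one (h2 : 2 ≤ D.N) : D.Closed [1] := by
  refine ⟨by simp; omega, by simp, by simp, ?_⟩
  simp [D.tgt_first (by omega) rfl, D.sB_one]

theorem closed_two (h2 : 2 ≤ D.N) (ht2 : D.tgt 2 ≠ 1) : D.Closed [1, 2] :=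
  (closed_one h2).append (by omega) h2 (by simp) (by simp [sB_tgt_two h2 ht2])

theorem labels_one (h2 : 2 ≤ D.N) (hs1 : D.src 1 = 1) :
    D.Labels [1] fun x => if x ∈ D.xs 1 then 1 else if x = 1 then 2 else 0 := by
  have ht1 := D.tgt_first (c := 1) (by omega) rfl
  have hmem := fun x => D.mem_xs 1 x le_rfl (by omega)
  refine ⟨fun x hx => ?_, fun x hx => ?_, fun x hx => by split_ifs <;> omega⟩
  · by_cases hx1 : x = 1
    · subst hx1; simp [hmem, D.sB_one]
    · simp [hmem, hx, hx1]
  · by_cases hx1 : x = 1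
    · subst hx1; simp [hmem]
    · simp [hmem, hx, hx1, hs1, ht1, Ne.symm hx1]
      split_ifs <;> simp

/-- The links of the empty graph. -/
theorem links_nil {A : List ℕ} (h : 1 ∈ A) {st : ℕ → ℕ} (hst : ∀ x, st x = if x = 1 then 2 else 0)
    (lo le : ℕ → ℕ) : D.Links A st lo 0 (fun _ => []) le := by
  refine ⟨fun L x => ?_, fun x _ hs => ?_, by simp [hst], fun x _ hs => ?_, by omega⟩
  · simp only [List.not_mem_nil, false_iff, hst]; split_ifs <;> simp
  · rw [hst] at hs; split_ifs at hs; omega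
  · rw [hst] at hs
    by_cases hx : x = 1
    · rw [hx, D.sB_one]; exact h
    · simp [hx] at hs

theorem wp_setUpCurrentGraph {m : ℕ} (h2 : 2 ≤ D.N) (hs1 : D.src 1 = 1) (hs2 : D.src 2 = 1)
    (ht2 : D.tgt 2 ≠ 1) {s : State} (hs : D.Stored m s)
    (hz : ∀ a ∈ [Arr.status, .listHead], s.arrs a = fun _ => 0)
    (hr : ∀ r ∈ [Reg.numL, .addHead, .numAdded], s.regs r = 0) {k : ℕ}
    (hk : D.debt (rate n m) [] ≤ k) :
    WP setUpCurrentGraph s k fun s' k' => ∃ lk el S ad, D.Adding m [] lk el S ad s' ∧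
      k + 800 * potential (s'.regs .numL) lk el + D.debt (rate n m) [1, 2] +
        60 * s'.regs .numL + 100 ≤ k' + D.debt (rate n m) [] := by
  simp only [List.mem_cons, List.not_mem_nil, or_false, forall_eq_or_imp, forall_eq] at hz hr
  obtain ⟨hst, hlh⟩ := hz
  obtain ⟨hnL, hah, hna⟩ := hr
  have hA := closed_two h2 ht2
  have hsB2 := sB_tgt_two h2 ht2
  have h21 : D.tgt 2 ∈ D.xs 1 :=
    (D.mem_xs 1 _ le_rfl (by omega)).2 ⟨D.tgt_mem 2 (by omega) h2, ht2, hsB2⟩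
  have hd₁ := D.debt_append (rate n m) (A := []) le_rfl (by omega : 1 ≤ D.N) (by simp)
  have hd₂ := D.debt_append (rate n m) (A := [1]) (by omega) h2 (by simp)
  simp only [List.nil_append, List.cons_append] at hd₁ hd₂
  have hmul : ∀ h, (400 + 1600 * (Nat.log 2 (n + 2 * m) + 1)) * h =
    400 * h + 1600 * (h * (Nat.log 2 (n + 2 * m) + 1)) := by intro h; ring
  have hr₁ := rate_bound rfl (D.logSum_xs_le m le_rfl (by omega : 1 ≤ D.N))
    (h := (D.ch 1).length) rfl
  have hr₂ := rate_bound rfl (D.logSum_xs_le m (by omega) h2) (h := (D.ch 2).length) rfl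
  have hm₁ := hmul (D.ch 1).length
  have hm₂ := hmul (D.ch 2).length
  generalize rate n m * (1 + (D.xs 1).length + (D.ch 1).length) = R₁ at hd₁ hr₁
  generalize rate n m * (1 + (D.xs 2).length + (D.ch 2).length) = R₂ at hd₂ hr₂
  generalize (D.ch 1).length * (Nat.log 2 (n + 2 * m) + 1) = Y₁ at hr₁ hm₁
  generalize (D.ch 2).length * (Nat.log 2 (n + 2 * m) + 1) = Y₂ at hr₂ hm₂
  unfold setUpCurrentGraph
  simp only [block]
  refine .seq (.run 5 (by omega) fun k₁ hk₁ => ?_)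
  refine .seq (.run 5 (by omega) fun k₂ hk₂ => ?_)
  generalize hs₁ : run (Prog.assign Reg.cur _ : Prog) _ = s₁
  have e₀ : ∀ a, a ≠ Arr.status → s₁.arrs a = s.arrs a := by
    intro a h; rw [← hs₁]; simp [h]
  have e₁ : ∀ r, r ≠ Reg.cur → s₁.regs r = s.regs r := by
    intro r h; rw [← hs₁]; simp [h]
  have e₂ : s₁.regs .cur = 1 := by rw [← hs₁]; simp
  have e₃ : ∀ x, s₁.arrs .status x = if x = 1 then 2 else 0 := by
    intro x; rw [← hs₁]; simp [hst, Function.update_apply]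
  have hS₁ : D.Stored m s₁ := hs.congr (by simp [e₁]) (by simp [e₀])
  have hnL₁ : s₁.regs .numL = 0 := by rw [e₁ _ (by simp)]; exact hnL
  -- The second chain is listed from the beginning although it is added later. This is harmless
  -- because the configuration only needs the labelled vertices and the edges of the links to be
  -- covered by the listed chains, and it allows one list to serve for all steps of the
  -- initialization. So far only the root is labelled and there are no links.
  have hC₁ : D.Conf m [1, 2] (fun _ => []) (fun _ => []) ∅ [] s₁ := by
    refine ⟨by rw [hnL₁]; exact links_nil (by simp) e₃ _ _, by rw [hnL₁]; omega,
      ⟨?_, by simp, by simp, by simp, by simp, by simp, by simp, ?_⟩, by simp, by simp, by simp⟩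
    · refine ⟨fun y => ⟨0, ?_⟩, by simp, by simp, by simp⟩
      rw [e₀ .listHead (by simp), hlh]
      exact DLL.nil
    · rw [e₁ _ (by simp), hah]; rfl
  have hp₁ : potential (s₁.regs .numL) (fun _ => []) (fun _ => []) = 0 := by rw [hnL₁]; rfl
  refine .seq (.conseq (wp_addLink hS₁ hC₁ e₂ (by simp) le_rfl (by omega) (fun x hx => ?_)
    (by simp [e₃, hs1]) (by simp [e₃, D.tgt_first (c := 1) (by omega) rfl]) (by simp) (by omega)) ?_)
  · rw [e₃, if_neg (D.mem_xs_range le_rfl (by omega) hx).2]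
  rintro s₂ k₃ ⟨hk₃, lk₂, hC₂, hl₂, hp₂, hst₂, hna₂, hor₂⟩ hf₂
  have hS₂ := hS₁.of_frame hf₂ (by decide) (by decide)
  refine .seq (.run 5 (by omega) fun k₄ hk₄ => ?_)
  generalize hs₃ : run (Prog.assign Reg.u _ : Prog) _ = s₃
  have i₀ : s₃.arrs = s₂.arrs := by rw [← hs₃]; simp
  have i₁ : ∀ r, r ≠ Reg.u → s₃.regs r = s₂.regs r := by
    intro r h₁; rw [← hs₃]; simp [h₁]
  have i₂ : s₃.regs .u = D.tgt 2 := by rw [← hs₃]; simp [hS₂.tgt]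
  have hS₃ : D.Stored m s₃ := hS₂.congr (by simp [i₁]) (by simp [i₀])
  have hC₃ := hC₂.congr (s' := s₃) (by simp [i₁]) i₀
  have i₃ := i₁ .numL (by simp)
  refine .seq (.conseq (wp_makeBranch hA hS₃ hC₃ (by rw [i₂]; exact D.tgt_mem 2 (by omega) h2)
    (by simp [i₂, i₀, hst₂, h21]) (by rw [i₃]; omega)) ?_)
  rintro s₄ k₅ ⟨lk₄, el₄, S₄, ad₄, hk₅, hl₄, hC₄, hst₄, hm₄⟩ hf₄
  have hS₄ := hS₃.of_frame hf₄ (by decide) (by decide)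
  rw [i₂, i₀, hst₂] at hst₄
  rw [i₃] at hk₅ hl₄
  simp only [Finset.notMem_empty, List.not_mem_nil, or_self, iff_false, not_or] at hm₄
  refine .seq (.run 5 (by omega) fun k₆ hk₆ => ?_)
  generalize hs₅ : run (Prog.assign Reg.cur _ : Prog) _ = s₅
  have j₀ : s₅.arrs = s₄.arrs := by rw [← hs₅]; simp
  have j₁ : ∀ r, r ≠ Reg.cur → s₅.regs r = s₄.regs r := by
    intro r h₁; rw [← hs₅]; simp [h₁]
  have j₂ : s₅.regs .cur = 2 := by rw [← hs₅]; simp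
  have hS₅ : D.Stored m s₅ := hS₄.congr (by simp [j₁]) (by simp [j₀])
  have hC₅ := hC₄.congr (s' := s₅) (by simp [j₁]) j₀
  have j₃ := j₁ .numL (by simp)
  have h11 : (1 : ℕ) ∉ D.xs 1 := fun h => (D.mem_xs_range le_rfl (by omega) h).2 rfl
  have hx2 : ∀ x ∈ D.xs 2, x ∉ D.xs 1 ∧ x ≠ 1 ∧ x ≠ D.tgt 2 := fun x hx => by
    refine ⟨fun h => ?_, (D.mem_xs_range (by omega) h2 hx).2, ?_⟩
    · have h₁ := ((D.mem_xs 1 x le_rfl (by omega)).1 h).2.2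
      have h₂ := ((D.mem_xs 2 x (by omega) h2).1 hx).2.2
      omega
    · rintro rfl; exact D.tgt_notMem (by omega) h2 hx
  refine .seq (.conseq (wp_addLink hS₅ hC₅ j₂ (by simp) (by omega) h2 (fun x hx => ?_) ?_ ?_
    (fun d hd => absurd hd (hm₄ d).2) (by omega)) ?_)
  · obtain ⟨h₁, h₂, h₃⟩ := hx2 x hx
    simp [j₀, hst₄, h₁, h₂, h₃, e₃]
  · simp [j₀, hst₄, hs2, Function.update_apply, h11, e₃]
  · simp [j₀, hst₄]
  rintro s₆ k₇ ⟨hk₇, lk₆, hC₆, hl₆, hp₆, hst₆, hna₆, hor₆⟩ hf₆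
  have hS₆ := hS₅.of_frame hf₆ (by decide) (by decide)
  rw [j₃] at hp₆ hl₆
  refine .seq (.run 5 (by omega) fun k₈ hk₈ => ?_)
  generalize hs₇ : run (Prog.assign Reg.cur _ : Prog) _ = s₇
  have l₀ : s₇.arrs = s₆.arrs := by rw [← hs₇]; simp
  have l₁ : ∀ r, r ≠ Reg.cur → s₇.regs r = s₆.regs r := by
    intro r h₁; rw [← hs₇]; simp [h₁]
  have l₂ : s₇.regs .cur = 1 := by rw [← hs₇]; simp
  have hS₇ : D.Stored m s₇ := hS₆.congr (by simp [l₁]) (by simp [l₀])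
  have hC₇ := hC₆.congr (s' := s₇) (by simp [l₁]) l₀
  have l₃ := l₁ .numL (by simp)
  refine .seq (.conseq (wp_processChildren hS₇ hC₇ l₂ (fun d _ => hm₄ d) (by rw [l₃]; omega)) ?_)
  rintro s₈ k₉ ⟨el₈, S₈, ad₈, hk₉, hC₈, hm₈⟩ hf₈
  have hS₈ := hS₇.of_frame hf₈ (by decide) (by decide)
  rw [l₃] at hk₉
  have hl₁₀ : s₈.regs .numL = s₆.regs .numL := by rw [hf₈.regs _ rfl, l₃]
  refine .seq (.run 5 (by omega) fun k₁₀ hk₁₀ => ?_)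
  generalize hs₉ : run (Prog.assign Reg.cur _ : Prog) _ = s₉
  have q₀ : s₉.arrs = s₈.arrs := by rw [← hs₉]; simp
  have q₁ : ∀ r, r ≠ Reg.cur → s₉.regs r = s₈.regs r := by
    intro r h₁; rw [← hs₉]; simp [h₁]
  have q₂ : s₉.regs .cur = 2 := by rw [← hs₉]; simp
  have hS₉ : D.Stored m s₉ := hS₈.congr (by simp [q₁]) (by simp [q₀])
  have hC₉ := hC₈.congr (s' := s₉) (by simp [q₁]) q₀
  have q₃ := q₁ .numL (by simp)
  refine .conseq (wp_processChildren hS₉ hC₉ q₂ (fun d hd => ?_) (by rw [q₃]; omega)) ?_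
  · rw [← not_or, hm₈]
    have h₁ := hm₄ d
    have h₂ := ((D.ch_mem 2 d).1 hd).2.2
    have h₃ : d ∉ D.ch 1 := fun h => by
      have := ((D.ch_mem 1 d).1 h).2.2; omega
    simp [h₁.1, h₁.2, h₃]
  rintro s₁₀ k₁₁ ⟨el₁₀, S₁₀, ad₁₀, hk₁₁, hC₁₀, hm₁₀⟩ hf₁₀
  rw [q₃] at hk₁₁
  have hl₁₁ : s₁₀.regs .numL = s₆.regs .numL := by rw [hf₁₀.regs _ rfl, q₃, hl₁₀]
  have hst₁₀ : s₁₀.arrs .status = s₆.arrs .status := by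
    rw [hf₁₀.arrs _ rfl, q₀, hf₈.arrs _ rfl, l₀]
  have hor₁₀ : s₁₀.arrs .order = s₆.arrs .order := by
    rw [hf₁₀.arrs _ rfl, q₀, hf₈.arrs _ rfl, l₀]
  have hna₄ : s₅.regs .numAdded = 1 := by
    rw [j₁ _ (by simp), hf₄.regs _ rfl, i₁ _ (by simp), hna₂, e₁ _ (by simp), hna]
  have hna₁₀ : s₁₀.regs .numAdded = 2 := by
    rw [hf₁₀.regs _ rfl, q₁ _ (by simp), hf₈.regs _ rfl, l₁ _ (by simp), hna₆, hna₄]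
  have hor₅ : s₅.arrs .order 1 = 1 := by
    rw [j₀, hf₄.arrs .order rfl, i₀, hor₂, e₁ .numAdded (by simp), hna]; simp
  refine ⟨lk₆, el₁₀, S₁₀, ad₁₀, ⟨hS₉.of_frame hf₁₀ (by decide) (by decide), hA, ?_, hC₁₀,
    fun d => ?_, hna₁₀, ?_, fun Ps h => by simpa using h⟩, by omega⟩
  · refine (labels_one h2 hs1).add (closed_one h2) (by omega) h2 (by simp) (by simp [hsB2])
      fun x => ?_
    rw [hst₁₀, hst₆, j₀, hst₄]
    by_cases hxt : x = D.tgt 2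
    · subst hxt; simp
    · by_cases hx1 : x = 1
      · simp [hx1, hs2, h11, e₃, Ne.symm ht2]
      · simp [hxt, hs2, hx1, e₃]
  · rw [hm₁₀, hm₈, D.ch_mem, D.ch_mem]
    have h₁ := hm₄ d
    simp only [h₁.1, h₁.2, or_self, false_or, List.mem_cons, List.not_mem_nil, or_false]
    omega
  · rw [hor₁₀, hor₆, hna₄]
    simp [List.range_succ, hor₅]

end ChainDec

/-! ### Reports, the whole program and the final bound -/

namespace ChainDec

variable {G : Graph ℕ ℕ} {n : ℕ} {D : ChainDec G n}

theorem wp_report {m : ℕ} (hV : G.vertexSet = Set.Icc 1 n) (hloop : G.Loopless) {B : List ℕ}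
    {lk el : ℕ → List ℕ} {S : Finset ℕ} {s : State} (h : D.Adding m B lk el S [] s)
    (hres : s.regs .res = 0) {k : ℕ} (hk : 60 * s.regs .numL + 80 ≤ k) :
    WP report s k fun s' _ =>
      (s'.regs .res = 1 ∧ (1 :: 2 :: B).length = D.N) ∨ ReportsTwoEdgeCut G s' := by
  have hL := h.conf.links
  have hA := h.closed
  -- With no addable chains left, every pending chain is stored with some link, so both endpoints
  -- are inner vertices of that link.
  have hdone : ∀ c, 1 ≤ c → c ≤ D.N → c ∉ 1 :: 2 :: B → D.sB (D.tgt c) ∈ 1 :: 2 :: B →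
      D.Same (s.arrs .status) (s.arrs .linkOf) c := by
    intro c h1 hN hc hp
    have h2 : 2 < c := by
      simp only [List.mem_cons, not_or] at hc; omega
    have := (h.pending c).2 ⟨⟨h2, hN⟩, hc, hp⟩
    simp only [List.not_mem_nil, or_false] at this
    exact h.conf.same c this
  unfold report
  refine .ite (by simp; omega) (fun hb => ?_) fun hb => ?_
  · simp only [Test.Holds, Expr.eval, h.numAdded, h.stored.numC] at hb
    refine .run 5 (by simp; omega) fun k₁ _ => .inl ⟨by simp, ?_⟩
    simpa using hb
  simp only [Test.Holds, Expr.eval, h.numAdded, h.stored.numC] at hb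
  simp only [Test.cost, Expr.cost, cost_ofNat, block, when]
  refine .seq (.run 5 (by omega) fun k₁ hk₁ => ?_)
  generalize hs₁ : run (Prog.assign Reg.i _ : Prog) s = s₁
  have e₀ : s₁.arrs = s.arrs := by rw [← hs₁]; simp
  have e₁ : ∀ r, r ≠ Reg.i → s₁.regs r = s.regs r := by intro r h; rw [← hs₁]; simp [h]
  have e₂ : s₁.regs .i = 1 := by rw [← hs₁]; simp
  -- Until a cut has been found, all links inspected so far have no inner vertex. The scan cannot
  -- end in this state, as some chain is missing and hence some link has an inner vertex.
  refine .while (fun s' k' => (s'.regs .res = 0 ∧ 1 ≤ s'.regs .i ∧ s'.regs .i ≤ s.regs .numL + 1 ∧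
      (∀ L, 1 ≤ L → L < s'.regs .i → lk L = []) ∧
      60 * (s.regs .numL + 1) + 10 ≤ k' + 60 * s'.regs .i) ∨ (ReportsTwoEdgeCut G s' ∧ 10 ≤ k'))
    (.inl ⟨by rw [e₁ _ (by simp), hres], by omega, by omega, by rw [e₂]; omega, by omega⟩) ?_
  rintro s' k' hI hf
  have f₁ : s'.regs .numL = s.regs .numL := by rw [hf.regs _ rfl, e₁ _ (by simp)]
  have f₂ : s'.arrs = s.arrs := by
    ext a; rw [hf.arrs a (by cases a <;> rfl), e₀]
  refine ⟨by simp [Test.cost, Expr.cost, cost_ofNat]; omega, fun hb => ?_, fun hb => ?_⟩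
  · simp only [Test.Holds, Expr.eval, f₁, eval_ofNat] at hb
    simp only [Test.cost, Expr.cost, cost_ofNat]
    rcases hI with ⟨h₁, h₂, h₃, h₄, h₅⟩ | ⟨h₁, -⟩
    swap
    · have := h₁.1; omega
    obtain ⟨i, hi⟩ : ∃ i, s'.regs .i = i := ⟨_, rfl⟩
    rw [hi] at h₂ h₃ h₄ h₅
    have hlt : i < s.regs .numL + 1 := by simpa [hi] using hb.2
    have hdll := h.conf.dll i h₂ (by omega)
    have hz := hL.zero_notMem i
    by_cases hl : s.arrs .linkFirst i = 0
    · refine .run 50 (by omega) fun k₂ hk₂ => .inl ?_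
      have hnil : lk i = [] :=
        (DLL.headD_eq_zero hz).1 (by rw [← hdll.fwd.head_eq]; exact hl)
      refine ⟨by simpa [run, f₂, hi, hl] using h₁, by simp [run, f₂, hi, hl],
        by simp [run, f₂, hi, hl]; omega, ?_, by simp [run, f₂, hi, hl]; omega⟩
      intro L hL1 hLi
      simp [run, f₂, hi, hl] at hLi
      by_cases hLi' : L = i
      · rw [hLi']; exact hnil
      · exact h₄ L hL1 (by omega)
    · refine .run 50 (by omega) fun k₂ hk₂ => .inr ⟨?_, by omega⟩
      obtain ⟨p, z, hpz⟩ : ∃ p z, lk i = p ++ [z] := by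
        rcases List.eq_nil_or_concat (lk i) with h0 | ⟨p, z, h0⟩
        · rw [h0] at hdll; exact absurd hdll.fwd hl
        · exact ⟨p, z, by simpa using h0⟩
      have hlast : s.arrs .linkLast i = z := by
        rw [hdll.bwd.head_eq, hpz]; simp
      obtain ⟨hc₁, hc₂⟩ := hL.isEdgeCut hA h.labels hdone hV hloop h₂ (by omega) hpz
      have := h.stored.parEdge
      refine ⟨by simp [run, f₂, hi, hl], ?_, ?_⟩
      · simpa [run, f₂, hi, hl, hlast, this] using hc₁
      · simpa [run, f₂, hi, hl, hlast, this] using hc₂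
  · right
    rcases hI with ⟨h₁, h₂, h₃, h₄, h₅⟩ | ⟨h₁, -⟩
    · simp only [Test.Holds, Expr.eval, f₁, eval_ofNat, h₁, true_and, not_lt] at hb
      obtain ⟨L, x, hL1, hLn, hx⟩ := hL.exists_mem hA hdone (by simpa using ‹¬_ = D.N›)
      rw [h₄ L hL1 (by simp at hb; omega)] at hx
      simp at hx
    · exact h₁

theorem wp_reportFirstChain {m : ℕ} {end1 end2 : ℕ → ℕ} (hG : IsInput G n m end1 end2) (hn : 2 ≤ n)
    (hN : 2 ≤ D.N) (h : ¬ (D.src 2 = 1 ∧ D.tgt 2 ≠ 1)) {s : State}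
    (hpar : s.arrs .par = D.par) (hpe : s.arrs .parEdge = D.parEdge) (hlow : s.arrs .low = D.low)
    (hback : s.arrs .backEdge = D.backEdge) {k : ℕ} (hk : 20 * n + 40 ≤ k) :
    WP reportFirstChain s k fun s' _ => ReportsTwoEdgeCut G s' := by
  have hlen := D.length_xs_le le_rfl (by omega : 1 ≤ D.N)
  have hfirst := D.first hG hn
  have htr := D.trail 1 le_rfl (by omega)
  rw [D.tgt_first (by omega) rfl] at htr
  have h11 : (1 : ℕ) ∉ D.xs 1 := fun h => (D.mem_xs_range le_rfl (by omega) h).2 rfl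
  have hne : D.low (D.backEdge 1) ≠ 1 := fun h => by
    have := (D.back _ _ (D.back_mem 1 le_rfl (by omega))).2.2.1
    rw [h, hfirst.2] at this
    exact lt_irrefl _ this
  unfold reportFirstChain
  simp only [block]
  refine .seq (.run 5 (by omega) fun k₁ hk₁ => ?_)
  refine .seq (.run 5 (by omega) fun k₂ hk₂ => ?_)
  generalize hs₁ : run (Prog.assign Reg.x _ : Prog) _ = s₁
  have e₀ : s₁.arrs = s.arrs := by rw [← hs₁]; simp
  have e₁ : s₁.regs .x = D.low (D.backEdge 1) := by rw [← hs₁]; simp [hlow, hback]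
  have e₂ : s₁.regs .cut1 = D.backEdge 1 := by rw [← hs₁]; simp [hback]
  refine .seq (.conseq (P := fun s' k' => 10 ≤ k' ∧
    ∃ y ∈ D.xs 1, s'.regs .cut2 = D.parEdge y ∧ D.par y = 1) ?_ ?_)
  -- Before the first round `cut2` is meaningless, so the invariant only records that the loop
  -- cannot stop yet: the lower endpoint of a back edge is not the root. Afterwards `cut2` is the
  -- tree edge that has just been passed.
  · refine .while (fun s' k' => ∃ dn rest, D.xs 1 = dn ++ rest ∧ Trail D.par (s'.regs .x) rest 1 ∧
      20 * (D.xs 1).length + 20 ≤ k' + 20 * dn.length ∧ (s'.regs .x ≠ 1 ∨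
      ∃ y ∈ D.xs 1, s'.regs .cut2 = D.parEdge y ∧ D.par y = s'.regs .x))
      ⟨[], D.xs 1, rfl, by rw [e₁]; exact htr, by simp; omega, .inl (by rw [e₁]; exact hne)⟩ ?_
    rintro s' k' ⟨dn, rest, hx, ht, hk', hor⟩ hf
    have f₁ : s'.arrs .par = D.par := by rw [hf.arrs _ rfl, e₀]; exact hpar
    have f₂ : s'.arrs .parEdge = D.parEdge := by rw [hf.arrs _ rfl, e₀]; exact hpe
    have hl : (D.xs 1).length = dn.length + rest.length := by rw [hx]; simp
    refine ⟨by simp; omega, fun hb => ?_, fun hb => ?_⟩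
    · simp only [Test.Holds, Expr.eval, eval_ofNat] at hb
      simp only [Test.cost, Expr.cost, cost_ofNat]
      obtain ⟨l', rfl, hl'⟩ := ht.exists_cons hb
      simp only [List.length_cons] at hl
      refine .run 10 (by omega) fun k₃ hk₃ => ?_
      refine ⟨dn ++ [s'.regs .x], l', by rw [hx]; simp, by simpa [run, f₁] using hl',
        by simp; omega, .inr ⟨s'.regs .x, by rw [hx]; simp, by simp [run, f₂], by simp [run, f₁]⟩⟩
    · simp only [Test.Holds, Expr.eval, eval_ofNat, not_not] at hb
      simp only [Test.cost, Expr.cost, cost_ofNat]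
      obtain ⟨y, hy, hy₁, hy₂⟩ := hor.resolve_left (not_not.2 hb)
      exact ⟨by omega, y, hy, hy₁, by rw [hy₂, hb]⟩
  rintro s₂ k₃ ⟨hk₃, y, hy, hy₁, hy₂⟩ hf₂
  obtain ⟨hc₁, hc₂⟩ := isEdgeCut_first hG hn hN h hy hy₂
  have hcut : s₂.regs .cut1 = D.backEdge 1 := by rw [hf₂.regs _ rfl, e₂]
  refine .run 5 (by omega) fun k₄ _ => ⟨by simp, ?_, ?_⟩
  · simpa [hcut, hy₁] using hc₁
  · simpa [hcut, hy₁] using hc₂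

theorem exists_inc (D : ChainDec G n) (hV : G.vertexSet = Set.Icc 1 n) (hN : 1 ≤ D.N)
    (hs1 : D.src 1 = 1) {v : ℕ} (hv : v ∈ G.vertexSet) : ∃ e ∈ G.edgeSet, G.Inc e v := by
  rw [hV] at hv
  by_cases h1 : v = 1
  · have := D.back_link le_rfl hN
    rw [hs1] at this
    exact ⟨_, this.edge_mem, h1 ▸ this.inc_left⟩
  · have := (D.tree v hv.1 hv.2 h1).2.2.2
    exact ⟨_, this.edge_mem, this.inc_left⟩

/-- If all chains have been added, they form a Mader sequence. -/
theorem Adding.isMaderSequence {m : ℕ} {B : List ℕ} {lk el : ℕ → List ℕ} {S : Finset ℕ}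
    {ad : List ℕ} {s : State} (h : D.Adding m B lk el S ad s) (hV : G.vertexSet = Set.Icc 1 n)
    (hloop : G.Loopless) (h2 : 2 ≤ D.N) (hs1 : D.src 1 = 1) (hs2 : D.src 2 = 1)
    (ht2 : D.tgt 2 ≠ 1) (hlen : (1 :: 2 :: B).length = D.N) :
    Mader.IsMaderSequence G (D.edges 1 ++ D.edges 2) (B.map D.edges) := by
  refine ⟨D.triple h2 hs1 hs2 ht2, ?_⟩
  have hu := D.union_all h.closed hlen hloop
  have := h.builds [] ⟨hu, fun v hv => by
    rw [hu]; exact D.exists_inc hV (by omega) hs1 hv⟩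
  rw [List.append_nil] at this
  convert this using 1
  ext e
  simp [union]

end ChainDec

theorem wp_program {G : Graph ℕ ℕ} {n m : ℕ} {end1 end2 : ℕ → ℕ} (hG : IsInput G n m end1 end2)
    (hn : 2 ≤ n) (hdeg : ∀ v ∈ G.vertexSet, 3 ≤ Mader.degree G G.edgeSet v) {k : ℕ}
    (hk : 1000 * (n + m) + 2000 + ChainDec.rate n m * (n + 2 * m) ≤ k) :
    WP program (input n m end1 end2) k fun s' _ =>
      ReportsMaderSequence G s' ∨ ReportsTwoEdgeCut G s' := by
  have hV := hG.vertexSet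
  unfold program
  simp only [block]
  refine .seq (.conseq (wp_buildIncidenceLists hG rfl (by omega)) ?_)
  rintro s₁ k₁ ⟨hk₁, inc, hi, ht, hsum⟩ hf₁
  refine .seq (.conseq (wp_depthFirstSearch hG (by omega) hi ht hsum ?_ (by omega)) ?_)
  · simp only [List.mem_cons, List.not_mem_nil, or_false, forall_eq_or_imp, forall_eq]
    refine ⟨?_, ?_, ?_, ?_, ?_, ?_, ?_⟩ <;> exact hf₁.arrs _ rfl
  rintro s₂ k₂ ⟨hk₂, P, p₁, p₂, p₃, p₄, p₅, p₆⟩ hf₂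
  have hz : ∀ a, buildIncidenceLists.writesArr a = false → depthFirstSearch.writesArr a = false →
      s₂.arrs a = (input n m end1 end2).arrs a := fun a h h' => by
    rw [hf₂.arrs a h', hf₁.arrs a h]
  have hzr : ∀ r, buildIncidenceLists.writesReg r = false → depthFirstSearch.writesReg r = false →
      s₂.regs r = (input n m end1 end2).regs r := fun r h h' => by
    rw [hf₂.regs r h', hf₁.regs r h]
  refine .seq (.conseq (wp_chainDecomposition hG (by omega) (P := P) ⟨p₁, p₂, p₃, p₄, p₅, p₆⟩
    (hzr _ rfl rfl) ?_ (by omega)) ?_)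
  · simp only [List.mem_cons, List.not_mem_nil, or_false, forall_eq_or_imp, forall_eq]
    refine ⟨?_, ?_, ?_⟩ <;> exact hz _ rfl rfl
  rintro s₃ k₃ ⟨hk₃, D, rfl, d₁, d₂, d₃, d₄, d₅, d₆, d₇⟩ hf₃
  have hS : D.Stored m s₃ := ⟨by rw [hf₃.regs _ rfl, hzr _ rfl rfl]; rfl, d₁, d₂,
    by rw [hf₃.arrs _ rfl, p₁], by rw [hf₃.arrs _ rfl, p₂], by rw [hf₃.arrs _ rfl, p₃],
    by rw [hf₃.arrs _ rfl, p₅], d₃, d₄, d₅, d₆⟩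
  have hfirst := D.first hG hn
  have h2 := D.two_le hG hn hdeg
  -- The construction of lists, search tree and chains is paid from the linear part of the budget.
  -- The rest of the budget covers the debt of all chains, since there are at most `m` of them.
  have hdebt := D.debt_nil_le (ChainDec.rate n m)
  have hmul : ChainDec.rate n m * (n + 2 * D.N) ≤ ChainDec.rate n m * (n + 2 * m) :=
    Nat.mul_le_mul_left _ (by omega)
  refine .ite (by simp [Test.cost, Expr.cost, cost_ofNat]; omega) (fun hb => ?_) fun hb => ?_
  · simp only [Test.Holds, Expr.eval, eval_ofNat, d₃, d₄] at hb
    simp only [Test.cost, Expr.cost, cost_ofNat]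
    obtain ⟨hs2, ht2⟩ := hb
    refine .seq (.conseq (ChainDec.wp_setUpCurrentGraph h2 hfirst.2 hs2 ht2 hS ?_ ?_ (by omega)) ?_)
    · simp only [List.mem_cons, List.not_mem_nil, or_false, forall_eq_or_imp, forall_eq]
      refine ⟨?_, ?_⟩ <;> rw [hf₃.arrs _ rfl, hz _ rfl rfl] <;> rfl
    · simp only [List.mem_cons, List.not_mem_nil, or_false, forall_eq_or_imp, forall_eq]
      refine ⟨?_, ?_, ?_⟩ <;> rw [hf₃.regs _ rfl, hzr _ rfl rfl] <;> rfl
    rintro s₄ k₄ ⟨lk₄, el₄, S₄, ad₄, h₄, hk₄⟩ hf₄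
    refine .seq (.conseq (ChainDec.wp_addChains hG.edgeSet hfirst.2 hs2 h₄ (by omega)) ?_)
    rintro s₅ k₅ ⟨hk₅, B, lk₅, el₅, S₅, h₅⟩ hf₅
    refine .conseq (ChainDec.wp_report hV hG.loopless h₅ ?_ hk₅) ?_
    · rw [hf₅.regs _ rfl, hf₄.regs _ rfl, hf₃.regs _ rfl, hzr _ rfl rfl]; rfl
    rintro s₆ k₆ (⟨hres, hlen⟩ | hcut) hf₆
    · refine .inl ⟨hres, D.edges 1, D.edges 2, B.map D.edges, ?_,
        h₅.isMaderSequence hV hG.loopless h2 hfirst.2 hs2 ht2 hlen⟩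
      have hce : ∀ c, 1 ≤ c → c ≤ D.N → chainEdges s₆ c = D.edges c := fun c h1 hN => by
        rw [ChainDec.edges, ← d₇ c h1 hN]
        unfold chainEdges
        rw [hf₆.arrs .chainStart rfl, hf₆.arrs .chainEdge rfl, hf₅.arrs .chainStart rfl,
          hf₅.arrs .chainEdge rfl, hf₄.arrs .chainStart rfl, hf₄.arrs .chainEdge rfl]
      have ho := congrArg (List.map (chainEdges s₆)) h₅.order
      rw [List.map_map] at ho
      unfold addedChains
      rw [hf₆.regs .numAdded rfl, h₅.numAdded, hf₆.arrs .order rfl]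
      refine ho.trans ?_
      rw [List.map_congr_left fun c hc => hce c (h₅.closed.range c hc).1 (h₅.closed.range c hc).2]
      rfl
    · exact .inr hcut
  · simp only [Test.Holds, Expr.eval, eval_ofNat, d₃, d₄] at hb
    simp only [Test.cost, Expr.cost, cost_ofNat]
    exact .conseq (ChainDec.wp_reportFirstChain hG hn h2 hb hS.par hS.parEdge hS.low hS.back
      (by omega)) fun s' k' h _ => .inr h

/-- The credits are bounded by a multiple of `(n + m) * log (n + m)`. -/
theorem credits_le {n m : ℕ} (h : 4 ≤ n + m) :
    ((1000 * (n + m) + 2000 + ChainDec.rate n m * (n + 2 * m) : ℕ) : ℝ) ≤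
      50000 * (((n : ℝ) + m) * Real.log ((n : ℝ) + m)) := by
  obtain ⟨q, hq⟩ : ∃ q, n + m = q := ⟨_, rfl⟩
  have hqr : (n : ℝ) + m = q := by rw [← hq]; push_cast; rfl
  rw [hqr]
  rw [hq] at h ⊢
  have hq4 : (4 : ℝ) ≤ q := by exact_mod_cast h
  have hl2 := Real.log_two_gt_d9
  have hl4 : Real.log 4 = 2 * Real.log 2 := by
    rw [show (4 : ℝ) = 2 ^ 2 by norm_num, Real.log_pow]; norm_num
  -- For `q ≥ 4` the logarithm is at least one, so terms linear in `q` and constants are absorbed by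
  -- `q * Real.log q`.
  have hlq : 1 ≤ Real.log q := by
    have := Real.log_le_log (by norm_num) hq4
    linarith
  have hnat : (Nat.log 2 q : ℝ) * Real.log 2 ≤ Real.log q := by
    rw [← Real.log_pow]
    refine Real.log_le_log (by positivity) ?_
    exact_mod_cast Nat.pow_log_le_self 2 (by omega)
  have hnat' : (Nat.log 2 q : ℝ) ≤ 2 * Real.log q := by
    have : (0 : ℝ) ≤ Nat.log 2 q := Nat.cast_nonneg _
    nlinarith
  -- Since `n + 2 * m ≤ 2 * q`, passing from `q` to this argument raises the logarithm by at most
  -- one.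
  have hlog : Nat.log 2 (n + 2 * m) ≤ Nat.log 2 q + 1 := by
    rw [← Nat.log_mul_base (by norm_num) (by omega)]
    exact Nat.log_mono_right (by omega)
  have hle : 1000 * q + 2000 + ChainDec.rate n m * (n + 2 * m) ≤
      1500 * q + 5000 * (Nat.log 2 q + 2) * (2 * q) := by
    have : ChainDec.rate n m * (n + 2 * m) ≤ 5000 * (Nat.log 2 q + 2) * (2 * q) :=
      Nat.mul_le_mul (Nat.mul_le_mul_left _ (by omega)) (by omega)
    omega
  have hcast : ((1000 * q + 2000 + ChainDec.rate n m * (n + 2 * m) : ℕ) : ℝ) ≤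
      1500 * q + 5000 * ((Nat.log 2 q : ℝ) + 2) * (2 * q) := by exact_mod_cast hle
  refine hcast.trans ?_
  have hq0 : (0 : ℝ) ≤ q := by linarith
  have h₁ : (q : ℝ) ≤ q * Real.log q := le_mul_of_one_le_right hq0 hlq
  have h₂ : (Nat.log 2 q : ℝ) * q ≤ 2 * (q * Real.log q) := by
    have := mul_le_mul_of_nonneg_right hnat' hq0
    linarith
  nlinarith

theorem mainTheorem5 :
    ∃ K : ℝ, ∀ (n m : ℕ) (G : Graph ℕ ℕ) (end1 end2 : ℕ → ℕ),
      G.vertexSet = Set.Icc 1 n → G.edgeSet = Set.Icc 1 m → G.Loopless →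
      (∀ e ∈ G.edgeSet, G.IsLink e (end1 e) (end2 e)) →
      (∀ v ∈ G.vertexSet, 3 ≤ Mader.degree G G.edgeSet v) →
      Mader.EdgeConnected 2 G →
      ∃ (s : GreedyChainAddition.State) (t : ℕ),
        RAM.Exec GreedyChainAddition.program (GreedyChainAddition.input n m end1 end2) s t ∧
        (t : ℝ) ≤ K * (((n : ℝ) + m) * Real.log ((n : ℝ) + m)) ∧
        (GreedyChainAddition.ReportsMaderSequence G s ∨
          GreedyChainAddition.ReportsTwoEdgeCut G s) := by
  refine ⟨50000, fun n m G end1 end2 hV hE hloop hlink hdeg hconn => ?_⟩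
  have hn : 2 ≤ n := by
    have := hconn.1
    rw [hV, ← Finset.coe_Icc, Set.encard_coe_eq_coe_finsetCard, Nat.card_Icc] at this
    have : 2 ≤ n + 1 - 1 := by exact_mod_cast this
    omega
  -- The three edges at one vertex give `n + m ≥ 5`, which is enough for `credits_le`.
  have hm : 3 ≤ m := by
    have h₁ := hdeg 1 (by rw [hV]; exact ⟨le_rfl, by omega⟩)
    have h₂ : Mader.degree G G.edgeSet 1 ≤ (Set.Icc 1 m).ncard := by
      refine Set.ncard_le_ncard (fun e he => ?_) (Set.finite_Icc 1 m)
      rw [← hE]; exact he.1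
    rw [← Finset.coe_Icc, Set.ncard_coe_finset, Nat.card_Icc] at h₂
    omega
  obtain ⟨s, t, he, ht, hQ⟩ :=
    wp_program (G := G) (end1 := end1) (end2 := end2) ⟨hV, hE, hloop, hlink, hconn⟩ hn hdeg le_rfl
  exact ⟨s, t, he, (Nat.cast_le.2 ht).trans (credits_le (by omega)), hQ⟩
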